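/- Let $F$ be a local field of characteristic different from $2$ (archimedean or not), $|\cdot|$ its normalized absolute value, $\psi:F\to\mathbb{C}^\times$ a nontrivial continuous unitary additive character, $dx$ the Haar measure on $F$ that is self-dual with respect to $\psi$, and $d^\times a=\zeta_F(1)|a|^{-1}da$. Let $J_0$ be an invertible symmetric matrix over $F$ of even size (size $0$ is allowed), let $i\ge 0$, let $J_i$ be the block diagonal matrix formed by $J_0$ and $i$ copies of $\begin{pmatrix}0&1\\1&0\end{pmatrix}$, and let $V_i$ be the space of column vectors of the size of $J_i$, with $Q_i(x)=\tfrac12x^tJ_ix$ and $\langle x,y\rangle=x^tJ_iy$. Put $V_{i+1}=V_i\oplus F^2$ with $Q_{i+1}(\xi,u_1,u_2)=Q_i(\xi)+u_1u_2$, and $X_i^\circ=\{\xi\in V_i:\xi\neq0,\ Q_i(\xi)=0\}$. Let $\mathrm{GO}_{V}$ be the group of orthogonal similitudes of $V$, with similitude norm $\lambda$; embed $\mathrm{GO}_{V_i}$ in $\mathrm{GO}_{V_{i+1}}$ by $h\mapsto\mathrm{diag}(h,\lambda(h),1)$. For $x\in V_i$ let $$u(x)=\begin{pmatrix}I_{V_i}&J_i^{-1}x&0\\0&1&0\\-x^t&-Q_i(J_i^{-1}x)&1\end{pmatrix}\in\mathrm{GO}_{V_{i+1}}.$$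 Let $\mathcal{S}(\cdot)$ denote Schwartz spaces (locally constant functions of compact support if $F$ is nonarchimedean). Let $\chi(a)=(a,(-1)^{\dim V_i/2}\det J_i)$ (Hilbert symbol), let $\gamma$ be the Weil index of $Q_i$ (so that $\gamma\cdot\psi(-Q_i)$ is the Fourier transform of $\psi(Q_i)$ with respect to $\psi(\langle x,y\rangle)$ and the self-dual measure), and let $\rho_i$ be the Weil representation of $\mathrm{SL}_2(F)$ on $\mathcal{S}(V_i)$, given by $$\rho_i\begin{pmatrix}a&\\&a^{-1}\end{pmatrix}f(x)=\chi(a)|a|^{\dim V_i/2}f(ax),\quad \rho_i\begin{pmatrix}1&t\\&1\end{pmatrix}f(x)=\psi(tQ_i(x))f(x),\quad \rho_i\begin{pmatrix}&1\\-1&\end{pmatrix}f(x)=\gamma\int_{V_i}f(y)\psi(\langle x,y\rangle)\,dy .$$ Let $r_i=\rho_i\otimes L^\vee$ on $\mathcal{S}(V_i\oplus F^2)$, where $L^\vee(g)f(v)=f(g^tv)$, and let $\mathcal{S}(X_i(F))=\mathcal{S}(V_i\oplus F^2)_{r_i(\mathrm{SL}_2(F))}$ be the space of coinvariants: the quotient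 by the span of all $f-r_i(g)f$ if $F$ is nonarchimedean, and by the closure of this span in the Fréchet topology if $F$ is archimedean. Let $K\le\mathrm{SL}_2(F)$ be a compact subgroup with $\mathrm{SL}_2(F)=N(F)T(F)K$, where $N$ is the group of upper triangular unipotent matrices and $T$ the diagonal torus. For $f\in\mathcal{S}(V_i\oplus F^2)$ put $$I(f)(\xi)=\int_{N(F)\backslash\mathrm{SL}_2(F)}r_i(g)f(\xi,0,1)\,d\dot g=\int_{F^\times\times K}r_i\!\left(\begin{pmatrix}a&\\&a^{-1}\end{pmatrix}k\right)f(\xi,0,1)\,\frac{d^\times a\,dk}{|a|^2}\qquad(\xi\in X_i^\circ),$$ where $dk$ has total mass $1$. Let $\mathcal{F}_2f(\xi,u_1,u_2)=\int_Ff(\xi,u_1,x)\psi(u_2x)\,dx$, let $\sigma_i(h)=\mathcal{F}_2\circ L(h)\circ\mathcal{F}_2^{-1}$ for $h\in\mathrm{GO}_{V_{i+1}}$ with $L(h)f(x)=f(h^{-1}x)$, and let $\mathcal{F}_{X_i}f(\xi,v_1,v_2)=\int_{F^2}f(\xi,w_1,w_2)\psi(w_1v_2-w_2v_1)\,dw_1dw_2$.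 **Proposition.** The integral defining $I(f)(\xi)$ converges absolutely. The operators $I$, $\sigma_i(h)$ and $\mathcal{F}_{X_i}$ descend to $\mathcal{S}(X_i(F))$, and $\sigma_i$ is there a representation of $\mathrm{GO}_{V_{i+1}}$. For $f\in\mathcal{S}(X_i(F))$, $\xi\in X_i^\circ$, $a\in F^\times$, $h\in\mathrm{GO}_{V_i}$ and $x\in V_i$ one has \begin{align*} I(\sigma_i(h)f)(\xi)&=|\lambda(h)|\,I(f)(h^{-1}\xi),\\ I(\sigma_i(\mathrm{diag}(I_{V_i},a,a^{-1}))f)(\xi)&=\chi(a)|a|^{1-\dim V_i/2}\,I(f)(a^{-1}\xi),\\ I(\sigma_i(u(x))f)(\xi)&=\overline{\psi}(x^t\xi)\,I(f)(\xi),\\ \sigma_i\begin{pmatrix}I_{V_i}&&\\&&1\\&1&\end{pmatrix}f&=\mathcal{F}_{X_i}(f). \end{align*} -/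

import Mathlib

open MeasureTheory Matrix
open scoped MatrixGroups NNReal ENNReal SchwartzMap

noncomputable section

namespace QuadricSchwartz

/-- The two kinds of local fields. A local field is a nontrivially normed proper field `F` that is
either ultrametric, or a normed `ℝ`-algebra (that is, `ℝ` or `ℂ`). -/
inductive LocalKind (F : Type*) [NontriviallyNormedField F] where
  | nonarch (h : IsUltrametricDist F) : LocalKind F
  | arch (alg : NormedAlgebra ℝ F) : LocalKind F

/-! ### Schwartz spaces -/

section Schwartz

variable {F : Type*} [NontriviallyNormedField F]

/-- The inclusion of the archimedean Schwartz space into the space of all functions. -/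
def schwartzIncl [NormedAlgebra ℝ F] (κ : Type*) [Fintype κ] :
    𝓢(κ → F, ℂ) →ₗ[ℂ] ((κ → F) → ℂ) where
  toFun f := fun x => f x
  map_add' _ _ := rfl
  map_smul' _ _ := rfl

/-- Locally constant functions of compact support. -/
def locConstCompact (F : Type*) [NontriviallyNormedField F] (κ : Type*) [Fintype κ] :
    Submodule ℂ ((κ → F) → ℂ) where
  carrier := {f | IsLocallyConstant f ∧ HasCompactSupport f}
  zero_mem' := ⟨IsLocallyConstant.const 0, HasCompactSupport.zero⟩
  add_mem' hf hg := ⟨hf.1.add hg.1, hf.2.add hg.2⟩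
  smul_mem' c _ hf := ⟨hf.1.comp (fun z => c • z), hf.2.comp_left (smul_zero c)⟩

/-- The Schwartz space `S(F^κ)`, as a space of functions: locally constant functions of compact
support if `F` is nonarchimedean, and the usual Schwartz space of the real vector space `F^κ` if
`F` is archimedean. -/
def schwartz (k : LocalKind F) (κ : Type*) [Fintype κ] : Submodule ℂ ((κ → F) → ℂ) :=
  match k with
  | .nonarch _ => locConstCompact F κ
  | .arch _ => LinearMap.range (schwartzIncl κ)

/-- The closure of a subspace `W` of `S(F^κ)`: nothing is done if `F` is nonarchimedean, and the
closure is taken in the Fréchet topology of the Schwartz space if `F` is archimedean. -/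
def schwartzClosure (k : LocalKind F) (κ : Type*) [Fintype κ] (W : Submodule ℂ ((κ → F) → ℂ)) :
    Submodule ℂ ((κ → F) → ℂ) :=
  match k with
  | .nonarch _ => W
  | .arch _ => ((W.comap (schwartzIncl κ)).topologicalClosure).map (schwartzIncl κ)

end Schwartz

/-! ### Absolute value, characters and measures -/

section Field

variable {F : Type*} [NontriviallyNormedField F] [ProperSpace F]

/-- The normalized absolute value: `|a|` is the factor by which multiplication by `a` scales a Haar
measure of `F` (so it is the square of the usual one on `ℂ`). -/
def modulus (a : Fˣ) : ℝ := (distribHaarChar F a : ℝ)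

open Classical in
/-- The Hilbert symbol `(a, b)`: it is `1` if `z² = a x² + b y²` has a solution
`(x, y, z) ≠ (0, 0, 0)` and `-1` otherwise. -/
def hilbertSymbol (a b : F) : ℂ :=
  if ∃ x y z : F, (x ≠ 0 ∨ y ≠ 0 ∨ z ≠ 0) ∧ z ^ 2 = a * x ^ 2 + b * y ^ 2 then 1 else -1

/-- The value at `1` of the local zeta function of `F`: `(1 - q⁻¹)⁻¹` with `q` the cardinality of
the residue field, or `π^{-s/2} Γ(s/2)` at `s = 1` for `ℝ`, or `2 (2π)^{-s} Γ(s)` at `s = 1` for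
`ℂ`. -/
def zetaOne (k : LocalKind F) : ℝ :=
  match k with
  | .nonarch _ =>
    (1 - (Nat.card (IsLocalRing.ResidueField
      (NormedField.valuation (K := F)).valuationSubring) : ℝ)⁻¹)⁻¹
  | .arch _ => if Module.finrank ℝ F = 1 then (Complex.Gammaℝ 1).re else (Complex.Gammaℂ 1).re

variable [MeasurableSpace F]

/-- `μ` is self-dual with respect to `ψ`: Fourier inversion holds on `S(F)` without a constant. -/
def IsSelfDual (k : LocalKind F) (ψ : AddChar F Circle) (μ : Measure F) : Prop :=
  ∀ f : F → ℂ, (fun v : Unit → F => f (v ())) ∈ schwartz k Unit →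
    ∀ x : F, ∫ y, (∫ z, f z * (ψ (y * z) : ℂ) ∂μ) * (ψ (-(x * y)) : ℂ) ∂μ = f x

/-- The measure `d^×a = ζ(1) |a|⁻¹ da` on `F^×`. -/
def mulMeasure (k : LocalKind F) (μ : Measure F) : Measure Fˣ :=
  ENNReal.ofReal (zetaOne k) •
    (μ.comap (Units.val : Fˣ → F)).withDensity (fun a => ENNReal.ofReal (modulus a)⁻¹)

end Field

/-! ### Quadratic spaces -/

section Quadratic

variable {F : Type*} [Field F] {κ : Type*} [Fintype κ] [DecidableEq κ]

/-- The matrix of the hyperbolic plane. -/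
def hypPlane : Matrix (Fin 2) (Fin 2) F := !![0, 1; 1, 0]

/-- The matrix `J_i`, with diagonal blocks `J₀` and `i` copies of the hyperbolic plane. It is the
matrix of `Q_i` on `V_i = F^(ι₀ ⊕ Fin 2 × Fin i)`. -/
def quadMatrix {ι₀ : Type*} (J₀ : Matrix ι₀ ι₀ F) (i : ℕ) :
    Matrix (ι₀ ⊕ Fin 2 × Fin i) (ι₀ ⊕ Fin 2 × Fin i) F :=
  fromBlocks J₀ 0 0 (blockDiagonal fun _ : Fin i => hypPlane)

/-- The matrix of `V ⊕ F²`, where `F²` is a hyperbolic plane. For `V = V_i` this is `V_{i+1}`. -/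
def addPlane (S : Matrix κ κ F) : Matrix (κ ⊕ Fin 2) (κ ⊕ Fin 2) F :=
  fromBlocks S 0 0 hypPlane

/-- The pairing `⟨x, y⟩ = xᵗ S y`. -/
def pairing (S : Matrix κ κ F) (x y : κ → F) : F := x ⬝ᵥ (S *ᵥ y)

/-- The quadratic form `Q(x) = xᵗ S x / 2`. -/
def quad (S : Matrix κ κ F) (x : κ → F) : F := pairing S x x / 2

/-- The punctured cone `X° = {ξ ≠ 0 : Q(ξ) = 0}`. -/
def cone (S : Matrix κ κ F) : Set (κ → F) := {ξ | quad S ξ = 0 ∧ ξ ≠ 0}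

/-- The orthogonal similitude group, as the group of pairs `(h, λ)` with `hᵗ S h = λ S`. -/
def GO (S : Matrix κ κ F) : Subgroup (GL κ F × Fˣ) where
  carrier := {p | (p.1 : Matrix κ κ F)ᵀ * S * p.1 = (p.2 : F) • S}
  one_mem' := by simp
  mul_mem' := by
    intro p q hp hq
    simp only [Set.mem_ofPred_eq] at hp hq ⊢
    calc ((p * q).1 : Matrix κ κ F)ᵀ * S * ((p * q).1 : Matrix κ κ F)
        = (q.1 : Matrix κ κ F)ᵀ * ((p.1 : Matrix κ κ F)ᵀ * S * p.1) * q.1 := by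
          simp [Matrix.mul_assoc]
      _ = (((p * q).2 : Fˣ) : F) • S := by
          rw [hp]; simp [hq, smul_smul]
  inv_mem' := by
    intro p hp
    simp only [Set.mem_ofPred_eq] at hp ⊢
    have h1 : (p.1 : Matrix κ κ F) * ((p⁻¹).1 : Matrix κ κ F) = 1 := by
      rw [← Units.val_mul]; simp
    have h2 : ((p⁻¹).1 : Matrix κ κ F)ᵀ * (p.1 : Matrix κ κ F)ᵀ = 1 := by
      rw [← Matrix.transpose_mul, h1, Matrix.transpose_one]
    have h3 : ((p⁻¹).1 : Matrix κ κ F)ᵀ * ((p.1 : Matrix κ κ F)ᵀ * S * p.1) *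
        ((p⁻¹).1 : Matrix κ κ F) = S := by
      calc _ = (((p⁻¹).1 : Matrix κ κ F)ᵀ * (p.1 : Matrix κ κ F)ᵀ) * S *
              ((p.1 : Matrix κ κ F) * ((p⁻¹).1 : Matrix κ κ F)) := by
            simp only [Matrix.mul_assoc]
        _ = S := by rw [h1, h2]; simp
    rw [hp] at h3
    have h4 : (p.2 : F) • (((p⁻¹).1 : Matrix κ κ F)ᵀ * S * ((p⁻¹).1 : Matrix κ κ F)) = S := by
      simpa using h3
    calc _ = ((p.2 : F)⁻¹ * (p.2 : F)) •
          (((p⁻¹).1 : Matrix κ κ F)ᵀ * S * ((p⁻¹).1 : Matrix κ κ F)) := by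
            rw [inv_mul_cancel₀ p.2.ne_zero, one_smul]
      _ = _ := by rw [mul_smul, h4]; simp

/-- The underlying matrix of a similitude. -/
def simMat {S : Matrix κ κ F} (h : GO S) : GL κ F := h.1.1

/-- The similitude norm. -/
def simNorm {S : Matrix κ κ F} (h : GO S) : Fˣ := h.1.2

/-- A matrix `A` with `Aᵗ S A = l S`, as an element of the similitude group. -/
def ofMatrixGO {S : Matrix κ κ F} (hS : IsUnit S.det) (A : Matrix κ κ F) (l : Fˣ)
    (hA : Aᵀ * S * A = (l : F) • S) : GO S :=
  ⟨(Matrix.GeneralLinearGroup.mkOfDetNeZero A (by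
      intro h0
      have := congrArg Matrix.det hA
      rw [Matrix.det_mul, h0, mul_zero, Matrix.det_smul] at this
      exact mul_ne_zero (pow_ne_zero _ l.ne_zero) hS.ne_zero this.symm), l), by
    change (A)ᵀ * S * A = (l : F) • S
    exact hA⟩

theorem hypPlane_det : (hypPlane : Matrix (Fin 2) (Fin 2) F).det = -1 := by
  simp [hypPlane, Matrix.det_fin_two]

theorem hypPlane_symm : (hypPlane : Matrix (Fin 2) (Fin 2) F)ᵀ = hypPlane := by
  ext i j; fin_cases i <;> fin_cases j <;> rfl

theorem addPlane_det {S : Matrix κ κ F} (hS : IsUnit S.det) : IsUnit (addPlane S).det := by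
  simpa [addPlane, Matrix.det_fromBlocks_zero₂₁, hypPlane_det] using hS

theorem quadMatrix_det {ι₀ : Type*} [Fintype ι₀] [DecidableEq ι₀] {J₀ : Matrix ι₀ ι₀ F}
    (h : J₀.det ≠ 0) (i : ℕ) : IsUnit (quadMatrix J₀ i).det := by
  simp [quadMatrix, Matrix.det_fromBlocks_zero₂₁, hypPlane_det, Matrix.det_blockDiagonal, h]

theorem quadMatrix_symm {ι₀ : Type*} {J₀ : Matrix ι₀ ι₀ F} (h : J₀.IsSymm) (i : ℕ) :
    (quadMatrix J₀ i).IsSymm := by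
  unfold quadMatrix
  refine Matrix.IsSymm.fromBlocks h (by simp) ?_
  simp [Matrix.IsSymm, Matrix.blockDiagonal_transpose, hypPlane_symm]

theorem quad_inv_mulVec {S : Matrix κ κ F} (h : GO S) (ξ : κ → F) :
    (simNorm h : F) * quad S (((simMat h)⁻¹ : GL κ F).1 *ᵥ ξ) = quad S ξ := by
  have h1 : (simMat h : Matrix κ κ F)ᵀ * S * (simMat h : Matrix κ κ F) = (simNorm h : F) • S :=
    h.2
  set η := ((simMat h)⁻¹ : GL κ F).1 *ᵥ ξ with hη
  have h2 : (simMat h : Matrix κ κ F) *ᵥ η = ξ := by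
    rw [hη, Matrix.mulVec_mulVec, ← Units.val_mul, mul_inv_cancel, Units.val_one,
      Matrix.one_mulVec]
  have h3 : pairing S ξ ξ = (simNorm h : F) * pairing S η η := by
    calc pairing S ξ ξ = pairing S ((simMat h : Matrix κ κ F) *ᵥ η)
            ((simMat h : Matrix κ κ F) *ᵥ η) := by rw [h2]
      _ = η ⬝ᵥ (((simMat h : Matrix κ κ F)ᵀ * S * (simMat h : Matrix κ κ F)) *ᵥ η) := by
          rw [pairing, ← Matrix.mulVec_mulVec, ← Matrix.mulVec_mulVec,
            Matrix.dotProduct_mulVec η, Matrix.vecMul_transpose]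
      _ = _ := by
          rw [h1, Matrix.smul_mulVec, dotProduct_smul, smul_eq_mul, pairing]
  rw [quad, quad, h3, mul_div_assoc]

/-- The point `h⁻¹ ξ` of the punctured cone. -/
def invActCone {S : Matrix κ κ F} (h : GO S) (ξ : cone S) : cone S :=
  ⟨((simMat h)⁻¹ : GL κ F).1 *ᵥ ξ.1, by
    refine ⟨?_, fun h0 => ξ.2.2 ?_⟩
    · have h1 := quad_inv_mulVec h ξ.1
      rw [ξ.2.1] at h1
      exact (mul_eq_zero.mp h1).resolve_left (simNorm h).ne_zero
    · have h1 : (simMat h : Matrix κ κ F) *ᵥ (((simMat h)⁻¹ : GL κ F).1 *ᵥ ξ.1) = ξ.1 := by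
        rw [Matrix.mulVec_mulVec, ← Units.val_mul, mul_inv_cancel, Units.val_one,
          Matrix.one_mulVec]
      rw [← h1, h0, Matrix.mulVec_zero]⟩

/-- The point `a ξ` of the punctured cone. -/
def smulCone {S : Matrix κ κ F} (a : Fˣ) (ξ : cone S) : cone S :=
  ⟨(a : F) • ξ.1, by
    have h1 := ξ.2.1
    refine ⟨?_, smul_ne_zero a.ne_zero ξ.2.2⟩
    simp only [quad, pairing, Matrix.mulVec_smul, dotProduct_smul, smul_dotProduct,
      smul_eq_mul] at h1 ⊢
    rw [mul_div_assoc, mul_div_assoc, h1, mul_zero, mul_zero]⟩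

/-- The embedding of `GO(V)` into `GO(V ⊕ F²)` by `h ↦ diag(h, λ(h), 1)`. -/
def embGO {S : Matrix κ κ F} (hS : IsUnit S.det) (h : GO S) : GO (addPlane S) :=
  ofMatrixGO (addPlane_det hS)
    (fromBlocks (simMat h : Matrix κ κ F) 0 0 !![(simNorm h : F), 0; 0, 1]) (simNorm h) (by
      have h1 : (simMat h : Matrix κ κ F)ᵀ * S * (simMat h : Matrix κ κ F) = (simNorm h : F) • S := h.2
      have h2 : (!![(simNorm h : F), 0; 0, 1])ᵀ * hypPlane * !![(simNorm h : F), 0; 0, 1] =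
          (simNorm h : F) • hypPlane := by
        ext i j; fin_cases i <;> fin_cases j <;> simp [hypPlane, Matrix.mul_apply, Fin.sum_univ_two]
      simp [addPlane, Matrix.fromBlocks_transpose, Matrix.fromBlocks_multiply,
        Matrix.fromBlocks_smul, h1, h2])

/-- The element `diag(1, a, a⁻¹)` of `GO(V ⊕ F²)`. -/
def torusGO {S : Matrix κ κ F} (hS : IsUnit S.det) (a : Fˣ) : GO (addPlane S) :=
  ofMatrixGO (addPlane_det hS) (fromBlocks 1 0 0 !![(a : F), 0; 0, (a : F)⁻¹]) 1 (by
    have h2 : (!![(a : F), 0; 0, (a : F)⁻¹])ᵀ * hypPlane * !![(a : F), 0; 0, (a : F)⁻¹] =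
        hypPlane := by
      ext i j; fin_cases i <;> fin_cases j <;> simp [hypPlane, Matrix.mul_apply, Fin.sum_univ_two]
    simp [addPlane, Matrix.fromBlocks_transpose, Matrix.fromBlocks_multiply, h2])

/-- The element of `GO(V ⊕ F²)` that interchanges the two coordinates of `F²`. -/
def swapGO {S : Matrix κ κ F} (hS : IsUnit S.det) : GO (addPlane S) :=
  ofMatrixGO (addPlane_det hS) (fromBlocks 1 0 0 !![0, 1; 1, 0]) 1 (by
    have h2 : (!![(0 : F), 1; 1, 0])ᵀ * hypPlane * !![(0 : F), 1; 1, 0] = hypPlane := by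
      ext i j; fin_cases i <;> fin_cases j <;> simp [hypPlane, Matrix.mul_apply, Fin.sum_univ_two]
    simp [addPlane, Matrix.fromBlocks_transpose, Matrix.fromBlocks_multiply, h2])

/-- The matrix of the unipotent element `u(x)`, with rows `(1, S⁻¹x, 0)`, `(0, 1, 0)` and
`(-xᵗ, -Q(S⁻¹x), 1)`. -/
def unipMatrix (S : Matrix κ κ F) (x : κ → F) : Matrix (κ ⊕ Fin 2) (κ ⊕ Fin 2) F :=
  fromBlocks 1 (of fun p j => ![(S⁻¹ *ᵥ x) p, 0] j)
    (of fun j p => ![0, -(x p)] j) !![1, 0; -(quad S (S⁻¹ *ᵥ x)), 1]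

theorem unipMatrix_mem {S : Matrix κ κ F} (hS : IsUnit S.det) (hs : S.IsSymm)
    (h2 : (2 : F) ≠ 0) (x : κ → F) :
    (unipMatrix S x)ᵀ * addPlane S * unipMatrix S x = ((1 : Fˣ) : F) • addPlane S := by
  set y := S⁻¹ *ᵥ x with hy
  have hSy : S *ᵥ y = x := by
    rw [hy, Matrix.mulVec_mulVec, Matrix.mul_nonsing_inv _ hS, Matrix.one_mulVec]
  have hq : quad S y + quad S y = y ⬝ᵥ x := by
    unfold quad pairing
    rw [hSy]; field_simp; ring
  have hB : S * (of fun p j => ![y p, 0] j : Matrix κ (Fin 2) F) =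
      of fun p j => ![x p, 0] j := by
    ext p j
    fin_cases j
    · simpa [Matrix.mul_apply, Matrix.mulVec, dotProduct] using congrFun hSy p
    · simp [Matrix.mul_apply]
  have hBt : (of fun p j => ![y p, 0] j : Matrix κ (Fin 2) F)ᵀ * S =
      (of fun p j => ![x p, 0] j : Matrix κ (Fin 2) F)ᵀ := by
    rw [← hB, Matrix.transpose_mul, hs.eq]
  have e11 : ((of fun j p => ![0, -(x p)] j : Matrix (Fin 2) κ F)ᵀ : Matrix κ (Fin 2) F) *
        (hypPlane : Matrix (Fin 2) (Fin 2) F) *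
      (of fun j p => ![0, -(x p)] j : Matrix (Fin 2) κ F) = 0 := by
    ext p p'
    simp [hypPlane, Matrix.mul_apply, Fin.sum_univ_two]
  have e12 : (of fun p j => ![x p, 0] j : Matrix κ (Fin 2) F) +
      ((of fun j p => ![0, -(x p)] j : Matrix (Fin 2) κ F)ᵀ : Matrix κ (Fin 2) F) *
        (hypPlane : Matrix (Fin 2) (Fin 2) F) *
        (!![1, 0; -(quad S y), 1] : Matrix (Fin 2) (Fin 2) F) = 0 := by
    ext p j
    fin_cases j <;> simp [hypPlane, Matrix.mul_apply, Fin.sum_univ_two]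
  have e21 : (of fun p j => ![x p, 0] j : Matrix κ (Fin 2) F)ᵀ +
      (!![1, 0; -(quad S y), 1] : Matrix (Fin 2) (Fin 2) F)ᵀ * hypPlane *
        (of fun j p => ![0, -(x p)] j : Matrix (Fin 2) κ F) = 0 := by
    ext j p
    fin_cases j <;> simp [hypPlane, Matrix.mul_apply, Fin.sum_univ_two]
  have e22 : (of fun p j => ![x p, 0] j : Matrix κ (Fin 2) F)ᵀ *
        (of fun p j => ![y p, 0] j : Matrix κ (Fin 2) F) +
      !![1, 0; -(quad S y), 1]ᵀ * hypPlane * !![1, 0; -(quad S y), 1] = hypPlane := by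
    have hq' : ∑ p, x p * y p = quad S y + quad S y := by
      rw [hq]; simp [dotProduct, mul_comm]
    ext j j'
    fin_cases j <;> fin_cases j' <;>
      simp [hypPlane, Matrix.mul_apply, Fin.sum_univ_two, hq']
  rw [unipMatrix, addPlane, ← hy, Matrix.fromBlocks_transpose, Matrix.fromBlocks_multiply,
    Matrix.fromBlocks_multiply]
  simp only [Matrix.transpose_one, Matrix.one_mul, Matrix.mul_zero, add_zero, zero_add,
    Matrix.mul_one, hBt, hB, e11, e12, e21, e22, Units.val_one, one_smul]

/-- The unipotent element `u(x)` of `GO(V ⊕ F²)`. -/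
def unipGO {S : Matrix κ κ F} (hS : IsUnit S.det) (hs : S.IsSymm) (h2 : (2 : F) ≠ 0)
    (x : κ → F) : GO (addPlane S) :=
  ofMatrixGO (addPlane_det hS) (unipMatrix S x) 1 (unipMatrix_mem hS hs h2 x)

end Quadratic

/-! ### The Weil representation -/

section Weil

variable {F : Type*} [NontriviallyNormedField F] [ProperSpace F] [MeasurableSpace F]
variable {κ : Type*} [Fintype κ] [DecidableEq κ]

/-- The measure on `V = F^κ` that is self-dual with respect to `ψ(⟨x, y⟩)`, if `μ` is self-dual on
`F` with respect to `ψ`. -/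
def quadMeasure (μ : Measure F) {S : Matrix κ κ F} (hS : IsUnit S.det) : Measure (κ → F) :=
  ENNReal.ofReal (modulus hS.unit ^ (1 / 2 : ℝ)) • Measure.pi fun _ => μ

/-- `γ` is the Weil index of `Q`: the Fourier transform of `ψ ∘ Q` is `γ · ψ ∘ (-Q)`, as tempered
distributions. -/
def IsWeilIndex (k : LocalKind F) (ψ : AddChar F Circle) (μ : Measure F) {S : Matrix κ κ F}
    (hS : IsUnit S.det) (γ : ℂ) : Prop :=
  ∀ φ ∈ schwartz k κ,
    ∫ x, (∫ y, φ y * (ψ (pairing S x y) : ℂ) ∂quadMeasure μ hS) * (ψ (quad S x) : ℂ)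
        ∂quadMeasure μ hS
      = γ * ∫ x, φ x * (ψ (-quad S x) : ℂ) ∂quadMeasure μ hS

/-- The Weil index `γ(Q)`. -/
def weilIndex (k : LocalKind F) (ψ : AddChar F Circle) (μ : Measure F) {S : Matrix κ κ F}
    (hS : IsUnit S.det) : ℂ :=
  Classical.epsilon (IsWeilIndex k ψ μ hS)

/-- The character `χ(a) = (a, (-1)^{dim V / 2} det S)` attached to the quadratic space. -/
def quadChar (S : Matrix κ κ F) (a : F) : ℂ :=
  hilbertSymbol a ((-1) ^ (Fintype.card κ / 2) * S.det)

open Classical in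
/-- The Weil representation `ρ` of `SL₂(F)` on functions on `V`. On the Borel subgroup it is
`ρ(a, b; 0, a⁻¹) f(x) = χ(a) |a|^{dim V / 2} ψ(a b Q(x)) f(a x)`, and for `c ≠ 0` the formula
below is that of `n(a/c) diag(-1/c, -c) w n(d/c)`, where `w = (0, 1; -1, 0)` acts by
`ρ(w) f(x) = γ ∫ f(y) ψ(⟨x, y⟩) dy`. -/
def weilRep (k : LocalKind F) (ψ : AddChar F Circle) (μ : Measure F) {S : Matrix κ κ F}
    (hS : IsUnit S.det) (g : SL(2, F)) (f : (κ → F) → ℂ) (x : κ → F) : ℂ :=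
  if hc : g 1 0 = 0 then
    quadChar S (g 0 0) *
      ((modulus (Units.mk0 (g 0 0) (by
        intro h0
        have := g.det_coe
        rw [Matrix.det_fin_two, h0, hc] at this
        simp at this)) ^ ((Fintype.card κ : ℝ) / 2) : ℝ) : ℂ) *
      (ψ (g 0 0 * g 0 1 * quad S x) : ℂ) * f (g 0 0 • x)
  else
    weilIndex k ψ μ hS * quadChar S (-g 1 0) *
      ((modulus (Units.mk0 (g 1 0) hc) ^ (-(Fintype.card κ : ℝ) / 2) : ℝ) : ℂ) *
      (ψ (g 0 0 * quad S x / g 1 0) : ℂ) *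
      ∫ y, f y * (ψ ((g 1 1 * quad S y - pairing S x y) / g 1 0) : ℂ) ∂quadMeasure μ hS

/-- The representation `r = ρ ⊗ L^∨` of `SL₂(F)` on functions on `V ⊕ F²`, where
`L^∨(g) f(u) = f(gᵗ u)`. -/
def mixedRep (k : LocalKind F) (ψ : AddChar F Circle) (μ : Measure F) {S : Matrix κ κ F}
    (hS : IsUnit S.det) (g : SL(2, F)) (f : (κ ⊕ Fin 2 → F) → ℂ) (v : κ ⊕ Fin 2 → F) : ℂ :=
  weilRep k ψ μ hS g
    (fun x => f (Sum.elim x ((g : Matrix (Fin 2) (Fin 2) F)ᵀ *ᵥ (v ∘ Sum.inr)))) (v ∘ Sum.inl)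

/-! ### The Schwartz space of the cone -/

/-- The (closure of the) span `W` of all `f - r(g) f`. -/
def coinvKernel (k : LocalKind F) (ψ : AddChar F Circle) (μ : Measure F) {S : Matrix κ κ F}
    (hS : IsUnit S.det) : Submodule ℂ ((κ ⊕ Fin 2 → F) → ℂ) :=
  schwartzClosure k (κ ⊕ Fin 2) (Submodule.span ℂ
    {w | ∃ g : SL(2, F), ∃ f ∈ schwartz k (κ ⊕ Fin 2), w = f - mixedRep k ψ μ hS g f})

/-- The Schwartz space `S(X) = S(V ⊕ F²)_{r(SL₂(F))}`, a space of coinvariants. -/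
abbrev ConeSchwartz (k : LocalKind F) (ψ : AddChar F Circle) (μ : Measure F) {S : Matrix κ κ F}
    (hS : IsUnit S.det) : Type _ :=
  schwartz k (κ ⊕ Fin 2) ⧸ (coinvKernel k ψ μ hS).submoduleOf (schwartz k (κ ⊕ Fin 2))

/-- The class in `S(X)` of an element of `S(V ⊕ F²)`. -/
def coneClass (k : LocalKind F) (ψ : AddChar F Circle) (μ : Measure F) {S : Matrix κ κ F}
    (hS : IsUnit S.det) : schwartz k (κ ⊕ Fin 2) →ₗ[ℂ] ConeSchwartz k ψ μ hS :=
  Submodule.mkQ _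

/-! ### The operator `I` -/

/-- The matrix `(1, t; 0, 1)`. -/
def upperUnip (t : F) : SL(2, F) := ⟨!![1, t; 0, 1], by simp [Matrix.det_fin_two]⟩

/-- The matrix `diag(a, a⁻¹)`. -/
def diagTorus (a : Fˣ) : SL(2, F) := ⟨!![(a : F), 0; 0, (a : F)⁻¹], by simp [Matrix.det_fin_two]⟩

/-- The Iwasawa decomposition `SL₂(F) = N(F) T(F) K`. -/
def IsIwasawa (K : Subgroup SL(2, F)) : Prop :=
  ∀ g : SL(2, F), ∃ (t : F) (a : Fˣ), ∃ m ∈ K, g = upperUnip t * diagTorus a * m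

instance instMeasurableSpaceSubgroup (K : Subgroup SL(2, F)) : MeasurableSpace K := borel K

instance instBorelSpaceSubgroup (K : Subgroup SL(2, F)) : BorelSpace K := ⟨rfl⟩

/-- The Haar measure on `K` of total mass `1`. -/
def maxCompactMeasure (K : Subgroup SL(2, F)) [CompactSpace K] : Measure K :=
  Measure.haarMeasure ⊤

/-- The measure `|a|⁻² d^×a dk` on `F^× × K`. It is the invariant measure on `N(F)\SL₂(F)` in the
coordinates `(a, k) ↦ N(F) diag(a, a⁻¹) k`: the quotient, by `dt` on `N(F)`, of the Haar measure
`d(n(t) diag(a, a⁻¹) k) = dt |a|⁻² d^×a dk` of `SL₂(F)`. -/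
def quotMeasure (k : LocalKind F) (μ : Measure F) (K : Subgroup SL(2, F)) [CompactSpace K] :
    Measure (Fˣ × K) :=
  ((mulMeasure k μ).withDensity fun a => ENNReal.ofReal ((modulus a ^ 2)⁻¹)).prod
    (maxCompactMeasure K)

/-- The function `g ↦ r(g) f(ξ, 0, 1)`, in the coordinates `g = diag(a, a⁻¹) k`. -/
def coneIntegrand (k : LocalKind F) (ψ : AddChar F Circle) (μ : Measure F) {S : Matrix κ κ F}
    (hS : IsUnit S.det) (K : Subgroup SL(2, F)) (f : (κ ⊕ Fin 2 → F) → ℂ) (ξ : κ → F)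
    (p : Fˣ × K) : ℂ :=
  mixedRep k ψ μ hS (diagTorus p.1 * p.2) f (Sum.elim ξ ![0, 1])

/-- `I(f)(ξ) = ∫_{N(F)\SL₂(F)} r(g) f(ξ, 0, 1) dg`. -/
def coneIntegral (k : LocalKind F) (ψ : AddChar F Circle) (μ : Measure F) {S : Matrix κ κ F}
    (hS : IsUnit S.det) (K : Subgroup SL(2, F)) [CompactSpace K] (f : (κ ⊕ Fin 2 → F) → ℂ)
    (ξ : κ → F) : ℂ :=
  ∫ p, coneIntegrand k ψ μ hS K f ξ p ∂quotMeasure k μ K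

/-! ### The action of the similitude group and the Fourier transforms -/

/-- The partial Fourier transform `F₂ f(ξ, u₁, u₂) = ∫ f(ξ, u₁, x) ψ(u₂ x) dx`. -/
def partialFourier (ψ : AddChar F Circle) (μ : Measure F) (f : (κ ⊕ Fin 2 → F) → ℂ)
    (v : κ ⊕ Fin 2 → F) : ℂ :=
  ∫ x, f (Sum.elim (v ∘ Sum.inl) ![v (Sum.inr 0), x]) * (ψ (v (Sum.inr 1) * x) : ℂ) ∂μ

/-- The inverse of the partial Fourier transform,
`F₂⁻¹ f(ξ, u₁, u₂) = ∫ f(ξ, u₁, x) ψ(-u₂ x) dx`. -/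
def partialFourierInv (ψ : AddChar F Circle) (μ : Measure F) (f : (κ ⊕ Fin 2 → F) → ℂ)
    (v : κ ⊕ Fin 2 → F) : ℂ :=
  ∫ x, f (Sum.elim (v ∘ Sum.inl) ![v (Sum.inr 0), x]) * (ψ (-(v (Sum.inr 1) * x)) : ℂ) ∂μ

/-- The operator `σ(h) = F₂ ∘ L(h) ∘ F₂⁻¹`, where `L(h) f(x) = f(h⁻¹ x)`. -/
def sigma (ψ : AddChar F Circle) (μ : Measure F) {S : Matrix κ κ F} (h : GO (addPlane S))
    (f : (κ ⊕ Fin 2 → F) → ℂ) : (κ ⊕ Fin 2 → F) → ℂ :=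
  partialFourier ψ μ fun x =>
    partialFourierInv ψ μ f (((simMat h)⁻¹ : GL (κ ⊕ Fin 2) F).1 *ᵥ x)

/-- The Fourier transform in the variable of `F²` with respect to `ψ(w ∧ v)`,
`f(ξ, v) ↦ ∫ f(ξ, w₁, w₂) ψ(w₁ v₂ - w₂ v₁) dw₁ dw₂`. -/
def wedgeFourier (ψ : AddChar F Circle) (μ : Measure F) (f : (κ ⊕ Fin 2 → F) → ℂ)
    (v : κ ⊕ Fin 2 → F) : ℂ :=
  ∫ w : Fin 2 → F, f (Sum.elim (v ∘ Sum.inl) w) *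
    (ψ (w 0 * v (Sum.inr 1) - w 1 * v (Sum.inr 0)) : ℂ) ∂Measure.pi fun _ => μ

end Weil

end QuadricSchwartz

end

/-!
Write `r` for the action of `SL₂(F)` on `S(V ⊕ F²)` (`mixedRep`), `m = dim V / 2`, and `Q` for the
quadratic form of `V`. The argument has four parts.

**`r` is a representation.** `weilRep` is given by a formula on each Bruhat cell, and
`sl_induction` reduces multiplicativity to left multiplication by `n(t)`, `diag(a, a⁻¹)` and `w`
(`weilRep_weylElt_mul` is the essential case). This needs three facts on the Weil index `γ` of `Q`:
it exists (`gauss_symm`), `γ(tQ) = χ(t) γ(Q)` (`weilConst_smul`) and `γ² = χ(-1)` (`weilConst_sq`).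
The form being diagonalizable, the last two reduce to binary norm forms `x² - d y²`. If `b` is not
a value of such a form `N`, the images of Haar measure under `N` and `b N`, suitably weighted, add
up to a Haar measure of `F` (`exists_map_norm_add`); integrating `ψ` against it gives `γ(bN) =
-γ(N)` (`weilConst_nonnorm`). Homogeneity of that measure and multiplicativity of the Hilbert
symbol both rest on the values of `N` having index at most `2` in `F^×` (`normIndexLeTwo`). It is
proved by elementary means: an approximation modulo `4` and Hensel's lemma for units and for `d` of
odd valuation, and symmetry of the symbol for the rest.

**`σ` descends.** Under the partial Fourier transform `F₂`, `r` becomes the Weil representation of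
`V ⊕ F²` with the form `Q + u₁u₂`: `n(t)` acts by `ψ(t Q)`, the torus by dilations and `w` by the
Fourier transform (`mixedRep_weylElt_partialFourier`). A similitude `h` acts there by a linear
change of variables, so `σ(h)` intertwines `r` with a twist of `r` by `λ(h)`, and `σ(h) (f - r(g)
f)` is again in the span of such differences (`sigma_mixedRep_sub_mem`). Over archimedean fields
the closure of the span is preserved because `σ(h)` is continuous: `IsSchwartzOp` collects what is
needed of the operators in both cases. `F_X` is `σ` of the swap (`sigma_swapGO`).

**`I` converges and descends.** `g ↦ (c, d)`, the bottom row, identifies `N\SL₂` with the plane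
without the origin, and takes the measure `|a|⁻² d^×a dk` to a multiple of Lebesgue measure
(`exists_map_quotMeasure`). As `Q(ξ) = 0`, `r(g) f(ξ, 0, 1)` depends on `(c, d)` only, and for `c ≠
0` it is `γ χ(-c) |c|⁻ᵐ ∫ f(y, c, d) ψ((d Q(y) - ⟨ξ, y⟩) / c) dy` (`coneFun`). For `|d| ≤ |c|` this
is a Fourier transform of a Schwartz function at a point of size at least `‖Sξ‖ / |c|`, with `S`
the matrix of `⟨·, ·⟩`; since `ξ ≠ 0`, it decays fast enough as `c → 0` to absorb `|c|⁻ᵐ`. The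
region `|c| ≤ |d|` is reduced to this one by `w` (`schwartzBounded_coneFun`). The estimates are by
Schwartz seminorms of `f`, hence `I` is continuous; it is `SL₂`-invariant because Lebesgue measure
of the plane is. So it kills the closure of the span (`integral_coneFun_eq_zero`).

**The formulas.** On `coneFun` each similitude in question acts by an affine change of the
variables `y` and `(c, d)`; `χ ∘ λ = 1` (`quadChar_similitude`) removes the character in the first
formula.
-/

set_option linter.unusedSectionVars false

noncomputable section

namespace QuadricSchwartz

/-- The product measure on a coordinate space `F^κ`. -/
notation "vol[" μ "]" => Measure.pi fun _ => μ

/-! ### The normalized absolute value and linear changes of variables -/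

theorem integral_congr_forall {X E : Type*} [MeasurableSpace X] [NormedAddCommGroup E]
    [NormedSpace ℝ E] {ν : Measure X} {f g : X → E} (h : ∀ x, f x = g x) :
    ∫ x, f x ∂ν = ∫ x, g x ∂ν :=
  congrArg (integral ν) (funext h)

section Modulus

variable {F : Type*} [NontriviallyNormedField F] [ProperSpace F]

theorem modulus_pos (a : Fˣ) : 0 < modulus a := by
  have := distribHaarChar_pos (G := Fˣ) (A := F) (g := a)
  exact_mod_cast this

@[simp] theorem modulus_one : modulus (1 : Fˣ) = 1 := by simp [modulus]

@[simp] theorem modulus_mul (a b : Fˣ) : modulus (a * b) = modulus a * modulus b := by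
  simp [modulus]

@[simp] theorem modulus_inv (a : Fˣ) : modulus a⁻¹ = (modulus a)⁻¹ := by
  simp [modulus]

@[simp] theorem modulus_pow (a : Fˣ) (n : ℕ) : modulus (a ^ n) = modulus a ^ n := by
  simp [modulus]

variable [MeasurableSpace F] [BorelSpace F] (μ : Measure F) [μ.IsAddHaarMeasure]

open Pointwise in
theorem modulus_mul_measure (a : Fˣ) (s : Set F) :
    ENNReal.ofReal (modulus a) * μ s = μ (a • s) := by
  rw [← distribHaarChar_mul μ a s, modulus, ENNReal.ofReal_coe_nnreal]

theorem map_mul_left_eq (a : Fˣ) :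
    μ.map (fun x => (a : F) * x) = ENNReal.ofReal (modulus a)⁻¹ • μ := by
  ext s hs
  rw [Measure.map_apply (measurable_const_mul _) hs, Measure.smul_apply, smul_eq_mul,
    ← modulus_inv, modulus_mul_measure]
  congr 1
  ext x
  rw [Set.mem_smul_set_iff_inv_smul_mem]
  simp [Units.smul_def]

open Pointwise in
/-- Compare the volumes of `a B ⊆ b B` for the closed unit ball `B`. -/
theorem modulus_mono {a b : Fˣ} (h : ‖(a : F)‖ ≤ ‖(b : F)‖) : modulus a ≤ modulus b := by
  let ν : Measure F := Measure.addHaar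
  have hpos : 0 < ν (Metric.closedBall 0 1) :=
    Metric.measure_closedBall_pos ν _ one_pos
  have hfin : ν (Metric.closedBall 0 1) ≠ ∞ :=
    (isCompact_closedBall (0 : F) 1).measure_lt_top.ne
  have hsub : (a • Metric.closedBall (0 : F) 1 : Set F) ⊆ (b • Metric.closedBall (0 : F) 1 : Set F) := by
    intro x hx
    rw [Set.mem_smul_set_iff_inv_smul_mem] at hx ⊢
    simp only [Metric.mem_closedBall, dist_zero_right, Units.smul_def, smul_eq_mul, norm_mul,
      Units.val_inv_eq_inv_val, norm_inv] at hx ⊢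
    have ha : 0 < ‖(a : F)‖ := norm_pos_iff.2 a.ne_zero
    refine le_trans ?_ hx
    gcongr
  have h1 := measure_mono (μ := ν) hsub
  rw [← modulus_mul_measure, ← modulus_mul_measure] at h1
  have h2 := (ENNReal.mul_le_mul_iff_left hpos.ne' hfin).1 h1
  exact (ENNReal.ofReal_le_ofReal_iff (modulus_pos b).le).1 h2

/-- The absolute value grows at most polynomially in the norm. -/
theorem modulus_le_norm_pow (F : Type*) [NontriviallyNormedField F] [ProperSpace F] :
    ∃ C : ℝ, 0 < C ∧ ∃ M : ℕ, ∀ a : Fˣ, modulus a ≤ C * (1 + ‖(a : F)‖) ^ M := by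
  borelize F
  -- compare `a` with the powers of a fixed `x` of norm greater than `1`
  obtain ⟨x, hx⟩ := NormedField.exists_one_lt_norm F
  have hx0 : x ≠ 0 := norm_pos_iff.1 (one_pos.trans hx)
  let u := Units.mk0 x hx0
  obtain ⟨M, hM⟩ := pow_unbounded_of_one_lt (modulus u) hx
  refine ⟨‖x‖ ^ M, pow_pos (one_pos.trans hx) _, M, fun a => ?_⟩
  have hle : ∀ n : ℕ, modulus (u ^ n) ≤ (‖x‖ ^ n) ^ M := by
    intro n
    rw [modulus_pow, ← pow_mul, mul_comm, pow_mul]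
    exact pow_le_pow_left₀ (modulus_pos _).le hM.le _
  by_cases ha : ‖(a : F)‖ ≤ 1
  · have h1 : modulus a ≤ modulus (1 : Fˣ) := modulus_mono (by simpa using ha)
    rw [modulus_one] at h1
    refine h1.trans ?_
    have h2 : 1 ≤ ‖x‖ ^ M := one_le_pow₀ hx.le
    have h3 : 1 ≤ (1 + ‖(a : F)‖) ^ M := one_le_pow₀ (by simp)
    nlinarith
  · push Not at ha
    obtain ⟨n, h1, h2⟩ := exists_nat_pow_near ha.le hx
    have h3 : modulus a ≤ modulus (u ^ (n + 1)) := modulus_mono (by simpa [u] using h2.le)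
    refine (h3.trans (hle _)).trans ?_
    rw [pow_succ, mul_pow, mul_comm]
    gcongr
    linarith

theorem measurable_modulus : Measurable (modulus : Fˣ → ℝ) := by
  classical
  -- the absolute value is a monotone function of the norm
  let m : ℝ → ℝ := fun r => sSup {y | ∃ a : Fˣ, ‖(a : F)‖ ≤ r ∧ y = modulus a}
  have hbdd : ∀ r, BddAbove {y | ∃ a : Fˣ, ‖(a : F)‖ ≤ r ∧ y = modulus a} := by
    intro r
    obtain ⟨C, hC, M, h⟩ := modulus_le_norm_pow F
    refine ⟨C * (1 + r) ^ M, ?_⟩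
    rintro _ ⟨a, ha, rfl⟩
    refine (h a).trans ?_
    gcongr
  have hm : ∀ a : Fˣ, modulus a = m ‖(a : F)‖ := by
    intro a
    apply le_antisymm
    · exact le_csSup (hbdd _) ⟨a, le_rfl, rfl⟩
    · refine csSup_le ⟨_, a, le_rfl, rfl⟩ ?_
      rintro _ ⟨b, hb, rfl⟩
      exact modulus_mono hb
  have hmono : MonotoneOn m (Set.Ioi 0) := by
    intro r hr s hs hrs
    by_cases hne : {y | ∃ a : Fˣ, ‖(a : F)‖ ≤ r ∧ y = modulus a}.Nonempty
    · refine csSup_le_csSup (hbdd _) hne ?_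
      rintro _ ⟨a, ha, rfl⟩
      exact ⟨a, ha.trans hrs, rfl⟩
    · rw [Set.not_nonempty_iff_eq_empty] at hne
      change sSup _ ≤ sSup _
      rw [hne, Real.sSup_empty]
      refine Real.sSup_nonneg ?_
      rintro _ ⟨b, _, rfl⟩
      exact (modulus_pos b).le
  have hmono' : Monotone m := by
    intro r s hrs
    by_cases hr : 0 < r
    · exact hmono hr (hr.trans_le hrs) hrs
    · have : {y | ∃ a : Fˣ, ‖(a : F)‖ ≤ r ∧ y = modulus a} = ∅ := by
        ext y
        simp only [Set.mem_ofPred_eq, Set.mem_empty_iff_false, iff_false, not_exists, not_and]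
        intro a ha
        exact absurd (norm_pos_iff.2 a.ne_zero) (by linarith)
      change sSup _ ≤ sSup _
      rw [this, Real.sSup_empty]
      refine Real.sSup_nonneg ?_
      rintro _ ⟨b, _, rfl⟩
      exact (modulus_pos b).le
  rw [show (modulus : Fˣ → ℝ) = fun a : Fˣ => m ‖(a : F)‖ from funext hm]
  have hval : Measurable (Units.val : Fˣ → F) := comap_measurable _
  exact hmono'.measurable.comp hval.norm

end Modulus

section LinearChange

variable {F : Type*} [NontriviallyNormedField F] [ProperSpace F] [MeasurableSpace F] [BorelSpace F]
variable (μ : Measure F) [μ.IsAddHaarMeasure] {κ : Type*} [Fintype κ]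

theorem measurable_mulVec (A : Matrix κ κ F) : Measurable fun x : κ → F => A *ᵥ x := by
  refine (Continuous.matrix_mulVec continuous_const continuous_id).measurable

variable [DecidableEq κ]

theorem measurePreserving_transvectionStruct (t : TransvectionStruct κ F) :
    MeasurePreserving (fun x : κ → F => t.toMatrix *ᵥ x) vol[μ] vol[μ] := by
  have ht : Measurable fun x : κ → F => t.toMatrix *ᵥ x := measurable_mulVec _
  refine ⟨ht, ?_⟩
  refine (Measure.pi_eq fun s hs => ?_).symm
  have h2s : MeasurableSet (Set.univ.pi s) := MeasurableSet.pi Set.countable_univ fun i _ => hs i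
  simp_rw [← Measure.pi_pi, ← lintegral_indicator_one h2s]
  rw [lintegral_map (measurable_one.indicator h2s) ht]
  refine lintegral_eq_of_lmarginal_eq {t.i} ((measurable_one.indicator h2s).comp ht)
    (measurable_one.indicator h2s) ?_
  simp_rw [lmarginal_singleton]
  ext x
  cases t with | mk t_i t_j t_hij t_c =>
  simp [transvection, add_mulVec, single_mulVec, t_hij.symm, ← Function.update_add,
    lintegral_add_right_eq_self fun xᵢ ↦ Set.indicator (Set.univ.pi s) 1 (Function.update x t_i xᵢ)]

/-- A linear change of variables scales the product measure by the absolute value of its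
determinant. -/
theorem map_mulVec_pi (A : Matrix κ κ F) (hA : IsUnit A.det) :
    (Measure.pi fun _ : κ => μ).map (fun x => A *ᵥ x) =
      ENNReal.ofReal (modulus hA.unit)⁻¹ • Measure.pi fun _ : κ => μ := by
  revert hA
  suffices H : A.det ≠ 0 → ∀ u : Fˣ, (u : F) = A.det →
      (Measure.pi fun _ : κ => μ).map (fun x => A *ᵥ x) =
      ENNReal.ofReal (modulus u)⁻¹ • Measure.pi fun _ : κ => μ from
    fun hA => H hA.ne_zero _ rfl
  intro hA
  apply diagonal_transvection_induction_of_det_ne_zero _ A hA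
  · intro D hD u hu
    have hD' : ∀ i, D i ≠ 0 := by
      rw [det_diagonal] at hD
      exact fun i => Finset.prod_ne_zero_iff.1 hD i (Finset.mem_univ i)
    have hfun : (fun x : κ → F => diagonal D *ᵥ x) = fun x i => D i * x i := by
      ext x i; simp [mulVec_diagonal]
    have hprod : u = ∏ i, Units.mk0 (D i) (hD' i) := by
      ext; rw [hu, det_diagonal, Units.coe_prod]; simp
    rw [hfun]
    have hmeas : Measurable fun (x : κ → F) i => D i * x i :=
      measurable_pi_lambda _ fun i => (measurable_pi_apply i).const_mul _
    have h1 : ∀ v : Fˣ, ENNReal.ofReal (modulus v) ≠ 0 := fun v => by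
      simpa using modulus_pos v
    -- compare the two sides after multiplication by `|det|`, on boxes
    have key : ENNReal.ofReal (modulus u) •
        (Measure.pi fun _ : κ => μ).map (fun x i => D i * x i) = vol[μ] := by
      refine (Measure.pi_eq fun s hs => ?_).symm
      rw [Measure.smul_apply, Measure.map_apply hmeas (MeasurableSet.univ_pi hs),
        show (fun (x : κ → F) i => D i * x i) ⁻¹' Set.univ.pi s =
          Set.univ.pi fun i => (fun x => D i * x) ⁻¹' s i by ext x; simp, Measure.pi_pi]
      have h2 : ∀ i, μ ((fun x => D i * x) ⁻¹' s i) =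
          ENNReal.ofReal (modulus (Units.mk0 (D i) (hD' i)))⁻¹ * μ (s i) := by
        intro i
        have := map_mul_left_eq μ (Units.mk0 (D i) (hD' i))
        rw [Units.val_mk0] at this
        rw [← Measure.map_apply (measurable_const_mul _) (hs i), this]; rfl
      have h3 : modulus u = ∏ i, modulus (Units.mk0 (D i) (hD' i)) := by
        simp [hprod, modulus]
      simp only [h2, Finset.prod_mul_distrib, smul_eq_mul]
      rw [← mul_assoc, h3, ENNReal.ofReal_prod_of_nonneg fun i _ => (modulus_pos _).le,
        ← Finset.prod_mul_distrib]
      rw [Finset.prod_eq_one, one_mul]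
      intro i _
      rw [← ENNReal.ofReal_mul (modulus_pos _).le, mul_inv_cancel₀ (modulus_pos _).ne',
        ENNReal.ofReal_one]
    rw [← key, smul_smul, ← ENNReal.ofReal_mul (inv_nonneg.2 (modulus_pos _).le),
      inv_mul_cancel₀ (modulus_pos _).ne', ENNReal.ofReal_one, one_smul, key]
  · intro t u hu
    have hu1 : u = 1 := by ext; simp [hu]
    rw [(measurePreserving_transvectionStruct μ t).map_eq, hu1]
    simp
  · intro A B hA hB IHA IHB u hu
    have hcomp : (fun x : κ → F => (A * B) *ᵥ x) =
        (fun x => A *ᵥ x) ∘ fun x => B *ᵥ x := by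
      ext x; simp [mulVec_mulVec]
    have hu' : u = Units.mk0 _ hA * Units.mk0 _ hB := by ext; simp [hu]
    rw [hcomp, ← Measure.map_map (measurable_mulVec A) (measurable_mulVec B),
      IHB (Units.mk0 _ hB) rfl, Measure.map_smul, IHA (Units.mk0 _ hA) rfl, smul_smul, hu',
      modulus_mul, mul_inv, ENNReal.ofReal_mul (inv_nonneg.2 (modulus_pos _).le), mul_comm]

variable {E : Type*} [NormedAddCommGroup E] [NormedSpace ℝ E]

theorem mulVec_measurableEmbedding (A : Matrix κ κ F) (hA : IsUnit A.det) :
    MeasurableEmbedding fun x : κ → F => A *ᵥ x := by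
  refine (Continuous.matrix_mulVec continuous_const continuous_id).measurableEmbedding ?_
  exact mulVec_injective_of_isUnit ((isUnit_iff_isUnit_det A).2 hA)

theorem integral_comp_mulVec (A : Matrix κ κ F) (hA : IsUnit A.det) (f : (κ → F) → E) :
    ∫ x, f (A *ᵥ x) ∂vol[μ] =
      (modulus hA.unit)⁻¹ • ∫ x, f x ∂vol[μ] := by
  rw [← (mulVec_measurableEmbedding A hA).integral_map, map_mulVec_pi μ A hA,
    integral_smul_measure, ENNReal.toReal_ofReal (inv_nonneg.2 (modulus_pos _).le)]

theorem integrable_comp_mulVec (A : Matrix κ κ F) (hA : IsUnit A.det) {f : (κ → F) → E}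
    (hf : Integrable f vol[μ]) :
    Integrable (fun x => f (A *ᵥ x)) vol[μ] := by
  have := (mulVec_measurableEmbedding A hA).integrable_map_iff (g := f)
    (μ := vol[μ])
  rw [map_mulVec_pi μ A hA] at this
  exact this.1 (hf.smul_measure ENNReal.ofReal_ne_top)

theorem integral_comp_units_mul (a : Fˣ) (f : F → E) :
    ∫ x, f (a * x) ∂μ = (modulus a)⁻¹ • ∫ x, f x ∂μ := by
  have he : MeasurableEmbedding fun x : F => (a : F) * x :=
    (continuous_const_mul (a : F)).measurableEmbedding (mul_right_injective₀ a.ne_zero)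
  rw [← he.integral_map, map_mul_left_eq μ a, integral_smul_measure,
    ENNReal.toReal_ofReal (inv_nonneg.2 (modulus_pos _).le)]

theorem integral_comp_units_smul (a : Fˣ) (f : (κ → F) → E) :
    ∫ x, f ((a : F) • x) ∂vol[μ] =
      (modulus a ^ Fintype.card κ)⁻¹ • ∫ x, f x ∂vol[μ] := by
  have hdet : (diagonal fun _ : κ => (a : F)).det = (a ^ Fintype.card κ : Fˣ) := by
    simp [det_diagonal]
  have hu : IsUnit (diagonal fun _ : κ => (a : F)).det := by
    rw [hdet]; exact Units.isUnit _
  have h1 : hu.unit = a ^ Fintype.card κ := by ext; rw [IsUnit.unit_spec, hdet]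
  have h2 := integral_comp_mulVec μ (diagonal fun _ : κ => (a : F)) hu f
  rw [h1, modulus_pow] at h2
  rw [← h2]
  congr 1
  ext x
  congr 1
  ext i
  simp [mulVec_diagonal]

end LinearChange

/-! ### Partial Fourier transforms of real Schwartz functions -/

section RealPartialFourier

open SchwartzMap LineDeriv

variable {D D₁ : Type*} [NormedAddCommGroup D] [NormedSpace ℝ D]
  [NormedAddCommGroup D₁] [NormedSpace ℝ D₁]

/-- A family of functionals on the Schwartz space, indexed by the points of `D`, that is bounded
by a single continuous seminorm. -/
def SeminormBounded {X : Type*} (Φ : 𝓢(D, ℂ) → X → ℝ) : Prop :=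
  ∃ (s : Finset (ℕ × ℕ)) (C : ℝ), 0 ≤ C ∧
    ∀ f x, Φ f x ≤ C * s.sup (schwartzSeminormFamily ℂ D ℂ) f

theorem exists_sup_seminorm_clm_le {D' : Type*} [NormedAddCommGroup D'] [NormedSpace ℝ D']
    (A : 𝓢(D', ℂ) →L[ℂ] 𝓢(D, ℂ)) (s : Finset (ℕ × ℕ)) :
    ∃ (s' : Finset (ℕ × ℕ)) (C : ℝ), 0 ≤ C ∧
      ∀ f, s.sup (schwartzSeminormFamily ℂ D ℂ) (A f) ≤
        C * s'.sup (schwartzSeminormFamily ℂ D' ℂ) f := by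
  have hc : Continuous ((s.sup (schwartzSeminormFamily ℂ D ℂ) : Seminorm ℂ 𝓢(D, ℂ)).comp
      A.toLinearMap) := by
    have h1 : Continuous (s.sup (schwartzSeminormFamily ℂ D ℂ) : Seminorm ℂ 𝓢(D, ℂ)) := by
      exact Seminorm.continuous_of_le (q := ∑ i ∈ s, schwartzSeminormFamily ℂ D ℂ i)
        (by
          have : Continuous fun f => ∑ i ∈ s, schwartzSeminormFamily ℂ D ℂ i f :=
            continuous_finsetSum _ fun i _ =>
              (schwartz_withSeminorms ℂ D ℂ).continuous_seminorm i
          convert this using 1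
          ext f
          simp only [← FunLike.coeAddMonoidHom_apply, map_sum, Finset.sum_apply])
        (Seminorm.finset_sup_le_sum _ s)
    exact h1.comp A.continuous
  obtain ⟨s', C, -, h⟩ := Seminorm.bound_of_continuous (schwartz_withSeminorms ℂ D' ℂ) _ hc
  exact ⟨s', C, C.2, fun f => h f⟩

theorem SeminormBounded.comp {X : Type*} {Φ : 𝓢(D, ℂ) → X → ℝ} (h : SeminormBounded Φ)
    {D' : Type*} [NormedAddCommGroup D'] [NormedSpace ℝ D']
    (A : 𝓢(D', ℂ) →L[ℂ] 𝓢(D, ℂ)) : SeminormBounded fun f x => Φ (A f) x := by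
  obtain ⟨s, C, hC, h⟩ := h
  obtain ⟨s', C', hC', h'⟩ := exists_sup_seminorm_clm_le A s
  refine ⟨s', C * C', mul_nonneg hC hC', fun f x => (h _ x).trans ?_⟩
  rw [mul_assoc]
  exact mul_le_mul_of_nonneg_left (h' f) hC

theorem SeminormBounded.const_mul {X : Type*} {Φ : 𝓢(D, ℂ) → X → ℝ} (h : SeminormBounded Φ)
    {c : ℝ} (hc : 0 ≤ c) : SeminormBounded fun f x => c * Φ f x := by
  obtain ⟨s, C, hC, h⟩ := h
  refine ⟨s, c * C, mul_nonneg hc hC, fun f x => ?_⟩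
  rw [mul_assoc]
  exact mul_le_mul_of_nonneg_left (h f x) hc

theorem SeminormBounded.add {X : Type*} {Φ Ψ : 𝓢(D, ℂ) → X → ℝ} (h : SeminormBounded Φ)
    (h' : SeminormBounded Ψ) : SeminormBounded fun f x => Φ f x + Ψ f x := by
  obtain ⟨s, C, hC, h⟩ := h
  obtain ⟨s', C', hC', h'⟩ := h'
  classical
  refine ⟨s ∪ s', C + C', add_nonneg hC hC', fun f x => ?_⟩
  rw [add_mul]
  refine add_le_add ((h f x).trans ?_) ((h' f x).trans ?_)
  · refine mul_le_mul_of_nonneg_left ?_ hC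
    exact (Finset.sup_mono (f := schwartzSeminormFamily ℂ D ℂ) Finset.subset_union_left) f
  · refine mul_le_mul_of_nonneg_left ?_ hC'
    exact (Finset.sup_mono (f := schwartzSeminormFamily ℂ D ℂ) Finset.subset_union_right) f

theorem SeminormBounded.sum {X ι : Type*} (t : Finset ι) {Φ : ι → 𝓢(D, ℂ) → X → ℝ}
    (h : ∀ i ∈ t, SeminormBounded (Φ i)) : SeminormBounded fun f x => ∑ i ∈ t, Φ i f x := by
  classical
  induction t using Finset.induction_on with
  | empty => exact ⟨∅, 0, le_rfl, fun f x => by simp⟩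
  | insert a t ha ih =>
    simp only [Finset.sum_insert ha]
    exact (h a (by simp)).add (ih fun i hi => h i (by simp [hi]))

theorem SeminormBounded.mono {X : Type*} {Φ Ψ : 𝓢(D, ℂ) → X → ℝ} (h : SeminormBounded Φ)
    (hle : ∀ f x, Ψ f x ≤ Φ f x) : SeminormBounded Ψ := by
  obtain ⟨s, C, hC, h⟩ := h
  exact ⟨s, C, hC, fun f x => (hle f x).trans (h f x)⟩

/-- A splitting `D = ker q ⊕ j(D₁)` with projection `p` to the first summand, and a bilinear form
`b` between `D` and `D₁`, for the definition of a partial Fourier transform. -/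
structure FourierSplitting (D D₁ : Type*) [NormedAddCommGroup D] [NormedSpace ℝ D]
    [NormedAddCommGroup D₁] [NormedSpace ℝ D₁] where
  /-- The projection to the variables that are not transformed. -/
  p : D →L[ℝ] D
  /-- The variables that are transformed. -/
  q : D →L[ℝ] D₁
  /-- The inclusion of the variables that are transformed. -/
  j : D₁ →L[ℝ] D
  /-- The pairing of the transform. -/
  b : D →L[ℝ] D₁ →L[ℝ] ℝ
  add_eq : ∀ x, p x + j (q x) = x
  p_p : ∀ x, p (p x) = p x
  p_j : ∀ y, p (j y) = 0
  q_p : ∀ x, q (p x) = 0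
  q_j : ∀ y, q (j y) = y
  /-- Finitely many values of the pairing control the transformed variable. -/
  nondeg : ∃ (n : ℕ) (v : Fin n → D₁) (C : ℝ), ∀ x, ‖q x‖ ≤ C * ∑ i, |b x (v i)|

variable (Λ : FourierSplitting D D₁)

namespace FourierSplitting

/-- The oscillating factor `exp(i b(x, y))`. -/
def osc (x : D) (y : D₁) : ℂ := Complex.exp (Complex.I * (Λ.b x y : ℝ))

@[simp] theorem norm_osc (x : D) (y : D₁) : ‖Λ.osc x y‖ = 1 := by
  rw [osc, mul_comm, Complex.norm_exp_ofReal_mul_I]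

theorem continuous_osc (x : D) : Continuous (Λ.osc x) := by
  unfold osc; fun_prop

theorem hasFDerivAt_osc_left (x : D) (y : D₁) :
    HasFDerivAt (fun x => Λ.osc x y)
      ((Λ.osc x y * Complex.I) • (Complex.ofRealCLM.comp (Λ.b.flip y))) x := by
  have h1 : HasFDerivAt (fun x => Complex.I * (Λ.b x y : ℂ))
      (Complex.I • (Complex.ofRealCLM.comp (Λ.b.flip y))) x := by
    have := (Complex.ofRealCLM.comp (Λ.b.flip y)).hasFDerivAt (x := x)
    exact this.const_mul Complex.I
  have := h1.cexp
  rwa [smul_smul] at this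

theorem hasFDerivAt_osc_right (x : D) (y : D₁) :
    HasFDerivAt (Λ.osc x)
      ((Λ.osc x y * Complex.I) • (Complex.ofRealCLM.comp (Λ.b x))) y := by
  have h1 : HasFDerivAt (fun y => Complex.I * (Λ.b x y : ℂ))
      (Complex.I • (Complex.ofRealCLM.comp (Λ.b x))) y := by
    have := (Complex.ofRealCLM.comp (Λ.b x)).hasFDerivAt (x := y)
    exact this.const_mul Complex.I
  have := h1.cexp
  rwa [smul_smul] at this

/-- Decay along the fibres of the splitting, uniformly in the base point. -/
theorem norm_slice_le {G : Type*} [NormedAddCommGroup G] [NormedSpace ℝ G] (N : ℕ)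
    (f : 𝓢(D, G)) (x : D) (y : D₁) :
    ‖f (Λ.p x + Λ.j y)‖ ≤ (1 + ‖Λ.q‖) ^ N * (2 ^ N *
      (Finset.Iic (N, 0)).sup (fun m => SchwartzMap.seminorm ℝ m.1 m.2) f) *
        (1 + ‖y‖) ^ (-(N : ℝ)) := by
  set S := (2 ^ N * (Finset.Iic (N, 0)).sup (fun m => SchwartzMap.seminorm ℝ m.1 m.2) f)
  have h1 := one_add_le_sup_seminorm_apply (𝕜 := ℝ) (m := (N, 0)) (k := N) (n := 0) le_rfl le_rfl f
    (Λ.p x + Λ.j y)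
  rw [norm_iteratedFDeriv_zero] at h1
  have hy : ‖y‖ ≤ ‖Λ.q‖ * ‖Λ.p x + Λ.j y‖ := by
    have := Λ.q.le_opNorm (Λ.p x + Λ.j y)
    rwa [map_add, Λ.q_p, Λ.q_j, zero_add] at this
  have hy' : 1 + ‖y‖ ≤ (1 + ‖Λ.q‖) * (1 + ‖Λ.p x + Λ.j y‖) := by
    have := norm_nonneg Λ.q
    have := norm_nonneg (Λ.p x + Λ.j y)
    nlinarith
  rw [Real.rpow_neg (by positivity), Real.rpow_natCast, ← div_eq_mul_inv,
    le_div_iff₀ (by positivity)]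
  calc ‖f (Λ.p x + Λ.j y)‖ * (1 + ‖y‖) ^ N
      ≤ ‖f (Λ.p x + Λ.j y)‖ * ((1 + ‖Λ.q‖) * (1 + ‖Λ.p x + Λ.j y‖)) ^ N := by gcongr
    _ = (1 + ‖Λ.q‖) ^ N * ((1 + ‖Λ.p x + Λ.j y‖) ^ N * ‖f (Λ.p x + Λ.j y)‖) := by
        rw [mul_pow]; ring
    _ ≤ (1 + ‖Λ.q‖) ^ N * S := by
        gcongr

variable [MeasurableSpace D₁] (ν : Measure D₁)

/-- The partial Fourier transform attached to a splitting. -/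
def transform (f : D → ℂ) (x : D) : ℂ := ∫ y, Λ.osc x y * f (Λ.p x + Λ.j y) ∂ν

variable [FiniteDimensional ℝ D] [FiniteDimensional ℝ D₁] [BorelSpace D₁] [ν.IsAddHaarMeasure]

omit [FiniteDimensional ℝ D] in
theorem integrable_slice {G : Type*} [NormedAddCommGroup G] [NormedSpace ℝ G]
    (f : 𝓢(D, G)) (x : D) : Integrable (fun y => f (Λ.p x + Λ.j y)) ν := by
  have hD₁ : SecondCountableTopology D₁ := by
    have : ProperSpace D₁ := FiniteDimensional.proper ℝ D₁
    infer_instance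
  refine ((Measure.integrable_pow_neg_integrablePower ν).const_mul _).mono' ?_
    (.of_forall fun y => Λ.norm_slice_le ν.integrablePower f x y)
  exact (f.continuous.comp (by fun_prop)).aestronglyMeasurable

omit [FiniteDimensional ℝ D] in
theorem integrable_osc_slice (f : 𝓢(D, ℂ)) (x : D) :
    Integrable (fun y => Λ.osc x y * f (Λ.p x + Λ.j y)) ν := by
  refine (Λ.integrable_slice ν f x).bdd_mul (c := 1) ?_ ?_
  · exact (Λ.continuous_osc x).aestronglyMeasurable
  · exact Filter.Eventually.of_forall fun y => by simp

omit [FiniteDimensional ℝ D] in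
theorem transform_bounded : SeminormBounded fun f x => ‖Λ.transform ν f x‖ := by
  set N := ν.integrablePower
  refine ⟨Finset.Iic (N, 0), (1 + ‖Λ.q‖) ^ N * 2 ^ N * ∫ y, (1 + ‖y‖) ^ (-(N : ℝ)) ∂ν,
    by positivity, fun f x => ?_⟩
  refine (norm_integral_le_integral_norm _).trans ?_
  have h1 : ∀ y, ‖Λ.osc x y * f (Λ.p x + Λ.j y)‖ ≤ (1 + ‖Λ.q‖) ^ N * (2 ^ N *
      (Finset.Iic (N, 0)).sup (fun m => SchwartzMap.seminorm ℝ m.1 m.2) f) *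
        (1 + ‖y‖) ^ (-(N : ℝ)) := fun y => by
    rw [norm_mul, norm_osc, one_mul]
    exact Λ.norm_slice_le N f x y
  refine (integral_mono (Λ.integrable_osc_slice ν f x).norm
    ((Measure.integrable_pow_neg_integrablePower ν).const_mul _) h1).trans ?_
  rw [integral_const_mul]
  have h2 : (Finset.Iic (N, 0)).sup (fun m => SchwartzMap.seminorm ℝ m.1 m.2) f =
      (Finset.Iic (N, 0)).sup (schwartzSeminormFamily ℂ D ℂ) f := by
    simp only [Seminorm.finset_sup_apply]
    rfl
  rw [h2]
  apply le_of_eq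
  ring

/-- The operator on Schwartz functions that corresponds, under the partial Fourier transform, to
the derivative in the direction `v`. -/
def derivOp (v : D) : 𝓢(D, ℂ) →L[ℂ] 𝓢(D, ℂ) :=
  lineDerivOpCLM ℂ 𝓢(D, ℂ) (Λ.p v) +
    Complex.I • smulLeftCLM ℂ (fun z => ((Λ.b v (Λ.q z) : ℝ) : ℂ))

omit [MeasurableSpace D₁] [FiniteDimensional ℝ D] [FiniteDimensional ℝ D₁] [BorelSpace D₁] in
theorem derivOp_apply (v : D) (f : 𝓢(D, ℂ)) (z : D) :
    Λ.derivOp v f z = fderiv ℝ f z (Λ.p v) + Complex.I * (Λ.b v (Λ.q z) * f z) := by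
  have ht : (fun z => ((Λ.b v (Λ.q z) : ℝ) : ℂ)).HasTemperateGrowth :=
    ((Complex.ofRealCLM.comp (Λ.b v)).comp Λ.q).hasTemperateGrowth
  simp only [derivOp, _root_.add_apply, _root_.smul_apply,
    smulLeftCLM_apply_apply ht]
  rfl

omit [FiniteDimensional ℝ D] in
/-- Differentiation under the integral sign; the derivative is the transform of another Schwartz
function. -/
theorem hasFDerivAt_transform (f : 𝓢(D, ℂ)) (x : D) :
    ∃ L : D →L[ℝ] ℂ, HasFDerivAt (Λ.transform ν f) L x ∧
      ∀ v, L v = Λ.transform ν (Λ.derivOp v f) x := by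
  set N := ν.integrablePower
  have hD₁ : SecondCountableTopology D₁ := by
    have : ProperSpace D₁ := FiniteDimensional.proper ℝ D₁
    infer_instance
  let F' : D → D₁ → D →L[ℝ] ℂ := fun x y =>
    Λ.osc x y • (fderivCLM ℂ D ℂ f (Λ.p x + Λ.j y)).comp Λ.p +
      f (Λ.p x + Λ.j y) • (Λ.osc x y * Complex.I) • (Complex.ofRealCLM.comp (Λ.b.flip y))
  -- the second term of the derivative is a slice of a vector-valued Schwartz function
  let L₀ : D →L[ℝ] D →L[ℝ] ℝ := (Λ.b.flip).comp Λ.q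
  let f₁ : 𝓢(D, D →L[ℝ] ℂ) := smulRightCLM ℂ ℂ L₀ f
  have hf₁ : ∀ z, f₁ z = f z • Complex.ofRealCLM.comp (Λ.b.flip (Λ.q z)) := by
    intro z
    ext v
    simp [f₁, L₀, mul_comm]
  have hF'n : ∀ x y, ‖F' x y‖ ≤ ‖fderivCLM ℂ D ℂ f (Λ.p x + Λ.j y)‖ * ‖Λ.p‖ +
      ‖f₁ (Λ.p x + Λ.j y)‖ := by
    intro x y
    refine (norm_add_le _ _).trans (add_le_add ?_ ?_)
    · rw [norm_smul, norm_osc, one_mul]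
      exact ContinuousLinearMap.opNorm_comp_le _ _
    · rw [hf₁, map_add Λ.q, Λ.q_p, Λ.q_j, zero_add, norm_smul, norm_smul, norm_smul, norm_mul,
        norm_osc, Complex.norm_I, one_mul, one_mul]
  have hF'cont : ∀ x, Continuous (F' x) := by
    intro x
    have h1 := Λ.continuous_osc x
    have h2 : Continuous fun y => fderivCLM ℂ D ℂ f (Λ.p x + Λ.j y) :=
      (fderivCLM ℂ D ℂ f).continuous.comp (by fun_prop)
    have h3 : Continuous fun y => f (Λ.p x + Λ.j y) := f.continuous.comp (by fun_prop)
    have h4 : Continuous fun y => Complex.ofRealCLM.comp (Λ.b.flip y) := by fun_prop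
    exact (h1.smul (h2.clm_comp continuous_const)).add
      (h3.smul ((h1.mul continuous_const).smul h4))
  have hdiff : ∀ x y, HasFDerivAt (fun x => Λ.osc x y * f (Λ.p x + Λ.j y)) (F' x y) x := by
    intro x y
    have h1 := Λ.hasFDerivAt_osc_left x y
    have h2 : HasFDerivAt (fun x => f (Λ.p x + Λ.j y))
        ((fderivCLM ℂ D ℂ f (Λ.p x + Λ.j y)).comp Λ.p) x := by
      have := f.hasFDerivAt (Λ.p x + Λ.j y)
      exact this.comp x (Λ.p.hasFDerivAt.add_const _)
    exact h1.mul h2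
  have hint : Integrable (F' x) ν := by
    refine (((Λ.integrable_slice ν (fderivCLM ℂ D ℂ f) x).norm.mul_const ‖Λ.p‖).add
      (Λ.integrable_slice ν f₁ x).norm).mono' (hF'cont x).aestronglyMeasurable
      (.of_forall fun y => hF'n x y)
  refine ⟨∫ y, F' x y ∂ν, ?_, ?_⟩
  · refine hasFDerivAt_integral_of_dominated_of_fderiv_le (𝕜 := ℝ) (s := Set.univ)
      (bound := fun y => ((1 + ‖Λ.q‖) ^ N * (2 ^ N *
      (Finset.Iic (N, 0)).sup (fun m => SchwartzMap.seminorm ℝ m.1 m.2) (fderivCLM ℂ D ℂ f)) *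
        (1 + ‖y‖) ^ (-(N : ℝ))) * ‖Λ.p‖ + ((1 + ‖Λ.q‖) ^ N * (2 ^ N *
      (Finset.Iic (N, 0)).sup (fun m => SchwartzMap.seminorm ℝ m.1 m.2) f₁) *
        (1 + ‖y‖) ^ (-(N : ℝ)))) Filter.univ_mem ?_ (Λ.integrable_osc_slice ν f x)
        (hF'cont x).aestronglyMeasurable ?_ ?_ ?_
    · exact Filter.Eventually.of_forall fun x =>
        (Λ.integrable_osc_slice ν f x).aestronglyMeasurable
    · refine Filter.Eventually.of_forall fun y x _ => (hF'n x y).trans ?_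
      gcongr
      · exact Λ.norm_slice_le N (fderivCLM ℂ D ℂ f) x y
      · exact Λ.norm_slice_le N f₁ x y
    · have := Measure.integrable_pow_neg_integrablePower ν
      exact ((this.const_mul _).mul_const _).add (this.const_mul _)
    · exact Filter.Eventually.of_forall fun y x _ => hdiff x y
  · intro v
    rw [ContinuousLinearMap.integral_apply hint v]
    refine integral_congr_forall fun y => ?_
    simp only [F', derivOp_apply, map_add, Λ.q_p, Λ.q_j, zero_add, fderivCLM_apply,
      _root_.add_apply, _root_.smul_apply, ContinuousLinearMap.comp_apply, smul_eq_mul,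
      ContinuousLinearMap.flip_apply, Complex.ofRealCLM_apply]
    ring

omit [FiniteDimensional ℝ D] in
theorem fderiv_transform (f : 𝓢(D, ℂ)) (x v : D) :
    fderiv ℝ (Λ.transform ν f) x v = Λ.transform ν (Λ.derivOp v f) x := by
  obtain ⟨L, h1, h2⟩ := Λ.hasFDerivAt_transform ν f x
  rw [h1.fderiv, h2]

theorem contDiff_transform (f : 𝓢(D, ℂ)) : ContDiff ℝ ((⊤ : ℕ∞) : WithTop ℕ∞) (Λ.transform ν f) := by
  rw [contDiff_infty]
  intro n
  induction n generalizing f with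
  | zero =>
    rw [Nat.cast_zero, contDiff_zero, continuous_iff_continuousAt]
    intro x
    obtain ⟨L, h1, -⟩ := Λ.hasFDerivAt_transform ν f x
    exact h1.continuousAt
  | succ n ih =>
    rw [Nat.cast_succ, contDiff_succ_iff_fderiv_apply]
    refine ⟨fun x => ?_, fun h => ?_, fun v => ?_⟩
    · obtain ⟨L, h1, -⟩ := Λ.hasFDerivAt_transform ν f x
      exact h1.differentiableAt
    · exact absurd h (by simp)
    · simp_rw [fderiv_transform]
      exact ih _

omit [FiniteDimensional ℝ D] in
/-- Integration by parts: a derivative in a transformed direction becomes a multiplication. -/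
theorem transform_lineDeriv (f : 𝓢(D, ℂ)) (x : D) (v : D₁) :
    Λ.transform ν (lineDerivOpCLM ℂ 𝓢(D, ℂ) (Λ.j v) f) x =
      -(Complex.I * Λ.b x v * Λ.transform ν f x) := by
  have hslice : ∀ y, HasFDerivAt (fun y => f (Λ.p x + Λ.j y))
      ((fderivCLM ℂ D ℂ f (Λ.p x + Λ.j y)).comp Λ.j) y := fun y =>
    (f.hasFDerivAt (Λ.p x + Λ.j y)).comp y (Λ.j.hasFDerivAt.const_add _)
  have hosc := fun y => Λ.hasFDerivAt_osc_right x y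
  have h1 : ∀ y, fderiv ℝ (fun y => f (Λ.p x + Λ.j y)) y v =
      lineDerivOpCLM ℂ 𝓢(D, ℂ) (Λ.j v) f (Λ.p x + Λ.j y) := fun y => by
    rw [(hslice y).fderiv]; rfl
  have h2 : ∀ y, fderiv ℝ (Λ.osc x) y v = Complex.I * Λ.b x v * Λ.osc x y := fun y => by
    rw [(hosc y).fderiv]
    simp only [_root_.smul_apply, ContinuousLinearMap.comp_apply, Complex.ofRealCLM_apply,
      smul_eq_mul]
    ring
  have key := integral_mul_fderiv_eq_neg_fderiv_mul_of_integrable (μ := ν) (f := Λ.osc x)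
    (g := fun y => f (Λ.p x + Λ.j y)) (v := v) ?_ ?_ (Λ.integrable_osc_slice ν f x)
    (fun y _ => (hosc y).differentiableAt) (fun y _ => (hslice y).differentiableAt)
  · simp only [h1, h2] at key
    unfold transform
    rw [key, ← integral_const_mul]
    congr 1
    refine integral_congr_forall fun y => ?_
    ring
  · simp only [h2, mul_assoc]
    exact ((Λ.integrable_osc_slice ν f x).const_mul _).const_mul _
  · simp only [h1]
    exact Λ.integrable_osc_slice ν _ x

omit [FiniteDimensional ℝ D] [FiniteDimensional ℝ D₁] [BorelSpace D₁] [ν.IsAddHaarMeasure] in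
theorem transform_smulLeft (f : 𝓢(D, ℂ)) (x : D) (φ : D →L[ℝ] ℝ) :
    Λ.transform ν (smulLeftCLM ℂ (fun z => ((φ (Λ.p z) : ℝ) : ℂ)) f) x =
      φ (Λ.p x) * Λ.transform ν f x := by
  have ht : (fun z => ((φ (Λ.p z) : ℝ) : ℂ)).HasTemperateGrowth :=
    ((Complex.ofRealCLM.comp φ).comp Λ.p).hasTemperateGrowth
  unfold transform
  rw [← integral_const_mul]
  refine integral_congr_forall fun y => ?_
  simp only [smulLeftCLM_apply_apply ht, map_add, Λ.p_p, Λ.p_j, add_zero, smul_eq_mul]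
  ring

/-- Powers of `‖x‖` are absorbed into `f`: the coordinates of `p x` by multiplying `f`, and those of
`q x`, which `nondeg` bounds by values of the pairing, by differentiating `f` along `j`. -/
theorem pow_mul_transform_bounded (k : ℕ) :
    SeminormBounded fun f x => ‖x‖ ^ k * ‖Λ.transform ν f x‖ := by
  induction k with
  | zero => simpa using Λ.transform_bounded ν
  | succ k ih =>
    obtain ⟨n, v, C, hC⟩ := Λ.nondeg
    let B := Module.finBasis ℝ D
    let φ : Fin (Module.finrank ℝ D) → D →L[ℝ] ℝ := fun i => (B.coord i).toContinuousLinearMap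
    let A₁ : Fin (Module.finrank ℝ D) → 𝓢(D, ℂ) →L[ℂ] 𝓢(D, ℂ) := fun i =>
      smulLeftCLM ℂ (fun z => ((φ i (Λ.p z) : ℝ) : ℂ))
    let A₂ : Fin n → 𝓢(D, ℂ) →L[ℂ] 𝓢(D, ℂ) := fun i => lineDerivOpCLM ℂ 𝓢(D, ℂ) (Λ.j (v i))
    have h1 : SeminormBounded fun f x => ∑ i, ‖B i‖ * (‖x‖ ^ k * ‖Λ.transform ν (A₁ i f) x‖) :=
      SeminormBounded.sum _ fun i _ => (ih.comp (A₁ i)).const_mul (norm_nonneg _)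
    have h2 : SeminormBounded fun f x => (‖Λ.j‖ * |C|) *
        ∑ i, (‖x‖ ^ k * ‖Λ.transform ν (A₂ i f) x‖) :=
      (SeminormBounded.sum _ fun i _ => ih.comp (A₂ i)).const_mul (by positivity)
    refine (h1.add h2).mono fun f x => ?_
    have e1 : ∀ i, ‖Λ.transform ν (A₁ i f) x‖ = |φ i (Λ.p x)| * ‖Λ.transform ν f x‖ := by
      intro i
      rw [transform_smulLeft, norm_mul, Complex.norm_real, Real.norm_eq_abs]
    have e2 : ∀ i, ‖Λ.transform ν (A₂ i f) x‖ = |Λ.b x (v i)| * ‖Λ.transform ν f x‖ := by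
      intro i
      rw [transform_lineDeriv, norm_neg, norm_mul, norm_mul, Complex.norm_I, one_mul,
        Complex.norm_real, Real.norm_eq_abs]
    simp only [e1, e2]
    have hp : ‖Λ.p x‖ ≤ ∑ i, ‖B i‖ * |φ i (Λ.p x)| := by
      conv_lhs => rw [← B.sum_repr (Λ.p x)]
      refine (norm_sum_le _ _).trans (le_of_eq ?_)
      refine Finset.sum_congr rfl fun i _ => ?_
      rw [norm_smul, Real.norm_eq_abs, mul_comm]
      rfl
    have hq : ‖Λ.j (Λ.q x)‖ ≤ ‖Λ.j‖ * (|C| * ∑ i, |Λ.b x (v i)|) := by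
      refine (Λ.j.le_opNorm _).trans ?_
      gcongr
      refine (hC x).trans ?_
      gcongr
      exact le_abs_self C
    have hx : ‖x‖ ≤ ∑ i, ‖B i‖ * |φ i (Λ.p x)| + ‖Λ.j‖ * (|C| * ∑ i, |Λ.b x (v i)|) := by
      conv_lhs => rw [← Λ.add_eq x]
      exact (norm_add_le _ _).trans (add_le_add hp hq)
    calc ‖x‖ ^ (k + 1) * ‖Λ.transform ν f x‖ = ‖x‖ * (‖x‖ ^ k * ‖Λ.transform ν f x‖) := by ring
      _ ≤ (∑ i, ‖B i‖ * |φ i (Λ.p x)| + ‖Λ.j‖ * (|C| * ∑ i, |Λ.b x (v i)|)) *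
          (‖x‖ ^ k * ‖Λ.transform ν f x‖) := by gcongr
      _ = _ := by
        rw [add_mul, Finset.sum_mul, mul_assoc, mul_assoc, mul_assoc, Finset.sum_mul,
          Finset.mul_sum]
        congr 1
        · exact Finset.sum_congr rfl fun i _ => by ring
        · simp only [Finset.mul_sum]
          exact Finset.sum_congr rfl fun i _ => by ring

theorem pow_mul_iteratedFDeriv_transform_bounded (k n : ℕ) :
    SeminormBounded fun f x => ‖x‖ ^ k * ‖iteratedFDeriv ℝ n (Λ.transform ν f) x‖ := by
  induction n with
  | zero =>
    simp only [norm_iteratedFDeriv_zero]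
    exact Λ.pow_mul_transform_bounded ν k
  | succ n ih =>
    let B := Module.finBasis ℝ D
    let φ : Fin (Module.finrank ℝ D) → ℂ →L[ℝ] D →L[ℝ] ℂ := fun i =>
      ContinuousLinearMap.smulRightL ℝ D ℂ ((B.coord i).toContinuousLinearMap)
    refine (SeminormBounded.sum Finset.univ fun i _ =>
      (ih.comp (Λ.derivOp (B i))).const_mul (norm_nonneg (φ i))).mono fun f x => ?_
    rw [← norm_iteratedFDeriv_fderiv]
    have h1 : fderiv ℝ (Λ.transform ν f) =
        fun x => ∑ i, (φ i ∘ Λ.transform ν (Λ.derivOp (B i) f)) x := by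
      ext x v
      conv_lhs => rw [← B.sum_repr v, map_sum]
      rw [_root_.sum_apply]
      refine Finset.sum_congr rfl fun i _ => ?_
      rw [map_smul, fderiv_transform]
      simp [φ]
    have hc : ∀ i, ContDiff ℝ n (Λ.transform ν (Λ.derivOp (B i) f)) := fun i =>
      (Λ.contDiff_transform ν _).of_le (mod_cast le_top)
    rw [h1, iteratedFDeriv_fun_sum_apply fun i _ =>
      ((φ i).contDiff.comp (hc i)).contDiffAt, mul_comm]
    refine (mul_le_mul_of_nonneg_right (norm_sum_le _ _) (by positivity)).trans ?_
    rw [Finset.sum_mul]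
    refine Finset.sum_le_sum fun i _ => ?_
    have := (φ i).norm_iteratedFDeriv_comp_left (x := x) (hc i).contDiffAt le_rfl
    calc _ ≤ (‖φ i‖ * ‖iteratedFDeriv ℝ n (Λ.transform ν (Λ.derivOp (B i) f)) x‖) * ‖x‖ ^ k := by
          gcongr
      _ = _ := by ring

/-- The partial Fourier transform as a continuous operator on the Schwartz space. -/
def transformCLM : 𝓢(D, ℂ) →L[ℂ] 𝓢(D, ℂ) :=
  SchwartzMap.mkCLM (fun f => Λ.transform ν f)
    (fun f g x => by
      unfold transform
      rw [← integral_add (Λ.integrable_osc_slice ν f x) (Λ.integrable_osc_slice ν g x)]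
      refine integral_congr_forall fun y => ?_
      simp [mul_add])
    (fun a f x => by
      unfold transform
      simp only [RingHom.id_apply, smul_eq_mul]
      rw [← integral_const_mul]
      refine integral_congr_forall fun y => ?_
      simp [mul_left_comm])
    (fun f => Λ.contDiff_transform ν f)
    (fun n => by
      obtain ⟨s, C, hC, h⟩ := Λ.pow_mul_iteratedFDeriv_transform_bounded ν n.1 n.2
      exact ⟨s, C, hC, fun f x => h f x⟩)

@[simp] theorem transformCLM_apply (f : 𝓢(D, ℂ)) (x : D) :
    Λ.transformCLM ν f x = Λ.transform ν f x := rfl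

end FourierSplitting

end RealPartialFourier

/-! ### Additive characters -/

section Characters

variable {F : Type*} [NontriviallyNormedField F]

/-- On a real vector space a continuous unitary character is the exponential of a real functional:
lift the character through the universal covering of the circle. -/
theorem exists_real_phase [NormedAlgebra ℝ F] (ψ : AddChar F Circle) (hψ : Continuous ψ) :
    ∃ ℓ : F →L[ℝ] ℝ, ∀ x, (ψ x : ℂ) = Complex.exp (Complex.I * (ℓ x : ℝ)) := by
  have : SimplyConnectedSpace F := by
    have : ContractibleSpace F := RealTopologicalVectorSpace.contractibleSpace
    infer_instance
  obtain ⟨g, ⟨hg0, hg⟩, -⟩ := Circle.isCoveringMap_exp.existsUnique_continuousMap_lifts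
    (⟨ψ, hψ⟩ : C(F, Circle)) 0 0 (by simp)
  have hg' : ∀ x, Circle.exp (g x) = ψ x := fun x => congrFun hg x
  have hadd : ∀ x y, g (x + y) = g x + g y := by
    intro x
    have := Circle.isCoveringMap_exp.eq_of_comp_eq (g₁ := fun y => g (x + y))
      (g₂ := fun y => g x + g y) (by fun_prop) (by fun_prop) (by
        ext y
        simp [hg', Circle.exp_add, AddChar.map_add_eq_mul]) 0 (by simp [hg0])
    exact congrFun this
  refine ⟨AddMonoidHom.toRealLinearMap (AddMonoidHom.mk' g hadd) g.continuous, fun x => ?_⟩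
  rw [← hg', Circle.coe_exp, mul_comm]
  rfl

theorem hasTemperateGrowth_exp_I :
    Function.HasTemperateGrowth fun t : ℝ => Complex.exp (Complex.I * (t : ℂ)) := by
  have hd : ∀ t : ℝ, HasDerivAt (fun t : ℝ => Complex.exp (Complex.I * (t : ℂ)))
      (Complex.I * Complex.exp (Complex.I * (t : ℂ))) t := by
    intro t
    have h1 : HasDerivAt (fun t : ℝ => Complex.I * (t : ℂ)) Complex.I t := by
      simpa using (Complex.ofRealCLM.hasDerivAt (x := t)).const_mul Complex.I
    simpa [mul_comm] using h1.cexp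
  have hiter : ∀ n : ℕ, iteratedDeriv n (fun t : ℝ => Complex.exp (Complex.I * (t : ℂ))) =
      fun t : ℝ => Complex.I ^ n * Complex.exp (Complex.I * (t : ℂ)) := by
    intro n
    induction n with
    | zero => simp
    | succ n ih =>
      rw [iteratedDeriv_succ, ih]
      ext t
      rw [((hd t).const_mul _).deriv]
      ring
  refine ⟨(contDiff_const.mul Complex.ofRealCLM.contDiff).cexp, fun n => ⟨0, 1, fun t => ?_⟩⟩
  rw [norm_iteratedFDeriv_eq_norm_iteratedDeriv, hiter]
  simp [mul_comm Complex.I, Complex.norm_exp_ofReal_mul_I]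

/-- The circle has no small subgroups. -/
theorem circle_eq_one_of_pow_near {z : Circle} (h : ∀ n : ℕ, ‖((z ^ n : Circle) : ℂ) - 1‖ < 1) :
    z = 1 := by
  have key : ∀ m : ℕ, (3 / 2 : ℝ) ^ m * ‖(z : ℂ) - 1‖ ≤ ‖((z ^ (2 ^ m) : Circle) : ℂ) - 1‖ := by
    intro m
    induction m with
    | zero => simp
    | succ m ih =>
      set w := ((z ^ (2 ^ m) : Circle) : ℂ) with hw
      have hw1 : ‖w‖ = 1 := Circle.norm_coe _
      have hlt : ‖w - 1‖ < 1 := h _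
      have h2 : ((z ^ (2 ^ (m + 1)) : Circle) : ℂ) - 1 = (w + 1) * (w - 1) := by
        rw [hw, pow_succ, pow_mul]; push_cast; ring
      have h3 : (3 / 2 : ℝ) ≤ ‖w + 1‖ := by
        -- the parallelogram law with `‖w - 1‖ < 1`
        have h4 := parallelogram_law_with_norm ℝ w 1
        rw [hw1, norm_one] at h4
        have := norm_nonneg (w - 1)
        nlinarith [norm_nonneg (w + 1)]
      rw [h2, norm_mul, pow_succ]
      nlinarith [norm_nonneg (w - 1), norm_nonneg ((z : ℂ) - 1)]
  have h0 : ‖(z : ℂ) - 1‖ = 0 := by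
    by_contra hne
    have hpos : 0 < ‖(z : ℂ) - 1‖ := lt_of_le_of_ne (norm_nonneg _) (Ne.symm hne)
    obtain ⟨m, hm⟩ := pow_unbounded_of_one_lt (‖(z : ℂ) - 1‖)⁻¹ (by norm_num : (1 : ℝ) < 3 / 2)
    have h5 := (key m).trans_lt (h _)
    rw [inv_lt_iff_one_lt_mul₀ hpos] at hm
    linarith [mul_comm (‖(z : ℂ) - 1‖) ((3 / 2 : ℝ) ^ m)]
  ext
  rw [norm_eq_zero, sub_eq_zero] at h0
  simpa using h0

theorem exists_ball_character_trivial [IsUltrametricDist F] (ψ : AddChar F Circle)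
    (hψ : Continuous ψ) : ∃ δ > 0, ∀ x, ‖x‖ < δ → ψ x = 1 := by
  have hc : Continuous fun x => ((ψ x : Circle) : ℂ) := by fun_prop
  obtain ⟨δ, hδ, h⟩ := Metric.continuous_iff.1 hc 0 1 one_pos
  refine ⟨δ, hδ, fun x hx => circle_eq_one_of_pow_near fun n => ?_⟩
  have hn : ‖(n : F) * x‖ < δ := by
    rw [norm_mul]
    have : ‖(n : F)‖ ≤ 1 := IsUltrametricDist.norm_natCast_le_one F n
    nlinarith [norm_nonneg x]
  have := h ((n : F) * x) (by simpa using hn)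
  rw [← nsmul_eq_mul, AddChar.map_nsmul_eq_pow, AddChar.map_zero_eq_one] at this
  simpa [dist_eq_norm] using this

/-- The annihilator of a ball under a nontrivial character is bounded. -/
theorem exists_bound_of_trivial_on_ball (ψ : AddChar F Circle) (hψ1 : ψ ≠ 1) {δ : ℝ}
    (hδ : 0 < δ) : ∃ R, ∀ x : F, (∀ t, ‖t‖ < δ → ψ (x * t) = 1) → ‖x‖ ≤ R := by
  obtain ⟨a, ha⟩ : ∃ a, ψ a ≠ 1 := by
    by_contra! hcon
    exact hψ1 (by ext x; simp [hcon x])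
  refine ⟨‖a‖ / δ, fun x hx => ?_⟩
  by_contra! hlt
  have hx0 : 0 < ‖x‖ := lt_of_le_of_lt (by positivity) hlt
  refine ha ?_
  have := hx (a / x) (by
    rw [norm_div, div_lt_iff₀ hx0]
    rw [div_lt_iff₀ hδ] at hlt
    linarith)
  rwa [mul_div_cancel₀ _ (norm_pos_iff.1 hx0)] at this

end Characters

/-! ### Operators on Schwartz spaces -/

section Operators

variable {F : Type*} [NontriviallyNormedField F]
variable {κ κ' κ'' : Type*} [Fintype κ] [Fintype κ'] [Fintype κ'']

/-- Local constancy of a compactly supported function is uniform. -/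
theorem mem_locConstCompact_iff [ProperSpace F] (f : (κ → F) → ℂ) :
    f ∈ locConstCompact F κ ↔
      (∃ δ > 0, ∀ x h, ‖h‖ < δ → f (x + h) = f x) ∧ ∃ R, ∀ x, f x ≠ 0 → ‖x‖ ≤ R := by
  constructor
  · rintro ⟨h1, h2⟩
    constructor
    · obtain ⟨δ, hδ, h⟩ := lebesgue_number_lemma_of_metric (c := fun v : ℂ => f ⁻¹' {v}) h2
        (fun v => h1 _) (fun x _ => Set.mem_iUnion.2 ⟨f x, rfl⟩)
      have hK : ∀ x y, x ∈ tsupport f → ‖y - x‖ < δ → f y = f x := by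
        intro x y hx hy
        obtain ⟨v, hv⟩ := h x hx
        have e1 : f y = v := hv (by simpa [dist_eq_norm] using hy)
        have e2 : f x = v := hv (Metric.mem_ball_self hδ)
        rw [e1, e2]
      refine ⟨δ, hδ, fun x z hz => ?_⟩
      by_cases hx : x ∈ tsupport f
      · exact hK _ _ hx (by simpa using hz)
      · by_cases hx' : x + z ∈ tsupport f
        · exact (hK _ _ hx' (by simpa using hz)).symm
        · rw [image_eq_zero_of_notMem_tsupport hx, image_eq_zero_of_notMem_tsupport hx']
    · obtain ⟨R, hR⟩ := h2.isBounded.exists_norm_le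
      exact ⟨R, fun x hx => hR x (subset_tsupport f hx)⟩
  · rintro ⟨⟨δ, hδ, h1⟩, R, h2⟩
    refine ⟨(IsLocallyConstant.iff_exists_open f).2 fun x =>
      ⟨Metric.ball x δ, Metric.isOpen_ball, Metric.mem_ball_self hδ, fun y hy => ?_⟩, ?_⟩
    · have := h1 x (y - x) (by simpa [dist_eq_norm] using hy)
      simpa using this
    · refine HasCompactSupport.intro (isCompact_closedBall (0 : κ → F) R) fun x hx => ?_
      by_contra hne
      exact hx (by simpa using h2 x hne)

/-- `T` maps `S(F^κ)` linearly to `S(F^κ')`, continuously if `F` is archimedean. -/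
def IsSchwartzOp (k : LocalKind F) (T : ((κ → F) → ℂ) → ((κ' → F) → ℂ)) : Prop :=
  match k with
  | .nonarch _ => (∀ f ∈ locConstCompact F κ, T f ∈ locConstCompact F κ') ∧
      (∀ f ∈ locConstCompact F κ, ∀ g ∈ locConstCompact F κ, T (f + g) = T f + T g) ∧
      ∀ (c : ℂ), ∀ f ∈ locConstCompact F κ, T (c • f) = c • T f
  | .arch _ => ∃ A : 𝓢(κ → F, ℂ) →L[ℂ] 𝓢(κ' → F, ℂ), ∀ f : 𝓢(κ → F, ℂ), T f = A f

namespace IsSchwartzOp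

variable {k : LocalKind F} {T : ((κ → F) → ℂ) → ((κ' → F) → ℂ)}

theorem mem (hT : IsSchwartzOp k T) {f : (κ → F) → ℂ} (hf : f ∈ schwartz k κ) :
    T f ∈ schwartz k κ' := by
  cases k with
  | nonarch _ => exact hT.1 f hf
  | arch _ =>
    obtain ⟨A, hA⟩ := hT
    obtain ⟨f, rfl⟩ := hf
    exact ⟨A f, (hA f).symm⟩

theorem map_add (hT : IsSchwartzOp k T) {f g : (κ → F) → ℂ} (hf : f ∈ schwartz k κ)
    (hg : g ∈ schwartz k κ) : T (f + g) = T f + T g := by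
  cases k with
  | nonarch _ => exact hT.2.1 f hf g hg
  | arch _ =>
    obtain ⟨A, hA⟩ := hT
    obtain ⟨f, rfl⟩ := hf
    obtain ⟨g, rfl⟩ := hg
    have h1 := hA (f + g)
    rw [_root_.map_add] at h1
    calc T (schwartzIncl κ f + schwartzIncl κ g) = A f + A g := h1
      _ = _ := by rw [← hA f, ← hA g]; rfl

theorem map_smul (hT : IsSchwartzOp k T) (c : ℂ) {f : (κ → F) → ℂ} (hf : f ∈ schwartz k κ) :
    T (c • f) = c • T f := by
  cases k with
  | nonarch _ => exact hT.2.2 c f hf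
  | arch _ =>
    obtain ⟨A, hA⟩ := hT
    obtain ⟨f, rfl⟩ := hf
    have h1 := hA (c • f)
    rw [_root_.map_smul] at h1
    calc T (c • schwartzIncl κ f) = c • A f := h1
      _ = _ := by rw [← hA f]; rfl

theorem comp {T' : ((κ' → F) → ℂ) → ((κ'' → F) → ℂ)} (hT' : IsSchwartzOp k T')
    (hT : IsSchwartzOp k T) : IsSchwartzOp k fun f => T' (T f) := by
  cases k with
  | nonarch _ =>
    refine ⟨fun f hf => hT'.1 _ (hT.1 f hf), fun f hf g hg => ?_, fun c f hf => ?_⟩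
    · beta_reduce
      rw [hT.2.1 f hf g hg, hT'.2.1 _ (hT.1 f hf) _ (hT.1 g hg)]
    · beta_reduce
      rw [hT.2.2 c f hf, hT'.2.2 c _ (hT.1 f hf)]
  | arch _ =>
    obtain ⟨A, hA⟩ := hT
    obtain ⟨B, hB⟩ := hT'
    exact ⟨B.comp A, fun f => (congrArg T' (hA f)).trans (hB (A f))⟩

theorem congr {T' : ((κ → F) → ℂ) → ((κ' → F) → ℂ)} (hT : IsSchwartzOp k T)
    (h : ∀ f ∈ schwartz k κ, T' f = T f) : IsSchwartzOp k T' := by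
  cases k with
  | nonarch _ =>
    refine ⟨fun f hf => ?_, fun f hf g hg => ?_, fun c f hf => ?_⟩
    · rw [h f hf]; exact hT.1 f hf
    · rw [h f hf, h g hg, h _ (Submodule.add_mem _ hf hg)]; exact hT.2.1 f hf g hg
    · rw [h f hf, h _ (Submodule.smul_mem _ c hf)]; exact hT.2.2 c f hf
  | arch _ =>
    obtain ⟨A, hA⟩ := hT
    exact ⟨A, fun f => (h _ ⟨f, rfl⟩).trans (hA f)⟩

theorem const_smul (hT : IsSchwartzOp k T) (c : ℂ) : IsSchwartzOp k fun f => c • T f := by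
  cases k with
  | nonarch _ =>
    refine ⟨fun f hf => Submodule.smul_mem _ c (hT.1 f hf), fun f hf g hg => ?_,
      fun c' f hf => ?_⟩
    · beta_reduce
      rw [hT.2.1 f hf g hg, smul_add]
    · beta_reduce
      rw [hT.2.2 c' f hf, smul_comm]
  | arch _ =>
    obtain ⟨A, hA⟩ := hT
    exact ⟨c • A, fun f => congrArg (c • ·) (hA f)⟩

end IsSchwartzOp

variable [ProperSpace F] {k : LocalKind F}

theorem finiteDimensional_of_normedAlgebra [NormedAlgebra ℝ F] : FiniteDimensional ℝ F :=
  FiniteDimensional.of_locallyCompactSpace ℝ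

/-- Substitution of an invertible linear map. -/
theorem isSchwartzOp_comp_linearEquiv (e : (κ' → F) ≃ₗ[F] (κ → F)) :
    IsSchwartzOp k fun (f : (κ → F) → ℂ) x => f (e x) := by
  let e' : (κ' → F) ≃L[F] (κ → F) := e.toContinuousLinearEquiv
  cases k with
  | nonarch _ =>
    refine ⟨fun f hf => ⟨?_, ?_⟩, fun f _ g _ => rfl, fun c f _ => rfl⟩
    · exact hf.1.comp_continuous e'.continuous
    · exact hf.2.comp_homeomorph e'.toHomeomorph
  | arch alg =>
    let e'' : (κ' → F) ≃L[ℝ] (κ → F) :=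
      { (e'.toLinearEquiv.restrictScalars ℝ : (κ' → F) ≃ₗ[ℝ] (κ → F)) with
        continuous_toFun := e'.continuous
        continuous_invFun := e'.symm.continuous }
    exact ⟨SchwartzMap.compCLMOfContinuousLinearEquiv ℂ e'', fun f => rfl⟩

omit [ProperSpace F] in
theorem schwartz_continuous {f : (κ → F) → ℂ} (hf : f ∈ schwartz k κ) : Continuous f := by
  cases k with
  | nonarch _ => exact hf.1.continuous
  | arch _ => obtain ⟨f, rfl⟩ := hf; exact f.continuous

omit [ProperSpace F] in
/-- Schwartz functions decay faster than any power. -/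
theorem schwartz_decay {f : (κ → F) → ℂ} (hf : f ∈ schwartz k κ) (N : ℕ) :
    ∃ C, ∀ x, (1 + ‖x‖) ^ N * ‖f x‖ ≤ C := by
  cases k with
  | nonarch _ =>
    obtain ⟨C, hC⟩ := (show HasCompactSupport fun x => (1 + ‖x‖) ^ N * ‖f x‖ from
      hf.2.norm.mul_left).exists_bound_of_continuous (by
        have := hf.1.continuous
        fun_prop)
    exact ⟨C, fun x => (Real.le_norm_self _).trans (hC x)⟩
  | arch _ =>
    obtain ⟨f, rfl⟩ := hf
    have := SchwartzMap.one_add_le_sup_seminorm_apply (𝕜 := ℝ) (m := (N, 0)) (k := N) (n := 0)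
      le_rfl le_rfl f
    simp only [norm_iteratedFDeriv_zero] at this
    exact ⟨_, this⟩

variable [MeasurableSpace F] [BorelSpace F]

theorem schwartz_integrable (μ : Measure F) [μ.IsAddHaarMeasure] {f : (κ → F) → ℂ}
    (hf : f ∈ schwartz k κ) : Integrable f vol[μ] := by
  cases k with
  | nonarch _ => exact hf.1.continuous.integrable_of_hasCompactSupport hf.2
  | arch _ =>
    have := finiteDimensional_of_normedAlgebra (F := F)
    obtain ⟨f, rfl⟩ := hf
    exact f.integrable

omit [MeasurableSpace F] [BorelSpace F] in
/-- The restriction of a Schwartz function to a slice. -/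
theorem schwartz_slice {f : (κ ⊕ κ' → F) → ℂ} (hf : f ∈ schwartz k (κ ⊕ κ')) (z : κ' → F) :
    (fun y => f (Sum.elim y z)) ∈ schwartz k κ := by
  have hn : ∀ y : κ → F, ‖y‖ ≤ ‖Sum.elim y z‖ := fun y =>
    (pi_norm_le_iff_of_nonneg (norm_nonneg _)).2 fun i => norm_le_pi_norm (Sum.elim y z) (Sum.inl i)
  cases k with
  | nonarch _ =>
    obtain ⟨⟨δ, hδ, h1⟩, R, h2⟩ := (mem_locConstCompact_iff f).1 hf
    refine (mem_locConstCompact_iff _).2 ⟨⟨δ, hδ, fun x h hh => ?_⟩, R, fun x hx => ?_⟩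
    · rw [← h1 (Sum.elim x z) (Sum.elim h 0)]
      · congr 1
        ext (i | i) <;> simp
      · refine lt_of_le_of_lt ((pi_norm_le_iff_of_nonneg (norm_nonneg _)).2 ?_) hh
        rintro (i | i)
        · exact norm_le_pi_norm h i
        · simp
    · exact (hn x).trans (h2 _ hx)
  | arch _ =>
    obtain ⟨f, rfl⟩ := hf
    let L : (κ → F) →L[ℝ] (κ ⊕ κ' → F) := ContinuousLinearMap.pi
      (Sum.rec (fun i => ContinuousLinearMap.proj i) (fun _ => 0))
    have hL : ∀ y, Sum.elim y z = L y + Sum.elim (0 : κ → F) z := by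
      intro y; ext (i | i) <;> simp [L]
    have ht : Function.HasTemperateGrowth fun y : κ → F => Sum.elim y z := by
      rw [funext hL]
      exact L.hasTemperateGrowth.add (Function.HasTemperateGrowth.const _)
    refine ⟨SchwartzMap.compCLM ℂ ht ⟨1, 1, fun y => ?_⟩ f, rfl⟩
    have := hn y
    linarith

omit [MeasurableSpace F] [BorelSpace F] in
/-- Multiplication by a character of a phase function of temperate growth. -/
theorem isSchwartzOp_phase (ψ : AddChar F Circle) (hψ : Continuous ψ) {P : (κ → F) → F}
    (hP : Continuous P) (hP' : ∀ _ : NormedAlgebra ℝ F, Function.HasTemperateGrowth P) :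
    IsSchwartzOp k fun (f : (κ → F) → ℂ) x => (ψ (P x) : ℂ) * f x := by
  cases k with
  | nonarch hF =>
    obtain ⟨δ, hδ, h1⟩ := exists_ball_character_trivial ψ hψ
    have hloc : IsLocallyConstant fun x : F => (ψ x : ℂ) := by
      refine (IsLocallyConstant.iff_exists_open _).2 fun x =>
        ⟨Metric.ball x δ, Metric.isOpen_ball, Metric.mem_ball_self hδ, fun y hy => ?_⟩
      have : ψ (y - x) = 1 := h1 _ (by simpa [dist_eq_norm] using hy)
      rw [← sub_add_cancel y x, AddChar.map_add_eq_mul, this, one_mul]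
    refine ⟨fun f hf => ⟨?_, ?_⟩, fun f _ g _ => ?_, fun c f _ => ?_⟩
    · exact (hloc.comp_continuous hP).mul hf.1
    · exact hf.2.mul_left
    · ext x; exact mul_add _ _ _
    · ext x; exact mul_left_comm _ _ _
  | arch alg =>
    obtain ⟨ℓ, hℓ⟩ := exists_real_phase ψ hψ
    have ht : Function.HasTemperateGrowth fun x : κ → F => (ψ (P x) : ℂ) := by
      have he : (fun x : κ → F => (ψ (P x) : ℂ)) =
          (fun t : ℝ => Complex.exp (Complex.I * (t : ℂ))) ∘ fun x => ℓ (P x) :=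
        funext fun x => hℓ _
      rw [he]
      exact hasTemperateGrowth_exp_I.comp (ℓ.hasTemperateGrowth.comp (hP' alg))
    refine ⟨SchwartzMap.smulLeftCLM ℂ fun x : κ → F => (ψ (P x) : ℂ), fun f => ?_⟩
    ext x
    rw [SchwartzMap.smulLeftCLM_apply_apply ht]
    rfl

omit [ProperSpace F] [MeasurableSpace F] [BorelSpace F] in
theorem hasTemperateGrowth_dotProduct_mulVec [NormedAlgebra ℝ F] (B : Matrix κ κ F) :
    Function.HasTemperateGrowth fun x : κ → F => x ⬝ᵥ (B *ᵥ x) := by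
  have hx : ∀ i, Function.HasTemperateGrowth fun x : κ → F => x i := fun i =>
    (ContinuousLinearMap.proj (R := ℝ) (φ := fun _ : κ => F) i).hasTemperateGrowth
  simp only [dotProduct, mulVec]
  exact .sum fun i _ => (hx i).mul (.sum fun j _ => (Function.HasTemperateGrowth.const _).mul (hx j))

omit [MeasurableSpace F] [BorelSpace F] in
/-- Multiplication by a quadratic chirp. -/
theorem isSchwartzOp_chirp (ψ : AddChar F Circle) (hψ : Continuous ψ) (B : Matrix κ κ F) :
    IsSchwartzOp k fun (f : (κ → F) → ℂ) x => (ψ (x ⬝ᵥ (B *ᵥ x)) : ℂ) * f x :=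
  isSchwartzOp_phase ψ hψ (continuous_id.dotProduct (continuous_const.matrix_mulVec continuous_id))
    fun _ => hasTemperateGrowth_dotProduct_mulVec B

/-- The Fourier transform in the first group of variables, for the standard pairing. -/
def blockFourier (ψ : AddChar F Circle) (μ : Measure F) (f : (κ ⊕ κ' → F) → ℂ)
    (x : κ ⊕ κ' → F) : ℂ :=
  ∫ y : κ → F, f (Sum.elim y (x ∘ Sum.inr)) * (ψ ((x ∘ Sum.inl) ⬝ᵥ y) : ℂ) ∂vol[μ]

end Operators

section Operators

variable {F : Type*} [NontriviallyNormedField F] [ProperSpace F] [MeasurableSpace F] [BorelSpace F]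
variable {κ κ' : Type*} [Fintype κ] [Fintype κ'] {k : LocalKind F}

omit [ProperSpace F] in
theorem measurable_character {ψ : AddChar F Circle} (hψ : Continuous ψ) :
    Measurable fun x => (ψ x : ℂ) :=
  (continuous_subtype_val.comp hψ).measurable

omit [ProperSpace F] [MeasurableSpace F] [BorelSpace F] in
theorem addChar_map_sum (ψ : AddChar F Circle) {ι : Type*} (s : Finset ι) (f : ι → F) :
    ψ (∑ i ∈ s, f i) = ∏ i ∈ s, ψ (f i) :=
  map_prod ψ.toMonoidHom (fun i => Multiplicative.ofAdd (f i)) s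

omit [ProperSpace F] [MeasurableSpace F] [BorelSpace F] in
theorem character_dotProduct_eq_one (ψ : AddChar F Circle) {x y : κ → F}
    (h : ∀ i, ψ (x i * y i) = 1) : ψ (x ⬝ᵥ y) = 1 := by
  rw [dotProduct, addChar_map_sum]
  exact Finset.prod_eq_one fun i _ => h i

theorem integrable_blockFourier (μ : Measure F) [μ.IsAddHaarMeasure] (ψ : AddChar F Circle)
    (hψ : Continuous ψ) {f : (κ ⊕ κ' → F) → ℂ} (hf : f ∈ schwartz k (κ ⊕ κ')) (x : κ ⊕ κ' → F) :
    Integrable (fun y : κ → F => f (Sum.elim y (x ∘ Sum.inr)) * (ψ ((x ∘ Sum.inl) ⬝ᵥ y) : ℂ))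
      vol[μ] := by
  refine (schwartz_integrable μ (schwartz_slice hf _)).mul_bdd (c := 1) ?_ ?_
  · exact ((continuous_subtype_val.comp hψ).comp
      (continuous_const.dotProduct continuous_id)).aestronglyMeasurable
  · exact Filter.Eventually.of_forall fun y => (Circle.norm_coe _).le

/-- Local constancy of `f` bounds the support of the transform, and the support of `f` gives its local
constancy. -/
theorem locConstCompact_blockFourier (hF : IsUltrametricDist F) (μ : Measure F)
    [μ.IsAddHaarMeasure] (ψ : AddChar F Circle) (hψ : Continuous ψ) (hψ1 : ψ ≠ 1)
    {f : (κ ⊕ κ' → F) → ℂ} (hf : f ∈ locConstCompact F (κ ⊕ κ')) :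
    blockFourier ψ μ f ∈ locConstCompact F (κ ⊕ κ') := by
  classical
  obtain ⟨⟨δ, hδ, h1⟩, R, h2⟩ := (mem_locConstCompact_iff f).1 hf
  obtain ⟨δψ, hδψ, hψδ⟩ := exists_ball_character_trivial ψ hψ
  obtain ⟨R', hR'⟩ := exists_bound_of_trivial_on_ball ψ hψ1 hδ
  have hshift : ∀ (y h₁ : κ → F) (z h₂ : κ' → F), ‖h₁‖ < δ → ‖h₂‖ < δ →
      f (Sum.elim (y + h₁) (z + h₂)) = f (Sum.elim y z) := by
    intro y a z b ha hb
    rw [← h1 (Sum.elim y z) (Sum.elim a b)]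
    · congr 1
      ext (i | i) <;> simp
    · rw [pi_norm_lt_iff hδ]
      rintro (i | i)
      · exact (norm_le_pi_norm a i).trans_lt ha
      · exact (norm_le_pi_norm b i).trans_lt hb
  refine (mem_locConstCompact_iff _).2 ⟨⟨min δ (δψ / (|R| + 1)), by positivity, fun x h hh => ?_⟩,
    max (max R R') 0, fun x hx => ?_⟩
  · unfold blockFourier
    refine integral_congr_forall fun y => ?_
    have hx2 : f (Sum.elim y ((x + h) ∘ Sum.inr)) = f (Sum.elim y (x ∘ Sum.inr)) := by
      have := hshift y 0 (x ∘ Sum.inr) (h ∘ Sum.inr) (by simpa using hδ)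
        ((pi_norm_lt_iff hδ).2 fun i =>
          (norm_le_pi_norm h (Sum.inr i)).trans_lt (hh.trans_le (min_le_left _ _)))
      rw [add_zero] at this
      exact this
    rw [hx2]
    by_cases h0 : f (Sum.elim y (x ∘ Sum.inr)) = 0
    · rw [h0, zero_mul, zero_mul]
    · have hy := h2 _ h0
      have : ψ ((h ∘ Sum.inl) ⬝ᵥ y) = 1 := character_dotProduct_eq_one ψ fun i => hψδ _ (by
        have e1 : ‖h (Sum.inl i)‖ < δψ / (|R| + 1) :=
          (norm_le_pi_norm h _).trans_lt (hh.trans_le (min_le_right _ _))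
        have e2 : ‖y i‖ ≤ |R| + 1 :=
          ((norm_le_pi_norm (Sum.elim y (x ∘ Sum.inr)) (Sum.inl i)).trans hy).trans
            ((le_abs_self R).trans (by linarith))
        have e3 : (0 : ℝ) < |R| + 1 := by positivity
        rw [lt_div_iff₀ e3] at e1
        rw [norm_mul]
        refine lt_of_le_of_lt ?_ e1
        exact mul_le_mul_of_nonneg_left e2 (norm_nonneg _))
      have hsplit : (x + h) ∘ Sum.inl = x ∘ Sum.inl + h ∘ Sum.inl := rfl
      rw [hsplit, add_dotProduct, AddChar.map_add_eq_mul, this, mul_one]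
  · refine (pi_norm_le_iff_of_nonneg (le_max_right _ _)).2 ?_
    rintro (i | i)
    · refine ((hR' _ fun t ht => ?_).trans (le_max_right _ _)).trans (le_max_left _ _)
      have e : blockFourier ψ μ f x = (ψ (x (Sum.inl i) * t) : ℂ) * blockFourier ψ μ f x := by
        conv_lhs => unfold blockFourier
        rw [← integral_add_right_eq_self _ (Pi.single i t : κ → F), blockFourier,
          ← integral_const_mul]
        refine integral_congr_forall fun y => ?_
        have := hshift y (Pi.single i t) (x ∘ Sum.inr) 0
          ((pi_norm_lt_iff hδ).2 fun j => by
            rcases eq_or_ne j i with rfl | hj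
            · simpa using ht
            · simpa [hj] using hδ) (by simpa using hδ)
        rw [add_zero] at this
        rw [this, dotProduct_add, AddChar.map_add_eq_mul, dotProduct_single]
        simp only [Circle.coe_mul, Function.comp]
        ring
      have : (ψ (x (Sum.inl i) * t) : ℂ) = 1 :=
        mul_right_cancel₀ hx (by rw [← e, one_mul])
      exact Circle.ext this
    · obtain ⟨y, hy⟩ : ∃ y, f (Sum.elim y (x ∘ Sum.inr)) ≠ 0 := by
        by_contra! hcon
        exact hx (by simp [blockFourier, hcon])
      exact (((norm_le_pi_norm (Sum.elim y (x ∘ Sum.inr)) (Sum.inr i)).trans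
        (h2 _ hy)).trans (le_max_left _ _)).trans (le_max_left _ _)

/-- The splitting of `F^κ ⊕ F^κ'` with the pairing `(x, y) ↦ ℓ(x₁ · y)`. -/
def blockSplitting [NormedAlgebra ℝ F] (ℓ : F →L[ℝ] ℝ) (hℓ : ℓ ≠ 0) :
    FourierSplitting (κ ⊕ κ' → F) (κ → F) where
  p := ContinuousLinearMap.pi (Sum.rec (fun _ => 0)
    (fun i => ContinuousLinearMap.proj (Sum.inr i)))
  q := ContinuousLinearMap.pi (fun i => ContinuousLinearMap.proj (Sum.inl i))
  j := ContinuousLinearMap.pi (Sum.rec (fun i => ContinuousLinearMap.proj i) (fun _ => 0))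
  b := by
    have := finiteDimensional_of_normedAlgebra (F := F)
    exact (LinearMap.mk₂ ℝ (fun (x : κ ⊕ κ' → F) (y : κ → F) => ℓ ((x ∘ Sum.inl) ⬝ᵥ y))
      (fun x y z => by
        rw [show (x + y) ∘ Sum.inl = x ∘ Sum.inl + y ∘ Sum.inl from rfl, add_dotProduct, map_add])
      (fun c x y => by
        rw [show (c • x) ∘ Sum.inl = c • (x ∘ Sum.inl) from rfl, smul_dotProduct, map_smul])
      (fun x y z => by rw [dotProduct_add, map_add])
      (fun c x y => by rw [dotProduct_smul, map_smul])).toContinuousBilinearMap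
  add_eq x := by ext (i | i) <;> simp
  p_p x := by ext (i | i) <;> simp
  p_j y := by ext (i | i) <;> simp
  q_p x := by ext i; simp
  q_j y := by ext i; simp
  nondeg := by
    classical
    have := finiteDimensional_of_normedAlgebra (F := F)
    let v := Module.finBasis ℝ (κ → F)
    let M : (κ → F) →ₗ[ℝ] (Fin (Module.finrank ℝ (κ → F)) → ℝ) := LinearMap.pi fun i =>
      { toFun := fun x => ℓ (x ⬝ᵥ v i)
        map_add' := fun x y => by rw [add_dotProduct, map_add]
        map_smul' := fun c x => by rw [smul_dotProduct, map_smul]; rfl }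
    have hker : LinearMap.ker M = ⊥ := by
      refine LinearMap.ker_eq_bot'.2 fun x hx => ?_
      let N : (κ → F) →ₗ[ℝ] ℝ :=
        { toFun := fun y => ℓ (x ⬝ᵥ y)
          map_add' := fun y z => by rw [dotProduct_add, map_add]
          map_smul' := fun c y => by rw [dotProduct_smul, map_smul]; rfl }
      have hN : N = 0 := v.ext fun i => congrFun hx i
      by_contra hne
      obtain ⟨i, hi⟩ := Function.ne_iff.1 hne
      refine hℓ (ContinuousLinearMap.ext fun a => ?_)
      have := LinearMap.congr_fun hN (Pi.single i (a / x i))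
      change ℓ (x ⬝ᵥ Pi.single i (a / x i)) = 0 at this
      rwa [dotProduct_single, mul_div_cancel₀ _ hi] at this
    obtain ⟨C, -, hC⟩ := M.exists_antilipschitzWith hker
    refine ⟨_, v, C, fun x => ?_⟩
    have h1 := hC.le_mul_dist (x ∘ Sum.inl) 0
    rw [map_zero, dist_zero_right, dist_zero_right] at h1
    refine h1.trans (mul_le_mul_of_nonneg_left ?_ C.2)
    exact (pi_norm_le_iff_of_nonneg (by positivity)).2 fun i =>
      Finset.single_le_sum (f := fun i => |ℓ ((x ∘ Sum.inl) ⬝ᵥ v i)|) (fun _ _ => abs_nonneg _)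
        (Finset.mem_univ i)

theorem isSchwartzOp_blockFourier (μ : Measure F) [μ.IsAddHaarMeasure] (ψ : AddChar F Circle)
    (hψ : Continuous ψ) (hψ1 : ψ ≠ 1) :
    IsSchwartzOp k (blockFourier ψ μ : ((κ ⊕ κ' → F) → ℂ) → ((κ ⊕ κ' → F) → ℂ)) := by
  cases k with
  | nonarch hF =>
    refine ⟨fun f hf => locConstCompact_blockFourier hF μ ψ hψ hψ1 hf, fun f hf g hg => ?_,
      fun c f hf => ?_⟩
    · ext x
      simp only [blockFourier, Pi.add_apply, add_mul]
      exact integral_add (integrable_blockFourier (k := .nonarch hF) μ ψ hψ hf x)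
        (integrable_blockFourier (k := .nonarch hF) μ ψ hψ hg x)
    · ext x
      simp only [blockFourier, Pi.smul_apply, smul_eq_mul, mul_assoc]
      exact integral_const_mul _ _
  | arch alg =>
    have := finiteDimensional_of_normedAlgebra (F := F)
    obtain ⟨ℓ, hℓ⟩ := exists_real_phase ψ hψ
    have hℓ0 : ℓ ≠ 0 := by
      rintro rfl
      refine hψ1 ?_
      ext x
      simp [hℓ]
    refine ⟨(blockSplitting ℓ hℓ0).transformCLM vol[μ], fun f => ?_⟩
    ext x
    rw [FourierSplitting.transformCLM_apply]
    refine integral_congr_forall fun y => ?_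
    have e1 : (blockSplitting (κ := κ) (κ' := κ') ℓ hℓ0).p x + (blockSplitting ℓ hℓ0).j y =
        Sum.elim y (x ∘ Sum.inr) := by
      ext (i | i) <;> simp [blockSplitting]
    rw [e1, mul_comm, hℓ]
    rfl

end Operators

/-! ### Test functions -/

section Bump

variable {F : Type*} [NontriviallyNormedField F] {κ κ' : Type*} [Fintype κ] [Fintype κ']

/-- Smooth functions of compact support, where smooth means locally constant if `F` is
nonarchimedean. -/
def IsBump (k : LocalKind F) (f : (κ → F) → ℂ) : Prop :=
  HasCompactSupport f ∧ match k with
    | .nonarch _ => IsLocallyConstant f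
    | .arch _ => ContDiff ℝ ((⊤ : ℕ∞) : WithTop ℕ∞) f

theorem IsBump.mem_schwartz {k : LocalKind F} {f : (κ → F) → ℂ} (hf : IsBump k f) :
    f ∈ schwartz k κ := by
  cases k with
  | nonarch _ => exact ⟨hf.2, hf.1⟩
  | arch _ => exact ⟨hf.1.toSchwartzMap hf.2, rfl⟩

/-- A function of compact support of the form `f(xᵗ B x)`. -/
theorem IsBump.comp_quadratic {k : LocalKind F} {f : (Unit → F) → ℂ} (hf : IsBump k f)
    (B : Matrix κ κ F) (hc : HasCompactSupport fun x : κ → F => f fun _ => x ⬝ᵥ (B *ᵥ x)) :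
    IsBump k fun x : κ → F => f fun _ => x ⬝ᵥ (B *ᵥ x) := by
  cases k with
  | nonarch _ =>
    refine ⟨hc, hf.2.comp_continuous (f := fun (x : κ → F) (_ : Unit) => x ⬝ᵥ (B *ᵥ x)) ?_⟩
    exact continuous_pi fun _ =>
      continuous_id.dotProduct (continuous_const.matrix_mulVec continuous_id)
  | arch _ =>
    refine ⟨hc, hf.2.comp (f := fun (x : κ → F) (_ : Unit) => x ⬝ᵥ (B *ᵥ x)) ?_⟩
    refine contDiff_pi.2 fun _ => ?_
    simp only [dotProduct, mulVec]
    refine ContDiff.sum fun i _ => (contDiff_apply ℝ F i).mul (ContDiff.sum fun j _ => ?_)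
    exact contDiff_const.mul (contDiff_apply ℝ F j)

/-- A nonnegative test function with value `1` at the origin. -/
theorem exists_bump [ProperSpace F] (k : LocalKind F) (κ : Type*) [Fintype κ] :
    ∃ g : (κ → F) → ℝ, IsBump k (fun x => (g x : ℂ)) ∧ (∀ x, 0 ≤ g x) ∧ g 0 = 1 := by
  classical
  cases k with
  | nonarch h =>
    have hcl : IsClopen (Metric.ball (0 : κ → F) 1) := IsUltrametricDist.isClopen_ball _ _
    refine ⟨(Metric.ball (0 : κ → F) 1).indicator 1, ⟨?_, ?_⟩, fun x => ?_, ?_⟩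
    · refine HasCompactSupport.intro (isCompact_closedBall (0 : κ → F) 1) fun x hx => ?_
      rw [Set.indicator_of_notMem fun h => hx (Metric.ball_subset_closedBall h)]
      simp
    · have : IsLocallyConstant ((Metric.ball (0 : κ → F) 1).indicator (1 : (κ → F) → ℝ)) :=
        (LocallyConstant.indicator (1 : LocallyConstant (κ → F) ℝ) hcl).isLocallyConstant
      exact this.comp fun x : ℝ => (x : ℂ)
    · exact Set.indicator_nonneg (fun _ _ => zero_le_one) _
    · simp
  | arch alg =>
    have := finiteDimensional_of_normedAlgebra (F := F)
    let b : ContDiffBump (0 : κ → F) := ⟨1, 2, one_pos, one_lt_two⟩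
    refine ⟨b, ⟨?_, ?_⟩, fun x => b.nonneg, ?_⟩
    · exact b.hasCompactSupport.comp_left (g := fun x : ℝ => (x : ℂ)) rfl
    · exact Complex.ofRealCLM.contDiff.comp b.contDiff
    · exact b.one_of_mem_closedBall (by simp [b])

theorem integral_bump_ne_zero [ProperSpace F] [MeasurableSpace F] [BorelSpace F] (μ : Measure F)
    [μ.IsAddHaarMeasure] {k : LocalKind F} {g : (κ → F) → ℝ} (hg : IsBump k (fun x => (g x : ℂ)))
    (hg0 : ∀ x, 0 ≤ g x) (hg1 : g 0 = 1) : ∫ x, (g x : ℂ) ∂vol[μ] ≠ 0 := by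
  have hc : Continuous g := by
    have := schwartz_continuous hg.mem_schwartz
    exact (Complex.continuous_re.comp this)
  have hcs : HasCompactSupport g := hg.1.comp_left (g := Complex.re) rfl
  rw [integral_complex_ofReal]
  have := hc.integral_pos_of_hasCompactSupport_nonneg_nonzero (μ := vol[μ]) hcs hg0
    (x := 0) (by rw [hg1]; exact one_ne_zero)
  exact_mod_cast this.ne'

end Bump

/-! ### The Fourier transform on `F^κ` and the constants of Gaussian integrals -/

section LocalAbs

variable {F : Type*} [NontriviallyNormedField F] [ProperSpace F]

open Classical in
/-- The normalized absolute value as a function on `F`, with value `0` at `0`. -/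
def localAbs (a : F) : ℝ := if h : a = 0 then 0 else modulus (Units.mk0 a h)

theorem localAbs_units (a : Fˣ) : localAbs (a : F) = modulus a := by
  rw [localAbs, dif_neg a.ne_zero]; congr 1; ext; rfl

theorem localAbs_of_ne_zero {a : F} (h : a ≠ 0) : localAbs a = modulus (Units.mk0 a h) :=
  dif_neg h

theorem localAbs_pos {a : F} (h : a ≠ 0) : 0 < localAbs a := by
  rw [localAbs_of_ne_zero h]; exact modulus_pos _

@[simp] theorem localAbs_zero : localAbs (0 : F) = 0 := dif_pos rfl

@[simp] theorem localAbs_one : localAbs (1 : F) = 1 := by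
  have := localAbs_units (1 : Fˣ); simpa using this

theorem localAbs_nonneg (a : F) : 0 ≤ localAbs a := by
  rcases eq_or_ne a 0 with rfl | h
  · simp
  · exact (localAbs_pos h).le

@[simp] theorem localAbs_mul (a b : F) : localAbs (a * b) = localAbs a * localAbs b := by
  rcases eq_or_ne a 0 with rfl | ha
  · simp
  rcases eq_or_ne b 0 with rfl | hb
  · simp
  have := modulus_mul (Units.mk0 a ha) (Units.mk0 b hb)
  rwa [← localAbs_units, ← localAbs_units, ← localAbs_units] at this

@[simp] theorem localAbs_inv (a : F) : localAbs a⁻¹ = (localAbs a)⁻¹ := by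
  rcases eq_or_ne a 0 with rfl | ha
  · simp
  have := modulus_inv (Units.mk0 a ha)
  rwa [← localAbs_units, ← localAbs_units, Units.val_inv_eq_inv_val] at this

@[simp] theorem localAbs_pow (a : F) (n : ℕ) : localAbs (a ^ n) = localAbs a ^ n := by
  induction n with
  | zero => simp
  | succ n ih => rw [pow_succ, localAbs_mul, ih, pow_succ]

@[simp] theorem localAbs_neg (a : F) : localAbs (-a) = localAbs a := by
  have h : localAbs (-1 : F) ^ 2 = 1 := by
    rw [← localAbs_pow]; simp
  have h1 : localAbs (-1 : F) = 1 := by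
    have := localAbs_nonneg (-1 : F)
    nlinarith
  rw [← neg_one_mul, localAbs_mul, h1, one_mul]

variable [MeasurableSpace F] [BorelSpace F] (μ : Measure F) [μ.IsAddHaarMeasure]
variable {κ : Type*} [Fintype κ] {E : Type*} [NormedAddCommGroup E] [NormedSpace ℝ E]

theorem integral_comp_mul {a : F} (ha : a ≠ 0) (f : F → E) :
    ∫ x, f (a * x) ∂μ = (localAbs a)⁻¹ • ∫ x, f x ∂μ := by
  rw [localAbs_of_ne_zero ha]; exact integral_comp_units_mul μ (Units.mk0 a ha) f

theorem integral_comp_smul {κ : Type*} [Fintype κ] {a : F} (ha : a ≠ 0) (f : (κ → F) → E) :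
    ∫ x, f (a • x) ∂vol[μ] =
      (localAbs a ^ Fintype.card κ)⁻¹ • ∫ x, f x ∂vol[μ] := by
  classical
  rw [localAbs_of_ne_zero ha]; exact integral_comp_units_smul μ (Units.mk0 a ha) f

theorem integral_comp_mulVec' [DecidableEq κ] {A : Matrix κ κ F} (hA : IsUnit A.det)
    (f : (κ → F) → E) :
    ∫ x, f (A *ᵥ x) ∂vol[μ] =
      (localAbs A.det)⁻¹ • ∫ x, f x ∂vol[μ] := by
  rw [integral_comp_mulVec μ A hA]
  rw [← localAbs_units, IsUnit.unit_spec]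

end LocalAbs

section Fourier

variable {F : Type*} [NontriviallyNormedField F] [ProperSpace F] [MeasurableSpace F] [BorelSpace F]
variable (k : LocalKind F) (ψ : AddChar F Circle) (μ : Measure F) [μ.IsAddHaarMeasure]
variable {κ : Type*} [Fintype κ]

/-- The Fourier transform on `F^κ` for the standard pairing. -/
def fourier (φ : (κ → F) → ℂ) (x : κ → F) : ℂ :=
  ∫ y, φ y * (ψ (x ⬝ᵥ y) : ℂ) ∂vol[μ]

variable {k ψ}

theorem isSchwartzOp_fourier (hψ : Continuous ψ) (hψ1 : ψ ≠ 1) :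
    IsSchwartzOp k (fourier ψ μ : ((κ → F) → ℂ) → ((κ → F) → ℂ)) := by
  have h1 : IsSchwartzOp k fun (f : (κ → F) → ℂ) (x : κ ⊕ Empty → F) =>
      f (LinearEquiv.funCongrLeft F F (Equiv.sumEmpty κ Empty).symm x) :=
    isSchwartzOp_comp_linearEquiv _
  have h2 : IsSchwartzOp k fun (f : (κ ⊕ Empty → F) → ℂ) (x : κ → F) =>
      f (LinearEquiv.funCongrLeft F F (Equiv.sumEmpty κ Empty) x) :=
    isSchwartzOp_comp_linearEquiv _
  exact (h2.comp ((isSchwartzOp_blockFourier μ ψ hψ hψ1).comp h1)).congr fun f _ => rfl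

omit [MeasurableSpace F] [BorelSpace F] in
theorem isSchwartzOp_quad (hψ : Continuous ψ) (S : Matrix κ κ F) :
    IsSchwartzOp k fun (f : (κ → F) → ℂ) x => (ψ (quad S x) : ℂ) * f x := by
  refine (isSchwartzOp_chirp ψ hψ ((2 : F)⁻¹ • S)).congr fun f _ => ?_
  ext x
  rw [smul_mulVec, dotProduct_smul, smul_eq_mul, ← div_eq_inv_mul]
  rfl

omit [ProperSpace F] [MeasurableSpace F] [BorelSpace F] in
theorem continuous_quad (S : Matrix κ κ F) : Continuous (quad S) :=
  (continuous_id.dotProduct (continuous_const.matrix_mulVec continuous_id)).div_const 2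

omit [MeasurableSpace F] [BorelSpace F] [ProperSpace F] in
theorem continuous_char {X : Type*} [TopologicalSpace X] (hψ : Continuous ψ) {f : X → F}
    (hf : Continuous f) : Continuous fun x => (ψ (f x) : ℂ) :=
  continuous_subtype_val.comp (hψ.comp hf)

omit [ProperSpace F] in
theorem integrable_mul_char {X : Type*} [TopologicalSpace X] [MeasurableSpace X]
    [OpensMeasurableSpace X] {ν : Measure X}
    (hψ : Continuous ψ) {φ : X → ℂ} (hφ : Integrable φ ν) {f : X → F}
    (hf : Continuous f) : Integrable (fun x => φ x * (ψ (f x) : ℂ)) ν := by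
  refine hφ.mul_bdd (c := 1) (AEStronglyMeasurable.mono_ac (ν := ν) (fun _ h => h) ?_) ?_
  · exact ((measurable_character hψ).stronglyMeasurable.comp_measurable
      hf.measurable).aestronglyMeasurable
  · exact Filter.Eventually.of_forall fun y => (Circle.norm_coe _).le

theorem integral_fourier_mul (hψ : Continuous ψ) {φ g : (κ → F) → ℂ}
    (hφ : Integrable φ vol[μ]) (hg : Integrable g vol[μ]) :
    ∫ x, fourier ψ μ φ x * g x ∂vol[μ] =
      ∫ y, φ y * fourier ψ μ g y ∂vol[μ] := by
  have h1 : Integrable (fun p : (κ → F) × (κ → F) => g p.1 * φ p.2 * (ψ (p.1 ⬝ᵥ p.2) : ℂ))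
      (vol[μ].prod vol[μ]) :=
    integrable_mul_char hψ (hg.mul_prod hφ) (continuous_fst.dotProduct continuous_snd)
  have h2 := integral_integral_swap (f := fun x y => g x * φ y * (ψ (x ⬝ᵥ y) : ℂ)) h1
  calc _ = ∫ x, ∫ y, g x * φ y * (ψ (x ⬝ᵥ y) : ℂ) ∂vol[μ]
          ∂vol[μ] := by
        refine integral_congr_forall fun x => ?_
        rw [fourier, mul_comm, ← integral_const_mul]
        simp only [mul_assoc]
    _ = _ := h2
    _ = _ := by
        refine integral_congr_forall fun y => ?_
        rw [fourier, ← integral_const_mul]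
        refine integral_congr_forall fun x => ?_
        rw [dotProduct_comm y x]; ring

omit [μ.IsAddHaarMeasure] in
theorem fourier_comp_add [μ.IsAddHaarMeasure] (φ : (κ → F) → ℂ) (a x : κ → F) :
    fourier ψ μ (fun y => φ (y + a)) x = (ψ (-(x ⬝ᵥ a)) : ℂ) * fourier ψ μ φ x := by
  rw [fourier, fourier, ← integral_const_mul,
    ← integral_add_right_eq_self (fun y => (ψ (-(x ⬝ᵥ a)) : ℂ) * (φ y * (ψ (x ⬝ᵥ y) : ℂ))) a]
  refine integral_congr_forall fun y => ?_
  rw [mul_left_comm, ← Circle.coe_mul, ← AddChar.map_add_eq_mul, dotProduct_add]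
  congr 4
  ring

theorem fourier_comp_smul (φ : (κ → F) → ℂ) {a : F} (ha : a ≠ 0) (x : κ → F) :
    fourier ψ μ (fun y => φ (a • y)) x =
      ((localAbs a ^ Fintype.card κ)⁻¹ : ℝ) • fourier ψ μ φ (a⁻¹ • x) := by
  rw [fourier, fourier, ← integral_comp_smul μ ha]
  refine integral_congr_forall fun y => ?_
  rw [smul_dotProduct, dotProduct_smul, smul_smul, inv_mul_cancel₀ ha, one_smul]

theorem integrable_fourier (hψ : Continuous ψ) (hψ1 : ψ ≠ 1) {φ : (κ → F) → ℂ}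
    (hφ : φ ∈ schwartz k κ) : Integrable (fourier ψ μ φ) vol[μ] :=
  schwartz_integrable μ ((isSchwartzOp_fourier μ hψ hψ1).mem hφ)

/-- The Fourier transform of a product of functions of one variable. -/
theorem fourier_prod (g : κ → F → ℂ) (x : κ → F) :
    fourier ψ μ (fun y => ∏ i, g i (y i)) x = ∏ i, ∫ z, g i z * (ψ (x i * z) : ℂ) ∂μ := by
  rw [← integral_fintype_prod_eq_prod, fourier]
  refine integral_congr_forall fun y => ?_
  rw [dotProduct, addChar_map_sum, Finset.prod_mul_distrib]
  congr 1
  exact map_prod Circle.coeHom _ _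

theorem integral_unit {E : Type*} [NormedAddCommGroup E] [NormedSpace ℝ E] (f : F → E) :
    ∫ v : Unit → F, f (v ()) ∂vol[μ] = ∫ x, f x ∂μ :=
  (measurePreserving_funUnique μ Unit).integral_comp
    (MeasurableEquiv.funUnique Unit F).measurableEmbedding f

theorem integrable_unit_iff {E : Type*} [NormedAddCommGroup E] (f : F → E) :
    Integrable (fun v : Unit → F => f (v ())) vol[μ] ↔ Integrable f μ :=
  (measurePreserving_funUnique μ Unit).integrable_comp_emb
    (MeasurableEquiv.funUnique Unit F).measurableEmbedding

theorem fourier_unit (g : F → ℂ) (x : Unit → F) :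
    fourier ψ μ (fun v => g (v ())) x = ∫ z, g z * (ψ (x () * z) : ℂ) ∂μ := by
  rw [fourier, ← integral_unit μ]
  refine integral_congr_forall fun y => ?_
  simp [dotProduct]

/-- Fourier inversion at the origin. -/
theorem integral_fourier (hψ : Continuous ψ) (hψ1 : ψ ≠ 1) (hμ : IsSelfDual k ψ μ)
    {φ : (κ → F) → ℂ} (hc : Continuous φ) (hb : ∃ M, ∀ x, ‖φ x‖ ≤ M)
    (hφ : Integrable φ vol[μ])
    (hF : Integrable (fourier ψ μ φ) vol[μ]) :
    ∫ x, fourier ψ μ φ x ∂vol[μ] = φ 0 := by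
  obtain ⟨g₀, hg₀, hg₀0, hg₀1⟩ := exists_bump k Unit
  -- a product `g` of functions of one variable, for which the inversion formula is self-duality
  let g1 : F → ℂ := fun x => g₀ fun _ => x
  have hg1s : (fun v : Unit → F => g1 (v ())) ∈ schwartz k Unit := hg₀.mem_schwartz
  have hg1c : Continuous g1 := by
    have h1 := schwartz_continuous hg1s
    exact h1.comp (continuous_pi fun _ => continuous_id : Continuous fun (x : F) (_ : Unit) => x)
  have hg1b : ∃ M, ∀ x, ‖g1 x‖ ≤ M := by
    obtain ⟨C, hC⟩ := schwartz_decay hg1s 0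
    exact ⟨C, fun x => by simpa using hC fun _ => x⟩
  let g1' : F → ℂ := fun x => ∫ z, g1 z * (ψ (x * z) : ℂ) ∂μ
  have hg1' : Integrable g1' μ := by
    rw [← integrable_unit_iff μ]
    refine (integrable_fourier μ hψ hψ1 hg1s).congr (.of_forall fun x => ?_)
    exact fourier_unit μ g1 x
  have hint1 : ∫ x, g1' x ∂μ = 1 := by
    have := hμ g1 hg1s 0
    simp only [zero_mul, neg_zero, AddChar.map_zero_eq_one, Circle.coe_one, mul_one] at this
    have hone : g1 0 = 1 := by
      change ((g₀ fun _ => 0 : ℝ) : ℂ) = 1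
      rw [show (fun _ : Unit => (0 : F)) = 0 from rfl, hg₀1]; simp
    rw [← hone, ← this]
  let g : (κ → F) → ℂ := fun x => ∏ i, g1 (x i)
  have hgc : Continuous g := continuous_finsetProd _ fun i _ => hg1c.comp (continuous_apply i)
  have hgint : Integrable g vol[μ] :=
    Integrable.fintype_prod fun i => by
      rw [← integrable_unit_iff μ]; exact schwartz_integrable μ hg1s
  have hg0 : g 0 = 1 := by
    refine Finset.prod_eq_one fun i _ => ?_
    change ((g₀ fun _ => 0 : ℝ) : ℂ) = 1
    rw [show (fun _ : Unit => (0 : F)) = 0 from rfl, hg₀1]; simp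
  obtain ⟨M1, hM1⟩ := hg1b
  have hgb : ∀ x, ‖g x‖ ≤ M1 ^ Fintype.card κ := fun x => by
    refine (Finset.norm_prod_le (Finset.univ : Finset κ) fun i => g1 (x i)).trans ?_
    refine (Finset.prod_le_prod (fun _ _ => norm_nonneg _) fun i _ => hM1 (x i)).trans ?_
    simp
  have hgf : fourier ψ μ g = fun x => ∏ i, g1' (x i) := by
    ext x; exact fourier_prod μ (fun _ => g1) x
  have hgfi : Integrable (fourier ψ μ g) vol[μ] := by
    rw [hgf]; exact Integrable.fintype_prod fun i => hg1'
  have hgfint : ∫ x, fourier ψ μ g x ∂vol[μ] = 1 := by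
    rw [hgf, integral_fintype_prod_eq_prod (f := fun _ => g1')]
    simp [hint1]
  obtain ⟨ε, hε0, hε1⟩ := NormedField.exists_norm_lt_one F
  have hε : ε ≠ 0 := norm_pos_iff.1 hε0
  have htend : ∀ x : κ → F, Filter.Tendsto (fun n : ℕ => ε ^ n • x) Filter.atTop (nhds 0) := by
    intro x
    have := (tendsto_pow_atTop_nhds_zero_of_norm_lt_one hε1).smul_const x
    simpa using this
  obtain ⟨Mφ, hMφ⟩ := hb
  -- the multiplication formula with a dilate of `g`; both sides converge as `n → ∞`
  have hid : ∀ n : ℕ, ∫ x, fourier ψ μ φ x * g (ε ^ n • x) ∂vol[μ] =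
      ∫ y, φ (ε ^ n • y) * fourier ψ μ g y ∂vol[μ] := by
    intro n
    have hn : ε ^ n ≠ 0 := pow_ne_zero n hε
    have hi : Integrable (fun x => g (ε ^ n • x)) vol[μ] := by
      exact Integrable.fintype_prod (f := fun _ x => g1 (ε ^ n * x)) fun i => by
        have hgi : Integrable g1 μ := by
          rw [← integrable_unit_iff μ]; exact schwartz_integrable μ hg1s
        have he : MeasurableEmbedding fun x : F => ε ^ n * x :=
          (continuous_const_mul (ε ^ n)).measurableEmbedding (mul_right_injective₀ hn)
        refine (he.integrable_map_iff (g := g1)).1 ?_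
        rw [show (fun x : F => ε ^ n * x) = fun x => ((Units.mk0 _ hn : Fˣ) : F) * x from rfl,
          map_mul_left_eq]
        exact hgi.smul_measure ENNReal.ofReal_ne_top
    rw [integral_fourier_mul μ hψ hφ hi]
    have h1 := integral_comp_smul μ (inv_ne_zero hn)
      (fun y => φ (ε ^ n • y) * fourier ψ μ g y) (κ := κ)
    simp only [smul_smul, mul_inv_cancel₀ hn, one_smul] at h1
    simp only [fourier_comp_smul μ g hn, mul_smul_comm]
    rw [integral_smul, h1, smul_smul, localAbs_inv, inv_pow, inv_inv, inv_mul_cancel₀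
      (pow_ne_zero _ (localAbs_pos hn).ne'), one_smul]
  have hl : Filter.Tendsto (fun n : ℕ => ∫ x, fourier ψ μ φ x * g (ε ^ n • x)
      ∂vol[μ]) Filter.atTop
      (nhds (∫ x, fourier ψ μ φ x * g 0 ∂vol[μ])) := by
    refine tendsto_integral_of_dominated_convergence
      (fun x => ‖fourier ψ μ φ x‖ * M1 ^ Fintype.card κ) (fun n => ?_) (hF.norm.mul_const _)
      (fun n => Filter.Eventually.of_forall fun x => ?_)
      (.of_forall fun x => ?_)
    · exact hF.aestronglyMeasurable.mul
        (hgc.comp (continuous_const_smul _)).aestronglyMeasurable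
    · rw [norm_mul]
      exact mul_le_mul_of_nonneg_left (hgb _) (norm_nonneg _)
    · exact ((hgc.tendsto 0).comp (htend x)).const_mul _
  have hr : Filter.Tendsto (fun n : ℕ => ∫ y, φ (ε ^ n • y) * fourier ψ μ g y
      ∂vol[μ]) Filter.atTop
      (nhds (∫ y, φ 0 * fourier ψ μ g y ∂vol[μ])) := by
    refine tendsto_integral_of_dominated_convergence
      (fun x => Mφ * ‖fourier ψ μ g x‖) (fun n => ?_) (hgfi.norm.const_mul _)
      (fun n => Filter.Eventually.of_forall fun x => ?_)
      (.of_forall fun x => ?_)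
    · exact (hc.comp (continuous_const_smul _)).aestronglyMeasurable.mul
        hgfi.aestronglyMeasurable
    · rw [norm_mul]
      exact mul_le_mul_of_nonneg_right (hMφ (ε ^ n • x)) (norm_nonneg _)
    · exact ((hc.tendsto 0).comp (htend x)).mul_const _
  rw [funext hid] at hl
  have := tendsto_nhds_unique hl hr
  rw [integral_const_mul, hgfint, hg0] at this
  simpa using this

/-- Fourier inversion. -/
theorem fourier_inversion (hψ : Continuous ψ) (hψ1 : ψ ≠ 1) (hμ : IsSelfDual k ψ μ)
    {φ : (κ → F) → ℂ} (hφ : φ ∈ schwartz k κ) (a : κ → F) :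
    ∫ x, fourier ψ μ φ x * (ψ (-(x ⬝ᵥ a)) : ℂ) ∂vol[μ] = φ a := by
  have hF := integrable_fourier μ hψ hψ1 hφ
  have h := integral_fourier (k := k) μ hψ hψ1 hμ (φ := fun y => φ (y + a))
    ((schwartz_continuous hφ).comp (continuous_add_const a))
    (by
      obtain ⟨C, hC⟩ := schwartz_decay hφ 0
      exact ⟨C, fun x => by simpa using hC (x + a)⟩)
    ((schwartz_integrable μ hφ).comp_add_right a)
    (by
      rw [funext (fourier_comp_add μ φ a)]
      simp_rw [mul_comm _ (fourier ψ μ φ _)]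
      exact integrable_mul_char hψ hF (continuous_id.dotProduct continuous_const).neg)
  simp only [fourier_comp_add, zero_add] at h
  simpa only [mul_comm] using h

/-! ### Gaussian integrals -/

/-- Completing the square. -/
theorem quad_add_dotProduct [DecidableEq κ] {S : Matrix κ κ F} (hS : IsUnit S.det) (hs : S.IsSymm)
    (h2 : (2 : F) ≠ 0) (x y : κ → F) :
    x ⬝ᵥ y + quad S x = -quad S⁻¹ y + quad S (x + S⁻¹ *ᵥ y) := by
  have h1 : S *ᵥ (S⁻¹ *ᵥ y) = y := by
    rw [mulVec_mulVec, mul_nonsing_inv _ hS, one_mulVec]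
  have h3 : (S⁻¹ *ᵥ y) ⬝ᵥ (S *ᵥ x) = x ⬝ᵥ y := by
    rw [dotProduct_mulVec, ← mulVec_transpose, hs.eq, h1, dotProduct_comm]
  simp only [quad, pairing, mulVec_add, add_dotProduct, dotProduct_add, h1, h3]
  rw [dotProduct_comm (S⁻¹ *ᵥ y) y]
  field_simp
  ring

variable [DecidableEq κ]

/-- The ratio of the two Gaussian integrals attached to `φ` does not depend on `φ`. -/
theorem gauss_symm (hψ : Continuous ψ) (h2 : (2 : F) ≠ 0) {S : Matrix κ κ F} (hS : IsUnit S.det)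
    (hs : S.IsSymm) {φ₁ φ₂ : (κ → F) → ℂ} (h₁ : Integrable φ₁ vol[μ])
    (h₂ : Integrable φ₂ vol[μ])
    (hF₁ : Integrable (fourier ψ μ φ₁) vol[μ])
    (hF₂ : Integrable (fourier ψ μ φ₂) vol[μ]) :
    (∫ y, φ₂ y * (ψ (-quad S⁻¹ y) : ℂ) ∂vol[μ]) *
        (∫ x, fourier ψ μ φ₁ x * (ψ (quad S x) : ℂ) ∂vol[μ]) =
      (∫ y, φ₁ y * (ψ (-quad S⁻¹ y) : ℂ) ∂vol[μ]) *
        (∫ x, fourier ψ μ φ₂ x * (ψ (quad S x) : ℂ) ∂vol[μ]) := by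
  -- both sides are `∫∫∫ η₂(z) η₁(y) ψ(Q(x + S⁻¹ y + S⁻¹ z)) dy dz dx`
  have key : ∀ φ η : (κ → F) → ℂ, Integrable φ vol[μ] →
      Integrable (fourier ψ μ φ) vol[μ] →
      Integrable η vol[μ] →
      (∫ y, η y ∂vol[μ]) *
        (∫ x, fourier ψ μ φ x * (ψ (quad S x) : ℂ) ∂vol[μ]) =
      ∫ x, ∫ z, ∫ y, η z * (φ y * (ψ (-quad S⁻¹ y) : ℂ)) *
        (ψ (quad S (x + S⁻¹ *ᵥ z + S⁻¹ *ᵥ y)) : ℂ)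
        ∂vol[μ] ∂vol[μ] ∂vol[μ] := by
    intro φ η hφ hF hη
    have hFi : Integrable (fun x => fourier ψ μ φ x * (ψ (quad S x) : ℂ))
        vol[μ] := integrable_mul_char hψ hF (continuous_quad S)
    have hFx : ∀ x, fourier ψ μ φ x * (ψ (quad S x) : ℂ) =
        ∫ y, φ y * (ψ (-quad S⁻¹ y) : ℂ) * (ψ (quad S (x + S⁻¹ *ᵥ y)) : ℂ)
          ∂vol[μ] := by
      intro x
      rw [fourier, ← integral_mul_const]
      refine integral_congr_forall fun y => ?_
      rw [mul_assoc, mul_assoc, ← Circle.coe_mul, ← Circle.coe_mul, ← AddChar.map_add_eq_mul,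
        ← AddChar.map_add_eq_mul, quad_add_dotProduct hS hs h2]
    set G : (κ → F) → ℂ := fun x => fourier ψ μ φ x * (ψ (quad S x) : ℂ) with hG
    have hshear : MeasurePreserving (fun p : (κ → F) × (κ → F) => (p.1, p.2 + S⁻¹ *ᵥ p.1))
        (vol[μ].prod vol[μ])
        (vol[μ].prod vol[μ]) := by
      refine MeasurePreserving.skew_product (MeasurePreserving.id _)
        (g := fun z x => x + S⁻¹ *ᵥ z) ?_ (.of_forall fun z => ?_)
      · exact measurable_snd.add ((measurable_mulVec S⁻¹).comp measurable_fst)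
      · exact map_add_right_eq_self _ _
    have hprod : Integrable (fun p : (κ → F) × (κ → F) => η p.1 * G (p.2 + S⁻¹ *ᵥ p.1))
        (vol[μ].prod vol[μ]) :=
      hshear.integrable_comp_of_integrable (hη.mul_prod hFi)
    have hswap := integral_integral_swap (f := fun z x => η z * G (x + S⁻¹ *ᵥ z)) hprod
    calc _ = ∫ z, ∫ x, η z * G (x + S⁻¹ *ᵥ z) ∂vol[μ]
            ∂vol[μ] := by
          rw [← integral_mul_const]
          refine integral_congr_forall fun z => ?_
          rw [integral_const_mul, integral_add_right_eq_self G]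
      _ = _ := hswap
      _ = _ := by
          refine integral_congr_forall fun x => ?_
          refine integral_congr_forall fun z => ?_
          rw [hG]
          beta_reduce
          rw [hFx, ← integral_const_mul]
          simp only [mul_assoc]
  have hη₁ := integrable_mul_char hψ h₁ (f := fun y => -quad S⁻¹ y) (continuous_quad S⁻¹).neg
  have hη₂ := integrable_mul_char hψ h₂ (f := fun y => -quad S⁻¹ y) (continuous_quad S⁻¹).neg
  rw [key φ₁ _ h₁ hF₁ hη₂, key φ₂ _ h₂ hF₂ hη₁]
  refine integral_congr_forall fun x => ?_
  have hint : Integrable (fun p : (κ → F) × (κ → F) =>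
      φ₂ p.1 * (ψ (-quad S⁻¹ p.1) : ℂ) * (φ₁ p.2 * (ψ (-quad S⁻¹ p.2) : ℂ)) *
        (ψ (quad S (x + S⁻¹ *ᵥ p.1 + S⁻¹ *ᵥ p.2)) : ℂ))
      (vol[μ].prod vol[μ]) := by
    refine integrable_mul_char hψ (hη₂.mul_prod hη₁) ((continuous_quad S).comp ?_)
    exact (continuous_const.add (continuous_const.matrix_mulVec continuous_fst)).add
      (continuous_const.matrix_mulVec continuous_snd)
  rw [integral_integral_swap (f := fun z y =>
      φ₂ z * (ψ (-quad S⁻¹ z) : ℂ) * (φ₁ y * (ψ (-quad S⁻¹ y) : ℂ)) *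
        (ψ (quad S (x + S⁻¹ *ᵥ z + S⁻¹ *ᵥ y)) : ℂ)) hint]
  refine integral_congr_forall fun z => ?_
  refine integral_congr_forall fun y => ?_
  rw [add_right_comm x]
  ring

/-- `c` is the constant of the Gaussian integral of `S`: the Fourier transform of `ψ(xᵗ S x / 2)`
is `c ψ(-xᵗ S⁻¹ x / 2)`, tested against integrable functions with integrable Fourier transform. -/
def IsGaussConst (ψ : AddChar F Circle) (μ : Measure F) (S : Matrix κ κ F) (c : ℂ) : Prop :=
  ∀ φ : (κ → F) → ℂ, Integrable φ vol[μ] →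
    Integrable (fourier ψ μ φ) vol[μ] →
    ∫ x, fourier ψ μ φ x * (ψ (quad S x) : ℂ) ∂vol[μ] =
      c * ∫ y, φ y * (ψ (-quad S⁻¹ y) : ℂ) ∂vol[μ]

/-- A Schwartz function on which the Gaussian functional does not vanish. -/
theorem exists_gauss_test (k : LocalKind F) (hψ : Continuous ψ) (S : Matrix κ κ F) :
    ∃ φ ∈ schwartz k κ, ∫ y, φ y * (ψ (-quad S⁻¹ y) : ℂ) ∂vol[μ] ≠ 0 := by
  obtain ⟨g, hg, hg0, hg1⟩ := exists_bump k κ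
  refine ⟨_, (isSchwartzOp_quad hψ S⁻¹).mem hg.mem_schwartz, ?_⟩
  convert integral_bump_ne_zero μ hg hg0 hg1 using 2
  ext y
  rw [mul_right_comm, ← Circle.coe_mul, ← AddChar.map_add_eq_mul, add_neg_cancel,
    AddChar.map_zero_eq_one, Circle.coe_one, one_mul]

theorem exists_isGaussConst (k : LocalKind F) (hψ : Continuous ψ) (hψ1 : ψ ≠ 1) (h2 : (2 : F) ≠ 0)
    {S : Matrix κ κ F} (hS : IsUnit S.det) (hs : S.IsSymm) : ∃ c, IsGaussConst ψ μ S c := by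
  obtain ⟨φ₂, hφ₂, hne⟩ := exists_gauss_test μ k hψ S
  refine ⟨(∫ x, fourier ψ μ φ₂ x * (ψ (quad S x) : ℂ) ∂vol[μ]) /
    ∫ y, φ₂ y * (ψ (-quad S⁻¹ y) : ℂ) ∂vol[μ], fun φ h1 h2' => ?_⟩
  have := gauss_symm μ hψ h2 hS hs h1 (schwartz_integrable μ hφ₂) h2'
    (integrable_fourier μ hψ hψ1 hφ₂)
  field_simp
  rw [mul_comm, this]
  ring

end Fourier

section WeilConst

variable {F : Type*} [NontriviallyNormedField F] [ProperSpace F] [MeasurableSpace F] [BorelSpace F]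
variable {k : LocalKind F} {ψ : AddChar F Circle} (μ : Measure F) [μ.IsAddHaarMeasure]
variable {κ : Type*} [Fintype κ] [DecidableEq κ]

theorem IsGaussConst.unique (k : LocalKind F) (hψ : Continuous ψ) (hψ1 : ψ ≠ 1)
    {S : Matrix κ κ F} {c c' : ℂ}
    (h : IsGaussConst ψ μ S c) (h' : IsGaussConst ψ μ S c') : c = c' := by
  obtain ⟨φ, hφ, hne⟩ := exists_gauss_test μ k hψ S
  have h1 := h φ (schwartz_integrable μ hφ) (integrable_fourier μ hψ hψ1 hφ)
  have h2 := h' φ (schwartz_integrable μ hφ) (integrable_fourier μ hψ hψ1 hφ)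
  exact mul_right_cancel₀ hne (h1.symm.trans h2)

omit [DecidableEq κ] in
theorem quad_congr (A S : Matrix κ κ F) (x : κ → F) : quad (Aᵀ * S * A) x = quad S (A *ᵥ x) := by
  unfold quad pairing
  rw [← mulVec_mulVec, ← mulVec_mulVec, dotProduct_mulVec x, vecMul_transpose]

theorem integrable_comp_mulVec_iff {E : Type*} [NormedAddCommGroup E] [NormedSpace ℝ E]
    {A : Matrix κ κ F} (hA : IsUnit A.det) {f : (κ → F) → E} :
    Integrable (fun x => f (A *ᵥ x)) vol[μ] ↔
      Integrable f vol[μ] := by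
  refine ⟨fun h => ?_, integrable_comp_mulVec μ A hA⟩
  have := integrable_comp_mulVec μ A⁻¹ (isUnit_nonsing_inv_det A hA) h
  simpa [mulVec_mulVec, mul_nonsing_inv A hA] using this

theorem fourier_comp_transpose {A : Matrix κ κ F} (hA : IsUnit A.det) (φ : (κ → F) → ℂ)
    (x : κ → F) : fourier ψ μ (fun y => φ (Aᵀ *ᵥ y)) (A *ᵥ x) =
      ((localAbs A.det)⁻¹ : ℝ) • fourier ψ μ φ x := by
  have hA' : IsUnit Aᵀ.det := by rwa [det_transpose]
  have := integral_comp_mulVec' μ hA' fun y => φ y * (ψ (x ⬝ᵥ y) : ℂ)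
  rw [det_transpose] at this
  rw [fourier, fourier, ← this]
  simp only [dotProduct_mulVec x, vecMul_transpose]

/-- Equivalent forms. -/
theorem IsGaussConst.congr {S A : Matrix κ κ F} (hA : IsUnit A.det) {c : ℂ}
    (h : IsGaussConst ψ μ S c) :
    IsGaussConst ψ μ (Aᵀ * S * A) (((localAbs A.det)⁻¹ : ℝ) * c) := by
  intro φ hφ hF
  have hpos := localAbs_pos hA.ne_zero
  have hA' : IsUnit Aᵀ.det := by rwa [det_transpose]
  have h1 : ∀ x, fourier ψ μ φ x * (ψ (quad (Aᵀ * S * A) x) : ℂ) = (localAbs A.det) •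
      (fourier ψ μ (fun y => φ (Aᵀ *ᵥ y)) (A *ᵥ x) * (ψ (quad S (A *ᵥ x)) : ℂ)) := by
    intro x
    rw [fourier_comp_transpose μ hA, quad_congr, smul_mul_assoc, smul_smul,
      mul_inv_cancel₀ hpos.ne', one_smul]
  have hinv : (Aᵀ * S * A)⁻¹ = A⁻¹ * S⁻¹ * (Aᵀ)⁻¹ := by
    rw [Matrix.mul_inv_rev, Matrix.mul_inv_rev, Matrix.mul_assoc]
  have h2 : ∀ y, quad S⁻¹ y = quad (Aᵀ * S * A)⁻¹ (Aᵀ *ᵥ y) := by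
    intro y
    rw [← quad_congr, hinv, transpose_transpose]
    congr 1
    rw [← Matrix.mul_assoc, ← Matrix.mul_assoc, mul_nonsing_inv _ hA, Matrix.one_mul,
      Matrix.mul_assoc, nonsing_inv_mul _ hA', Matrix.mul_one]
  have hF' : Integrable (fourier ψ μ fun y => φ (Aᵀ *ᵥ y)) vol[μ] := by
    rw [← integrable_comp_mulVec_iff μ hA]
    simp only [fourier_comp_transpose μ hA]
    exact hF.smul ((localAbs A.det)⁻¹ : ℝ)
  simp only [h1]
  rw [integral_smul, integral_comp_mulVec' μ hA
    fun z => fourier ψ μ (fun y => φ (Aᵀ *ᵥ y)) z * (ψ (quad S z) : ℂ), smul_smul,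
    mul_inv_cancel₀ hpos.ne', one_smul, h _ ((integrable_comp_mulVec_iff μ hA').2 hφ) hF']
  simp only [h2]
  rw [integral_comp_mulVec' μ hA' fun w => φ w * (ψ (-quad (Aᵀ * S * A)⁻¹ w) : ℂ), det_transpose,
    Complex.real_smul]
  ring

theorem inv_neg_matrix {S : Matrix κ κ F} (hS : IsUnit S.det) : (-S)⁻¹ = -S⁻¹ := by
  refine inv_eq_right_inv ?_
  rw [neg_mul_neg, mul_nonsing_inv _ hS]

omit [DecidableEq κ] in
theorem quad_neg (S : Matrix κ κ F) (x : κ → F) : quad (-S) x = -quad S x := by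
  simp only [quad, pairing, neg_mulVec, dotProduct_neg, neg_div]

theorem localAbs_det_neg (S : Matrix κ κ F) : localAbs (-S).det = localAbs S.det := by
  rw [det_neg, localAbs_mul, localAbs_pow, localAbs_neg, localAbs_one, one_pow, one_mul]

/-- Apply Fourier inversion to the Schwartz function `φ^ · ψ(xᵗ S x / 2)`, whose Fourier transform
is again a Gaussian transform. -/
theorem IsGaussConst.mul_neg (hψ : Continuous ψ) (hψ1 : ψ ≠ 1) (hμ : IsSelfDual k ψ μ)
    (h2 : (2 : F) ≠ 0) {S : Matrix κ κ F} (hS : IsUnit S.det) (hs : S.IsSymm) {c c' : ℂ}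
    (h : IsGaussConst ψ μ S c) (h' : IsGaussConst ψ μ (-S) c') :
    c * c' * localAbs S.det = 1 := by
  obtain ⟨g, hg, hg0, hg1⟩ := exists_bump k κ
  set φ : (κ → F) → ℂ := fun x => (g x : ℂ) with hφd
  have hφ : φ ∈ schwartz k κ := hg.mem_schwartz
  have hφi := schwartz_integrable μ hφ
  have hne : ∫ x, φ x ∂vol[μ] ≠ 0 := integral_bump_ne_zero μ hg hg0 hg1
  have hFS := (isSchwartzOp_fourier (k := k) μ hψ hψ1).mem hφ
  set θ : (κ → F) → ℂ := fun x => (ψ (quad S x) : ℂ) * fourier ψ μ φ x with hθ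
  have hθS : θ ∈ schwartz k κ := (isSchwartzOp_quad hψ S).mem hFS
  set η : (κ → F) → ℂ := fun x => (ψ (quad (-S⁻¹) x) : ℂ) * φ x with hη
  have hηS : η ∈ schwartz k κ := (isSchwartzOp_quad hψ (-S⁻¹)).mem hφ
  have hSsymm : (S⁻¹).IsSymm := by
    rw [Matrix.IsSymm, transpose_nonsing_inv, hs.eq]
  have hθF : ∀ z, fourier ψ μ θ z =
      c * ((ψ (-quad S⁻¹ z) : ℂ) * fourier ψ μ η ((-S⁻¹) *ᵥ z)) := by
    intro z
    have e1 : fourier ψ μ θ z = ∫ x, fourier ψ μ (fun y => φ (y + -z)) x * (ψ (quad S x) : ℂ)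
        ∂vol[μ] := by
      rw [fourier]
      refine integral_congr_forall fun x => ?_
      rw [fourier_comp_add, dotProduct_neg, neg_neg, hθ, dotProduct_comm z x]
      ring
    have hF' : Integrable (fourier ψ μ fun y => φ (y + -z)) vol[μ] := by
      rw [funext (fourier_comp_add μ φ (-z))]
      simp_rw [mul_comm _ (fourier ψ μ φ _)]
      exact integrable_mul_char hψ (integrable_fourier μ hψ hψ1 hφ)
        (continuous_id.dotProduct continuous_const).neg
    rw [e1, h _ (hφi.comp_add_right (-z)) hF']
    congr 1
    rw [← integral_add_right_eq_self _ z, fourier, ← integral_const_mul]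
    refine integral_congr_forall fun y => ?_
    rw [add_neg_cancel_right, hη]
    beta_reduce
    rw [quad_neg, mul_comm (φ y), mul_right_comm, ← mul_assoc, ← Circle.coe_mul, ← Circle.coe_mul,
      ← AddChar.map_add_eq_mul, ← AddChar.map_add_eq_mul]
    congr 4
    have e2 : (S⁻¹ *ᵥ z) ⬝ᵥ y = y ⬝ᵥ (S⁻¹ *ᵥ z) := dotProduct_comm _ _
    have e3 : z ⬝ᵥ (S⁻¹ *ᵥ y) = y ⬝ᵥ (S⁻¹ *ᵥ z) := by
      rw [dotProduct_mulVec, ← mulVec_transpose, hSsymm.eq, e2]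
    simp only [quad, pairing, mulVec_add, add_dotProduct, dotProduct_add, neg_mulVec,
      neg_dotProduct, e2, e3]
    field_simp
    ring
  -- inversion at the origin: the integral of the transform of `θ` is `θ 0 = ∫ φ`, and not zero
  have hinv := integral_fourier (k := k) μ hψ hψ1 hμ (schwartz_continuous hθS)
    (by
      obtain ⟨C, hC⟩ := schwartz_decay hθS 0
      exact ⟨C, fun x => by simpa using hC x⟩) (schwartz_integrable μ hθS)
    (integrable_fourier μ hψ hψ1 hθS)
  have hθ0 : θ 0 = ∫ x, φ x ∂vol[μ] := by
    rw [hθ]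
    simp [quad, pairing, fourier]
  have hnS : IsUnit (-S).det := by
    rw [det_neg]; exact ((isUnit_one.neg).pow _).mul hS
  have hint := integral_comp_mulVec' μ hnS fun z =>
    (ψ (-quad S⁻¹ z) : ℂ) * fourier ψ μ η ((-S⁻¹) *ᵥ z)
  have e4 : ∀ w, (-S⁻¹) *ᵥ ((-S) *ᵥ w) = w := by
    intro w
    rw [mulVec_mulVec, neg_mul_neg, nonsing_inv_mul _ hS, one_mulVec]
  have e5 : ∀ w, quad S⁻¹ ((-S) *ᵥ w) = quad S w := by
    intro w
    rw [← quad_congr, transpose_neg, hs.eq, Matrix.neg_mul, neg_mul_neg,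
      mul_nonsing_inv _ hS, Matrix.one_mul]
  have e6 := h' η (schwartz_integrable μ hηS) (integrable_fourier μ hψ hψ1 hηS)
  have e7 : ∀ y, η y * (ψ (-quad (-S)⁻¹ y) : ℂ) = φ y := by
    intro y
    rw [inv_neg_matrix hS, hη]
    beta_reduce
    rw [mul_right_comm, ← Circle.coe_mul, ← AddChar.map_add_eq_mul, add_neg_cancel,
      AddChar.map_zero_eq_one, Circle.coe_one, one_mul]
  simp only [e4, e5] at hint
  simp only [e7, quad_neg, mul_comm (fourier ψ μ η _)] at e6
  rw [e6, localAbs_det_neg, Complex.real_smul] at hint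
  have hpos : (localAbs S.det : ℂ) ≠ 0 := by exact_mod_cast (localAbs_pos hS.ne_zero).ne'
  simp only [hθF] at hinv
  rw [integral_const_mul, hθ0] at hinv
  push_cast at hint
  rw [eq_inv_mul_iff_mul_eq₀ hpos] at hint
  rw [← hint] at hinv
  refine mul_right_cancel₀ hne ?_
  rw [one_mul]
  refine Eq.trans ?_ hinv
  ring

variable (ψ)

/-- The Weil index of the form `xᵗ S x / 2`, as the normalized constant of the Gaussian integral. -/
def weilConst (S : Matrix κ κ F) : ℂ :=
  Classical.epsilon (IsGaussConst ψ μ S) * (Real.sqrt (localAbs S.det) : ℝ)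

variable {ψ}

theorem isGaussConst_weilConst (k : LocalKind F) (hψ : Continuous ψ) (hψ1 : ψ ≠ 1)
    (h2 : (2 : F) ≠ 0) {S : Matrix κ κ F} (hS : IsUnit S.det) (hs : S.IsSymm) :
    IsGaussConst ψ μ S (weilConst ψ μ S * ((Real.sqrt (localAbs S.det))⁻¹ : ℝ)) := by
  have hpos : (Real.sqrt (localAbs S.det) : ℂ) ≠ 0 := by
    exact_mod_cast (Real.sqrt_pos.2 (localAbs_pos hS.ne_zero)).ne'
  rw [weilConst, mul_assoc, Complex.ofReal_inv, mul_inv_cancel₀ hpos, mul_one]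
  exact Classical.epsilon_spec (exists_isGaussConst μ k hψ hψ1 h2 hS hs)

theorem weilConst_eq (k : LocalKind F) (hψ : Continuous ψ) (hψ1 : ψ ≠ 1)
    (h2 : (2 : F) ≠ 0) {S : Matrix κ κ F} (hS : IsUnit S.det) (hs : S.IsSymm) {c : ℂ}
    (h : IsGaussConst ψ μ S c) : weilConst ψ μ S = c * (Real.sqrt (localAbs S.det) : ℝ) := by
  rw [h.unique μ k hψ hψ1 (isGaussConst_weilConst μ k hψ hψ1 h2 hS hs)]
  have hpos : (Real.sqrt (localAbs S.det) : ℂ) ≠ 0 := by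
    exact_mod_cast (Real.sqrt_pos.2 (localAbs_pos hS.ne_zero)).ne'
  rw [mul_assoc, Complex.ofReal_inv, inv_mul_cancel₀ hpos, mul_one]

theorem weilConst_congr (k : LocalKind F) (hψ : Continuous ψ) (hψ1 : ψ ≠ 1) (h2 : (2 : F) ≠ 0)
    {S A : Matrix κ κ F} (hS : IsUnit S.det) (hs : S.IsSymm) (hA : IsUnit A.det) :
    weilConst ψ μ (Aᵀ * S * A) = weilConst ψ μ S := by
  have hS' : IsUnit (Aᵀ * S * A).det := by
    rw [det_mul, det_mul, det_transpose]; exact (hA.mul hS).mul hA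
  have hs' : (Aᵀ * S * A).IsSymm := by
    rw [Matrix.IsSymm, transpose_mul, transpose_mul, transpose_transpose, hs.eq, Matrix.mul_assoc]
  rw [weilConst_eq μ k hψ hψ1 h2 hS' hs'
    ((isGaussConst_weilConst μ k hψ hψ1 h2 hS hs).congr μ hA)]
  have hA0 := localAbs_pos hA.ne_zero
  have hS0 := localAbs_pos hS.ne_zero
  have e : Real.sqrt (localAbs (Aᵀ * S * A).det) =
      localAbs A.det * Real.sqrt (localAbs S.det) := by
    rw [det_mul, det_mul, det_transpose, localAbs_mul, localAbs_mul,
      show localAbs A.det * localAbs S.det * localAbs A.det =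
        localAbs A.det ^ 2 * localAbs S.det by ring, Real.sqrt_mul (by positivity),
      Real.sqrt_sq hA0.le]
  rw [e]
  have h1 : (localAbs A.det : ℂ) ≠ 0 := by exact_mod_cast hA0.ne'
  have h3 : (Real.sqrt (localAbs S.det) : ℂ) ≠ 0 := by exact_mod_cast (Real.sqrt_pos.2 hS0).ne'
  push_cast
  field_simp

theorem weilConst_mul_neg (hψ : Continuous ψ) (hψ1 : ψ ≠ 1) (hμ : IsSelfDual k ψ μ)
    (h2 : (2 : F) ≠ 0) {S : Matrix κ κ F} (hS : IsUnit S.det) (hs : S.IsSymm) :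
    weilConst ψ μ S * weilConst ψ μ (-S) = 1 := by
  have hnS : IsUnit (-S).det := by
    rw [det_neg]; exact ((isUnit_one.neg).pow _).mul hS
  have := (isGaussConst_weilConst μ k hψ hψ1 h2 hS hs).mul_neg μ hψ hψ1 hμ h2 hS hs
    (isGaussConst_weilConst μ k hψ hψ1 h2 hnS hs.neg)
  rw [localAbs_det_neg] at this
  have hS0 := localAbs_pos hS.ne_zero
  have h3 : (Real.sqrt (localAbs S.det) : ℂ) ≠ 0 := by exact_mod_cast (Real.sqrt_pos.2 hS0).ne'
  have h4 : ((localAbs S.det : ℝ) : ℂ) =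
      (Real.sqrt (localAbs S.det) : ℂ) * (Real.sqrt (localAbs S.det) : ℂ) := by
    rw [← Complex.ofReal_mul, Real.mul_self_sqrt hS0.le]
  rw [h4] at this
  push_cast at this
  field_simp at this
  exact this

variable (ψ)

/-- The Weil index of the form `a x² / 2` in one variable. -/
def weilConst₁ (a : F) : ℂ := weilConst ψ μ (diagonal fun _ : Unit => a)

variable {ψ}

omit [DecidableEq κ] in
theorem quad_diagonal [DecidableEq κ] (d : κ → F) (x : κ → F) :
    quad (diagonal d) x = ∑ i, d i * x i ^ 2 / 2 := by
  rw [quad, pairing, dotProduct, Finset.sum_div]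
  refine Finset.sum_congr rfl fun i _ => ?_
  rw [mulVec_diagonal]; ring

theorem diagonal_inv_of_ne_zero {ι : Type*} [Fintype ι] [DecidableEq ι] {d : ι → F}
    (hd : ∀ i, d i ≠ 0) : (diagonal d)⁻¹ = diagonal fun i => (d i)⁻¹ := by
  refine inv_eq_right_inv ?_
  rw [diagonal_mul_diagonal]
  simp [hd]

/-- The Weil index of an orthogonal sum of lines: evaluate both sides on a product of functions of
one variable. -/
theorem weilConst_diagonal (k : LocalKind F) (hψ : Continuous ψ) (hψ1 : ψ ≠ 1)
    (h2 : (2 : F) ≠ 0) {d : κ → F} (hd : ∀ i, d i ≠ 0) :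
    weilConst ψ μ (diagonal d) = ∏ i, weilConst₁ ψ μ (d i) := by
  have hu1 : ∀ i, IsUnit (diagonal fun _ : Unit => d i).det := fun i => by simp [hd i]
  have hu : IsUnit (diagonal d).det := by
    rw [det_diagonal]; exact IsUnit.mk0 _ (Finset.prod_ne_zero_iff.2 fun i _ => hd i)
  choose φ hφ hne using fun i => exists_gauss_test μ k hψ (diagonal fun _ : Unit => d i)
  have hφu : ∀ i, (fun v : Unit → F => φ i fun _ => v ()) = φ i := fun i => rfl
  let f : κ → F → ℂ := fun i x => φ i fun _ => x
  let f' : κ → F → ℂ := fun i x => ∫ z, f i z * (ψ (x * z) : ℂ) ∂μ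
  have hff : ∀ i, fourier ψ μ (φ i) = fun v : Unit → F => f' i (v ()) := fun i => by
    ext v; exact fourier_unit μ (f i) v
  have hfi : ∀ i, Integrable (f i) μ := fun i => by
    rw [← integrable_unit_iff μ]; exact schwartz_integrable μ (hφ i)
  have hfi' : ∀ i, Integrable (f' i) μ := fun i => by
    rw [← integrable_unit_iff μ, ← hff i]; exact integrable_fourier μ hψ hψ1 (hφ i)
  have hG := isGaussConst_weilConst μ k hψ hψ1 h2 hu (isSymm_diagonal d)
    (fun y => ∏ i, f i (y i)) (Integrable.fintype_prod hfi) (by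
      rw [funext (fourier_prod μ f)]; exact Integrable.fintype_prod hfi')
  have hG1 : ∀ i, ∫ x, f' i x * (ψ (d i * x ^ 2 / 2) : ℂ) ∂μ =
      weilConst₁ ψ μ (d i) * ((Real.sqrt (localAbs (d i)))⁻¹ : ℝ) *
        ∫ x, f i x * (ψ (-((d i)⁻¹ * x ^ 2 / 2)) : ℂ) ∂μ := by
    intro i
    have := isGaussConst_weilConst μ k hψ hψ1 h2 (hu1 i) (isSymm_diagonal _) (φ i)
      (schwartz_integrable μ (hφ i)) (integrable_fourier μ hψ hψ1 (hφ i))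
    rw [hff] at this
    simp only [diagonal_inv_of_ne_zero fun _ => hd i, quad_diagonal] at this
    rw [← integral_unit μ, ← integral_unit μ]
    simpa [weilConst₁] using this
  have hne1 : ∀ i, ∫ x, f i x * (ψ (-((d i)⁻¹ * x ^ 2 / 2)) : ℂ) ∂μ ≠ 0 := by
    intro i
    have := hne i
    simp only [diagonal_inv_of_ne_zero fun _ => hd i, quad_diagonal] at this
    rw [← integral_unit μ]
    simpa using this
  have hprod : ∀ (g : κ → F → ℂ) (e : κ → F), ∫ x, (∏ i, g i (x i)) *
      (ψ (∑ i, e i * x i ^ 2 / 2) : ℂ) ∂vol[μ] =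
      ∏ i, ∫ x, g i x * (ψ (e i * x ^ 2 / 2) : ℂ) ∂μ := by
    intro g e
    rw [← integral_fintype_prod_eq_prod (f := fun i x => g i x * (ψ (e i * x ^ 2 / 2) : ℂ))]
    refine integral_congr_forall fun x => ?_
    rw [addChar_map_sum, Finset.prod_mul_distrib]
    congr 1
    exact map_prod Circle.coeHom _ _
  have hl : ∫ x, fourier ψ μ (fun y => ∏ i, f i (y i)) x * (ψ (quad (diagonal d) x) : ℂ)
      ∂vol[μ] = ∏ i, ∫ x, f' i x * (ψ (d i * x ^ 2 / 2) : ℂ) ∂μ := by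
    rw [← hprod]
    simp only [fourier_prod, quad_diagonal]
    rfl
  have hr : ∫ y, (∏ i, f i (y i)) * (ψ (-quad (diagonal d)⁻¹ y) : ℂ) ∂vol[μ] =
      ∏ i, ∫ x, f i x * (ψ (-((d i)⁻¹ * x ^ 2 / 2)) : ℂ) ∂μ := by
    have := hprod f fun i => -(d i)⁻¹
    simp only [neg_mul, neg_div, Finset.sum_neg_distrib] at this
    rw [← this]
    rw [diagonal_inv_of_ne_zero hd]
    simp only [quad_diagonal]
  rw [hl, hr] at hG
  simp only [hG1, Finset.prod_mul_distrib] at hG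
  have hP : (∏ i, ∫ x, f i x * (ψ (-((d i)⁻¹ * x ^ 2 / 2)) : ℂ) ∂μ) ≠ 0 :=
    Finset.prod_ne_zero_iff.2 fun i _ => hne1 i
  have hdet : Real.sqrt (localAbs (diagonal d).det) = ∏ i, Real.sqrt (localAbs (d i)) := by
    rw [det_diagonal]
    have : ∀ s : Finset κ, Real.sqrt (localAbs (∏ i ∈ s, d i)) =
        ∏ i ∈ s, Real.sqrt (localAbs (d i)) := by
      intro s
      induction s using Finset.induction_on with
      | empty => simp
      | insert i s hi ih =>
        rw [Finset.prod_insert hi, Finset.prod_insert hi, localAbs_mul,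
          Real.sqrt_mul (localAbs_nonneg _), ih]
    exact this _
  have h0 : (∏ i, (((Real.sqrt (localAbs (d i)))⁻¹ : ℝ) : ℂ)) ≠ 0 := by
    refine Finset.prod_ne_zero_iff.2 fun i _ => ?_
    exact_mod_cast inv_ne_zero (Real.sqrt_pos.2 (localAbs_pos (hd i))).ne'
  have := mul_right_cancel₀ hP hG
  rw [hdet, ← Finset.prod_inv_distrib] at this
  push_cast at this h0
  exact (mul_right_cancel₀ h0 this).symm

end WeilConst

/-! ### Values of binary forms `x² - d y²` and the Hilbert symbol -/

section NormForm

variable {F : Type*} [Field F]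

/-- `a` is a value of the form `x² - d y²`. -/
def IsNormValue (d a : F) : Prop := ∃ x y : F, a = x ^ 2 - d * y ^ 2

theorem isNormValue_sq (d s : F) : IsNormValue d (s ^ 2) := ⟨s, 0, by ring⟩

theorem isNormValue_neg_self (d : F) : IsNormValue d (-d) := ⟨0, 1, by ring⟩

theorem IsNormValue.mul {d a b : F} (ha : IsNormValue d a) (hb : IsNormValue d b) :
    IsNormValue d (a * b) := by
  obtain ⟨x, y, rfl⟩ := ha
  obtain ⟨z, w, rfl⟩ := hb
  exact ⟨x * z + d * y * w, x * w + y * z, by ring⟩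

theorem IsNormValue.of_mul {d a b : F} (ha0 : a ≠ 0) (ha : IsNormValue d a)
    (hab : IsNormValue d (a * b)) : IsNormValue d b := by
  have := (ha.mul hab).mul (isNormValue_sq d a⁻¹)
  convert this using 1
  field_simp

theorem isNormValue_mul_sq_iff {d s a : F} (hs : s ≠ 0) :
    IsNormValue (d * s ^ 2) a ↔ IsNormValue d a := by
  constructor
  · rintro ⟨x, y, rfl⟩
    exact ⟨x, s * y, by ring⟩
  · rintro ⟨x, y, rfl⟩
    exact ⟨x, y / s, by field_simp⟩

/-- The form `x² - d y²` is universal if `d` is a square. -/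
theorem isNormValue_of_sq (h2 : (2 : F) ≠ 0) {t : F} (ht : t ≠ 0) (a : F) :
    IsNormValue (t ^ 2) a :=
  ⟨(a + 1) / 2, (a - 1) / (2 * t), by field_simp; ring⟩

theorem isNormValue_iff (h2 : (2 : F) ≠ 0) {a b : F} (hb0 : b ≠ 0) :
    IsNormValue b a ↔
      ∃ x y z : F, (x ≠ 0 ∨ y ≠ 0 ∨ z ≠ 0) ∧ z ^ 2 = a * x ^ 2 + b * y ^ 2 := by
  constructor
  · rintro ⟨x, y, h⟩
    exact ⟨1, y, x, Or.inl one_ne_zero, by rw [h]; ring⟩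
  · rintro ⟨x, y, z, h0, h⟩
    by_cases hx : x = 0
    · subst hx
      have hy : y ≠ 0 := by
        rintro rfl
        simp at h0 h
        exact h0 h
      have hb : b = (z / y) ^ 2 := by field_simp; linear_combination -h
      have hz : z ≠ 0 := by
        rintro rfl
        exact hb0 (by rw [hb]; simp)
      rw [hb]
      exact isNormValue_of_sq h2 (div_ne_zero hz hy) a
    · exact ⟨z / x, y / x, by field_simp; linear_combination -h⟩

/-- The values of `x² - d y²` have index at most `2` in the multiplicative group. -/
def NormIndexLeTwo (d : F) : Prop := ∀ b b' : F, b ≠ 0 → b' ≠ 0 → ¬ IsNormValue d b →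
  ¬ IsNormValue d b' → IsNormValue d (b * b')

end NormForm

section Arch

variable {F : Type*} [NontriviallyNormedField F]

theorem isNormValue_index_of_arch [NormedAlgebra ℝ F] {d b b' : F}
    (hb : ¬ IsNormValue d b) (hb' : ¬ IsNormValue d b') : IsNormValue d (b * b') := by
  have key : ∀ x : F, (∃ s, x = s ^ 2) → IsNormValue d x := by
    rintro _ ⟨s, rfl⟩; exact isNormValue_sq d s
  rcases NormedAlgebra.Real.nonempty_algEquiv_or F with ⟨⟨e⟩⟩ | ⟨⟨e⟩⟩
  · have hneg : ∀ x : F, ¬ IsNormValue d x → e x < 0 := by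
      intro x hx
      by_contra! h
      refine hx (key x ⟨e.symm (Real.sqrt (e x)), ?_⟩)
      apply e.injective
      rw [map_pow, AlgEquiv.apply_symm_apply, Real.sq_sqrt h]
    refine key _ ⟨e.symm (Real.sqrt (e (b * b'))), ?_⟩
    apply e.injective
    rw [map_pow, AlgEquiv.apply_symm_apply, Real.sq_sqrt]
    rw [map_mul]
    exact (mul_pos_of_neg_of_neg (hneg b hb) (hneg b' hb')).le
  · obtain ⟨s, hs⟩ := IsAlgClosed.exists_pow_nat_eq (e b) (n := 2) two_pos
    refine absurd (key b ⟨e.symm s, ?_⟩) hb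
    apply e.injective
    rw [map_pow, AlgEquiv.apply_symm_apply, hs]

end Arch

section Nonarch

variable {F : Type*} [NontriviallyNormedField F] [ProperSpace F] [hF : IsUltrametricDist F]

theorem ultrametric_norm_sub_le (x y : F) : ‖x - y‖ ≤ max ‖x‖ ‖y‖ := by
  have := IsUltrametricDist.norm_add_le_max x (-y)
  rwa [norm_neg, ← sub_eq_add_neg] at this

/-- A field element generating the maximal ideal. -/
def IsUniformizer (p : F) : Prop := 0 < ‖p‖ ∧ ‖p‖ < 1 ∧ ∀ x : F, ‖x‖ < 1 → ‖x‖ ≤ ‖p‖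

theorem exists_isUniformizer (F : Type*) [NontriviallyNormedField F] [ProperSpace F]
    [IsUltrametricDist F] : ∃ p : F, IsUniformizer p := by
  obtain ⟨ε, hε0, hε1⟩ := NormedField.exists_norm_lt_one F
  have hc : IsCompact (Metric.ball (0 : F) 1) :=
    (isCompact_closedBall (0 : F) 1).of_isClosed_subset
      (IsUltrametricDist.isClopen_ball _ _).1 Metric.ball_subset_closedBall
  obtain ⟨p, hp, hmax⟩ := hc.exists_isMaxOn ⟨ε, by simpa using hε1⟩ continuous_norm.continuousOn
  have h : ∀ x : F, ‖x‖ < 1 → ‖x‖ ≤ ‖p‖ := fun x hx => hmax (by simpa using hx)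
  exact ⟨p, hε0.trans_le (h ε hε1), by simpa using hp, h⟩

theorem IsUniformizer.ne_zero {p : F} (hp : IsUniformizer p) : p ≠ 0 := norm_pos_iff.1 hp.1

theorem IsUniformizer.exists_zpow {p : F} (hp : IsUniformizer p) {x : F} (hx : x ≠ 0) :
    ∃ n : ℤ, ‖x‖ = ‖p‖ ^ n := by
  obtain ⟨n, h1, h2⟩ := exists_mem_Ico_zpow (norm_pos_iff.2 hx)
    ((one_lt_inv₀ hp.1).2 hp.2.1)
  have hpn : 0 < ‖p‖ ^ n := zpow_pos hp.1 n
  rw [_root_.inv_zpow', _root_.zpow_neg] at h1 h2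
  refine ⟨-n, ?_⟩
  rw [_root_.zpow_neg]
  refine le_antisymm ?_ h1
  by_contra! hlt
  -- then `‖x p^(n+1)‖` lies strictly between `‖p‖` and `1`
  have hb : ‖x * p ^ (n + 1)‖ < 1 := by
    rw [norm_mul, norm_zpow]
    have hpn1 : 0 < ‖p‖ ^ (n + 1) := zpow_pos hp.1 _
    calc ‖x‖ * ‖p‖ ^ (n + 1) < (‖p‖ ^ (n + 1))⁻¹ * ‖p‖ ^ (n + 1) :=
          mul_lt_mul_of_pos_right h2 hpn1
      _ = 1 := inv_mul_cancel₀ hpn1.ne'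
  have := hp.2.2 _ hb
  rw [norm_mul, norm_zpow, zpow_add₀ hp.1.ne', zpow_one, ← mul_assoc] at this
  have h3 : ‖x‖ * ‖p‖ ^ n ≤ 1 := le_of_mul_le_mul_right (by linarith) hp.1
  rw [inv_lt_iff_one_lt_mul₀ hpn, mul_comm] at hlt
  linarith

/-- Elements of norm less than `‖p‖ ^ n` have norm at most `‖p‖ ^ (n + 1)`. -/
theorem IsUniformizer.le_of_lt {p : F} (hp : IsUniformizer p) {n : ℕ} {x : F}
    (hx : ‖x‖ < ‖p‖ ^ n) : ‖x‖ ≤ ‖p‖ ^ (n + 1) := by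
  have hpn : 0 < ‖p‖ ^ n := pow_pos hp.1 n
  have := hp.2.2 (x / p ^ n) (by rwa [norm_div, norm_pow, div_lt_one hpn])
  rw [norm_div, norm_pow, div_le_iff₀ hpn] at this
  rwa [pow_succ, mul_comm]

/-- A quadratic Hensel lemma, by contraction. -/
theorem exists_quadratic_fixed {c e : F} (hc : ‖c‖ < 1) (he : ‖e‖ ≤ 1) :
    ∃ y : F, ‖y‖ ≤ ‖c‖ ∧ y = c + e * y ^ 2 := by
  have hmaps : Set.MapsTo (fun y => c + e * y ^ 2) (Metric.closedBall (0 : F) ‖c‖)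
      (Metric.closedBall (0 : F) ‖c‖) := by
    intro y hy
    rw [mem_closedBall_zero_iff] at hy ⊢
    refine (IsUltrametricDist.norm_add_le_max _ _).trans (max_le le_rfl ?_)
    rw [norm_mul, norm_pow]
    have := norm_nonneg y
    nlinarith [mul_le_mul he hy (norm_nonneg y) zero_le_one, norm_nonneg e]
  obtain ⟨y, hy, hfix, -⟩ := ContractingWith.exists_fixedPoint'
    (K := ⟨‖c‖, norm_nonneg c⟩) (f := fun y => c + e * y ^ 2)
    (Metric.isClosed_closedBall (x := (0 : F)) (ε := ‖c‖)).isComplete hmaps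
    ⟨by exact_mod_cast hc, LipschitzWith.of_dist_le_mul fun x y => by
      have hx := x.2
      have hy := y.2
      rw [mem_closedBall_zero_iff] at hx hy
      rw [Subtype.dist_eq, Subtype.dist_eq, dist_eq_norm, dist_eq_norm]
      change ‖c + e * (x : F) ^ 2 - (c + e * (y : F) ^ 2)‖ ≤ ‖c‖ * ‖(x : F) - y‖
      rw [show c + e * (x : F) ^ 2 - (c + e * (y : F) ^ 2) =
        e * ((x : F) + y) * ((x : F) - y) by ring, norm_mul, norm_mul]
      have h1 : ‖(x : F) + y‖ ≤ ‖c‖ :=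
        (IsUltrametricDist.norm_add_le_max _ _).trans (max_le hx hy)
      have h2 : ‖e‖ * ‖(x : F) + y‖ ≤ ‖c‖ := by
        nlinarith [norm_nonneg e, norm_nonneg ((x : F) + y)]
      exact mul_le_mul_of_nonneg_right h2 (norm_nonneg _)⟩
    (x := 0) (by simp) (edist_ne_top _ _)
  exact ⟨y, by simpa using hy, hfix.symm⟩

/-- The criterion for `1 + 4 a` to be a square. -/
theorem one_add_four_mul_isSq {a x : F} (h1 : ‖1 + 2 * x‖ = 1) (hx : ‖x ^ 2 + x - a‖ < 1) :
    ∃ s, 1 + 4 * a = s ^ 2 := by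
  have h0 : 1 + 2 * x ≠ 0 := by
    intro h; rw [h, norm_zero] at h1; exact zero_ne_one h1
  obtain ⟨y, -, hy⟩ := exists_quadratic_fixed (c := (a - x ^ 2 - x) / (1 + 2 * x))
    (e := -1 / (1 + 2 * x))
    (by rw [norm_div, h1, div_one, show a - x ^ 2 - x = -(x ^ 2 + x - a) by ring, norm_neg]; exact hx)
    (by rw [norm_div, h1, div_one, norm_neg, norm_one])
  refine ⟨1 + 2 * (x + y), ?_⟩
  have hy' : (1 + 2 * x) * y = a - x ^ 2 - x - y ^ 2 := by
    have h3 := congrArg (fun t => (1 + 2 * x) * t) hy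
    beta_reduce at h3
    rw [h3]; field_simp; ring
  linear_combination (-4) * hy'

theorem norm_add_eq_one {u x : F} (hu : ‖u‖ = 1) (hx : ‖x‖ < 1) : ‖u + x‖ = 1 := by
  rw [IsUltrametricDist.norm_add_eq_max_of_norm_ne_norm (by rw [hu]; exact hx.ne'), hu,
    max_eq_left hx.le]

/-- The residue field, as a finite field with a reduction map on the elements of norm at
most `1`. -/
theorem exists_residue.{u} (F : Type u) [NontriviallyNormedField F] [ProperSpace F]
    [IsUltrametricDist F] : ∃ (R : Type u) (_ : Field R) (_ : Finite R) (r : F → R),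
    (∀ x y, ‖x‖ ≤ 1 → ‖y‖ ≤ 1 → r (x + y) = r x + r y) ∧
    (∀ x y, ‖x‖ ≤ 1 → ‖y‖ ≤ 1 → r (x * y) = r x * r y) ∧
    (∀ x, ‖x‖ ≤ 1 → (r x = 0 ↔ ‖x‖ < 1)) ∧ r 1 = 1 ∧ ∀ t, ∃ x, ‖x‖ ≤ 1 ∧ r x = t := by
  classical
  let O := (NormedField.valuation (K := F)).valuationSubring
  have hO : ∀ x : F, x ∈ O ↔ ‖x‖ ≤ 1 := fun x => by
    rw [Valuation.mem_valuationSubring_iff, NormedField.valuation_apply, ← NNReal.coe_le_coe]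
    simp
  let r : F → IsLocalRing.ResidueField O := fun x =>
    if hx : x ∈ O then IsLocalRing.residue O ⟨x, hx⟩ else 0
  have hr : ∀ x (hx : x ∈ O), r x = IsLocalRing.residue O ⟨x, hx⟩ := fun x hx => dif_pos hx
  have hadd : ∀ x y, ‖x‖ ≤ 1 → ‖y‖ ≤ 1 → r (x + y) = r x + r y := by
    intro x y hx hy
    rw [hr x ((hO x).2 hx), hr y ((hO y).2 hy), hr _ (O.add_mem _ _ ((hO x).2 hx) ((hO y).2 hy)),
      ← map_add]
    rfl
  have hzero : ∀ x, ‖x‖ ≤ 1 → (r x = 0 ↔ ‖x‖ < 1) := by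
    intro x hx
    rw [hr x ((hO x).2 hx), IsLocalRing.residue_eq_zero_iff, IsLocalRing.mem_maximalIdeal,
      mem_nonunits_iff]
    constructor
    · intro h
      refine lt_of_le_of_ne hx fun h1 => h ?_
      have hx0 : x ≠ 0 := by rintro rfl; simp at h1
      refine IsUnit.of_mul_eq_one (⟨x⁻¹, (hO _).2 (by rw [norm_inv, h1, inv_one])⟩ : O) ?_
      ext
      simp [hx0]
    · intro h hu
      obtain ⟨y, hy⟩ := hu.exists_right_inv
      have h1 : x * (y : F) = 1 := congrArg Subtype.val hy
      have h2 : ‖x‖ * ‖(y : F)‖ = 1 := by rw [← norm_mul, h1, norm_one]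
      have h3 := (hO _).1 y.2
      nlinarith [norm_nonneg x, norm_nonneg (y : F)]
  have hsurj : ∀ t, ∃ x, ‖x‖ ≤ 1 ∧ r x = t := by
    intro t
    obtain ⟨⟨x, hx⟩, rfl⟩ := IsLocalRing.residue_surjective t
    exact ⟨x, (hO x).1 hx, hr x hx⟩
  have hneg : ∀ x, ‖x‖ ≤ 1 → r (-x) = -r x := by
    intro x hx
    rw [hr x ((hO x).2 hx), hr _ (O.neg_mem _ ((hO x).2 hx)), ← map_neg]
    rfl
  have hfin : Finite (IsLocalRing.ResidueField O) := by
    obtain ⟨t, ht, htf, hcov⟩ := (isCompact_closedBall (0 : F) 1).finite_cover_balls one_pos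
    refine Set.finite_univ_iff.1 ((htf.image r).subset fun a _ => ?_)
    obtain ⟨x, hx, rfl⟩ := hsurj a
    obtain ⟨y, hy, hxy⟩ := Set.mem_iUnion₂.1 (hcov (by simpa using hx : x ∈ Metric.closedBall 0 1))
    have hy1 : ‖y‖ ≤ 1 := by simpa using ht hy
    refine ⟨y, hy, ?_⟩
    have hsub : ‖x + -y‖ < 1 := by simpa [dist_eq_norm, sub_eq_add_neg] using hxy
    have := (hzero _ hsub.le).2 hsub
    rw [hadd x (-y) hx (by rwa [norm_neg]), hneg y hy1, ← sub_eq_add_neg, sub_eq_zero] at this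
    exact this.symm
  refine ⟨IsLocalRing.ResidueField O, inferInstance, hfin, r, hadd, ?_, hzero, ?_, hsurj⟩
  · intro x y hx hy
    rw [hr x ((hO x).2 hx), hr y ((hO y).2 hy), hr _ (O.mul_mem _ _ ((hO x).2 hx) ((hO y).2 hy)),
      ← map_mul]
    rfl
  · rw [hr 1 O.one_mem, ← map_one (IsLocalRing.residue O)]
    rfl

theorem residue_sub_iff {R : Type*} [Field R] {r : F → R}
    (hadd : ∀ x y, ‖x‖ ≤ 1 → ‖y‖ ≤ 1 → r (x + y) = r x + r y)
    (hzero : ∀ x, ‖x‖ ≤ 1 → (r x = 0 ↔ ‖x‖ < 1)) {x y : F} (hx : ‖x‖ ≤ 1) (hy : ‖y‖ ≤ 1) :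
    ‖x - y‖ < 1 ↔ r x = r y := by
  have h1 : ‖x - y‖ ≤ 1 := (ultrametric_norm_sub_le x y).trans (max_le hx hy)
  rw [← hzero _ h1]
  have := hadd (x - y) y h1 hy
  rw [sub_add_cancel] at this
  rw [this]
  simp

theorem norm_sq_le_one {x : F} (hx : ‖x‖ ≤ 1) : ‖x ^ 2‖ ≤ 1 := by
  rw [norm_pow]; exact pow_le_one₀ (norm_nonneg _) hx

theorem exists_sq_near (h2 : ‖(2 : F)‖ < 1) {u : F} (hu : ‖u‖ ≤ 1) :
    ∃ x, ‖x‖ ≤ 1 ∧ ‖u - x ^ 2‖ < 1 := by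
  obtain ⟨R, _, _, r, hadd, hmul, hzero, hone, hsurj⟩ := exists_residue F
  have h20 : (2 : R) = 0 := by
    rw [← one_add_one_eq_two, ← hone, ← hadd 1 1 (by simp) (by simp), one_add_one_eq_two]
    exact (hzero _ h2.le).2 h2
  have : CharP R 2 := CharTwo.of_one_ne_zero_of_two_eq_zero one_ne_zero h20
  have := Fintype.ofFinite R
  obtain ⟨t, ht⟩ := FiniteField.isSquare_of_char_two (ringChar.eq R 2) (r u)
  obtain ⟨x, hx, rfl⟩ := hsurj t
  refine ⟨x, hx, (residue_sub_iff hadd hzero hu (norm_sq_le_one hx)).2 ?_⟩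
  rw [ht, sq, hmul x x hx hx]

/-- The image of `x ↦ x² + x` on a finite field of characteristic `2` has index `2`. -/
theorem exists_artinSchreier_near (h2 : ‖(2 : F)‖ < 1) {a b : F} (ha : ‖a‖ ≤ 1) (hb : ‖b‖ ≤ 1)
    (hna : ∀ x, ‖x‖ ≤ 1 → ¬ ‖x ^ 2 + x - a‖ < 1) (hnb : ∀ x, ‖x‖ ≤ 1 → ¬ ‖x ^ 2 + x - b‖ < 1) :
    ∃ x, ‖x‖ ≤ 1 ∧ ‖x ^ 2 + x - (a + b)‖ < 1 := by
  obtain ⟨R, _, _, r, hadd, hmul, hzero, hone, hsurj⟩ := exists_residue F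
  have h20 : (2 : R) = 0 := by
    rw [← one_add_one_eq_two, ← hone, ← hadd 1 1 (by simp) (by simp), one_add_one_eq_two]
    exact (hzero _ h2.le).2 h2
  let P : R →+ R :=
    { toFun := fun z => z ^ 2 + z
      map_zero' := by simp
      map_add' := fun z w => by linear_combination (z * w) * h20 }
  have hker : Nat.card P.ker = 2 := by
    have hset : (P.ker : Set R) = {0, 1} := by
      ext z
      have : z ^ 2 + z = 0 ↔ z = 0 ∨ z = 1 := by
        rw [show z ^ 2 + z = z * (z - 1) by linear_combination z * h20, mul_eq_zero, sub_eq_zero]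
      simpa [P, AddMonoidHom.mem_ker] using this
    change Nat.card (P.ker : Set R) = 2
    rw [hset, Nat.card_coe_set_eq, Set.ncard_pair zero_ne_one]
  have hidx : P.range.index = 2 := by
    have h1 := P.range.card_mul_index
    have h3 := P.ker.card_mul_index
    rw [AddSubgroup.index_ker] at h3
    have hpos : 0 < Nat.card P.range := by
      have : Nonempty P.range := ⟨0⟩
      have : Finite P.range := Subtype.finite
      exact Nat.card_pos
    rw [hker] at h3
    have : Nat.card P.range * P.range.index = Nat.card P.range * 2 := by rw [h1, ← h3, mul_comm]
    exact Nat.eq_of_mul_eq_mul_left hpos this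
  have hle : ∀ x : F, ‖x‖ ≤ 1 → ‖x ^ 2 + x‖ ≤ 1 := fun x hx =>
    (IsUltrametricDist.norm_add_le_max _ _).trans (max_le (norm_sq_le_one hx) hx)
  have hPr : ∀ x : F, ‖x‖ ≤ 1 → r (x ^ 2 + x) = P (r x) := fun x hx => by
    rw [hadd _ _ (norm_sq_le_one hx) hx, sq, hmul x x hx hx, ← sq]; rfl
  have hmem : ∀ c : F, ‖c‖ ≤ 1 → (r c ∈ P.range ↔ ∃ x, ‖x‖ ≤ 1 ∧ ‖x ^ 2 + x - c‖ < 1) := by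
    intro c hc
    constructor
    · rintro ⟨z, hz⟩
      obtain ⟨x, hx, rfl⟩ := hsurj z
      exact ⟨x, hx, (residue_sub_iff hadd hzero (hle x hx) hc).2 ((hPr x hx).trans hz)⟩
    · rintro ⟨x, hx, h⟩
      exact ⟨r x, (hPr x hx).symm.trans ((residue_sub_iff hadd hzero (hle x hx) hc).1 h)⟩
  have hab : ‖a + b‖ ≤ 1 := (IsUltrametricDist.norm_add_le_max _ _).trans (max_le ha hb)
  rw [← hmem _ hab, hadd a b ha hb, AddSubgroup.add_mem_iff_of_index_two hidx]
  refine iff_of_false ?_ ?_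
  · rw [hmem a ha]; push Not; exact fun x hx => not_lt.1 (hna x hx)
  · rw [hmem b hb]; push Not; exact fun x hx => not_lt.1 (hnb x hx)

theorem residue_two_ne_zero {R : Type*} [Field R] {r : F → R} (h2 : ‖(2 : F)‖ = 1)
    (hadd : ∀ x y, ‖x‖ ≤ 1 → ‖y‖ ≤ 1 → r (x + y) = r x + r y)
    (hzero : ∀ x, ‖x‖ ≤ 1 → (r x = 0 ↔ ‖x‖ < 1)) (hone : r 1 = 1) : (2 : R) ≠ 0 := by
  rw [← one_add_one_eq_two, ← hone, ← hadd 1 1 (by simp) (by simp), one_add_one_eq_two, ne_eq,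
    hzero _ h2.le, h2]
  exact lt_irrefl 1

/-- A unit congruent to a square is a square, in odd residue characteristic. -/
theorem isSq_of_near (h2 : ‖(2 : F)‖ = 1) {u x : F} (hu : ‖u‖ = 1) (hx : ‖u - x ^ 2‖ < 1) :
    ∃ s, u = s ^ 2 := by
  have hx2 : ‖x ^ 2‖ = 1 := by
    have := norm_add_eq_one hu (x := -(u - x ^ 2)) (by rwa [norm_neg])
    rwa [show u + -(u - x ^ 2) = x ^ 2 by ring] at this
  have hx0 : x ≠ 0 := by rintro rfl; simp at hx2
  have h40 : (4 : F) ≠ 0 := by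
    have : (2 : F) ≠ 0 := norm_ne_zero_iff.1 (by rw [h2]; exact one_ne_zero)
    rw [show (4 : F) = 2 * 2 by norm_num]; exact mul_ne_zero this this
  have h4 : ‖(4 : F)‖ = 1 := by
    rw [show (4 : F) = 2 * 2 by norm_num, norm_mul, h2, one_mul]
  obtain ⟨s, hs⟩ := one_add_four_mul_isSq (a := (u / x ^ 2 - 1) / 4) (x := 0) (by simp) (by
    rw [show (0 : F) ^ 2 + 0 - (u / x ^ 2 - 1) / 4 = -((u - x ^ 2) / (4 * x ^ 2)) by field_simp; ring,
      norm_neg, norm_div, norm_mul, h4, hx2]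
    simpa using hx)
  refine ⟨s * x, ?_⟩
  rw [mul_pow, ← hs]
  field_simp
  ring

theorem mul_isSq_of_not_isSq (h2 : ‖(2 : F)‖ = 1) {u v : F} (hu : ‖u‖ = 1) (hv : ‖v‖ = 1)
    (hnu : ¬ ∃ s, u = s ^ 2) (hnv : ¬ ∃ s, v = s ^ 2) : ∃ s, u * v = s ^ 2 := by
  classical
  obtain ⟨R, _, _, r, hadd, hmul, hzero, hone, hsurj⟩ := exists_residue F
  have := Fintype.ofFinite R
  have hns : ∀ w : F, ‖w‖ = 1 → (¬ ∃ s, w = s ^ 2) → ¬ IsSquare (r w) := by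
    rintro w hw hn ⟨t, ht⟩
    obtain ⟨x, hx, rfl⟩ := hsurj t
    refine hn (isSq_of_near h2 hw ((residue_sub_iff hadd hzero hw.le (norm_sq_le_one hx)).2 ?_))
    rw [ht, sq, hmul x x hx hx]
  have huv : ‖u * v‖ = 1 := by rw [norm_mul, hu, hv, one_mul]
  by_contra hcon
  have e1 := quadraticChar_neg_one_iff_not_isSquare.2 (hns u hu hnu)
  have e2 := quadraticChar_neg_one_iff_not_isSquare.2 (hns v hv hnv)
  have e3 := quadraticChar_neg_one_iff_not_isSquare.2 (hns _ huv hcon)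
  rw [hmul u v hu.le hv.le, map_mul, e1, e2] at e3
  norm_num at e3

/-- A binary form with unit discriminant represents all units, in odd residue characteristic. -/
theorem isNormValue_unit_of_odd (h2 : ‖(2 : F)‖ = 1) {d u : F} (hd : ‖d‖ = 1) (hu : ‖u‖ = 1) :
    IsNormValue d u := by
  classical
  obtain ⟨R, _, _, r, hadd, hmul, hzero, hone, hsurj⟩ := exists_residue F
  have := Fintype.ofFinite R
  have h20 := residue_two_ne_zero h2 hadd hzero hone
  have hrd : r d ≠ 0 := by rw [ne_eq, hzero d hd.le, hd]; exact lt_irrefl 1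
  have hodd : Fintype.card R % 2 = 1 :=
    FiniteField.odd_card_of_char_ne_two fun h => h20 (by
      have := ringChar.charP R
      rw [h] at this
      exact CharTwo.two_eq_zero)
  obtain ⟨a, b, hab⟩ := FiniteField.exists_root_sum_quadratic
    (f := Polynomial.X ^ 2 - Polynomial.C (r u)) (g := Polynomial.C (-r d) * Polynomial.X ^ 2)
    (Polynomial.degree_X_pow_sub_C two_pos _)
    (Polynomial.degree_C_mul_X_pow 2 (neg_ne_zero.2 hrd)) hodd
  obtain ⟨x, hx, rfl⟩ := hsurj a
  obtain ⟨y, hy, rfl⟩ := hsurj b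
  simp only [Polynomial.eval_sub, Polynomial.eval_pow, Polynomial.eval_X, Polynomial.eval_C,
    Polynomial.eval_mul] at hab
  have hx2 := norm_sq_le_one hx
  have hdy : ‖d * y ^ 2‖ ≤ 1 := by rw [norm_mul, hd, one_mul]; exact norm_sq_le_one hy
  -- `w = x² - d y²` is a value congruent to `u`, so that `u / w` is a square
  set w := x ^ 2 - d * y ^ 2 with hw
  have hw1 : ‖w‖ ≤ 1 := (ultrametric_norm_sub_le _ _).trans (max_le hx2 hdy)
  have hrw : r w = r u := by
    have e := hadd w (d * y ^ 2) hw1 hdy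
    rw [hw, sub_add_cancel, ← hw, hmul d _ hd.le (norm_sq_le_one hy), sq, sq, hmul x x hx hx,
      hmul y y hy hy] at e
    linear_combination hab - e
  have huw : ‖u - w‖ < 1 := (residue_sub_iff hadd hzero hu.le hw1).2 hrw.symm
  have hwn : ‖w‖ = 1 := by
    have := norm_add_eq_one hu (x := -(u - w)) (by rwa [norm_neg])
    rwa [show u + -(u - w) = w by ring] at this
  have hw0 : w ≠ 0 := norm_ne_zero_iff.1 (by rw [hwn]; exact one_ne_zero)
  obtain ⟨s, hs⟩ := isSq_of_near h2 (u := u / w) (x := 1) (by rw [norm_div, hu, hwn, div_one]) (by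
    rw [show u / w - 1 ^ 2 = (u - w) / w by field_simp, norm_div, hwn, div_one]
    exact huw)
  have : u = w * s ^ 2 := by rw [← hs]; field_simp
  rw [this]
  exact IsNormValue.mul ⟨x, y, hw⟩ (isNormValue_sq d s)

/-- In residue characteristic `2`, the approximation of a unit by a square is improved from an even
level to the next one. -/
theorem exists_sq_improve {p : F} (hp : IsUniformizer p) (h2 : ‖(2 : F)‖ < 1) (h20 : (2 : F) ≠ 0)
    {j : ℕ} (hj : ‖(4 : F)‖ ≤ ‖p‖ ^ (2 * j + 1)) {v : F} (hv1 : ‖v‖ = 1)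
    (hv : ‖v - 1‖ ≤ ‖p‖ ^ (2 * j)) : ∃ s, ‖s‖ = 1 ∧ ‖v * s ^ 2 - 1‖ ≤ ‖p‖ ^ (2 * j + 1) := by
  have hp0 := hp.ne_zero
  rcases Nat.eq_zero_or_pos j with rfl | hj0
  · obtain ⟨x, hx, hvx⟩ := exists_sq_near h2 hv1.le
    have hx2 : ‖x ^ 2‖ = 1 := by
      have := norm_add_eq_one hv1 (x := -(v - x ^ 2)) (by rwa [norm_neg])
      rwa [show v + -(v - x ^ 2) = x ^ 2 by ring] at this
    have hx1 : ‖x‖ = 1 := by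
      rw [norm_pow] at hx2
      exact (pow_eq_one_iff_of_nonneg (norm_nonneg _) two_ne_zero).1 hx2
    have hx0 : x ≠ 0 := by rintro rfl; simp at hx1
    refine ⟨x⁻¹, by rw [norm_inv, hx1, inv_one], ?_⟩
    have e : v * x⁻¹ ^ 2 - 1 = (v - x ^ 2) / x ^ 2 := by field_simp
    rw [e, norm_div, hx2, div_one]
    exact hp.le_of_lt (n := 0) (by simpa using hvx)
  · set z := (v - 1) / p ^ (2 * j) with hz
    have hpk : p ^ (2 * j) ≠ 0 := pow_ne_zero _ hp0
    have hz1 : ‖z‖ ≤ 1 := by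
      rw [hz, norm_div, norm_pow]
      exact div_le_one_of_le₀ hv (by positivity)
    obtain ⟨y, hy, hzy⟩ := exists_sq_near h2 hz1
    have hvz : v = 1 + p ^ (2 * j) * z := by rw [hz]; field_simp; ring
    -- `‖2‖² ≤ ‖p‖^(2j+1)` forces `‖2‖ ≤ ‖p‖^(j+1)`
    have h2j : ‖(2 : F)‖ ≤ ‖p‖ ^ (j + 1) := by
      obtain ⟨n, hn⟩ := hp.exists_zpow h20
      have h4 : ‖(4 : F)‖ = ‖p‖ ^ (2 * n) := by
        rw [show (4 : F) = 2 * 2 by norm_num, norm_mul, hn, ← zpow_add₀ hp.1.ne', two_mul]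
      rw [h4, ← zpow_natCast, zpow_le_zpow_iff_right_of_lt_one₀ hp.1 hp.2.1] at hj
      rw [hn, ← zpow_natCast, zpow_le_zpow_iff_right_of_lt_one₀ hp.1 hp.2.1]
      push_cast at hj ⊢
      omega
    have hpj : ‖p ^ j * y‖ < 1 := by
      rw [norm_mul, norm_pow]
      have := pow_lt_one₀ (norm_nonneg p) hp.2.1 hj0.ne'
      nlinarith [norm_nonneg y, pow_nonneg (norm_nonneg p) j]
    refine ⟨1 + p ^ j * y, norm_add_eq_one norm_one hpj, ?_⟩
    have e : v * (1 + p ^ j * y) ^ 2 - 1 =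
        p ^ (2 * j) * (z - y ^ 2) + (2 * (p ^ j * (v * y)) + (2 * (p ^ (2 * j) * y ^ 2) +
          p ^ (2 * j) * (p ^ (2 * j) * (z * y ^ 2)))) := by
      rw [hvz]; ring
    have hple : ∀ m, ‖p‖ ^ m ≤ 1 := fun m => pow_le_one₀ (norm_nonneg _) hp.2.1.le
    rw [e]
    refine (IsUltrametricDist.norm_add_le_max _ _).trans (max_le ?_ ?_)
    · rw [norm_mul, norm_pow, pow_succ ‖p‖ (2 * j)]
      exact mul_le_mul_of_nonneg_left (by simpa using hp.le_of_lt (n := 0) (by simpa using hzy))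
        (by positivity)
    refine (IsUltrametricDist.norm_add_le_max _ _).trans (max_le ?_ ?_)
    · rw [norm_mul, norm_mul, norm_mul, norm_pow, hv1, one_mul]
      calc ‖(2 : F)‖ * (‖p‖ ^ j * ‖y‖) ≤ ‖p‖ ^ (j + 1) * (‖p‖ ^ j * 1) := by gcongr
        _ = _ := by ring
    refine (IsUltrametricDist.norm_add_le_max _ _).trans (max_le ?_ ?_)
    · rw [norm_mul, norm_mul, norm_pow, norm_pow]
      calc ‖(2 : F)‖ * (‖p‖ ^ (2 * j) * ‖y‖ ^ 2) ≤ ‖p‖ ^ (j + 1) * (‖p‖ ^ (2 * j) * 1) := by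
            gcongr; exact pow_le_one₀ (norm_nonneg _) hy
        _ = ‖p‖ ^ (2 * j + 1) * ‖p‖ ^ j := by ring
        _ ≤ _ := mul_le_of_le_one_right (by positivity) (hple _)
    · rw [norm_mul, norm_mul, norm_mul, norm_pow, norm_pow]
      calc ‖p‖ ^ (2 * j) * (‖p‖ ^ (2 * j) * (‖z‖ * ‖y‖ ^ 2))
          ≤ ‖p‖ ^ (2 * j) * (‖p‖ ^ 1 * (1 * 1)) := by
            have h3 : ‖p‖ ^ (2 * j) ≤ ‖p‖ ^ 1 :=
              pow_le_pow_of_le_one (norm_nonneg _) hp.2.1.le (by omega)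
            have h4 : ‖y‖ ^ 2 ≤ 1 := pow_le_one₀ (norm_nonneg _) hy
            gcongr
        _ = _ := by ring

/-- If `d` is a uniformizer, every unit is congruent to `1` modulo `4` up to a value of
`x² - d y²`. -/
theorem exists_value_near {p : F} (hp : IsUniformizer p) (h2 : ‖(2 : F)‖ < 1) (h20 : (2 : F) ≠ 0)
    {u : F} (hu : ‖u‖ = 1) (n : ℕ) (hn : ‖(4 : F)‖ ≤ ‖p‖ ^ n) :
    ∃ h, IsNormValue p h ∧ ‖h‖ = 1 ∧ ‖u * h - 1‖ ≤ ‖p‖ ^ n := by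
  induction n with
  | zero =>
    refine ⟨1, ⟨1, 0, by ring⟩, norm_one, ?_⟩
    rw [mul_one, pow_zero]
    exact (ultrametric_norm_sub_le _ _).trans (max_le hu.le norm_one.le)
  | succ n ih =>
    obtain ⟨h, hh, hh1, hle⟩ := ih (hn.trans (pow_le_pow_of_le_one (norm_nonneg _) hp.2.1.le
      (Nat.le_succ n)))
    have huh : ‖u * h‖ = 1 := by rw [norm_mul, hu, hh1, one_mul]
    rcases Nat.even_or_odd' n with ⟨j, rfl | rfl⟩
    · obtain ⟨s, hs, hs'⟩ := exists_sq_improve hp h2 h20 hn huh hle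
      refine ⟨h * s ^ 2, hh.mul (isNormValue_sq p s), by rw [norm_mul, norm_pow, hh1, hs]; norm_num,
        ?_⟩
      rwa [← mul_assoc]
    · set z := (u * h - 1) / p ^ (2 * j + 1) with hz
      have hpk : p ^ (2 * j + 1) ≠ 0 := pow_ne_zero _ hp.ne_zero
      have hz1 : ‖z‖ ≤ 1 := by
        rw [hz, norm_div, norm_pow]
        exact div_le_one_of_le₀ hle (by positivity)
      obtain ⟨y, hy, hzy⟩ := exists_sq_near h2 hz1
      have hvz : u * h = 1 + p ^ (2 * j + 1) * z := by rw [hz]; field_simp; ring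
      have hy2 := norm_sq_le_one hy
      have hsmall : ‖-(p * (p ^ j * y) ^ 2)‖ < 1 := by
        rw [norm_neg, norm_mul, mul_pow, norm_mul, norm_pow, norm_pow p]
        have h1 : (‖p‖ ^ j) ^ 2 ≤ 1 :=
          pow_le_one₀ (by positivity) (pow_le_one₀ (norm_nonneg _) hp.2.1.le)
        have h3 : (‖p‖ ^ j) ^ 2 * ‖y ^ 2‖ ≤ 1 := mul_le_one₀ h1 (norm_nonneg _) hy2
        calc ‖p‖ * ((‖p‖ ^ j) ^ 2 * ‖y ^ 2‖) ≤ ‖p‖ * 1 := by gcongr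
          _ < 1 := by rw [mul_one]; exact hp.2.1
      refine ⟨h * (1 ^ 2 - p * (p ^ j * y) ^ 2), hh.mul ⟨1, p ^ j * y, rfl⟩, ?_, ?_⟩
      · rw [norm_mul, hh1, one_mul, one_pow, sub_eq_add_neg]
        exact norm_add_eq_one norm_one hsmall
      · have e : u * (h * (1 ^ 2 - p * (p ^ j * y) ^ 2)) - 1 =
            p ^ (2 * j + 1) * (z - y ^ 2) + -(p ^ (2 * j + 1) * (p ^ (2 * j + 1) * (z * y ^ 2))) := by
          rw [← mul_assoc, hvz]; ring
        rw [e]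
        refine (IsUltrametricDist.norm_add_le_max _ _).trans (max_le ?_ ?_)
        · rw [norm_mul, norm_pow, pow_succ _ (2 * j + 1)]
          exact mul_le_mul_of_nonneg_left
            (by simpa using hp.le_of_lt (n := 0) (by simpa using hzy)) (by positivity)
        · rw [norm_neg, norm_mul, norm_mul, norm_mul, norm_pow]
          calc ‖p‖ ^ (2 * j + 1) * (‖p‖ ^ (2 * j + 1) * (‖z‖ * ‖y ^ 2‖))
              ≤ ‖p‖ ^ (2 * j + 1) * (‖p‖ ^ 1 * (1 * 1)) := by
                have h3 : ‖p‖ ^ (2 * j + 1) ≤ ‖p‖ ^ 1 :=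
                  pow_le_pow_of_le_one (norm_nonneg _) hp.2.1.le (by omega)
                gcongr
            _ = _ := by ring

theorem exists_pow_norm_four {p : F} (hp : IsUniformizer p) (h20 : (2 : F) ≠ 0) :
    ∃ n : ℕ, ‖(4 : F)‖ = ‖p‖ ^ n := by
  have h40 : (4 : F) ≠ 0 := by
    rw [show (4 : F) = 2 * 2 by norm_num]; exact mul_ne_zero h20 h20
  obtain ⟨m, hm⟩ := hp.exists_zpow h40
  have : 0 ≤ m := by
    by_contra! hneg
    have h4 : ‖(4 : F)‖ ≤ 1 := by
      have := IsUltrametricDist.norm_natCast_le_one F 4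
      simpa using this
    have := one_lt_zpow_of_neg₀ hp.1 hp.2.1 hneg
    linarith
  lift m to ℕ using this
  exact ⟨m, by simpa using hm⟩

/-- Up to values, the units are `1 + 4a` and `1 + 4b`. As they are not squares, `x² + x` takes neither
the value `a` nor `b` modulo `p`; its values in the residue field have index `2`, so it takes the
value `a + b`, and `(1 + 4a)(1 + 4b)` is a square. -/
theorem unit_index_of_uniformizer {p : F} (hp : IsUniformizer p) (h20 : (2 : F) ≠ 0) {u v : F}
    (hu : ‖u‖ = 1) (hv : ‖v‖ = 1) (hnu : ¬ IsNormValue p u) (hnv : ¬ IsNormValue p v) :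
    IsNormValue p (u * v) := by
  have hsq : ∀ x : F, (∃ s, x = s ^ 2) → IsNormValue p x := by
    rintro _ ⟨s, rfl⟩; exact isNormValue_sq p s
  have h2le : ‖(2 : F)‖ ≤ 1 := by
    have := IsUltrametricDist.norm_natCast_le_one F 2
    simpa using this
  rcases h2le.eq_or_lt with h2 | h2
  · exact hsq _ (mul_isSq_of_not_isSq h2 hu hv (fun h => hnu (hsq _ h)) fun h => hnv (hsq _ h))
  · have h40 : (4 : F) ≠ 0 := by
      rw [show (4 : F) = 2 * 2 by norm_num]; exact mul_ne_zero h20 h20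
    obtain ⟨n, hn⟩ := exists_pow_norm_four hp h20
    have hstep : ∀ w : F, ‖w‖ = 1 → ∃ h a, IsNormValue p h ∧ ‖h‖ = 1 ∧ ‖a‖ ≤ 1 ∧
        w * h = 1 + 4 * a := by
      intro w hw
      obtain ⟨h, hh, hh1, hle⟩ := exists_value_near hp h2 h20 hw n hn.le
      refine ⟨h, (w * h - 1) / 4, hh, hh1, ?_, by field_simp; ring⟩
      rw [norm_div, hn]
      exact div_le_one_of_le₀ hle (by positivity)
    have h12 : ∀ x : F, ‖x‖ ≤ 1 → ‖1 + 2 * x‖ = 1 := fun x hx =>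
      norm_add_eq_one norm_one (by rw [norm_mul]; nlinarith [norm_nonneg x, norm_nonneg (2 : F)])
    obtain ⟨h, a, hh, hh1, ha, hua⟩ := hstep u hu
    obtain ⟨h', b, hh', hh1', hb, hvb⟩ := hstep v hv
    have hne : ∀ {w : F}, ‖w‖ = 1 → w ≠ 0 := fun hw =>
      norm_ne_zero_iff.1 (by rw [hw]; exact one_ne_zero)
    have hna : ∀ x, ‖x‖ ≤ 1 → ¬ ‖x ^ 2 + x - a‖ < 1 := by
      intro x hx hlt
      have := hsq _ (one_add_four_mul_isSq (h12 x hx) hlt)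
      rw [← hua, mul_comm] at this
      exact hnu (hh.of_mul (hne hh1) this)
    have hnb : ∀ x, ‖x‖ ≤ 1 → ¬ ‖x ^ 2 + x - b‖ < 1 := by
      intro x hx hlt
      have := hsq _ (one_add_four_mul_isSq (h12 x hx) hlt)
      rw [← hvb, mul_comm] at this
      exact hnv (hh'.of_mul (hne hh1') this)
    obtain ⟨x, hx, hlt⟩ := exists_artinSchreier_near h2 ha hb hna hnb
    have h4ab : ‖4 * (a * b)‖ < 1 := by
      rw [show (4 : F) = 2 * 2 by norm_num, norm_mul, norm_mul, norm_mul]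
      have h1 : ‖a‖ * ‖b‖ ≤ 1 := mul_le_one₀ ha (norm_nonneg _) hb
      have h4 : ‖(2 : F)‖ * ‖(2 : F)‖ < 1 := by nlinarith [norm_nonneg (2 : F)]
      nlinarith [mul_nonneg (norm_nonneg a) (norm_nonneg b), mul_nonneg (norm_nonneg (2 : F)) (norm_nonneg (2 : F))]
    have hlt' : ‖x ^ 2 + x - (a + b + 4 * (a * b))‖ < 1 := by
      rw [show x ^ 2 + x - (a + b + 4 * (a * b)) = (x ^ 2 + x - (a + b)) - 4 * (a * b) by ring]
      exact (ultrametric_norm_sub_le _ _).trans_lt (max_lt hlt h4ab)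
    have hfin := hsq _ (one_add_four_mul_isSq (h12 x hx) hlt')
    have e : 1 + 4 * (a + b + 4 * (a * b)) = (h * h') * (u * v) := by
      linear_combination (-(1 + 4 * b)) * hua - u * h * hvb
    rw [e] at hfin
    exact (hh.mul hh').of_mul (mul_ne_zero (hne hh1) (hne hh1')) hfin

/-- Every element is a power of the value `-p` times a unit. -/
theorem normIndexLeTwo_of_uniformizer {p : F} (hp : IsUniformizer p) (h20 : (2 : F) ≠ 0) :
    NormIndexLeTwo p := by
  have hpow : ∀ n : ℤ, IsNormValue p ((-p) ^ n) := by
    have hnat : ∀ n : ℕ, IsNormValue p ((-p) ^ n) := by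
      intro n
      induction n with
      | zero => exact ⟨1, 0, by ring⟩
      | succ n ih => rw [pow_succ]; exact ih.mul (isNormValue_neg_self p)
    intro n
    obtain ⟨m, rfl | rfl⟩ := n.eq_nat_or_neg
    · rw [zpow_natCast]; exact hnat m
    · refine (hnat m).of_mul (pow_ne_zero _ (neg_ne_zero.2 hp.ne_zero)) ?_
      rw [_root_.zpow_neg, zpow_natCast, mul_inv_cancel₀ (pow_ne_zero _ (neg_ne_zero.2 hp.ne_zero))]
      exact ⟨1, 0, by ring⟩
  have hdec : ∀ b : F, b ≠ 0 → ∃ (n : ℤ) (u : F), ‖u‖ = 1 ∧ b = (-p) ^ n * u := by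
    intro b hb
    obtain ⟨n, hn⟩ := hp.exists_zpow hb
    have hpn : (-p) ^ n ≠ 0 := zpow_ne_zero _ (neg_ne_zero.2 hp.ne_zero)
    refine ⟨n, b / (-p) ^ n, ?_, by field_simp⟩
    rw [norm_div, norm_zpow, norm_neg, hn, div_self (zpow_ne_zero _ hp.1.ne')]
  intro b b' hb hb' hnb hnb'
  obtain ⟨n, u, hu, rfl⟩ := hdec b hb
  obtain ⟨m, v, hv, rfl⟩ := hdec b' hb'
  have := unit_index_of_uniformizer hp h20 hu hv (fun h => hnb ((hpow n).mul h))
    (fun h => hnb' ((hpow m).mul h))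
  rw [mul_mul_mul_comm]
  exact ((hpow n).mul (hpow m)).mul this

end Nonarch

section Symbol

variable {F : Type*} [Field F]

open Classical in
/-- The Hilbert symbol `(a, d)` as an integer, defined by the values of `x² - d y²`. -/
def normSign (a d : F) : ℤ := if IsNormValue d a then 1 else -1

theorem normSign_eq_one_iff {a d : F} : normSign a d = 1 ↔ IsNormValue d a := by
  unfold normSign; split_ifs with h <;> simp [h]

theorem normSign_sq (a d : F) : normSign a d * normSign a d = 1 := by
  unfold normSign; split_ifs <;> simp

theorem normSign_eq_neg_one {a d : F} (h : ¬ IsNormValue d a) : normSign a d = -1 := if_neg h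

theorem normSign_neg_self (d : F) : normSign (-d) d = 1 :=
  normSign_eq_one_iff.2 (isNormValue_neg_self d)

theorem isNormValue_comm (h2 : (2 : F) ≠ 0) {a b : F} (ha : a ≠ 0) (hb : b ≠ 0) :
    IsNormValue b a ↔ IsNormValue a b := by
  rw [isNormValue_iff h2 hb, isNormValue_iff h2 ha]
  constructor <;>
  · rintro ⟨x, y, z, h, e⟩
    exact ⟨y, x, z, by tauto, by rw [e]; ring⟩

theorem normSign_comm (h2 : (2 : F) ≠ 0) {a b : F} (ha : a ≠ 0) (hb : b ≠ 0) :
    normSign a b = normSign b a := by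
  by_cases h : IsNormValue b a
  · rw [normSign_eq_one_iff.2 h, normSign_eq_one_iff.2 ((isNormValue_comm h2 ha hb).1 h)]
  · rw [normSign_eq_neg_one h, normSign_eq_neg_one (mt (isNormValue_comm h2 ha hb).2 h)]

theorem NormIndexLeTwo.normSign_mul {d : F} (hd : NormIndexLeTwo d) {a b : F} (ha : a ≠ 0)
    (hb : b ≠ 0) : normSign (a * b) d = normSign a d * normSign b d := by
  have key : ∀ {x y : F}, x ≠ 0 → IsNormValue d x → ¬ IsNormValue d y → ¬ IsNormValue d (x * y) :=
    fun hx0 hx hy h => hy (hx.of_mul hx0 h)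
  by_cases h1 : IsNormValue d a <;> by_cases h3 : IsNormValue d b
  · rw [normSign_eq_one_iff.2 h1, normSign_eq_one_iff.2 h3, normSign_eq_one_iff.2 (h1.mul h3)]; rfl
  · rw [normSign_eq_one_iff.2 h1, normSign_eq_neg_one h3, normSign_eq_neg_one (key ha h1 h3)]; rfl
  · rw [normSign_eq_neg_one h1, normSign_eq_one_iff.2 h3, mul_comm a,
      normSign_eq_neg_one (key hb h3 h1)]; rfl
  · rw [normSign_eq_neg_one h1, normSign_eq_neg_one h3, normSign_eq_one_iff.2 (hd a b ha hb h1 h3)]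
    rfl

/-- If `x² - d y²` has a value of odd valuation, the index for `d` is controlled by the indices for
elements of odd valuation: for such `b`, `b'` and a value `w`, the sign `(w b b', d)` equals
`(w b b', -w b b' d)`, which expands by multiplicativity in the arguments of odd valuation. -/
theorem normIndex_of_odd_value (h2 : (2 : F) ≠ 0) {d w b b' : F} (hd0 : d ≠ 0) (hw0 : w ≠ 0)
    (hb0 : b ≠ 0) (hb0' : b' ≠ 0) (hw : IsNormValue d w) (hIw : NormIndexLeTwo w)
    (hIb : NormIndexLeTwo b) (hIb' : NormIndexLeTwo b') (hIz : NormIndexLeTwo (-(w * b * b' * d)))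
    (hnb : ¬ IsNormValue d b) (hnb' : ¬ IsNormValue d b') : IsNormValue d (b * b') := by
  have hx0 : w * b * b' ≠ 0 := mul_ne_zero (mul_ne_zero hw0 hb0) hb0'
  have hz0 : -(w * b * b' * d) ≠ 0 := neg_ne_zero.2 (mul_ne_zero hx0 hd0)
  have hd1 : normSign d w = 1 := by
    rw [normSign_comm h2 hd0 hw0]; exact normSign_eq_one_iff.2 hw
  have hd2 : normSign d b = -1 := by
    rw [normSign_comm h2 hd0 hb0]; exact normSign_eq_neg_one hnb
  have hd3 : normSign d b' = -1 := by
    rw [normSign_comm h2 hd0 hb0']; exact normSign_eq_neg_one hnb'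
  have e1 : normSign w (-(w * b * b' * d)) = normSign b w * normSign b' w := by
    rw [normSign_comm h2 hw0 hz0, show -(w * b * b' * d) = -w * b * b' * d by ring,
      hIw.normSign_mul (mul_ne_zero (mul_ne_zero (neg_ne_zero.2 hw0) hb0) hb0') hd0,
      hIw.normSign_mul (mul_ne_zero (neg_ne_zero.2 hw0) hb0) hb0',
      hIw.normSign_mul (neg_ne_zero.2 hw0) hb0, normSign_neg_self, hd1]
    ring
  have e2 : normSign b (-(w * b * b' * d)) = -(normSign b w * normSign b' b) := by
    rw [normSign_comm h2 hb0 hz0, show -(w * b * b' * d) = -b * w * b' * d by ring,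
      hIb.normSign_mul (mul_ne_zero (mul_ne_zero (neg_ne_zero.2 hb0) hw0) hb0') hd0,
      hIb.normSign_mul (mul_ne_zero (neg_ne_zero.2 hb0) hw0) hb0',
      hIb.normSign_mul (neg_ne_zero.2 hb0) hw0, normSign_neg_self, hd2, normSign_comm h2 hw0 hb0]
    ring
  have e3 : normSign b' (-(w * b * b' * d)) = -(normSign b' w * normSign b' b) := by
    rw [normSign_comm h2 hb0' hz0, show -(w * b * b' * d) = -b' * w * b * d by ring,
      hIb'.normSign_mul (mul_ne_zero (mul_ne_zero (neg_ne_zero.2 hb0') hw0) hb0) hd0,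
      hIb'.normSign_mul (mul_ne_zero (neg_ne_zero.2 hb0') hw0) hb0,
      hIb'.normSign_mul (neg_ne_zero.2 hb0') hw0, normSign_neg_self, hd3,
      normSign_comm h2 hw0 hb0', normSign_comm h2 hb0 hb0']
    ring
  have e4 : normSign (w * b * b') (-(w * b * b' * d)) = 1 := by
    rw [hIz.normSign_mul (mul_ne_zero hw0 hb0) hb0', hIz.normSign_mul hw0 hb0, e1, e2, e3]
    have s1 := normSign_sq b w
    have s2 := normSign_sq b' w
    have s3 := normSign_sq b' b
    calc _ = (normSign b w * normSign b w) * (normSign b' w * normSign b' w) *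
          (normSign b' b * normSign b' b) := by ring
      _ = 1 := by rw [s1, s2, s3]; norm_num
  have h5 : IsNormValue (w * b * b') (-(w * b * b') * d) := by
    rw [isNormValue_comm h2 (by rwa [neg_mul]) hx0, neg_mul]
    exact normSign_eq_one_iff.1 e4
  have h6 : IsNormValue (w * b * b') d :=
    (isNormValue_neg_self _).of_mul (neg_ne_zero.2 hx0) h5
  rw [isNormValue_comm h2 hd0 hx0, mul_assoc] at h6
  exact hw.of_mul hw0 h6

end Symbol

section Index

variable {F : Type*} [NontriviallyNormedField F] [ProperSpace F]

theorem IsNormValue.index_congr {d s : F} (hs : s ≠ 0) (h : NormIndexLeTwo (d * s ^ 2)) :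
    NormIndexLeTwo d := by
  intro b b' hb hb' h1 h2
  rw [← isNormValue_mul_sq_iff hs] at h1 h2 ⊢
  exact h b b' hb hb' h1 h2

variable [hF : IsUltrametricDist F]

/-- The parity of the valuation of a nonzero element. -/
theorem IsUniformizer.parity {p : F} (hp : IsUniformizer p) {x : F} (hx : x ≠ 0) :
    (∃ m : ℤ, ‖x‖ = ‖p‖ ^ (2 * m)) ∨ ∃ m : ℤ, ‖x‖ = ‖p‖ ^ (2 * m + 1) := by
  obtain ⟨n, hn⟩ := hp.exists_zpow hx
  rcases Int.even_or_odd' n with ⟨m, rfl | rfl⟩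
  · exact Or.inl ⟨m, hn⟩
  · exact Or.inr ⟨m, hn⟩

theorem normIndexLeTwo_of_odd {p : F} (hp : IsUniformizer p) (h20 : (2 : F) ≠ 0) {d : F}
    {m : ℤ} (hd : ‖d‖ = ‖p‖ ^ (2 * m + 1)) : NormIndexLeTwo d := by
  have hpm : p ^ (-m) ≠ 0 := zpow_ne_zero _ hp.ne_zero
  refine IsNormValue.index_congr hpm (normIndexLeTwo_of_uniformizer ?_ h20)
  have h1 : ‖d * (p ^ (-m)) ^ 2‖ = ‖p‖ := by
    rw [norm_mul, norm_pow, norm_zpow, hd, ← zpow_natCast, ← _root_.zpow_mul, ← zpow_add₀ hp.1.ne']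
    push_cast
    rw [show 2 * m + 1 + -m * 2 = 1 by ring, zpow_one]
  exact ⟨by rw [h1]; exact hp.1, by rw [h1]; exact hp.2.1, by rw [h1]; exact hp.2.2⟩

/-- If all units are values, the index is at most `2`. -/
theorem normIndexLeTwo_of_units {p : F} (hp : IsUniformizer p) {d : F}
    (h : ∀ u : F, ‖u‖ = 1 → IsNormValue d u) : NormIndexLeTwo d := by
  have heven : ∀ x : F, ∀ m : ℤ, ‖x‖ = ‖p‖ ^ (2 * m) → IsNormValue d x := by
    intro x m hx
    have hpm : p ^ m ≠ 0 := zpow_ne_zero _ hp.ne_zero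
    have := (isNormValue_sq d (p ^ m)).mul (h (x / (p ^ m) ^ 2) (by
      rw [norm_div, norm_pow, norm_zpow, hx, ← zpow_natCast, ← _root_.zpow_mul, mul_comm m]
      exact div_self (zpow_ne_zero _ hp.1.ne')))
    rwa [mul_div_cancel₀ _ (pow_ne_zero 2 hpm)] at this
  intro b b' hb hb' hnb hnb'
  obtain ⟨m, hm⟩ := (hp.parity hb).resolve_left fun ⟨m, hm⟩ => hnb (heven b m hm)
  obtain ⟨n, hn⟩ := (hp.parity hb').resolve_left fun ⟨m, hm⟩ => hnb' (heven b' m hm)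
  refine heven _ (m + n + 1) ?_
  rw [norm_mul, hm, hn, ← zpow_add₀ hp.1.ne']
  congr 1
  ring

/-- If no value has odd valuation, then `d` is, up to squares, congruent to `1` modulo `4`. -/
theorem exists_sq_near_one {p : F} (hp : IsUniformizer p) (h2 : ‖(2 : F)‖ < 1)
    (h20 : (2 : F) ≠ 0) {d : F} (hd : ‖d‖ = 1)
    (hodd : ∀ w : F, w ≠ 0 → IsNormValue d w → ¬ ∃ m : ℤ, ‖w‖ = ‖p‖ ^ (2 * m + 1))
    (n : ℕ) (hn : ‖(4 : F)‖ ≤ ‖p‖ ^ n) : ∃ s, ‖s‖ = 1 ∧ ‖d * s ^ 2 - 1‖ ≤ ‖p‖ ^ n := by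
  induction n with
  | zero =>
    refine ⟨1, norm_one, ?_⟩
    rw [one_pow, mul_one, pow_zero]
    exact (ultrametric_norm_sub_le _ _).trans (max_le hd.le norm_one.le)
  | succ n ih =>
    obtain ⟨s, hs, hle⟩ := ih (hn.trans (pow_le_pow_of_le_one (norm_nonneg _) hp.2.1.le
      (Nat.le_succ n)))
    rcases Nat.even_or_odd' n with ⟨j, rfl | rfl⟩
    · obtain ⟨t, ht, ht'⟩ := exists_sq_improve hp h2 h20 hn
        (v := d * s ^ 2) (by rw [norm_mul, norm_pow, hd, hs]; norm_num) hle
      refine ⟨s * t, by rw [norm_mul, hs, ht, one_mul], ?_⟩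
      rwa [mul_pow, ← mul_assoc]
    · refine ⟨s, hs, ?_⟩
      rcases hle.lt_or_eq with hlt | heq
      · exact hp.le_of_lt hlt
      · have h0 : 1 ^ 2 - d * s ^ 2 ≠ 0 := by
          intro h0
          rw [show d * s ^ 2 - 1 = -(1 ^ 2 - d * s ^ 2) by ring, h0, neg_zero, norm_zero] at heq
          exact (pow_pos hp.1 _).ne heq
        refine absurd ⟨(j : ℤ), ?_⟩ (hodd _ h0 ⟨1, s, rfl⟩)
        rw [show (1 : F) ^ 2 - d * s ^ 2 = -(d * s ^ 2 - 1) by ring, norm_neg, heq, ← zpow_natCast]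
        push_cast
        rfl

/-- Above `2`, either `x² - d y²` has a value of odd valuation, and the index is controlled by the
case of odd valuation, or `d` is `1` modulo `4` up to squares, and all units are values. -/
theorem normIndexLeTwo_of_unit {p : F} (hp : IsUniformizer p) (h20 : (2 : F) ≠ 0) {d : F}
    (hd : ‖d‖ = 1) : NormIndexLeTwo d := by
  have hd0 : d ≠ 0 := norm_ne_zero_iff.1 (by rw [hd]; exact one_ne_zero)
  have h2le : ‖(2 : F)‖ ≤ 1 := by
    have := IsUltrametricDist.norm_natCast_le_one F 2
    simpa using this
  rcases h2le.eq_or_lt with h2 | h2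
  · exact normIndexLeTwo_of_units hp fun u hu => isNormValue_unit_of_odd h2 hd hu
  by_cases hodd : ∃ w : F, w ≠ 0 ∧ IsNormValue d w ∧ ∃ m : ℤ, ‖w‖ = ‖p‖ ^ (2 * m + 1)
  · obtain ⟨w, hw0, hw, m, hm⟩ := hodd
    -- multiplication by `w` makes the valuation of `b` odd without changing the class of `b`
    have hodd' : ∀ b : F, b ≠ 0 → ¬ IsNormValue d b → ∃ b₁ : F, b₁ ≠ 0 ∧
        (∃ n : ℤ, ‖b₁‖ = ‖p‖ ^ (2 * n + 1)) ∧ ¬ IsNormValue d b₁ ∧ (b₁ = b ∨ b₁ = w * b) := by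
      intro b hb hnb
      rcases hp.parity hb with ⟨n, hn⟩ | ⟨n, hn⟩
      · refine ⟨w * b, mul_ne_zero hw0 hb, ⟨m + n, ?_⟩, fun h => hnb (hw.of_mul hw0 h), Or.inr rfl⟩
        rw [norm_mul, hm, hn, ← zpow_add₀ hp.1.ne']
        congr 1; ring
      · exact ⟨b, hb, ⟨n, hn⟩, hnb, Or.inl rfl⟩
    intro b b' hb hb' hnb hnb'
    obtain ⟨b₁, hb₁, ⟨n, hn⟩, hnb₁, h1⟩ := hodd' b hb hnb
    obtain ⟨b₂, hb₂, ⟨n', hn'⟩, hnb₂, h3⟩ := hodd' b' hb' hnb'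
    have hz : ‖-(w * b₁ * b₂ * d)‖ = ‖p‖ ^ (2 * (m + n + n' + 1) + 1) := by
      rw [norm_neg, norm_mul, norm_mul, norm_mul, hm, hn, hn', hd, mul_one, ← zpow_add₀ hp.1.ne',
        ← zpow_add₀ hp.1.ne']
      congr 1; ring
    have hmain := normIndex_of_odd_value h20 hd0 hw0 hb₁ hb₂ hw (normIndexLeTwo_of_odd hp h20 hm)
      (normIndexLeTwo_of_odd hp h20 hn) (normIndexLeTwo_of_odd hp h20 hn')
      (normIndexLeTwo_of_odd hp h20 hz) hnb₁ hnb₂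
    rcases h1 with rfl | rfl <;> rcases h3 with rfl | rfl
    · exact hmain
    · exact hw.of_mul hw0 (by convert hmain using 1; ring)
    · exact hw.of_mul hw0 (by convert hmain using 1; ring)
    · exact (hw.mul hw).of_mul (mul_ne_zero hw0 hw0) (by convert hmain using 1; ring)
  · push Not at hodd
    have h40 : (4 : F) ≠ 0 := by
      rw [show (4 : F) = 2 * 2 by norm_num]; exact mul_ne_zero h20 h20
    obtain ⟨n, hn⟩ := exists_pow_norm_four hp h20
    obtain ⟨s, hs, hle⟩ := exists_sq_near_one hp h2 h20 hd
      (fun w hw0 hw ⟨m, hm⟩ => hodd w hw0 hw m hm) n hn.le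
    have hs0 : s ≠ 0 := norm_ne_zero_iff.1 (by rw [hs]; exact one_ne_zero)
    set a := (d * s ^ 2 - 1) / 4 with ha
    have ha1 : ‖a‖ ≤ 1 := by
      rw [ha, norm_div, hn]; exact div_le_one_of_le₀ hle (by positivity)
    have hda : d * s ^ 2 = 1 + 4 * a := by rw [ha]; field_simp; ring
    -- `x² + x y - a y²` is equivalent to `x² - d y²`, and represents all units by Hensel's lemma
    refine normIndexLeTwo_of_units hp fun u hu => ?_
    obtain ⟨x, hx, hux⟩ := exists_sq_near h2 hu.le
    have hx2 : ‖x ^ 2‖ = 1 := by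
      have := norm_add_eq_one hu (x := -(u - x ^ 2)) (by rwa [norm_neg])
      rwa [show u + -(u - x ^ 2) = x ^ 2 by ring] at this
    have hx1 : ‖x‖ = 1 := by
      rw [norm_pow] at hx2
      exact (pow_eq_one_iff_of_nonneg (norm_nonneg _) two_ne_zero).1 hx2
    have hx0 : x ≠ 0 := by rintro rfl; simp at hx1
    obtain ⟨y, -, hy⟩ := exists_quadratic_fixed (c := (u - x ^ 2) / x) (e := a / x)
      (by rwa [norm_div, hx1, div_one]) (by rwa [norm_div, hx1, div_one])
    have hy' : x * y = u - x ^ 2 + a * y ^ 2 := by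
      have h3 := congrArg (fun t => x * t) hy
      beta_reduce at h3
      rw [h3]; field_simp
    refine ⟨x + y / 2, s * y / 2, ?_⟩
    have e : d * (s * y / 2) ^ 2 = (1 + 4 * a) * (y / 2) ^ 2 := by rw [← hda]; ring
    rw [e]
    field_simp
    linear_combination (-4) * hy'

theorem normIndexLeTwo_of_nonarch (h20 : (2 : F) ≠ 0) {d : F} (hd : d ≠ 0) : NormIndexLeTwo d := by
  obtain ⟨p, hp⟩ := exists_isUniformizer F
  rcases hp.parity hd with ⟨m, hm⟩ | ⟨m, hm⟩
  · refine IsNormValue.index_congr (s := p ^ (-m)) (zpow_ne_zero _ hp.ne_zero)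
      (normIndexLeTwo_of_unit hp h20 ?_)
    rw [norm_mul, norm_pow, norm_zpow, hm, ← zpow_natCast, ← _root_.zpow_mul, ← zpow_add₀ hp.1.ne']
    push_cast
    rw [show 2 * m + -m * 2 = 0 by ring, zpow_zero]
  · exact normIndexLeTwo_of_odd hp h20 hm

end Index

section Hilbert

variable {F : Type*} [NontriviallyNormedField F] [ProperSpace F]

theorem normIndexLeTwo (k : LocalKind F) (h2 : (2 : F) ≠ 0) {d : F} (hd : d ≠ 0) :
    NormIndexLeTwo d := by
  cases k with
  | nonarch h => exact normIndexLeTwo_of_nonarch h2 hd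
  | arch _ => exact fun b b' _ _ hb hb' => isNormValue_index_of_arch hb hb'

theorem hilbertSymbol_eq_normSign (h2 : (2 : F) ≠ 0) {a b : F} (hb : b ≠ 0) :
    hilbertSymbol a b = normSign a b := by
  by_cases h : IsNormValue b a
  · rw [normSign_eq_one_iff.2 h, hilbertSymbol, if_pos ((isNormValue_iff h2 hb).1 h)]
    simp
  · rw [normSign_eq_neg_one h, hilbertSymbol, if_neg (mt (isNormValue_iff h2 hb).2 h)]
    simp

theorem hilbertSymbol_mul_left (k : LocalKind F) (h2 : (2 : F) ≠ 0) {a a' b : F} (ha : a ≠ 0)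
    (ha' : a' ≠ 0) (hb : b ≠ 0) :
    hilbertSymbol (a * a') b = hilbertSymbol a b * hilbertSymbol a' b := by
  simp only [hilbertSymbol_eq_normSign h2 hb, (normIndexLeTwo k h2 hb).normSign_mul ha ha',
    Int.cast_mul]

theorem hilbertSymbol_comm (h2 : (2 : F) ≠ 0) {a b : F} (ha : a ≠ 0) (hb : b ≠ 0) :
    hilbertSymbol a b = hilbertSymbol b a := by
  rw [hilbertSymbol_eq_normSign h2 hb, hilbertSymbol_eq_normSign h2 ha, normSign_comm h2 ha hb]

theorem hilbertSymbol_mul_right (k : LocalKind F) (h2 : (2 : F) ≠ 0) {a b b' : F} (ha : a ≠ 0)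
    (hb : b ≠ 0) (hb' : b' ≠ 0) :
    hilbertSymbol a (b * b') = hilbertSymbol a b * hilbertSymbol a b' := by
  rw [hilbertSymbol_comm h2 ha (mul_ne_zero hb hb'), hilbertSymbol_mul_left k h2 hb hb' ha,
    hilbertSymbol_comm h2 ha hb, hilbertSymbol_comm h2 ha hb']

theorem hilbertSymbol_mul_self (h2 : (2 : F) ≠ 0) (a : F) {b : F} (hb : b ≠ 0) :
    hilbertSymbol a b * hilbertSymbol a b = 1 := by
  rw [hilbertSymbol_eq_normSign h2 hb, ← Int.cast_mul, normSign_sq, Int.cast_one]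

theorem hilbertSymbol_sq_left (h2 : (2 : F) ≠ 0) (s : F) {b : F} (hb : b ≠ 0) :
    hilbertSymbol (s ^ 2) b = 1 := by
  rw [hilbertSymbol_eq_normSign h2 hb, normSign_eq_one_iff.2 (isNormValue_sq b s), Int.cast_one]

theorem hilbertSymbol_one_left (h2 : (2 : F) ≠ 0) {b : F} (hb : b ≠ 0) :
    hilbertSymbol 1 b = 1 := by
  have := hilbertSymbol_sq_left h2 1 hb
  rwa [one_pow] at this

end Hilbert

/-! ### Homogeneous measures -/

section Homogeneous

variable {F : Type*} [NontriviallyNormedField F] [ProperSpace F] [MeasurableSpace F] [BorelSpace F]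
variable (μ : Measure F) [μ.IsAddHaarMeasure] {κ : Type*} [Fintype κ]

instance nullSingletonClass_addHaar : NullSingletonClass μ := by
  have : (nhdsWithin (0 : F) {0}ᶜ).NeBot := NormedField.nhdsNE_neBot 0
  infer_instance

theorem lintegral_comp_mul {a : F} (ha : a ≠ 0) (f : F → ℝ≥0∞) :
    ∫⁻ x, f (a * x) ∂μ = ENNReal.ofReal (localAbs a)⁻¹ * ∫⁻ x, f x ∂μ := by
  have he : MeasurableEmbedding fun x : F => a * x :=
    (continuous_const_mul a).measurableEmbedding (mul_right_injective₀ ha)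
  have h1 := map_mul_left_eq μ (Units.mk0 a ha)
  rw [Units.val_mk0] at h1
  rw [← he.lintegral_map, h1, lintegral_smul_measure, localAbs_of_ne_zero ha]
  rfl

theorem lintegral_comp_mulVec [DecidableEq κ] {A : Matrix κ κ F} (hA : IsUnit A.det)
    (f : (κ → F) → ℝ≥0∞) :
    ∫⁻ x, f (A *ᵥ x) ∂vol[μ] =
      ENNReal.ofReal (localAbs A.det)⁻¹ * ∫⁻ x, f x ∂vol[μ] := by
  rw [← (mulVec_measurableEmbedding A hA).lintegral_map, map_mulVec_pi μ A hA,
    lintegral_smul_measure, ← localAbs_units, IsUnit.unit_spec]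
  rfl

theorem measurable_localAbs : Measurable (localAbs : F → ℝ) := by
  have hemb : MeasurableEmbedding (Units.val : Fˣ → F) :=
    ⟨Units.val_injective, comap_measurable _, fun {s} hs => by
      obtain ⟨t, ht, rfl⟩ := hs
      rw [Set.image_preimage_eq_inter_range]
      refine ht.inter ?_
      have : Set.range (Units.val : Fˣ → F) = {0}ᶜ := by
        ext x
        exact ⟨fun ⟨u, hu⟩ => by rw [← hu]; exact u.ne_zero,
          fun hx => ⟨Units.mk0 x hx, rfl⟩⟩
      rw [this]
      exact (measurableSet_singleton 0).compl⟩
  have h1 : localAbs = Function.extend (Units.val : Fˣ → F) modulus (fun _ => (0 : ℝ)) := by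
    ext x
    rcases eq_or_ne x 0 with rfl | hx
    · rw [localAbs_zero, Function.extend_apply']
      rintro ⟨u, hu⟩
      exact u.ne_zero hu
    · have := hemb.injective.extend_apply modulus (fun _ => (0 : ℝ)) (Units.mk0 x hx)
      rw [Units.val_mk0] at this
      rw [this, localAbs_of_ne_zero hx]
  rw [h1]
  exact hemb.measurable_extend measurable_modulus measurable_const

theorem measurable_ofReal_localAbs : Measurable fun x : F => ENNReal.ofReal (localAbs x) :=
  ENNReal.measurable_ofReal.comp measurable_localAbs

/-- Haar measure is determined up to a constant by its homogeneity under the multiplicative group: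
expand `Λ(h) μ(w)` as an integral over pairs, in two ways. -/
theorem homogeneous_aux (Λ : Measure F) [SFinite Λ] (h0 : Λ {0} = 0)
    (hΛ : ∀ a : F, a ≠ 0 → ∀ g : F → ℝ≥0∞, Measurable g →
      ∫⁻ y, g (a * y) ∂Λ = ENNReal.ofReal (localAbs a)⁻¹ * ∫⁻ y, g y ∂Λ)
    {h w : F → ℝ≥0∞} (hh : Measurable h) (hw : Measurable w) :
    (∫⁻ y, h y ∂Λ) * ∫⁻ x, w x ∂μ =
      (∫⁻ z, w z ∂Λ) * ∫⁻ x, ENNReal.ofReal (localAbs x⁻¹ ^ 2) * h x⁻¹ ∂μ := by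
  have hne : ∀ᵐ y ∂Λ, y ≠ 0 := by
    rw [ae_iff]; simpa using h0
  have hneμ : ∀ᵐ x ∂μ, x ≠ 0 := by
    rw [ae_iff]; simp
  have hm1 : Measurable fun p : F × F => h p.1 * (ENNReal.ofReal (localAbs p.1) * w (p.1 * p.2)) :=
    (hh.comp measurable_fst).mul ((measurable_ofReal_localAbs.comp measurable_fst).mul
      (hw.comp (measurable_fst.mul measurable_snd)))
  have hinvm : Measurable fun x : F => x⁻¹ := measurable_inv
  have hm2 : Measurable fun p : F × F => ENNReal.ofReal (localAbs p.1⁻¹ ^ 2) *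
      (h (p.1⁻¹ * p.2) * (ENNReal.ofReal (localAbs p.2) * w p.2)) := by
    refine Measurable.mul ?_ (Measurable.mul ?_ ?_)
    · exact ENNReal.measurable_ofReal.comp
        ((measurable_localAbs.comp (hinvm.comp measurable_fst)).pow_const 2)
    · exact hh.comp ((hinvm.comp measurable_fst).mul measurable_snd)
    · exact ((measurable_ofReal_localAbs.comp measurable_snd).mul (hw.comp measurable_snd))
  calc (∫⁻ y, h y ∂Λ) * ∫⁻ x, w x ∂μ
      = ∫⁻ y, ∫⁻ x, h y * (ENNReal.ofReal (localAbs y) * w (y * x)) ∂μ ∂Λ := by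
        rw [← lintegral_mul_const _ hh]
        refine lintegral_congr_ae (hne.mono fun y hy => ?_)
        beta_reduce
        have hwy : Measurable fun x => w (y * x) := hw.comp (measurable_const_mul y)
        rw [lintegral_const_mul _ (hwy.const_mul _), lintegral_const_mul _ hwy,
          lintegral_comp_mul μ hy, ← mul_assoc (ENNReal.ofReal (localAbs y)),
          ← ENNReal.ofReal_mul (localAbs_nonneg y), mul_inv_cancel₀ (localAbs_pos hy).ne',
          ENNReal.ofReal_one, one_mul]
    _ = ∫⁻ x, ∫⁻ y, h y * (ENNReal.ofReal (localAbs y) * w (y * x)) ∂Λ ∂μ :=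
        lintegral_lintegral_swap hm1.aemeasurable
    _ = ∫⁻ x, ∫⁻ z, ENNReal.ofReal (localAbs x⁻¹ ^ 2) *
          (h (x⁻¹ * z) * (ENNReal.ofReal (localAbs z) * w z)) ∂Λ ∂μ := by
        refine lintegral_congr_ae (hneμ.mono fun x hx => ?_)
        beta_reduce
        have hg : Measurable fun z => h (x⁻¹ * z) * (ENNReal.ofReal (localAbs (x⁻¹ * z)) * w z) :=
          (hh.comp (measurable_const_mul _)).mul
            ((measurable_ofReal_localAbs.comp (measurable_const_mul _)).mul hw)
        have := hΛ x hx _ hg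
        simp only [inv_mul_cancel_left₀ hx] at this
        simp only [mul_comm _ x]
        rw [this, ← lintegral_const_mul _ hg]
        refine lintegral_congr fun z => ?_
        rw [localAbs_mul, ENNReal.ofReal_mul (localAbs_nonneg _), pow_two,
          ENNReal.ofReal_mul (localAbs_nonneg _), localAbs_inv]
        ring
    _ = ∫⁻ z, ∫⁻ x, ENNReal.ofReal (localAbs x⁻¹ ^ 2) *
          (h (x⁻¹ * z) * (ENNReal.ofReal (localAbs z) * w z)) ∂μ ∂Λ :=
        lintegral_lintegral_swap hm2.aemeasurable
    _ = ∫⁻ z, w z * (∫⁻ x, ENNReal.ofReal (localAbs x⁻¹ ^ 2) * h x⁻¹ ∂μ) ∂Λ := by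
        refine lintegral_congr_ae (hne.mono fun z hz => ?_)
        beta_reduce
        have hm3 : Measurable fun x : F => ENNReal.ofReal (localAbs x⁻¹ ^ 2) * h x⁻¹ :=
          (ENNReal.measurable_ofReal.comp
            ((measurable_localAbs.comp hinvm).pow_const 2)).mul (hh.comp hinvm)
        have := lintegral_comp_mul μ (inv_ne_zero hz) fun x =>
          ENNReal.ofReal (localAbs x⁻¹ ^ 2) * h x⁻¹
        have e : ∀ x, ENNReal.ofReal (localAbs x⁻¹ ^ 2) *
            (h (x⁻¹ * z) * (ENNReal.ofReal (localAbs z) * w z)) =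
            (w z * ENNReal.ofReal (localAbs z)⁻¹) *
              (ENNReal.ofReal (localAbs (z⁻¹ * x)⁻¹ ^ 2) * h (z⁻¹ * x)⁻¹) := by
          intro x
          have hz' := localAbs_pos hz
          rw [mul_inv, inv_inv, mul_comm z x⁻¹, localAbs_mul, mul_pow,
            show ENNReal.ofReal (localAbs x⁻¹ ^ 2 * localAbs z ^ 2) =
              ENNReal.ofReal (localAbs x⁻¹ ^ 2) * ENNReal.ofReal (localAbs z ^ 2) from
              ENNReal.ofReal_mul (by positivity)]
          have : ENNReal.ofReal (localAbs z)⁻¹ * ENNReal.ofReal (localAbs z ^ 2) =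
              ENNReal.ofReal (localAbs z) := by
            rw [← ENNReal.ofReal_mul (by positivity)]
            congr 1
            field_simp
          rw [← this]
          ring
        simp only [e]
        have hm4 : Measurable fun x : F =>
            ENNReal.ofReal (localAbs (z⁻¹ * x)⁻¹ ^ 2) * h (z⁻¹ * x)⁻¹ :=
          hm3.comp (measurable_const_mul z⁻¹)
        rw [lintegral_const_mul _ hm4, this, localAbs_inv, inv_inv,
          mul_assoc, ← mul_assoc (ENNReal.ofReal _), ← ENNReal.ofReal_mul (by
            exact inv_nonneg.2 (localAbs_nonneg z)), inv_mul_cancel₀ (localAbs_pos hz).ne',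
          ENNReal.ofReal_one, one_mul]
    _ = _ := by rw [lintegral_mul_const _ hw]

/-- A homogeneous measure without an atom at `0` is a multiple of Haar measure: apply
`homogeneous_aux` to `Λ` and to `μ`, with the same `h` and the unit ball as `w`. -/
theorem homogeneous_unique (Λ : Measure F) [SFinite Λ] (h0 : Λ {0} = 0)
    (hΛ : ∀ a : F, a ≠ 0 → ∀ g : F → ℝ≥0∞, Measurable g →
      ∫⁻ y, g (a * y) ∂Λ = ENNReal.ofReal (localAbs a)⁻¹ * ∫⁻ y, g y ∂Λ) :
    Λ = (Λ (Metric.ball 0 1) / μ (Metric.ball 0 1)) • μ := by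
  set B : Set F := Metric.ball 0 1 with hB
  have hBm : MeasurableSet B := measurableSet_ball
  have hB0 : μ B ≠ 0 := (Metric.measure_ball_pos μ 0 one_pos).ne'
  have hBt : μ B ≠ ⊤ := measure_ball_lt_top.ne
  have hw : Measurable (B.indicator (1 : F → ℝ≥0∞)) := measurable_one.indicator hBm
  ext s hs
  have hh : Measurable (s.indicator (1 : F → ℝ≥0∞)) := measurable_one.indicator hs
  have e1 := homogeneous_aux μ Λ h0 hΛ hh hw
  have e2 := homogeneous_aux μ μ (by simp) (fun a ha g _ => lintegral_comp_mul μ ha g) hh hw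
  rw [lintegral_indicator_one hs, lintegral_indicator_one hBm] at e1 e2
  rw [lintegral_indicator_one hBm] at e1
  rw [mul_comm (μ s)] at e2
  have e3 := (ENNReal.mul_right_inj hB0 hBt).1 e2
  rw [← e3] at e1
  rw [Measure.smul_apply, smul_eq_mul, ENNReal.div_eq_inv_mul, mul_assoc, ← e1, mul_comm (Λ s),
    ← mul_assoc, ENNReal.inv_mul_cancel hB0 hBt, one_mul]

end Homogeneous

/-! ### Gauss constants of norm forms -/

section WeilRepresentation

open Filter Topology

variable {F : Type*} [NontriviallyNormedField F] [ProperSpace F] [MeasurableSpace F] [BorelSpace F]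
variable {k : LocalKind F} {ψ : AddChar F Circle} (μ : Measure F) [μ.IsAddHaarMeasure]
variable {κ : Type*} [Fintype κ] [DecidableEq κ]

theorem quad_smul (S : Matrix κ κ F) (s : F) (x : κ → F) : quad S (s • x) = s ^ 2 * quad S x := by
  simp only [quad, pairing, mulVec_smul, dotProduct_smul, smul_dotProduct, smul_eq_mul]
  ring

theorem smul_quad (S : Matrix κ κ F) (s : F) (x : κ → F) : quad (s • S) x = s * quad S x := by
  simp only [quad, pairing, smul_mulVec, dotProduct_smul, smul_eq_mul]
  ring

theorem fourier_fourier_neg (hψ : Continuous ψ) (hψ1 : ψ ≠ 1) (hμ : IsSelfDual k ψ μ)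
    {φ : (κ → F) → ℂ} (hφ : φ ∈ schwartz k κ) :
    fourier ψ μ (fun y => fourier ψ μ φ (-y)) = φ := by
  ext a
  have h := integral_comp_smul μ (neg_ne_zero.2 (one_ne_zero (α := F)))
    fun x => fourier ψ μ φ x * (ψ (-(x ⬝ᵥ a)) : ℂ)
  simp only [neg_smul, one_smul, localAbs_neg, localAbs_one, one_pow, inv_one, neg_dotProduct,
    neg_neg] at h
  rw [← fourier_inversion μ hψ hψ1 hμ hφ a, ← h, fourier]
  refine integral_congr_ae (Eventually.of_forall fun x => ?_)
  beta_reduce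
  rw [dotProduct_comm]

theorem schwartz_comp_neg {φ : (κ → F) → ℂ} (hφ : φ ∈ schwartz k κ) :
    (fun x => φ (-x)) ∈ schwartz k κ :=
  (isSchwartzOp_comp_linearEquiv (LinearEquiv.neg F)).mem hφ

/-- The Gauss constant as a limit of convergent Gaussian integrals. -/
theorem tendsto_gauss (hψ : Continuous ψ) (hψ1 : ψ ≠ 1) (hμ : IsSelfDual k ψ μ)
    {S : Matrix κ κ F} {c : ℂ} (hc : IsGaussConst ψ μ S c) {φ : (κ → F) → ℂ}
    (hφ : φ ∈ schwartz k κ) {s : ℕ → F} (hs0 : ∀ n, s n ≠ 0) (hs : Tendsto s atTop (𝓝 0)) :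
    Tendsto (fun n => ∫ v, φ (s n • v) * (ψ (quad S v) : ℂ) ∂vol[μ]) atTop
      (𝓝 (c * φ 0)) := by
  set φ' : (κ → F) → ℂ := fun y => fourier ψ μ φ (-y) with hφ'
  have hφ'S : φ' ∈ schwartz k κ := schwartz_comp_neg ((isSchwartzOp_fourier μ hψ hψ1).mem hφ)
  have hφ'i := schwartz_integrable μ hφ'S
  have hF : fourier ψ μ φ' = φ := fourier_fourier_neg μ hψ hψ1 hμ hφ
  have hscale : ∀ n, ∫ v, φ (s n • v) * (ψ (quad S v) : ℂ) ∂vol[μ] =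
      c * ∫ y, φ' y * (ψ (-(s n ^ 2 * quad S⁻¹ y)) : ℂ) ∂vol[μ] := by
    intro n
    set t := s n with ht
    have ht0 : t ≠ 0 := hs0 n
    have hpos : localAbs t ^ Fintype.card κ ≠ 0 := pow_ne_zero _ (localAbs_pos ht0).ne'
    have e1 : ∀ v, φ (t • v) = ((localAbs t ^ Fintype.card κ)⁻¹ : ℝ) •
        fourier ψ μ (fun y => φ' (t⁻¹ • y)) v := by
      intro v
      rw [fourier_comp_smul μ φ' (inv_ne_zero ht0), inv_inv, hF, smul_smul, localAbs_inv,
        inv_pow, inv_inv, inv_mul_cancel₀ hpos, one_smul]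
    have hsub : (fun y => φ' (t⁻¹ • y)) ∈ schwartz k κ :=
      (isSchwartzOp_comp_linearEquiv
        (LinearEquiv.smulOfNeZero F (κ → F) t⁻¹ (inv_ne_zero ht0))).mem hφ'S
    simp only [e1, smul_mul_assoc]
    rw [integral_smul, hc _ (schwartz_integrable μ hsub) (integrable_fourier μ hψ hψ1 hsub)]
    have e2 : ∀ y, φ' (t⁻¹ • y) * (ψ (-quad S⁻¹ y) : ℂ) =
        (fun y => φ' y * (ψ (-(t ^ 2 * quad S⁻¹ y)) : ℂ)) (t⁻¹ • y) := by
      intro y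
      beta_reduce
      rw [quad_smul, ← mul_assoc, ← mul_pow, mul_inv_cancel₀ ht0, one_pow, one_mul]
    simp only [e2]
    rw [integral_comp_smul μ (inv_ne_zero ht0) (fun y => φ' y * (ψ (-(t ^ 2 * quad S⁻¹ y)) : ℂ)),
      mul_smul_comm, smul_smul, localAbs_inv, inv_pow, inv_inv, inv_mul_cancel₀ hpos, one_smul]
  simp only [hscale]
  refine Tendsto.const_mul _ ?_
  have h0 : ∫ y, φ' y ∂vol[μ] = φ 0 := by
    rw [← hF]
    simp [fourier]
  rw [← h0]
  refine tendsto_integral_of_dominated_convergence (fun y => ‖φ' y‖) (fun n => ?_) hφ'i.norm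
    (fun n => Eventually.of_forall fun y => ?_) (Eventually.of_forall fun y => ?_)
  · exact (integrable_mul_char hψ hφ'i
      ((continuous_const.mul (continuous_quad _)).neg)).aestronglyMeasurable
  · rw [norm_mul, Circle.norm_coe, mul_one]
  · have h1 : Tendsto (fun n => -(s n ^ 2 * quad S⁻¹ y)) atTop (𝓝 0) := by
      simpa using ((hs.pow 2).mul_const (quad S⁻¹ y)).neg
    have h2 : Tendsto (fun n => φ' y * (ψ (-(s n ^ 2 * quad S⁻¹ y)) : ℂ)) atTop
        (𝓝 (φ' y * (ψ 0 : ℂ))) :=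
      ((continuous_char hψ continuous_id).continuousAt.tendsto.comp h1).const_mul _
    simpa using h2

/-- The norm form `(x² - d y²) / 2`. -/
abbrev normMatrix (d : F) : Matrix (Fin 2) (Fin 2) F := diagonal ![1, -d]

theorem quad_normMatrix (d : F) (x : Fin 2 → F) :
    quad (normMatrix d) x = (x 0 ^ 2 - d * x 1 ^ 2) / 2 := by
  rw [quad_diagonal]
  simp
  ring

theorem det_normMatrix (d : F) : (normMatrix d).det = -d := by simp

/-- Multiplication by the number with coordinates `α` in `F(√d)`. -/
def mulMatrix (d : F) (α : Fin 2 → F) : Matrix (Fin 2) (Fin 2) F := !![α 0, d * α 1; α 1, α 0]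

theorem quad_mulMatrix (d : F) (α x : Fin 2 → F) :
    quad (normMatrix d) (mulMatrix d α *ᵥ x) =
      (α 0 ^ 2 - d * α 1 ^ 2) * quad (normMatrix d) x := by
  rw [quad_normMatrix, quad_normMatrix]
  simp [mulMatrix, mulVec, dotProduct, Fin.sum_univ_two]
  ring

theorem det_mulMatrix (d : F) (α : Fin 2 → F) :
    (mulMatrix d α).det = α 0 ^ 2 - d * α 1 ^ 2 := by
  simp [mulMatrix, det_fin_two]; ring

theorem mulMatrix_congr (d : F) (α : Fin 2 → F) :
    (mulMatrix d α)ᵀ * normMatrix d * mulMatrix d α =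
      (α 0 ^ 2 - d * α 1 ^ 2) • normMatrix d := by
  ext i j
  fin_cases i <;> fin_cases j <;>
    simp [mulMatrix, normMatrix, mul_apply, Fin.sum_univ_two] <;> ring

theorem quad_normMatrix_anisotropic (h2 : (2 : F) ≠ 0) {d b : F} (hd : d ≠ 0)
    (hb : ¬ IsNormValue d b) {x : Fin 2 → F} (hx : quad (normMatrix d) x = 0) : x = 0 := by
  rw [quad_normMatrix, div_eq_zero_iff, or_iff_left h2, sub_eq_zero] at hx
  have h1 : x 1 = 0 := by
    by_contra h1
    have h0 : x 0 ≠ 0 := by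
      intro h0
      rw [h0] at hx
      exact mul_ne_zero hd (pow_ne_zero 2 h1) (by simpa using hx.symm)
    have : d = (x 0 / x 1) ^ 2 := by
      rw [div_pow, hx]; field_simp
    rw [this] at hb
    exact hb (isNormValue_of_sq h2 (div_ne_zero h0 h1) b)
  have h0 : x 0 = 0 := by
    rw [h1] at hx
    exact pow_eq_zero_iff (two_ne_zero) |>.1 (by simpa using hx)
  ext i
  fin_cases i
  · exact h0
  · exact h1

/-- An anisotropic form is bounded below by a multiple of the square of the norm. -/
theorem exists_norm_sq_le_quad {S : Matrix κ κ F} (hS : ∀ x, quad S x = 0 → x = 0) :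
    ∃ c : ℝ, 0 < c ∧ ∀ x, c * ‖x‖ ^ 2 ≤ ‖quad S x‖ := by
  obtain ⟨e, he⟩ := NormedField.exists_one_lt_norm F
  have he0 : 0 < ‖e‖ := one_pos.trans he
  let A : Set (κ → F) := {x | 1 / ‖e‖ ≤ ‖x‖ ∧ ‖x‖ ≤ 1}
  have hA : IsCompact A := by
    refine (isCompact_closedBall (0 : κ → F) 1).of_isClosed_subset ?_ ?_
    · exact (isClosed_le continuous_const continuous_norm).inter
        (isClosed_le continuous_norm continuous_const)
    · intro x hx
      simpa using hx.2
  have hpos : ∀ x ∈ A, 0 < ‖quad S x‖ := by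
    intro x hx
    refine norm_pos_iff.2 fun h => ?_
    have := hx.1
    rw [hS x h, norm_zero] at this
    exact absurd this (not_le.2 (by positivity))
  obtain ⟨c, hc, hcA⟩ : ∃ c : ℝ, 0 < c ∧ ∀ x ∈ A, c ≤ ‖quad S x‖ := by
    rcases A.eq_empty_or_nonempty with h | h
    · exact ⟨1, one_pos, by simp [h]⟩
    · obtain ⟨x, hx, hmin⟩ := hA.exists_isMinOn h (continuous_quad S).norm.continuousOn
      exact ⟨_, hpos x hx, fun y hy => hmin hy⟩
  refine ⟨c, hc, fun x => ?_⟩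
  rcases eq_or_ne x 0 with rfl | hx
  · simp
  obtain ⟨t, ht0, ht1, ht2, -⟩ := rescale_to_shell he one_pos hx
  have h1 := hcA (t • x) ⟨ht2, ht1.le⟩
  rw [quad_smul, norm_mul, norm_pow] at h1
  have htp : 0 < ‖t‖ := norm_pos_iff.2 ht0
  have h3 : ‖t‖ ^ 2 * ‖x‖ ^ 2 ≤ 1 := by
    rw [← mul_pow, ← norm_smul]
    exact pow_le_one₀ (norm_nonneg _) ht1.le
  have : ‖t‖ ^ 2 * (c * ‖x‖ ^ 2) ≤ ‖t‖ ^ 2 * ‖quad S x‖ := by nlinarith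
  exact le_of_mul_le_mul_left this (by positivity)

/-- The sum of the push-forwards of Haar measure under the norm form and under its multiple by a
non-norm is homogeneous, hence a Haar measure of `F`. -/
theorem exists_map_norm_add (h2 : (2 : F) ≠ 0) {d b : F} (hd : d ≠ 0) (hI : NormIndexLeTwo d)
    (hb0 : b ≠ 0) (hb : ¬ IsNormValue d b) :
    ∃ C : ℝ≥0∞, C ≠ ⊤ ∧
      vol[μ].map (quad (normMatrix d)) +
        ENNReal.ofReal (localAbs b) • vol[μ].map (quad (b • normMatrix d)) =
      C • μ := by
  set q := quad (normMatrix d) with hq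
  set q' := quad (b • normMatrix d) with hq'
  have hqm : Measurable q := (continuous_quad _).measurable
  have hqm' : Measurable q' := (continuous_quad _).measurable
  have hqq : ∀ x, q' x = b * q x := smul_quad _ b
  set lam : Measure (Fin 2 → F) := vol[μ] with hlam
  set Λ : Measure F := lam.map q + ENNReal.ofReal (localAbs b) • lam.map q' with hΛ
  have haniso : ∀ x, q x = 0 → x = 0 := fun x => quad_normMatrix_anisotropic h2 hd hb
  have hint : ∀ g : F → ℝ≥0∞, Measurable g → ∫⁻ y, g y ∂Λ =
      ∫⁻ x, g (q x) ∂lam + ENNReal.ofReal (localAbs b) * ∫⁻ x, g (b * q x) ∂lam := by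
    intro g hg
    rw [hΛ, lintegral_add_measure, lintegral_smul_measure, lintegral_map hg hqm,
      lintegral_map hg hqm']
    simp only [hqq, smul_eq_mul]
  -- values of the norm form act by linear maps of determinant `a`
  have hnorm : ∀ a : F, a ≠ 0 → IsNormValue d a → ∀ g : F → ℝ≥0∞,
      ∫⁻ x, g (a * q x) ∂lam = ENNReal.ofReal (localAbs a)⁻¹ * ∫⁻ x, g (q x) ∂lam := by
    rintro a ha ⟨x, y, rfl⟩ g
    have hdet : (mulMatrix d ![x, y]).det = x ^ 2 - d * y ^ 2 := det_mulMatrix d ![x, y]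
    have hu : IsUnit (mulMatrix d ![x, y]).det := by rw [hdet]; exact ha.isUnit
    have := lintegral_comp_mulVec μ hu fun v => g (q v)
    rw [hdet] at this
    rw [← this]
    refine lintegral_congr fun v => ?_
    rw [hq, quad_mulMatrix]
    rfl
  have hhom : ∀ a : F, a ≠ 0 → ∀ g : F → ℝ≥0∞, Measurable g →
      ∫⁻ y, g (a * y) ∂Λ = ENNReal.ofReal (localAbs a)⁻¹ * ∫⁻ y, g y ∂Λ := by
    intro a ha g hg
    have hga : Measurable fun y => g (a * y) := hg.comp (measurable_const_mul a)
    rw [hint _ hga, hint _ hg]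
    have hbp := localAbs_pos hb0
    have hap := localAbs_pos ha
    by_cases haN : IsNormValue d a
    · rw [hnorm a ha haN g]
      have := hnorm a ha haN fun y => g (b * y)
      simp only [mul_left_comm b a] at this
      rw [this, mul_add, mul_left_comm]
    -- a non-value interchanges the two summands, since `a b` and `a b⁻¹` are values
    · have hab := hI a b ha hb0 haN hb
      have hab' : IsNormValue d (a * b⁻¹) := by
        have := hab.mul (isNormValue_sq d b⁻¹)
        convert this using 1
        field_simp
      have e1 := hnorm (a * b) (mul_ne_zero ha hb0) hab g
      have e2 := hnorm (a * b⁻¹) (mul_ne_zero ha (inv_ne_zero hb0)) hab' fun y => g (b * y)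
      have e3 : ∀ x, b * (a * b⁻¹ * q x) = a * q x := fun x => by field_simp
      simp only [e3] at e2
      simp only [← mul_assoc a b]
      rw [e1, e2, mul_add, add_comm, ← mul_assoc, ← mul_assoc, ← ENNReal.ofReal_mul hbp.le,
        ← ENNReal.ofReal_mul (inv_nonneg.2 hap.le), localAbs_mul, localAbs_mul, localAbs_inv]
      congr 3
      · field_simp
      · field_simp
  have hpre : ∀ s : Set F, MeasurableSet s → Λ s =
      lam (q ⁻¹' s) + ENNReal.ofReal (localAbs b) * lam (q' ⁻¹' s) := by
    intro s hs
    rw [hΛ, Measure.add_apply, Measure.smul_apply, Measure.map_apply hqm hs,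
      Measure.map_apply hqm' hs, smul_eq_mul]
  have hΛ0 : Λ {0} = 0 := by
    have h1 : q ⁻¹' {0} ⊆ {0} := fun x hx => haniso x hx
    have h2 : q' ⁻¹' {0} ⊆ {0} := fun x hx => by
      refine haniso x ?_
      have : b * q x = 0 := by rw [← hqq]; exact hx
      exact (mul_eq_zero.1 this).resolve_left hb0
    have h3 : lam {0} = 0 := by simp [hlam]
    rw [hpre _ (measurableSet_singleton 0), measure_mono_null h1 h3, measure_mono_null h2 h3]
    simp
  have hbdd : ∀ r : ℝ, lam (q ⁻¹' Metric.ball 0 r) ≠ ⊤ := by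
    intro r
    obtain ⟨c, hc, hcq⟩ := exists_norm_sq_le_quad haniso
    have hsub : q ⁻¹' Metric.ball 0 r ⊆ Metric.closedBall 0 (Real.sqrt (r / c)) := by
      intro x hx
      have hx' : ‖q x‖ < r := by simpa using hx
      rw [mem_closedBall_zero_iff]
      refine Real.le_sqrt_of_sq_le ?_
      rw [le_div_iff₀ hc]
      linarith [hcq x, hx'.le]
    exact ((measure_mono hsub).trans_lt (isCompact_closedBall _ _).measure_lt_top).ne
  have : SFinite Λ := by
    have h1 : SFinite (lam.map q) := inferInstance
    have h2 : SFinite (ENNReal.ofReal (localAbs b) • lam.map q') := by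
      change SFinite ((localAbs b).toNNReal • lam.map q')
      infer_instance
    rw [hΛ]; infer_instance
  refine ⟨_, ?_, homogeneous_unique μ Λ hΛ0 hhom⟩
  refine ENNReal.div_ne_top ?_ (Metric.measure_ball_pos μ 0 one_pos).ne'
  rw [hpre _ measurableSet_ball]
  refine ENNReal.add_ne_top.2 ⟨hbdd 1, ENNReal.mul_ne_top ENNReal.ofReal_ne_top ?_⟩
  have : q' ⁻¹' Metric.ball 0 1 = q ⁻¹' Metric.ball 0 (1 / ‖b‖) := by
    ext x
    rw [Set.mem_preimage, Set.mem_preimage, mem_ball_zero_iff, mem_ball_zero_iff, hqq, norm_mul,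
      lt_div_iff₀' (norm_pos_iff.2 hb0)]
  rw [this]
  exact hbdd _

/-- The Weil constants of the norm form and of its multiple by a non-norm are opposite: the sum of
the two push-forward measures is a Haar measure, against which `ψ` integrates to `0`. -/
theorem weilConst_nonnorm (hψ : Continuous ψ) (hψ1 : ψ ≠ 1) (hμ : IsSelfDual k ψ μ)
    (h2 : (2 : F) ≠ 0) {d b : F} (hd : d ≠ 0) (hb0 : b ≠ 0) (hb : ¬ IsNormValue d b) :
    weilConst ψ μ (b • normMatrix d) = -weilConst ψ μ (normMatrix d) := by
  have hI : NormIndexLeTwo d := normIndexLeTwo k h2 hd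
  obtain ⟨C, hC, hmap⟩ := exists_map_norm_add μ h2 hd hI hb0 hb
  set S := normMatrix d with hSdef
  have haniso : ∀ x, quad S x = 0 → x = 0 := fun x => quad_normMatrix_anisotropic h2 hd hb
  have haniso' : ∀ x, quad (b • S) x = 0 → x = 0 := fun x hx => by
    rw [smul_quad] at hx
    exact haniso x ((mul_eq_zero.1 hx).resolve_left hb0)
  obtain ⟨g, hg, -, hg1⟩ := exists_bump k Unit
  set κ₀ : F → ℂ := fun x => (g fun _ => x : ℝ) with hκ₀
  have hκS : (fun v : Unit → F => κ₀ (v ())) ∈ schwartz k Unit := hg.mem_schwartz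
  have hκc : Continuous κ₀ := by
    have := (schwartz_continuous hg.mem_schwartz).comp
      (continuous_pi fun _ => continuous_id : Continuous fun x : F => fun _ : Unit => x)
    exact this
  have hκ0 : κ₀ 0 = 1 := by
    have : (fun _ : Unit => (0 : F)) = 0 := rfl
    simp [hκ₀, this, hg1]
  obtain ⟨R, hR⟩ : ∃ R, ∀ x, κ₀ x ≠ 0 → ‖x‖ ≤ R := by
    obtain ⟨R, hR⟩ := hg.1.isCompact.isBounded.exists_norm_le
    refine ⟨R, fun x hx => ?_⟩
    have := hR (fun _ => x) (subset_tsupport _ hx)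
    simpa using this
  -- compositions with anisotropic forms are Schwartz functions
  have hcomp : ∀ T : Matrix (Fin 2) (Fin 2) F, (∀ x, quad T x = 0 → x = 0) →
      (fun x => κ₀ (quad T x)) ∈ schwartz k (Fin 2) := by
    intro T hT
    obtain ⟨c, hc, hcq⟩ := exists_norm_sq_le_quad hT
    have e : ∀ x, quad T x = x ⬝ᵥ (((2 : F)⁻¹ • T) *ᵥ x) := by
      intro x
      rw [smul_mulVec, dotProduct_smul, smul_eq_mul, quad, pairing, div_eq_inv_mul]
    have hcs : HasCompactSupport fun x : Fin 2 → F =>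
        ((g fun _ => x ⬝ᵥ (((2 : F)⁻¹ • T) *ᵥ x) : ℝ) : ℂ) := by
      refine HasCompactSupport.of_support_subset_isCompact
        (isCompact_closedBall (0 : Fin 2 → F) (Real.sqrt (R / c))) fun x hx => ?_
      have h1 : κ₀ (quad T x) ≠ 0 := by rw [e]; exact hx
      rw [mem_closedBall_zero_iff]
      refine Real.le_sqrt_of_sq_le ?_
      rw [le_div_iff₀ hc]
      linarith [hcq x, hR _ h1]
    have h := (hg.comp_quadratic ((2 : F)⁻¹ • T) hcs).mem_schwartz
    convert h using 2 with x
    rw [e]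
  obtain ⟨e, he0, he1⟩ := NormedField.exists_norm_lt_one F
  have he : e ≠ 0 := norm_pos_iff.1 he0
  set s : ℕ → F := fun n => e ^ n with hs
  have hs0 : ∀ n, s n ≠ 0 := fun n => pow_ne_zero n he
  have hst : Tendsto s atTop (𝓝 0) := tendsto_pow_atTop_nhds_zero_of_norm_lt_one he1
  have hbu : IsUnit S.det := by rw [det_normMatrix]; exact (neg_ne_zero.2 hd).isUnit
  have hss : S.IsSymm := Matrix.isSymm_diagonal _
  have hbu' : IsUnit (b • S).det := by
    rw [det_smul]; exact (mul_ne_zero (pow_ne_zero _ hb0) hbu.ne_zero).isUnit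
  have hss' : (b • S).IsSymm := by
    rw [Matrix.IsSymm, transpose_smul, hss.eq]
  have l1 := tendsto_gauss μ hψ hψ1 hμ (isGaussConst_weilConst μ k hψ hψ1 h2 hbu hss)
    (hcomp S haniso) hs0 hst
  have l2 := (tendsto_gauss μ hψ hψ1 hμ (isGaussConst_weilConst μ k hψ hψ1 h2 hbu' hss')
    (hcomp (b • S) haniso') hs0 hst).const_mul (localAbs b : ℂ)
  have l3 := l1.add l2
  -- the sum of the two integrals is an integral against Haar measure
  have hsum : ∀ n, (∫ v, κ₀ (quad S (s n • v)) * (ψ (quad S v) : ℂ) ∂vol[μ]) +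
      (localAbs b : ℂ) *
        ∫ v, κ₀ (quad (b • S) (s n • v)) * (ψ (quad (b • S) v) : ℂ) ∂vol[μ] =
      C.toReal • ((localAbs (s n) ^ 2)⁻¹ • ∫ z, κ₀ z * (ψ ((s n ^ 2)⁻¹ * z) : ℂ) ∂μ) := by
    intro n
    set t := s n with ht
    have ht0 : t ^ 2 ≠ 0 := pow_ne_zero 2 (hs0 n)
    set G : F → ℂ := fun y => κ₀ (t ^ 2 * y) * (ψ y : ℂ) with hG
    have hGc : Continuous G := by
      exact (hκc.comp (continuous_const.mul continuous_id)).mul (continuous_char hψ continuous_id)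
    have hm : ∀ T : Matrix (Fin 2) (Fin 2) F,
        ∫ v, κ₀ (quad T (t • v)) * (ψ (quad T v) : ℂ) ∂vol[μ] =
          ∫ y, G y ∂vol[μ].map (quad T) := by
      intro T
      rw [integral_map (continuous_quad T).measurable.aemeasurable hGc.aestronglyMeasurable]
      simp only [quad_smul, hG]
    have hGi : Integrable G (C • μ) := by
      have hκi : Integrable κ₀ μ := (integrable_unit_iff μ κ₀).1 (schwartz_integrable μ hκS)
      have h1 : Integrable (fun y => κ₀ (t ^ 2 * y)) μ := by
        have he : MeasurableEmbedding fun x : F => t ^ 2 * x :=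
          (continuous_const_mul (t ^ 2)).measurableEmbedding (mul_right_injective₀ ht0)
        have h := map_mul_left_eq μ (Units.mk0 (t ^ 2) ht0)
        rw [Units.val_mk0] at h
        refine (he.integrable_map_iff (g := κ₀)).1 ?_
        rw [h]
        exact hκi.smul_measure ENNReal.ofReal_ne_top
      exact (integrable_mul_char hψ h1 continuous_id).smul_measure hC
    have hGi' := hGi
    rw [← hmap] at hGi'
    rw [hm, hm]
    have e1 : (localAbs b : ℂ) * ∫ y, G y ∂vol[μ].map (quad (b • S)) =
        ∫ y, G y ∂(ENNReal.ofReal (localAbs b) • vol[μ].map (quad (b • S))) := by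
      rw [integral_smul_measure, ENNReal.toReal_ofReal (localAbs_nonneg b), Complex.real_smul]
    rw [e1, ← integral_add_measure hGi'.left_of_add_measure hGi'.right_of_add_measure, hmap,
      integral_smul_measure]
    congr 1
    have e2 : ∀ y, G y = (fun z => κ₀ z * (ψ ((t ^ 2)⁻¹ * z) : ℂ)) (t ^ 2 * y) := by
      intro y
      simp only [hG, inv_mul_cancel_left₀ ht0]
    rw [funext e2, integral_comp_mul μ ht0, localAbs_pow]
  -- and tends to zero, because the Fourier transform decays
  have hzero : Tendsto (fun n => C.toReal •
      ((localAbs (s n) ^ 2)⁻¹ • ∫ z, κ₀ z * (ψ ((s n ^ 2)⁻¹ * z) : ℂ) ∂μ)) atTop (𝓝 0) := by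
    rw [← smul_zero C.toReal]
    refine Tendsto.const_smul ?_ _
    obtain ⟨C₁, hC₁, M, hM⟩ := modulus_le_norm_pow F
    have hFS := (isSchwartzOp_fourier μ hψ hψ1).mem hκS
    obtain ⟨D, hD⟩ := schwartz_decay hFS (M + 1)
    have hest : ∀ n, ‖(localAbs (s n) ^ 2)⁻¹ • ∫ z, κ₀ z * (ψ ((s n ^ 2)⁻¹ * z) : ℂ) ∂μ‖ ≤
        C₁ * D * ‖s n ^ 2‖ := by
      intro n
      have ht0 : s n ^ 2 ≠ 0 := pow_ne_zero 2 (hs0 n)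
      have h1 := hM (Units.mk0 _ (inv_ne_zero ht0))
      rw [← localAbs_units, Units.val_mk0, localAbs_inv, localAbs_pow] at h1
      have h2 := hD fun _ => (s n ^ 2)⁻¹
      rw [fourier_unit] at h2
      have h3 : ‖(fun _ : Unit => (s n ^ 2)⁻¹)‖ = ‖(s n ^ 2)⁻¹‖ := by
        simp
      rw [h3] at h2
      set A := ‖∫ z, κ₀ z * (ψ ((s n ^ 2)⁻¹ * z) : ℂ) ∂μ‖ with hA
      have hA0 : 0 ≤ A := norm_nonneg _
      rw [norm_smul, Real.norm_of_nonneg (by have := localAbs_nonneg (s n); positivity)]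
      set X := ‖(s n ^ 2)⁻¹‖ with hX
      have hX0 : 0 < X := norm_pos_iff.2 (inv_ne_zero ht0)
      have hXs : ‖s n ^ 2‖ = X⁻¹ := by rw [hX, norm_inv, inv_inv]
      rw [hXs]
      have h4 : (1 + X) ^ M * A * X ≤ D := by
        calc (1 + X) ^ M * A * X ≤ (1 + X) ^ M * A * (1 + X) := by
              gcongr; linarith
          _ = (1 + X) ^ (M + 1) * A := by ring
          _ ≤ D := h2
      calc (localAbs (s n) ^ 2)⁻¹ * A ≤ C₁ * (1 + X) ^ M * A := by gcongr
        _ = C₁ * ((1 + X) ^ M * A * X) * X⁻¹ := by field_simp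
        _ ≤ C₁ * D * X⁻¹ := by gcongr
    refine squeeze_zero_norm hest ?_
    have : Tendsto (fun n => C₁ * D * ‖s n ^ 2‖) atTop (𝓝 (C₁ * D * ‖(0 : F) ^ 2‖)) :=
      ((hst.pow 2).norm).const_mul _
    simpa using this
  have hlim := tendsto_nhds_unique (l3.congr hsum) hzero
  have hq0 : ∀ T : Matrix (Fin 2) (Fin 2) F, quad T 0 = 0 := fun T => by simp [quad, pairing]
  rw [hq0, hq0, hκ0, mul_one, mul_one, det_smul, localAbs_mul, localAbs_pow,
    Real.sqrt_mul (by have := localAbs_nonneg b; positivity), Fintype.card_fin,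
    Real.sqrt_sq (localAbs_nonneg b)] at hlim
  have hbp : (localAbs b : ℂ) ≠ 0 := Complex.ofReal_ne_zero.2 (localAbs_pos hb0).ne'
  have hdp : (Real.sqrt (localAbs S.det) : ℂ) ≠ 0 :=
    Complex.ofReal_ne_zero.2 (Real.sqrt_pos.2 (localAbs_pos hbu.ne_zero)).ne'
  push_cast at hlim
  field_simp at hlim
  linear_combination hlim

/-! ### Scaling of Weil constants -/

section Diagonalize

variable {F : Type*} [Field F] {κ : Type*} [Fintype κ] [DecidableEq κ]

theorem exists_diagonalization (h2 : (2 : F) ≠ 0) {S : Matrix κ κ F} (hs : S.IsSymm) :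
    ∃ (A : Matrix κ κ F) (d : κ → F), IsUnit A.det ∧ Aᵀ * S * A = diagonal d := by
  have : Invertible (2 : F) := invertibleOfNonzero h2
  have hB : LinearMap.IsSymm (Matrix.toBilin' S) := by
    refine ⟨fun x y => ?_⟩
    rw [Matrix.toBilin'_apply', Matrix.toBilin'_apply', dotProduct_mulVec,
      ← mulVec_transpose, hs.eq, dotProduct_comm]
    rfl
  obtain ⟨v₀, hv₀⟩ := LinearMap.BilinForm.exists_orthogonal_basis hB
  have hcard : Fintype.card (Fin (Module.finrank F (κ → F))) = Fintype.card κ := by simp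
  let e := Fintype.equivOfCardEq hcard
  let v := v₀.reindex e
  refine ⟨(Pi.basisFun F κ).toMatrix v, fun i => Matrix.toBilin' S (v i) (v i), ?_, ?_⟩
  · rw [← Module.Basis.det_apply]
    exact (Pi.basisFun F κ).isUnit_det v
  · ext i j
    have h1 : ((((Pi.basisFun F κ).toMatrix v)ᵀ * S * (Pi.basisFun F κ).toMatrix v) i j) =
        Matrix.toBilin' S (v i) (v j) := by
      rw [Matrix.toBilin'_apply', Matrix.mul_assoc, mul_apply]
      simp only [dotProduct, mulVec, mul_apply, transpose_apply,
        Module.Basis.toMatrix_apply, Pi.basisFun_repr]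
    rw [h1]
    rcases eq_or_ne i j with rfl | hij
    · rw [diagonal_apply_eq]
    · rw [diagonal_apply_ne _ hij]
      have := hv₀ (fun h => hij (e.symm.injective h) : e.symm i ≠ e.symm j)
      simpa [v] using this

end Diagonalize

variable (hψ : Continuous ψ) (hψ1 : ψ ≠ 1) (hμ : IsSelfDual k ψ μ) (h2 : (2 : F) ≠ 0)
  (hn : Even (Fintype.card κ))

include hψ hψ1 hμ h2 in
theorem weilConst_ne_zero {S : Matrix κ κ F} (hS : IsUnit S.det) (hs : S.IsSymm) :
    weilConst ψ μ S ≠ 0 :=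
  left_ne_zero_of_mul_eq_one (weilConst_mul_neg μ hψ hψ1 hμ h2 hS hs)

include hψ hψ1 hμ h2 in
theorem weilConst₁_ne_zero {a : F} (ha : a ≠ 0) : weilConst₁ ψ μ a ≠ 0 :=
  weilConst_ne_zero μ hψ hψ1 hμ h2 (by simpa using ha) (Matrix.isSymm_diagonal _)

include hψ hψ1 hμ h2 in
/-- Compare `t ⟨1, u⟩` with `⟨1, u⟩`: they are isometric if `t` is a value of this norm form, and
otherwise their constants are opposite. -/
theorem weilConst₁_mul {t u : F} (ht : t ≠ 0) (hu : u ≠ 0) :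
    weilConst₁ ψ μ t * weilConst₁ ψ μ (t * u) =
      hilbertSymbol t (-u) * (weilConst₁ ψ μ 1 * weilConst₁ ψ μ u) := by
  set d := -u with hd
  have hd0 : d ≠ 0 := neg_ne_zero.2 hu
  have hS : IsUnit (normMatrix d).det := by
    rw [det_normMatrix]; exact (neg_ne_zero.2 hd0).isUnit
  have e1 : weilConst ψ μ (normMatrix d) = weilConst₁ ψ μ 1 * weilConst₁ ψ μ u := by
    rw [normMatrix, weilConst_diagonal μ k hψ hψ1 h2 (fun i => by fin_cases i <;> simp [hd0])]
    simp [hd]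
  have e2 : weilConst ψ μ (t • normMatrix d) = weilConst₁ ψ μ t * weilConst₁ ψ μ (t * u) := by
    have : t • normMatrix d = diagonal ![t, t * u] := by
      ext i j
      fin_cases i <;> fin_cases j <;> simp [hd]
    rw [this, weilConst_diagonal μ k hψ hψ1 h2 (fun i => by fin_cases i <;> simp [ht, hu])]
    simp
  rw [← e1, ← e2, hilbertSymbol_eq_normSign h2 hd0]
  by_cases h : IsNormValue d t
  · rw [normSign_eq_one_iff.2 h, Int.cast_one, one_mul]
    obtain ⟨x, y, rfl⟩ := h
    have := mulMatrix_congr d ![x, y]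
    simp only [cons_val_zero, cons_val_one] at this
    rw [← this]
    refine weilConst_congr μ k hψ hψ1 h2 hS (Matrix.isSymm_diagonal _) ?_
    rw [det_mulMatrix]
    exact ht.isUnit
  · rw [normSign_eq_neg_one h, weilConst_nonnorm μ hψ hψ1 hμ h2 hd0 ht h]
    simp

theorem hilbertSymbol_mul_sq_right (k : LocalKind F) (h2 : (2 : F) ≠ 0) {t x s : F} (ht : t ≠ 0)
    (hx : x ≠ 0) (hs : s ≠ 0) : hilbertSymbol t (x * s ^ 2) = hilbertSymbol t x := by
  rw [hilbertSymbol_mul_right k h2 ht hx (pow_ne_zero 2 hs),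
    hilbertSymbol_comm h2 ht (pow_ne_zero 2 hs), hilbertSymbol_sq_left h2 s ht, mul_one]

theorem hilbertSymbol_prod_right (k : LocalKind F) (h2 : (2 : F) ≠ 0) {t : F} (ht : t ≠ 0)
    {ι : Type*} (s : Finset ι) {d : ι → F} (hd : ∀ i, d i ≠ 0) :
    hilbertSymbol t (∏ i ∈ s, d i) = ∏ i ∈ s, hilbertSymbol t (d i) := by
  classical
  induction s using Finset.induction_on with
  | empty =>
    rw [Finset.prod_empty, Finset.prod_empty, hilbertSymbol_comm h2 ht one_ne_zero,
      hilbertSymbol_one_left h2 ht]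
  | insert i s hi ih =>
    rw [Finset.prod_insert hi, Finset.prod_insert hi, hilbertSymbol_mul_right k h2 ht (hd i)
      (Finset.prod_ne_zero_iff.2 fun j _ => hd j), ih]

theorem hilbertSymbol_pow_right (k : LocalKind F) (h2 : (2 : F) ≠ 0) {t x : F} (ht : t ≠ 0)
    (hx : x ≠ 0) (m : ℕ) : hilbertSymbol t (x ^ m) = hilbertSymbol t x ^ m := by
  have := hilbertSymbol_prod_right k h2 ht (Finset.range m) (d := fun _ => x) fun _ => hx
  simpa using this

include hψ hψ1 hμ h2 hn in
/-- The Weil constant of `t S` for even rank: on diagonal forms this is a product of the identities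
for binary forms. -/
theorem weilConst_smul {S : Matrix κ κ F} (hS : IsUnit S.det)
    (hs : S.IsSymm) {t : F} (ht : t ≠ 0) :
    weilConst ψ μ (t • S) = quadChar S t * weilConst ψ μ S := by
  obtain ⟨A, d, hA, hd⟩ := exists_diagonalization h2 hs
  obtain ⟨m, hm⟩ := hn
  have hdet : A.det ^ 2 * S.det = ∏ i, d i := by
    rw [← det_diagonal, ← hd, det_mul, det_mul, det_transpose]
    ring
  have hd0 : ∀ i, d i ≠ 0 := by
    have : ∏ i, d i ≠ 0 := by
      rw [← hdet]; exact mul_ne_zero (pow_ne_zero 2 hA.ne_zero) hS.ne_zero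
    exact fun i => Finset.prod_ne_zero_iff.1 this i (Finset.mem_univ i)
  have htS : IsUnit (t • S).det := by
    rw [det_smul]; exact (mul_ne_zero (pow_ne_zero _ ht) hS.ne_zero).isUnit
  have hts : (t • S).IsSymm := by rw [Matrix.IsSymm, transpose_smul, hs.eq]
  have e1 : Aᵀ * (t • S) * A = diagonal fun i => t * d i := by
    rw [Matrix.mul_smul, Matrix.smul_mul, hd, ← diagonal_smul]
    rfl
  rw [← weilConst_congr μ k hψ hψ1 h2 htS hts hA, ← weilConst_congr μ k hψ hψ1 h2 hS hs hA, e1, hd,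
    weilConst_diagonal μ k hψ hψ1 h2 hd0,
    weilConst_diagonal μ k hψ hψ1 h2 fun i => mul_ne_zero ht (hd0 i)]
  have hft := weilConst₁_ne_zero μ hψ hψ1 hμ h2 ht
  have hf1 := weilConst₁_ne_zero μ hψ hψ1 hμ h2 (one_ne_zero (α := F))
  have e2 : ∀ i, weilConst₁ ψ μ (t * d i) =
      hilbertSymbol t (-d i) * (weilConst₁ ψ μ 1 / weilConst₁ ψ μ t) * weilConst₁ ψ μ (d i) := by
    intro i
    have := weilConst₁_mul μ hψ hψ1 hμ h2 ht (hd0 i)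
    field_simp
    linear_combination this
  have e3 : (weilConst₁ ψ μ 1 / weilConst₁ ψ μ t) ^ 2 = hilbertSymbol t (-1) := by
    have h := weilConst₁_mul μ hψ hψ1 hμ h2 ht (one_ne_zero (α := F))
    rw [mul_one] at h
    have h' := hilbertSymbol_mul_self h2 t (neg_ne_zero.2 (one_ne_zero (α := F)))
    rw [div_pow, div_eq_iff (pow_ne_zero 2 hft)]
    linear_combination -hilbertSymbol t (-1) * h + (-weilConst₁ ψ μ 1 ^ 2) * h'
  simp only [e2, Finset.prod_mul_distrib, Finset.prod_const, Finset.card_univ]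
  congr 1
  rw [← hilbertSymbol_prod_right k h2 ht _ (fun i => neg_ne_zero.2 (hd0 i)), hm, ← two_mul, pow_mul,
    e3, ← hilbertSymbol_pow_right k h2 ht (neg_ne_zero.2 one_ne_zero), quadChar, Finset.prod_neg,
    Finset.card_univ, hm, ← two_mul, pow_mul, neg_one_sq, one_pow, one_mul, ← hdet,
    Nat.mul_div_cancel_left m two_pos, mul_comm (A.det ^ 2),
    hilbertSymbol_mul_sq_right k h2 ht hS.ne_zero hA.ne_zero, mul_comm,
    hilbertSymbol_mul_right k h2 ht (pow_ne_zero _ (neg_ne_zero.2 one_ne_zero)) hS.ne_zero]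

theorem neg_one_pow_mul_det_ne_zero {S : Matrix κ κ F} (hS : IsUnit S.det) (m : ℕ) :
    (-1) ^ m * S.det ≠ 0 :=
  mul_ne_zero (pow_ne_zero _ (neg_ne_zero.2 one_ne_zero)) hS.ne_zero

theorem quadChar_mul (k : LocalKind F) (h2 : (2 : F) ≠ 0) {S : Matrix κ κ F} (hS : IsUnit S.det)
    {a b : F} (ha : a ≠ 0) (hb : b ≠ 0) : quadChar S (a * b) = quadChar S a * quadChar S b :=
  hilbertSymbol_mul_left k h2 ha hb (neg_one_pow_mul_det_ne_zero hS _)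

theorem quadChar_one (h2 : (2 : F) ≠ 0) {S : Matrix κ κ F} (hS : IsUnit S.det) :
    quadChar S 1 = 1 :=
  hilbertSymbol_one_left h2 (neg_one_pow_mul_det_ne_zero hS _)

theorem quadChar_mul_self (h2 : (2 : F) ≠ 0) {S : Matrix κ κ F} (hS : IsUnit S.det) (a : F) :
    quadChar S a * quadChar S a = 1 :=
  hilbertSymbol_mul_self h2 a (neg_one_pow_mul_det_ne_zero hS _)

theorem quadChar_inv (k : LocalKind F) (h2 : (2 : F) ≠ 0) {S : Matrix κ κ F} (hS : IsUnit S.det)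
    {a : F} (ha : a ≠ 0) : quadChar S a⁻¹ = quadChar S a := by
  have h1 : quadChar S a * quadChar S a⁻¹ = 1 := by
    rw [← quadChar_mul k h2 hS ha (inv_ne_zero ha), mul_inv_cancel₀ ha, quadChar_one h2 hS]
  have h3 := quadChar_mul_self h2 hS a
  linear_combination quadChar S a * h1 - quadChar S a⁻¹ * h3

include hψ hψ1 hμ h2 hn in
theorem weilConst_sq {S : Matrix κ κ F} (hS : IsUnit S.det)
    (hs : S.IsSymm) : weilConst ψ μ S ^ 2 * quadChar S (-1) = 1 := by
  have h1 := weilConst_mul_neg μ hψ hψ1 hμ h2 hS hs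
  have h3 : -S = (-1 : F) • S := by simp
  rw [h3, weilConst_smul μ hψ hψ1 hμ h2 hn hS hs (neg_ne_zero.2 one_ne_zero)] at h1
  linear_combination h1

/-- The character of the quadratic space is trivial on similitude norms. -/
theorem quadChar_similitude (μ : Measure F) [μ.IsAddHaarMeasure] (hψ : Continuous ψ)
    (hψ1 : ψ ≠ 1) (hμ : IsSelfDual k ψ μ)
    (h2 : (2 : F) ≠ 0) (hn : Even (Fintype.card κ)) {S : Matrix κ κ F} (hS : IsUnit S.det)
    (hs : S.IsSymm) {A : Matrix κ κ F} (hA : IsUnit A.det) {l : F} (hl : l ≠ 0)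
    (h : Aᵀ * S * A = l • S) : quadChar S l = 1 := by
  have h1 := weilConst_congr μ k hψ hψ1 h2 hS hs hA
  rw [h, weilConst_smul μ hψ hψ1 hμ h2 hn hS hs hl] at h1
  exact mul_right_cancel₀ (weilConst_ne_zero μ hψ hψ1 hμ h2 hS hs) (by rw [h1, one_mul])

/-! ### The Weil index -/

theorem integral_quadMeasure {E : Type*} [NormedAddCommGroup E] [NormedSpace ℝ E]
    {S : Matrix κ κ F} (hS : IsUnit S.det) (f : (κ → F) → E) :
    ∫ x, f x ∂quadMeasure μ hS =
      Real.sqrt (localAbs S.det) • ∫ x, f x ∂vol[μ] := by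
  rw [quadMeasure, integral_smul_measure, ENNReal.toReal_ofReal
    (Real.rpow_nonneg (modulus_pos _).le _), ← Real.sqrt_eq_rpow, ← localAbs_units,
    IsUnit.unit_spec]

theorem integrable_quadMeasure {E : Type*} [NormedAddCommGroup E]
    {S : Matrix κ κ F} (hS : IsUnit S.det) {f : (κ → F) → E}
    (hf : Integrable f vol[μ]) : Integrable f (quadMeasure μ hS) :=
  hf.smul_measure ENNReal.ofReal_ne_top

theorem pairing_eq {S : Matrix κ κ F} (hs : S.IsSymm) (x y : κ → F) :
    pairing S x y = (S *ᵥ x) ⬝ᵥ y := by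
  rw [pairing, dotProduct_mulVec, ← mulVec_transpose, hs.eq]

/-- The Fourier transform with respect to the bilinear form of `S`. -/
def quadFourier (ψ : AddChar F Circle) (μ : Measure F) {S : Matrix κ κ F} (hS : IsUnit S.det)
    (φ : (κ → F) → ℂ) (x : κ → F) : ℂ :=
  ∫ y, φ y * (ψ (pairing S x y) : ℂ) ∂quadMeasure μ hS

theorem quadFourier_eq {S : Matrix κ κ F} (hS : IsUnit S.det) (hs : S.IsSymm)
    (φ : (κ → F) → ℂ) (x : κ → F) :
    quadFourier ψ μ hS φ x = Real.sqrt (localAbs S.det) • fourier ψ μ φ (S *ᵥ x) := by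
  rw [quadFourier, integral_quadMeasure, fourier]
  simp only [pairing_eq hs]

theorem inv_transpose_mul {S : Matrix κ κ F} (hS : IsUnit S.det) (hs : S.IsSymm) (s : F) :
    (S⁻¹)ᵀ * (s • S) * S⁻¹ = s • S⁻¹ := by
  rw [transpose_nonsing_inv, hs.eq, Matrix.mul_smul, Matrix.smul_mul,
    nonsing_inv_mul _ hS, Matrix.one_mul]

theorem isUnit_det_inv {S : Matrix κ κ F} (hS : IsUnit S.det) : IsUnit (S⁻¹).det := by
  rw [det_nonsing_inv, Ring.inverse_eq_inv']
  exact (inv_ne_zero hS.ne_zero).isUnit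

include hψ hψ1 hμ h2 in
/-- Fourier transform of the Gaussian `ψ(s Q)`, in terms of the Weil constant of `Q`. -/
theorem quadFourier_gauss {m : ℕ} (hm : Fintype.card κ = 2 * m) {S : Matrix κ κ F}
    (hS : IsUnit S.det) (hs : S.IsSymm) {s : F} (hs0 : s ≠ 0) {φ : (κ → F) → ℂ}
    (hφ : Integrable φ vol[μ])
    (hF : Integrable (fourier ψ μ φ) vol[μ]) :
    ∫ x, quadFourier ψ μ hS φ x * (ψ (s * quad S x) : ℂ) ∂quadMeasure μ hS =
      weilConst ψ μ S * quadChar S s * ((localAbs s ^ m)⁻¹ : ℝ) *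
        ∫ y, φ y * (ψ (-(quad S y / s)) : ℂ) ∂quadMeasure μ hS := by
  have hn : Even (Fintype.card κ) := ⟨m, by omega⟩
  have hSi := isUnit_det_inv hS
  have hdet : (s • S⁻¹).det = s ^ (2 * m) * (S.det)⁻¹ := by
    rw [det_smul, det_nonsing_inv, Ring.inverse_eq_inv', hm]
  have hT : IsUnit (s • S⁻¹).det := by
    rw [hdet]; exact (mul_ne_zero (pow_ne_zero _ hs0) (inv_ne_zero hS.ne_zero)).isUnit
  have hsi : (S⁻¹).IsSymm := by rw [Matrix.IsSymm, transpose_nonsing_inv, hs.eq]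
  have hTs : (s • S⁻¹).IsSymm := by rw [Matrix.IsSymm, transpose_smul, hsi.eq]
  have hsS : IsUnit (s • S).det := by
    rw [det_smul]; exact (mul_ne_zero (pow_ne_zero _ hs0) hS.ne_zero).isUnit
  have hsSs : (s • S).IsSymm := by rw [Matrix.IsSymm, transpose_smul, hs.eq]
  have hw : weilConst ψ μ (s • S⁻¹) = quadChar S s * weilConst ψ μ S := by
    rw [← inv_transpose_mul hS hs s, weilConst_congr μ k hψ hψ1 h2 hsS hsSs hSi,
      weilConst_smul μ hψ hψ1 hμ h2 hn hS hs hs0]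
  have hTinv : (s • S⁻¹)⁻¹ = s⁻¹ • S := by
    refine Matrix.inv_eq_right_inv ?_
    rw [Matrix.smul_mul, Matrix.mul_smul, smul_smul, mul_inv_cancel₀ hs0, one_smul,
      nonsing_inv_mul _ hS]
  have hG := isGaussConst_weilConst μ k hψ hψ1 h2 hT hTs φ hφ hF
  have hq : ∀ x, quad (s • S⁻¹) (S *ᵥ x) = s * quad S x := by
    intro x
    rw [smul_quad, ← quad_congr, hs.eq, mul_nonsing_inv _ hS, Matrix.one_mul]
  have h1 := integral_comp_mulVec' μ hS fun z => fourier ψ μ φ z * (ψ (quad (s • S⁻¹) z) : ℂ)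
  rw [hG, hw] at h1
  simp only [hq, hTinv, smul_quad] at h1
  rw [integral_quadMeasure, integral_quadMeasure]
  simp only [quadFourier_eq μ hS hs, smul_mul_assoc]
  rw [integral_smul, h1]
  have hD := localAbs_pos hS.ne_zero
  have hsp := localAbs_pos hs0
  have e1 : Real.sqrt (localAbs (s • S⁻¹).det) =
      localAbs s ^ m * (Real.sqrt (localAbs S.det))⁻¹ := by
    rw [hdet, localAbs_mul, localAbs_pow, localAbs_inv, Real.sqrt_mul (by positivity),
      Real.sqrt_inv, mul_comm 2 m, pow_mul, Real.sqrt_sq (by positivity)]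
  rw [e1]
  have hr : Real.sqrt (localAbs S.det) * Real.sqrt (localAbs S.det) = localAbs S.det :=
    Real.mul_self_sqrt hD.le
  set r := Real.sqrt (localAbs S.det) with hrdef
  have hr0 : r ≠ 0 := (Real.sqrt_pos.2 hD).ne'
  rw [smul_smul, smul_smul, hr, mul_inv_cancel₀ hD.ne', one_smul, Complex.real_smul]
  have e2 : ∀ y, s⁻¹ * quad S y = quad S y / s := fun y => by field_simp
  simp only [e2]
  push_cast
  field_simp

include hψ hψ1 hμ h2 hn in
theorem isWeilIndex_weilConst {S : Matrix κ κ F}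
    (hS : IsUnit S.det) (hs : S.IsSymm) : IsWeilIndex k ψ μ hS (weilConst ψ μ S) := by
  obtain ⟨m, hm⟩ := hn
  intro φ hφ
  have h := quadFourier_gauss μ hψ hψ1 hμ h2 (hm.trans (two_mul m).symm) hS hs one_ne_zero
    (schwartz_integrable μ hφ) (integrable_fourier μ hψ hψ1 hφ)
  simpa [quadFourier, quadChar_one h2 hS] using h

include hψ hψ1 hμ h2 hn in
theorem weilIndex_eq {S : Matrix κ κ F}
    (hS : IsUnit S.det) (hs : S.IsSymm) : weilIndex k ψ μ hS = weilConst ψ μ S := by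
  have h1 := isWeilIndex_weilConst μ hψ hψ1 hμ h2 hn hS hs
  have h3 : IsWeilIndex k ψ μ hS (weilIndex k ψ μ hS) := Classical.epsilon_spec ⟨_, h1⟩
  obtain ⟨φ, hφ, hne⟩ := exists_gauss_test μ k hψ S⁻¹
  rw [nonsing_inv_nonsing_inv _ hS] at hne
  have h4 := (h3 φ hφ).symm.trans (h1 φ hφ)
  refine mul_right_cancel₀ ?_ h4
  rw [integral_quadMeasure]
  exact smul_ne_zero (Real.sqrt_pos.2 (localAbs_pos hS.ne_zero)).ne' hne

include hψ hψ1 hμ in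
theorem quadFourier_inversion {S : Matrix κ κ F} (hS : IsUnit S.det) (hs : S.IsSymm) {φ : (κ → F) → ℂ}
    (hφ : φ ∈ schwartz k κ) (a : κ → F) :
    ∫ x, quadFourier ψ μ hS φ x * (ψ (-pairing S a x) : ℂ) ∂quadMeasure μ hS = φ a := by
  have hD := localAbs_pos hS.ne_zero
  have h1 := integral_comp_mulVec' μ hS fun z => fourier ψ μ φ z * (ψ (-(z ⬝ᵥ a)) : ℂ)
  rw [fourier_inversion μ hψ hψ1 hμ hφ] at h1
  rw [integral_quadMeasure]
  simp only [quadFourier_eq μ hS hs, smul_mul_assoc]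
  rw [integral_smul, smul_smul, Real.mul_self_sqrt hD.le]
  have e : ∀ x, pairing S a x = (S *ᵥ x) ⬝ᵥ a := fun x => by rw [pairing, dotProduct_comm]
  simp only [e]
  rw [h1, smul_smul, mul_inv_cancel₀ hD.ne', one_smul]

/-! ### The Weil representation -/

section SpecialLinear

variable {F : Type*} [Field F]

/-- The Weyl element `(0, 1; -1, 0)`. -/
def weylElt : SL(2, F) := ⟨!![0, 1; -1, 0], by simp [det_fin_two]⟩

theorem sl_mul_apply (g h : SL(2, F)) (i j : Fin 2) :
    (g * h) i j = g i 0 * h 0 j + g i 1 * h 1 j := by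
  change (g.1 * h.1) i j = _
  rw [mul_apply, Fin.sum_univ_two]

end SpecialLinear

theorem half_rpow {m n : ℕ} (hm : n = 2 * m) {x : ℝ} (hx : 0 < x) :
    x ^ ((n : ℝ) / 2) = x ^ m ∧ x ^ (-(n : ℝ) / 2) = (x ^ m)⁻¹ := by
  have : (n : ℝ) / 2 = m := by rw [hm]; push_cast; ring
  rw [neg_div, this, Real.rpow_neg hx.le, Real.rpow_natCast]
  exact ⟨rfl, rfl⟩

theorem weilRep_of_eq_zero {m : ℕ} (hm : Fintype.card κ = 2 * m) {S : Matrix κ κ F}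
    (hS : IsUnit S.det) {g : SL(2, F)} (hc : g 1 0 = 0) (f : (κ → F) → ℂ) (x : κ → F) :
    weilRep k ψ μ hS g f x = quadChar S (g 0 0) * ((localAbs (g 0 0) ^ m : ℝ) : ℂ) *
      (ψ (g 0 0 * g 0 1 * quad S x) : ℂ) * f (g 0 0 • x) := by
  rw [weilRep, dif_pos hc, (half_rpow hm (modulus_pos _)).1, ← localAbs_units, Units.val_mk0]

include hψ hψ1 hμ h2 in
theorem weilRep_of_ne_zero {m : ℕ} (hm : Fintype.card κ = 2 * m) {S : Matrix κ κ F}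
    (hS : IsUnit S.det) (hs : S.IsSymm) {g : SL(2, F)} (hc : g 1 0 ≠ 0) (f : (κ → F) → ℂ)
    (x : κ → F) :
    weilRep k ψ μ hS g f x = weilConst ψ μ S * quadChar S (-g 1 0) *
      (((localAbs (g 1 0) ^ m)⁻¹ : ℝ) : ℂ) * (ψ (g 0 0 * quad S x / g 1 0) : ℂ) *
      ∫ y, f y * (ψ ((g 1 1 * quad S y - pairing S x y) / g 1 0) : ℂ) ∂quadMeasure μ hS := by
  rw [weilRep, dif_neg hc, (half_rpow hm (modulus_pos _)).2, ← localAbs_units, Units.val_mk0,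
    weilIndex_eq μ hψ hψ1 hμ h2 ⟨m, by omega⟩ hS hs]

theorem char_mul (ψ : AddChar F Circle) (a b : F) : (ψ (a + b) : ℂ) = ψ a * ψ b := by
  rw [AddChar.map_add_eq_mul, Circle.coe_mul]

theorem integral_quadMeasure_smul {m : ℕ} (hm : Fintype.card κ = 2 * m) {S : Matrix κ κ F}
    (hS : IsUnit S.det) {a : F} (ha : a ≠ 0) (f : (κ → F) → ℂ) :
    ∫ x, f (a • x) ∂quadMeasure μ hS =
      (((localAbs a ^ m)⁻¹ * (localAbs a ^ m)⁻¹ : ℝ) : ℂ) * ∫ x, f x ∂quadMeasure μ hS := by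
  rw [integral_quadMeasure, integral_quadMeasure, integral_comp_smul μ ha, smul_comm, hm,
    two_mul, pow_add, mul_inv, Complex.real_smul]

theorem weilRep_upperUnip (h2 : (2 : F) ≠ 0) {m : ℕ} (hm : Fintype.card κ = 2 * m)
    {S : Matrix κ κ F} (hS : IsUnit S.det) (t : F) (f : (κ → F) → ℂ) (x : κ → F) :
    weilRep k ψ μ hS (upperUnip t) f x = (ψ (t * quad S x) : ℂ) * f x := by
  rw [weilRep_of_eq_zero μ hm hS (by simp [upperUnip])]
  simp [upperUnip, quadChar_one h2 hS]

theorem weilRep_diagTorus {m : ℕ} (hm : Fintype.card κ = 2 * m)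
    {S : Matrix κ κ F} (hS : IsUnit S.det) (a : Fˣ) (f : (κ → F) → ℂ) (x : κ → F) :
    weilRep k ψ μ hS (diagTorus a) f x =
      quadChar S a * ((localAbs (a : F) ^ m : ℝ) : ℂ) * f ((a : F) • x) := by
  rw [weilRep_of_eq_zero μ hm hS (by simp [diagTorus])]
  simp [diagTorus]

include hψ hψ1 hμ h2 in
theorem weilRep_weylElt {m : ℕ} (hm : Fintype.card κ = 2 * m) {S : Matrix κ κ F}
    (hS : IsUnit S.det) (hs : S.IsSymm) (f : (κ → F) → ℂ) (x : κ → F) :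
    weilRep k ψ μ hS weylElt f x = weilConst ψ μ S * quadFourier ψ μ hS f x := by
  rw [weilRep_of_ne_zero μ hψ hψ1 hμ h2 hm hS hs (by simp [weylElt])]
  simp [weylElt, quadFourier, quadChar_one h2 hS]

include hψ hψ1 hμ h2 in
theorem weilRep_upperUnip_mul {m : ℕ} (hm : Fintype.card κ = 2 * m) {S : Matrix κ κ F}
    (hS : IsUnit S.det) (hs : S.IsSymm) (t : F) (g : SL(2, F)) (f : (κ → F) → ℂ) :
    weilRep k ψ μ hS (upperUnip t * g) f =
      weilRep k ψ μ hS (upperUnip t) (weilRep k ψ μ hS g f) := by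
  ext x
  have e00 : (upperUnip t * g) 0 0 = g 0 0 + t * g 1 0 := by
    rw [sl_mul_apply]; simp [upperUnip]
  have e01 : (upperUnip t * g) 0 1 = g 0 1 + t * g 1 1 := by
    rw [sl_mul_apply]; simp [upperUnip]
  have e10 : (upperUnip t * g) 1 0 = g 1 0 := by
    rw [sl_mul_apply]; simp [upperUnip]
  have e11 : (upperUnip t * g) 1 1 = g 1 1 := by
    rw [sl_mul_apply]; simp [upperUnip]
  have hdet := g.det_coe
  rw [det_fin_two] at hdet
  rw [weilRep_upperUnip μ h2 hm hS]
  by_cases hc : g 1 0 = 0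
  · rw [weilRep_of_eq_zero μ hm hS (e10.trans hc), weilRep_of_eq_zero μ hm hS hc, e00, e01, hc,
      mul_zero, add_zero]
    rw [hc, mul_zero, sub_zero] at hdet
    have : g 0 0 * (g 0 1 + t * g 1 1) * quad S x =
        t * quad S x + g 0 0 * g 0 1 * quad S x := by linear_combination t * quad S x * hdet
    rw [this, char_mul]
    ring
  · rw [weilRep_of_ne_zero μ hψ hψ1 hμ h2 hm hS hs (by rwa [e10]),
      weilRep_of_ne_zero μ hψ hψ1 hμ h2 hm hS hs hc, e00, e10, e11]
    have : (g 0 0 + t * g 1 0) * quad S x / g 1 0 =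
        t * quad S x + g 0 0 * quad S x / g 1 0 := by field_simp; ring
    rw [this, char_mul]
    ring

include hψ hψ1 hμ h2 in
/-- Multiplicativity of the quadratic character. -/
theorem weilRep_diagTorus_mul {m : ℕ} (hm : Fintype.card κ = 2 * m) {S : Matrix κ κ F}
    (hS : IsUnit S.det) (hs : S.IsSymm) (a : Fˣ) (g : SL(2, F)) (f : (κ → F) → ℂ) :
    weilRep k ψ μ hS (diagTorus a * g) f =
      weilRep k ψ μ hS (diagTorus a) (weilRep k ψ μ hS g f) := by
  ext x
  have ha := a.ne_zero
  have e00 : (diagTorus a * g) 0 0 = a * g 0 0 := by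
    rw [sl_mul_apply]; simp [diagTorus]
  have e01 : (diagTorus a * g) 0 1 = a * g 0 1 := by
    rw [sl_mul_apply]; simp [diagTorus]
  have e10 : (diagTorus a * g) 1 0 = (a : F)⁻¹ * g 1 0 := by
    rw [sl_mul_apply]; simp [diagTorus]
  have e11 : (diagTorus a * g) 1 1 = (a : F)⁻¹ * g 1 1 := by
    rw [sl_mul_apply]; simp [diagTorus]
  have hdet := g.det_coe
  rw [det_fin_two] at hdet
  rw [weilRep_diagTorus μ hm hS]
  by_cases hc : g 1 0 = 0
  · rw [weilRep_of_eq_zero μ hm hS (by rw [e10, hc, mul_zero]), weilRep_of_eq_zero μ hm hS hc,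
      e00, e01, quad_smul, smul_smul, mul_comm (g 0 0) (a : F)]
    rw [hc, mul_zero, sub_zero] at hdet
    have h0 : g 0 0 ≠ 0 := left_ne_zero_of_mul_eq_one hdet
    have : (a : F) * g 0 0 * (a * g 0 1) * quad S x = g 0 0 * g 0 1 * (a ^ 2 * quad S x) := by ring
    rw [this, quadChar_mul k h2 hS ha h0, localAbs_mul, mul_pow]
    push_cast
    ring
  · rw [weilRep_of_ne_zero μ hψ hψ1 hμ h2 hm hS hs
        (by rw [e10]; exact mul_ne_zero (inv_ne_zero ha) hc),
      weilRep_of_ne_zero μ hψ hψ1 hμ h2 hm hS hs hc, e00, e10, e11, quad_smul]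
    have e1 : ∀ y, ((a : F)⁻¹ * g 1 1 * quad S y - pairing S x y) / ((a : F)⁻¹ * g 1 0) =
        (g 1 1 * quad S y - pairing S ((a : F) • x) y) / g 1 0 := by
      intro y
      have : pairing S ((a : F) • x) y = a * pairing S x y := by
        simp [pairing, smul_dotProduct]
      rw [this]
      field_simp
    have e2 : (a : F) * g 0 0 * quad S x / ((a : F)⁻¹ * g 1 0) =
        g 0 0 * (a ^ 2 * quad S x) / g 1 0 := by field_simp
    have e3 : -((a : F)⁻¹ * g 1 0) = (a : F)⁻¹ * -g 1 0 := by ring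
    simp only [e1]
    rw [e2, e3, quadChar_mul k h2 hS (inv_ne_zero ha) (neg_ne_zero.2 hc), quadChar_inv k h2 hS ha,
      localAbs_mul, localAbs_inv, mul_pow, mul_inv, inv_pow, inv_inv]
    push_cast
    ring

include hψ hψ1 in
theorem integrable_fourier_mul_char {φ : (κ → F) → ℂ}
    (hφ : φ ∈ schwartz k κ) (u : κ → F) :
    Integrable (fourier ψ μ fun y => φ y * (ψ (u ⬝ᵥ y) : ℂ)) vol[μ] := by
  have e : (fourier ψ μ fun y => φ y * (ψ (u ⬝ᵥ y) : ℂ)) = fun x => fourier ψ μ φ (x + u) := by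
    ext x
    refine integral_congr_forall fun y => ?_
    rw [add_dotProduct, char_mul]
    ring
  rw [e]
  exact (integrable_fourier μ hψ hψ1 hφ).comp_add_right u

theorem quad_add {S : Matrix κ κ F} (hs : S.IsSymm) (h2 : (2 : F) ≠ 0) (x y : κ → F) :
    quad S (x + y) = quad S x + pairing S y x + quad S y := by
  have : pairing S x y = pairing S y x := by rw [pairing_eq hs, pairing, dotProduct_comm]
  simp only [quad, pairing, mulVec_add, dotProduct_add, add_dotProduct] at this ⊢
  rw [this]
  field_simp
  ring

include hψ hψ1 hμ h2 in
/-- If `c = 0` this is a substitution. If `a = 0` it is Fourier inversion. Otherwise complete the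
square and use the Fourier transform of a Gaussian. In the last two cases the product of the two
Weil indices is accounted for by `γ² = χ(-1)`. -/
theorem weilRep_weylElt_mul {m : ℕ} (hm : Fintype.card κ = 2 * m) {S : Matrix κ κ F}
    (hS : IsUnit S.det) (hs : S.IsSymm) (g : SL(2, F)) {f : (κ → F) → ℂ}
    (hf : f ∈ schwartz k κ) :
    weilRep k ψ μ hS (weylElt * g) f =
      weilRep k ψ μ hS weylElt (weilRep k ψ μ hS g f) := by
  ext x
  have e00 : (weylElt * g : SL(2, F)) 0 0 = g 1 0 := by
    rw [sl_mul_apply]; simp [weylElt]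
  have e01 : (weylElt * g : SL(2, F)) 0 1 = g 1 1 := by
    rw [sl_mul_apply]; simp [weylElt]
  have e10 : (weylElt * g : SL(2, F)) 1 0 = -g 0 0 := by
    rw [sl_mul_apply]; simp [weylElt]
  have e11 : (weylElt * g : SL(2, F)) 1 1 = -g 0 1 := by
    rw [sl_mul_apply]; simp [weylElt]
  have hdet := g.det_coe
  rw [det_fin_two] at hdet
  rw [weilRep_weylElt μ hψ hψ1 hμ h2 hm hS hs]
  have hn : Even (Fintype.card κ) := ⟨m, by omega⟩
  have hγ := weilConst_sq μ hψ hψ1 hμ h2 hn hS hs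
  set γ := weilConst ψ μ S with hγdef
  generalize ha : g 0 0 = a at *
  generalize hb : g 0 1 = b at *
  generalize hc : g 1 0 = c at *
  generalize hd : g 1 1 = d at *
  have hone : (-1 : F) ≠ 0 := neg_ne_zero.2 one_ne_zero
  by_cases hc0 : c = 0
  · subst hc0
    rw [mul_zero, sub_zero] at hdet
    have ha0 : a ≠ 0 := left_ne_zero_of_mul_eq_one hdet
    have hap : (localAbs a : ℂ) ≠ 0 := Complex.ofReal_ne_zero.2 (localAbs_pos ha0).ne'
    rw [weilRep_of_ne_zero μ hψ hψ1 hμ h2 hm hS hs (by rw [e10]; exact neg_ne_zero.2 ha0), e00, e10,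
      e11, zero_mul, zero_div, AddChar.map_zero_eq_one, Circle.coe_one, neg_neg, localAbs_neg,
      quadFourier]
    simp only [weilRep_of_eq_zero μ hm hS hc, ha, hb]
    set H : (κ → F) → ℂ := fun z => quadChar S a * ((localAbs a ^ m : ℝ) : ℂ) *
      (f z * (ψ ((-b * quad S z - pairing S x z) / -a) : ℂ)) with hH
    have e : ∀ y, quadChar S a * ((localAbs a ^ m : ℝ) : ℂ) * (ψ (a * b * quad S y) : ℂ) *
        f (a • y) * (ψ (pairing S x y) : ℂ) = H (a • y) := by
      intro y
      have : (-b * quad S (a • y) - pairing S x (a • y)) / -a =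
          a * b * quad S y + pairing S x y := by
        rw [quad_smul, pairing, mulVec_smul, dotProduct_smul, smul_eq_mul, ← pairing]
        field_simp
        ring
      rw [hH]
      beta_reduce
      rw [this, char_mul]
      ring
    rw [funext e, integral_quadMeasure_smul μ hm hS ha0 H, hH, integral_const_mul, ← hγdef]
    push_cast
    field_simp
  have hcp : (localAbs c : ℂ) ≠ 0 := Complex.ofReal_ne_zero.2 (localAbs_pos hc0).ne'
  have hc' : g 1 0 ≠ 0 := by rwa [hc]
  have hχ : γ ^ 2 * quadChar S (-c) = quadChar S c := by
    have : -c = c * -1 := by ring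
    rw [this, quadChar_mul k h2 hS hc0 hone]
    linear_combination quadChar S c * hγ
  set φ₁ : (κ → F) → ℂ := fun y => f y * (ψ (d * quad S y / c) : ℂ) with hφ₁
  have hφ₁S : φ₁ ∈ schwartz k κ := by
    have h := (isSchwartzOp_quad (k := k) hψ ((d / c) • S)).mem hf
    convert h using 2 with y
    simp only [hφ₁]
    rw [smul_quad, mul_comm, mul_div_right_comm]
  -- both remaining cases start from the transform of `f` times a Gaussian
  have hinner : ∀ z, weilRep k ψ μ hS g f z = γ * quadChar S (-c) *
      (((localAbs c ^ m)⁻¹ : ℝ) : ℂ) * (ψ (a * quad S z / c) : ℂ) *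
      quadFourier ψ μ hS φ₁ ((-c⁻¹) • z) := by
    intro z
    rw [weilRep_of_ne_zero μ hψ hψ1 hμ h2 hm hS hs hc', ha, hc, hd, quadFourier]
    congr 1
    refine integral_congr_forall fun y => ?_
    have : (d * quad S y - pairing S z y) / c =
        d * quad S y / c + pairing S ((-c⁻¹) • z) y := by
      have : pairing S ((-c⁻¹) • z) y = -c⁻¹ * pairing S z y := by
        simp [pairing, smul_dotProduct]
      rw [this]
      field_simp
      ring
    simp only [hφ₁, this, char_mul]
    ring
  have hstart : quadFourier ψ μ hS (weilRep k ψ μ hS g f) x = γ * quadChar S (-c) *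
      ((localAbs c ^ m : ℝ) : ℂ) * ∫ z, quadFourier ψ μ hS φ₁ z *
        (ψ (a * c * quad S z - c * pairing S x z) : ℂ) ∂quadMeasure μ hS := by
    have hcc : -c ≠ 0 := neg_ne_zero.2 hc0
    set H : (κ → F) → ℂ := fun w => γ * quadChar S (-c) * (((localAbs c ^ m)⁻¹ : ℝ) : ℂ) *
      (quadFourier ψ μ hS φ₁ w * (ψ (a * c * quad S w - c * pairing S x w) : ℂ)) with hHdef
    have hH : ∀ z, weilRep k ψ μ hS g f z * (ψ (pairing S x z) : ℂ) = H ((-c⁻¹) • z) := by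
      intro z
      have : a * c * quad S ((-c⁻¹) • z) - c * pairing S x ((-c⁻¹) • z) =
          a * quad S z / c + pairing S x z := by
        rw [quad_smul, pairing, mulVec_smul, dotProduct_smul, smul_eq_mul, ← pairing]
        field_simp
        ring
      rw [hHdef]
      beta_reduce
      rw [hinner, this, char_mul]
      ring
    have hci : -c⁻¹ ≠ 0 := neg_ne_zero.2 (inv_ne_zero hc0)
    rw [quadFourier, funext hH, integral_quadMeasure_smul μ hm hS hci H, hHdef, integral_const_mul,
      localAbs_neg, localAbs_inv, inv_pow, inv_inv]
    push_cast
    field_simp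
  rw [hstart]
  by_cases ha0 : a = 0
  · rw [weilRep_of_eq_zero μ hm hS (by rw [e10, ha0, neg_zero]), e00, e01, ha0]
    have h1 := quadFourier_inversion μ hψ hψ1 hμ hS hs hφ₁S (c • x)
    have e : ∀ z, 0 * c * quad S z - c * pairing S x z = -pairing S (c • x) z := by
      intro z
      simp [pairing, smul_dotProduct]
    simp only [e]
    rw [h1, hφ₁]
    beta_reduce
    have : d * quad S (c • x) / c = c * d * quad S x := by rw [quad_smul]; field_simp
    rw [this]
    linear_combination (-((localAbs c ^ m : ℝ) : ℂ) * (ψ (c * d * quad S x) : ℂ) * f (c • x)) * hχ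
  · have hap : (localAbs a : ℂ) ≠ 0 := Complex.ofReal_ne_zero.2 (localAbs_pos ha0).ne'
    rw [weilRep_of_ne_zero μ hψ hψ1 hμ h2 hm hS hs (by rw [e10]; exact neg_ne_zero.2 ha0), e00, e10,
      e11, neg_neg, localAbs_neg, ← hγdef]
    -- the shift that completes the square
    set u : κ → F := a⁻¹ • x with hu
    set φ₂ : (κ → F) → ℂ := fun y => φ₁ y * (ψ ((S *ᵥ u) ⬝ᵥ y) : ℂ) with hφ₂
    have hφ₂i : Integrable φ₂ vol[μ] :=
      integrable_mul_char hψ (schwartz_integrable μ hφ₁S)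
        (by simpa using (continuous_const.dotProduct continuous_id : Continuous fun y : κ → F =>
          (S *ᵥ u) ⬝ᵥ y))
    have hG := quadFourier_gauss μ hψ hψ1 hμ h2 hm hS hs (mul_ne_zero ha0 hc0) hφ₂i
      (integrable_fourier_mul_char μ hψ hψ1 hφ₁S _)
    have hsh : ∀ z, quadFourier ψ μ hS φ₂ z = quadFourier ψ μ hS φ₁ (z + u) := by
      intro z
      refine integral_congr_forall fun y => ?_
      simp only [hφ₂]
      rw [pairing_eq hs (z + u), mulVec_add, add_dotProduct, char_mul, pairing_eq hs]
      ring
    have hint : ∫ z, quadFourier ψ μ hS φ₁ z *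
        (ψ (a * c * quad S z - c * pairing S x z) : ℂ) ∂quadMeasure μ hS =
        (ψ (-(c * quad S x / a)) : ℂ) * ∫ z, quadFourier ψ μ hS φ₂ z *
          (ψ (a * c * quad S z) : ℂ) ∂quadMeasure μ hS := by
      rw [integral_quadMeasure, integral_quadMeasure, mul_smul_comm, ← integral_const_mul]
      congr 1
      rw [← integral_add_right_eq_self _ u]
      refine integral_congr_forall fun z => ?_
      rw [hsh]
      have : a * c * quad S (z + u) - c * pairing S x (z + u) =
          -(c * quad S x / a) + a * c * quad S z := by
        have h3 : pairing S x (z + u) = pairing S x z + a⁻¹ * (2 * quad S x) := by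
          simp only [hu, pairing, quad, mulVec_add, dotProduct_add, mulVec_smul,
            dotProduct_smul, smul_eq_mul]
          field_simp
        have h4 : pairing S u z = a⁻¹ * pairing S x z := by
          simp [hu, pairing, smul_dotProduct]
        rw [quad_add hs h2, h3, h4, hu, quad_smul]
        field_simp
        ring
      rw [this, char_mul]
      ring
    rw [hint, hG]
    have hlast : ∀ y, φ₂ y * (ψ (-(quad S y / (a * c))) : ℂ) =
        f y * (ψ ((-b * quad S y - pairing S x y) / -a) : ℂ) := by
      intro y
      have h4 : (S *ᵥ u) ⬝ᵥ y = a⁻¹ * pairing S x y := by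
        rw [← pairing_eq hs]; simp [hu, pairing, smul_dotProduct]
      have : (-b * quad S y - pairing S x y) / -a =
          d * quad S y / c + a⁻¹ * pairing S x y + -(quad S y / (a * c)) := by
        field_simp
        linear_combination -quad S y * hdet
      rw [this, char_mul, char_mul]
      simp only [hφ₂, hφ₁, h4]
      ring
    simp only [hlast]
    have hcdiv : c * quad S x / -a = -(c * quad S x / a) := by rw [div_neg]
    rw [hcdiv, quadChar_mul k h2 hS ha0 hc0, ← hγdef, localAbs_mul, mul_pow]
    have hχ2 := quadChar_mul_self h2 hS c
    push_cast
    field_simp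
    generalize (∫ y, f y * (ψ (-((-(b * quad S y) - pairing S x y) / a)) : ℂ)
      ∂quadMeasure μ hS) = X
    linear_combination (-quadChar S a * X * γ * quadChar S c) * hχ - quadChar S a * X * γ * hχ2

end WeilRepresentation

/-! ### The representation on the mixed model -/

section MixedRep

variable {F : Type*} [NontriviallyNormedField F]

/-- Left multiplication by the standard generators reaches all of `SL₂(F)`. -/
theorem sl_induction {P : SL(2, F) → Prop} (h1 : P 1)
    (hn : ∀ (t : F) g, P g → P (upperUnip t * g)) (hm : ∀ (a : Fˣ) g, P g → P (diagTorus a * g))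
    (hw : ∀ g, P g → P (weylElt * g)) (g : SL(2, F)) : P g := by
  have hdet := g.det_coe
  rw [det_fin_two] at hdet
  by_cases hc : g 1 0 = 0
  · rw [hc, mul_zero, sub_zero] at hdet
    have ha : g 0 0 ≠ 0 := left_ne_zero_of_mul_eq_one hdet
    have : g = diagTorus (Units.mk0 _ ha) * (upperUnip (g 0 1 / g 0 0) * 1) := by
      ext i j
      rw [mul_one, sl_mul_apply]
      fin_cases i <;> fin_cases j <;> simp [diagTorus, upperUnip, hc]
      · field_simp
      · exact eq_inv_of_mul_eq_one_right hdet
    rw [this]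
    exact hm _ _ (hn _ _ h1)
  · have : g = upperUnip (g 0 0 / g 1 0) * (diagTorus (-(Units.mk0 _ hc)⁻¹) *
        (weylElt * (upperUnip (g 1 1 / g 1 0) * 1))) := by
      ext i j
      rw [mul_one]
      simp only [sl_mul_apply]
      fin_cases i <;> fin_cases j <;> simp [diagTorus, upperUnip, weylElt]
      · field_simp
      · field_simp
        linear_combination -hdet
      · field_simp
    rw [this]
    exact hn _ _ (hm _ _ (hw _ (hn _ _ h1)))

variable [ProperSpace F] {k : LocalKind F} {κ κ' : Type*} [Fintype κ] [DecidableEq κ]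
  [Fintype κ'] [DecidableEq κ']

theorem isSchwartzOp_comp_mulVec {A : Matrix κ κ F} (hA : IsUnit A.det) :
    IsSchwartzOp k fun (f : (κ → F) → ℂ) x => f (A *ᵥ x) := by
  have := A.invertibleOfIsUnitDet hA
  have h := isSchwartzOp_comp_linearEquiv (k := k) (toLinearEquiv' A this)
  exact h

theorem isSchwartzOp_comp_blocks {A : Matrix κ κ F} {B : Matrix κ' κ' F} (hA : IsUnit A.det)
    (hB : IsUnit B.det) : IsSchwartzOp k fun (f : (κ ⊕ κ' → F) → ℂ) v =>
      f (Sum.elim (A *ᵥ (v ∘ Sum.inl)) (B *ᵥ (v ∘ Sum.inr))) := by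
  have h := isSchwartzOp_comp_mulVec (k := k) (A := fromBlocks A 0 0 B)
    (by rw [det_fromBlocks_zero₂₁]; exact hA.mul hB)
  refine h.congr fun f _ => ?_
  ext v
  rw [fromBlocks_mulVec]
  simp

variable [MeasurableSpace F] [BorelSpace F]
variable {ψ : AddChar F Circle} (μ : Measure F) [μ.IsAddHaarMeasure]

/-- Chirps in the variables of the quadratic space. -/
theorem isSchwartzOp_quad_inl (hψ : Continuous ψ) (S : Matrix κ κ F) :
    IsSchwartzOp k fun (f : (κ ⊕ κ' → F) → ℂ) v =>
      (ψ (quad S (v ∘ Sum.inl)) : ℂ) * f v := by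
  refine (isSchwartzOp_quad hψ (fromBlocks S 0 0 0)).congr fun f _ => ?_
  ext v
  congr 3
  simp [quad, pairing, fromBlocks_mulVec, dotProduct, Fintype.sum_sum_type]

theorem sl_transpose_isUnit (g : SL(2, F)) :
    IsUnit ((g : Matrix (Fin 2) (Fin 2) F)ᵀ).det := by
  rw [det_transpose, g.det_coe]; exact isUnit_one

variable {S : Matrix κ κ F}
variable (hψ : Continuous ψ) (hψ1 : ψ ≠ 1) (hμ : IsSelfDual k ψ μ) (h2 : (2 : F) ≠ 0)
  (hn : Even (Fintype.card κ))

include h2 hn in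
theorem mixedRep_upperUnip (hS : IsUnit S.det)
    (t : F) (f : (κ ⊕ Fin 2 → F) → ℂ) (v : κ ⊕ Fin 2 → F) :
    mixedRep k ψ μ hS (upperUnip t) f v = (ψ (t * quad S (v ∘ Sum.inl)) : ℂ) *
      f (Sum.elim (v ∘ Sum.inl) ((upperUnip t).1ᵀ *ᵥ (v ∘ Sum.inr))) := by
  obtain ⟨m, hm⟩ := hn
  rw [mixedRep, weilRep_upperUnip μ h2 (hm.trans (two_mul m).symm) hS]

include hψ hψ1 hμ h2 hn in
theorem mixedRep_weylElt (hS : IsUnit S.det) (hs : S.IsSymm)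
    (f : (κ ⊕ Fin 2 → F) → ℂ) (v : κ ⊕ Fin 2 → F) :
    mixedRep k ψ μ hS weylElt f v = weilConst ψ μ S * quadFourier ψ μ hS
      (fun x => f (Sum.elim x (weylElt.1ᵀ *ᵥ (v ∘ Sum.inr)))) (v ∘ Sum.inl) := by
  obtain ⟨m, hm⟩ := hn
  rw [mixedRep, weilRep_weylElt μ hψ hψ1 hμ h2 (hm.trans (two_mul m).symm) hS hs]

theorem mixedRep_mul_of_weilRep_mul {hS : IsUnit S.det} {g g' : SL(2, F)}
    (h : ∀ φ ∈ schwartz k κ, weilRep k ψ μ hS (g * g') φ =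
      weilRep k ψ μ hS g (weilRep k ψ μ hS g' φ)) {f : (κ ⊕ Fin 2 → F) → ℂ}
    (hf : f ∈ schwartz k (κ ⊕ Fin 2)) :
    mixedRep k ψ μ hS (g * g') f = mixedRep k ψ μ hS g (mixedRep k ψ μ hS g' f) := by
  ext v
  rw [mixedRep, h _ (schwartz_slice hf _), mixedRep]
  congr 1
  ext x
  rw [mixedRep]
  have e1 : ∀ (x : κ → F) (u : Fin 2 → F), Sum.elim x u ∘ Sum.inl = x := fun _ _ => rfl
  have e2 : ∀ (x : κ → F) (u : Fin 2 → F), Sum.elim x u ∘ Sum.inr = u := fun _ _ => rfl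
  have e3 : ((g * g' : SL(2, F)) : Matrix (Fin 2) (Fin 2) F)ᵀ *ᵥ (v ∘ Sum.inr) =
      (g' : Matrix (Fin 2) (Fin 2) F)ᵀ *ᵥ ((g : Matrix (Fin 2) (Fin 2) F)ᵀ *ᵥ (v ∘ Sum.inr)) := by
    rw [mulVec_mulVec, ← transpose_mul]
    rfl
  rw [e1, e2, e3]

include h2 hn in
theorem mixedRep_one (hS : IsUnit S.det)
    (f : (κ ⊕ Fin 2 → F) → ℂ) : mixedRep k ψ μ hS 1 f = f := by
  have h1 : (1 : SL(2, F)) = upperUnip 0 := by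
    ext i j
    fin_cases i <;> fin_cases j <;> simp [upperUnip]
  ext v
  have h3 : (upperUnip (0 : F)).1ᵀ = 1 := by
    rw [← h1]; simp
  rw [h1, mixedRep_upperUnip μ h2 hn hS, h3, zero_mul, AddChar.map_zero_eq_one, one_mulVec,
    Sum.elim_comp_inl_inr, Circle.coe_one, one_mul]

include hψ h2 hn in
theorem isSchwartzOp_mixedRep_upperUnip (hS : IsUnit S.det) (t : F) :
    IsSchwartzOp k (mixedRep k ψ μ hS (upperUnip t)) := by
  have hB := sl_transpose_isUnit (upperUnip t)
  refine ((isSchwartzOp_quad_inl hψ (t • S)).comp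
    (isSchwartzOp_comp_blocks (A := (1 : Matrix κ κ F)) (by simp) hB)).congr fun f _ => ?_
  ext v
  rw [mixedRep_upperUnip μ h2 hn hS, smul_quad]
  beta_reduce
  rw [one_mulVec]

include hψ hψ1 hμ h2 hn in
theorem isSchwartzOp_mixedRep_weylElt (hS : IsUnit S.det) (hs : S.IsSymm) :
    IsSchwartzOp k (mixedRep k ψ μ hS weylElt) := by
  have hB := sl_transpose_isUnit (weylElt : SL(2, F))
  refine (((isSchwartzOp_comp_blocks hS hB).comp
    (isSchwartzOp_blockFourier μ ψ hψ hψ1)).const_smul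
      (weilConst ψ μ S * (Real.sqrt (localAbs S.det) : ℝ))).congr fun f _ => ?_
  ext v
  rw [mixedRep_weylElt μ hψ hψ1 hμ h2 hn hS hs, quadFourier_eq μ hS hs, Complex.real_smul]
  simp only [Pi.smul_apply, smul_eq_mul, mul_assoc]
  rfl

theorem isSchwartzOp_mixedRep_diagTorus (hn : Even (Fintype.card κ)) (hS : IsUnit S.det) (a : Fˣ) :
    IsSchwartzOp k (mixedRep k ψ μ hS (diagTorus a)) := by
  obtain ⟨m, hm⟩ := hn
  have hB := sl_transpose_isUnit (diagTorus a)
  have hA : IsUnit ((a : F) • (1 : Matrix κ κ F)).det := by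
    rw [det_smul]; simp
  refine ((isSchwartzOp_comp_blocks hA hB).const_smul
    (quadChar S (a : F) * ((localAbs (a : F) ^ m : ℝ) : ℂ))).congr fun f _ => ?_
  ext v
  rw [mixedRep, weilRep_diagTorus μ (hm.trans (two_mul m).symm) hS]
  simp only [Pi.smul_apply, smul_eq_mul, smul_mulVec, one_mulVec]

include hψ hψ1 hμ h2 hn in
theorem isSchwartzOp_mixedRep (hS : IsUnit S.det) (hs : S.IsSymm)
    (g : SL(2, F)) : IsSchwartzOp k (mixedRep k ψ μ hS g) := by
  obtain ⟨m, hm⟩ := id hn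
  have hm' := hm.trans (two_mul m).symm
  induction g using sl_induction with
  | h1 =>
    have h1 : (1 : SL(2, F)) = upperUnip 0 := by
      ext i j
      fin_cases i <;> fin_cases j <;> simp [upperUnip]
    rw [h1]
    exact isSchwartzOp_mixedRep_upperUnip μ hψ h2 hn hS 0
  | hn t g ih =>
    exact ((isSchwartzOp_mixedRep_upperUnip μ hψ h2 hn hS t).comp ih).congr fun f hf =>
      mixedRep_mul_of_weilRep_mul μ
        (fun φ _ => weilRep_upperUnip_mul μ hψ hψ1 hμ h2 hm' hS hs t g φ) hf
  | hm a g ih =>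
    exact ((isSchwartzOp_mixedRep_diagTorus μ hn hS a).comp ih).congr fun f hf =>
      mixedRep_mul_of_weilRep_mul μ
        (fun φ _ => weilRep_diagTorus_mul μ hψ hψ1 hμ h2 hm' hS hs a g φ) hf
  | hw g ih =>
    exact ((isSchwartzOp_mixedRep_weylElt μ hψ hψ1 hμ h2 hn hS hs).comp ih).congr fun f hf =>
      mixedRep_mul_of_weilRep_mul μ
        (fun φ hφ => weilRep_weylElt_mul μ hψ hψ1 hμ h2 hm' hS hs g hφ) hf

include hψ hψ1 hμ h2 hn in
/-- `r` is a representation on the Schwartz space. -/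
theorem mixedRep_mul (hS : IsUnit S.det) (hs : S.IsSymm)
    (g g' : SL(2, F)) {f : (κ ⊕ Fin 2 → F) → ℂ} (hf : f ∈ schwartz k (κ ⊕ Fin 2)) :
    mixedRep k ψ μ hS (g * g') f = mixedRep k ψ μ hS g (mixedRep k ψ μ hS g' f) := by
  obtain ⟨m, hm⟩ := id hn
  have hm' := hm.trans (two_mul m).symm
  have hmem : ∀ g, ∀ f ∈ schwartz k (κ ⊕ Fin 2), mixedRep k ψ μ hS g f ∈ schwartz k (κ ⊕ Fin 2) :=
    fun g f hf => (isSchwartzOp_mixedRep μ hψ hψ1 hμ h2 hn hS hs g).mem hf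
  -- both sides of the identity are compatible with a generator on the left
  have key : ∀ g₀ : SL(2, F), (∀ g f, f ∈ schwartz k (κ ⊕ Fin 2) →
      mixedRep k ψ μ hS (g₀ * g) f = mixedRep k ψ μ hS g₀ (mixedRep k ψ μ hS g f)) →
      ∀ g, (∀ g' f, f ∈ schwartz k (κ ⊕ Fin 2) →
        mixedRep k ψ μ hS (g * g') f = mixedRep k ψ μ hS g (mixedRep k ψ μ hS g' f)) →
      ∀ g' f, f ∈ schwartz k (κ ⊕ Fin 2) → mixedRep k ψ μ hS (g₀ * g * g') f =
        mixedRep k ψ μ hS (g₀ * g) (mixedRep k ψ μ hS g' f) := by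
    intro g₀ h0 g h g' f hf
    rw [mul_assoc, h0 _ _ hf, h _ _ hf, h0 _ _ (hmem _ _ hf)]
  revert g' f
  suffices h : ∀ g' f, f ∈ schwartz k (κ ⊕ Fin 2) →
      mixedRep k ψ μ hS (g * g') f = mixedRep k ψ μ hS g (mixedRep k ψ μ hS g' f) from
    fun g' f hf => h g' f hf
  induction g using sl_induction with
  | h1 => intro g' f hf; rw [one_mul, mixedRep_one μ h2 hn hS]
  | hn t g ih =>
    exact key _ (fun g f hf => mixedRep_mul_of_weilRep_mul μ
        (fun φ _ => weilRep_upperUnip_mul μ hψ hψ1 hμ h2 hm' hS hs t g φ) hf) g ih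
  | hm a g ih =>
    exact key _ (fun g f hf => mixedRep_mul_of_weilRep_mul μ
        (fun φ _ => weilRep_diagTorus_mul μ hψ hψ1 hμ h2 hm' hS hs a g φ) hf) g ih
  | hw g ih =>
    exact key _ (fun g f hf => mixedRep_mul_of_weilRep_mul μ
        (fun φ hφ => weilRep_weylElt_mul μ hψ hψ1 hμ h2 hm' hS hs g hφ) hf) g ih

end MixedRep

/-! ### The invariant measure on `N\SL₂` as Lebesgue measure of the plane -/

section Units

variable {F : Type*} [NontriviallyNormedField F] [ProperSpace F] [MeasurableSpace F] [BorelSpace F]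
variable (μ : Measure F) [μ.IsAddHaarMeasure]

theorem units_measurableEmbedding : MeasurableEmbedding (Units.val : Fˣ → F) :=
  ⟨Units.val_injective, comap_measurable _, fun {s} hs => by
    obtain ⟨t, ht, rfl⟩ := hs
    rw [Set.image_preimage_eq_inter_range]
    refine ht.inter ?_
    have : Set.range (Units.val : Fˣ → F) = {0}ᶜ := by
      ext x
      exact ⟨fun ⟨u, hu⟩ => by rw [← hu]; exact u.ne_zero,
        fun hx => ⟨Units.mk0 x hx, rfl⟩⟩
    rw [this]
    exact (measurableSet_singleton 0).compl⟩

theorem map_comap_units : (μ.comap (Units.val : Fˣ → F)).map Units.val = μ := by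
  rw [units_measurableEmbedding.map_comap]
  refine Measure.restrict_eq_self_of_ae_mem ?_
  have h : ∀ᵐ x ∂μ, x ≠ 0 := by rw [ae_iff]; simp
  exact h.mono fun x hx => ⟨Units.mk0 x hx, rfl⟩

instance sigmaFinite_comap_units : SigmaFinite (μ.comap (Units.val : Fˣ → F)) := by
  refine SigmaFinite.of_map _ units_measurableEmbedding.measurable.aemeasurable ?_
  rw [map_comap_units]
  infer_instance

instance measurableMul_units : MeasurableMul Fˣ where
  measurable_const_mul c := by
    refine measurable_comap_iff.2 ?_
    exact units_measurableEmbedding.measurable.const_mul (c : F)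
  measurable_mul_const c := by
    refine measurable_comap_iff.2 ?_
    exact units_measurableEmbedding.measurable.mul_const (c : F)

/-- The multiplicative Haar measure `|a|⁻¹ da`, without the normalizing factor `ζ(1)`. -/
def unitsMeasure : Measure Fˣ :=
  (μ.comap (Units.val : Fˣ → F)).withDensity fun a => ENNReal.ofReal (modulus a)⁻¹

instance sFinite_unitsMeasure : SFinite (unitsMeasure μ) := by
  unfold unitsMeasure; infer_instance

theorem lintegral_unitsMeasure {g : F → ℝ≥0∞} (hg : Measurable g) :
    ∫⁻ a : Fˣ, g a ∂unitsMeasure μ = ∫⁻ x, ENNReal.ofReal (localAbs x)⁻¹ * g x ∂μ := by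
  have hm : Measurable fun a : Fˣ => ENNReal.ofReal (modulus a)⁻¹ :=
    ENNReal.measurable_ofReal.comp measurable_modulus.inv
  have hg' : Measurable fun a : Fˣ => g a := hg.comp units_measurableEmbedding.measurable
  rw [unitsMeasure, lintegral_withDensity_eq_lintegral_mul _ hm hg']
  conv_rhs => rw [← map_comap_units μ]
  rw [units_measurableEmbedding.lintegral_map]
  simp only [localAbs_units]
  rfl

instance isMulLeftInvariant_unitsMeasure : (unitsMeasure μ).IsMulLeftInvariant := by
  refine ⟨fun c => ?_⟩
  ext s hs
  obtain ⟨t, ht, rfl⟩ := hs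
  have hc : Measurable fun a : Fˣ => c * a := measurable_const_mul c
  have hs : MeasurableSet (Units.val ⁻¹' t : Set Fˣ) := ⟨t, ht, rfl⟩
  have ht' : Measurable (t.indicator (1 : F → ℝ≥0∞)) := measurable_one.indicator ht
  have ht2 : Measurable fun x : F => t.indicator (1 : F → ℝ≥0∞) (c * x) :=
    ht'.comp (measurable_const_mul (c : F))
  rw [Measure.map_apply hc hs, ← lintegral_indicator_one hs, ← lintegral_indicator_one (hc hs)]
  have h1 := lintegral_unitsMeasure μ ht'
  have h2 := lintegral_unitsMeasure μ ht2
  have e1 : ∀ a : Fˣ, (Units.val ⁻¹' t : Set Fˣ).indicator (1 : Fˣ → ℝ≥0∞) a =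
      t.indicator (1 : F → ℝ≥0∞) a := fun a => rfl
  have e2 : ∀ a : Fˣ, ((fun a : Fˣ => c * a) ⁻¹' (Units.val ⁻¹' t)).indicator
      (1 : Fˣ → ℝ≥0∞) a = t.indicator (1 : F → ℝ≥0∞) (c * a) := fun a => rfl
  simp only [e1, e2]
  rw [h1, h2]
  have h3 := lintegral_comp_mul μ c.ne_zero fun x =>
    ENNReal.ofReal (localAbs x)⁻¹ * t.indicator (1 : F → ℝ≥0∞) x
  have hcp := localAbs_pos c.ne_zero
  have e3 : ∀ x, ENNReal.ofReal (localAbs x)⁻¹ * t.indicator (1 : F → ℝ≥0∞) (c * x) =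
      ENNReal.ofReal (localAbs (c : F)) * (ENNReal.ofReal (localAbs ((c : F) * x))⁻¹ *
        t.indicator (1 : F → ℝ≥0∞) (c * x)) := by
    intro x
    rw [← mul_assoc, ← ENNReal.ofReal_mul hcp.le, localAbs_mul, mul_inv,
      mul_inv_cancel_left₀ hcp.ne']
  simp only [e3]
  rw [lintegral_const_mul' _ _ ENNReal.ofReal_ne_top, h3, ← mul_assoc, ← ENNReal.ofReal_mul hcp.le,
    mul_inv_cancel₀ hcp.ne', ENNReal.ofReal_one, one_mul]

end Units

section CompactGroup

variable {G : Type*} [Group G] [TopologicalSpace G] [IsTopologicalGroup G] [CompactSpace G]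
  [MeasurableSpace G] [BorelSpace G]

theorem isMulRightInvariant_haar_of_compact :
    (Measure.haarMeasure (⊤ : TopologicalSpace.PositiveCompacts G)).IsMulRightInvariant := by
  have : IsProbabilityMeasure (Measure.haarMeasure (⊤ : TopologicalSpace.PositiveCompacts G)) :=
    ⟨by simpa using Measure.haarMeasure_self (K₀ := (⊤ : TopologicalSpace.PositiveCompacts G))⟩
  refine ⟨fun g => ?_⟩
  set ν := Measure.haarMeasure (⊤ : TopologicalSpace.PositiveCompacts G)
  have h1 : IsProbabilityMeasure (ν.map (· * g)) :=
    Measure.isProbabilityMeasure_map (measurable_mul_const g).aemeasurable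
  exact Measure.isHaarMeasure_eq_of_isProbabilityMeasure _ _

end CompactGroup

section Plane

variable {F : Type*} [NontriviallyNormedField F] [ProperSpace F] [MeasurableSpace F] [BorelSpace F]
variable (K : Subgroup SL(2, F)) [CompactSpace K]

instance isProbabilityMeasure_maxCompactMeasure : IsProbabilityMeasure (maxCompactMeasure K) :=
  ⟨Measure.haarMeasure_self (K₀ := (⊤ : TopologicalSpace.PositiveCompacts K))⟩

instance isHaarMeasure_maxCompactMeasure : (maxCompactMeasure K).IsHaarMeasure :=
  Measure.isHaarMeasure_haarMeasure ⊤

instance isMulRightInvariant_maxCompactMeasure : (maxCompactMeasure K).IsMulRightInvariant :=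
  isMulRightInvariant_haar_of_compact

variable (μ : Measure F) [μ.IsAddHaarMeasure]

/-- The action of `SL₂(F)` on the plane from the right, written on column vectors. -/
def planeAct (g : SL(2, F)) (v : Fin 2 → F) : Fin 2 → F := (g : Matrix (Fin 2) (Fin 2) F)ᵀ *ᵥ v

theorem planeAct_apply (g : SL(2, F)) (v : Fin 2 → F) (j : Fin 2) :
    planeAct g v j = g 0 j * v 0 + g 1 j * v 1 := by
  simp [planeAct, mulVec, dotProduct, Fin.sum_univ_two]

theorem planeAct_mul (g h : SL(2, F)) (v : Fin 2 → F) :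
    planeAct (g * h) v = planeAct h (planeAct g v) := by
  ext j
  simp only [planeAct_apply, sl_mul_apply]
  ring

theorem planeAct_inv_zero (g : SL(2, F)) (v : Fin 2 → F) :
    planeAct g⁻¹ v 0 = g 1 1 * v 0 - g 1 0 * v 1 := by
  rw [planeAct_apply, Matrix.SpecialLinearGroup.SL2_inv_expl]
  change g 1 1 * v 0 + -g 1 0 * v 1 = _
  ring

theorem planeAct_inv_one (g : SL(2, F)) (v : Fin 2 → F) :
    planeAct g⁻¹ v 1 = g 0 0 * v 1 - g 0 1 * v 0 := by
  rw [planeAct_apply, Matrix.SpecialLinearGroup.SL2_inv_expl]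
  change -g 0 1 * v 0 + g 0 0 * v 1 = _
  ring

theorem planeAct_one (v : Fin 2 → F) : planeAct 1 v = v := by
  ext j
  fin_cases j <;> simp [planeAct_apply]

theorem planeAct_smul (g : SL(2, F)) (a : F) (v : Fin 2 → F) :
    planeAct g (a • v) = a • planeAct g v := by
  rw [planeAct, planeAct, mulVec_smul]

/-- The bottom row of `diag(a, a⁻¹) k`. -/
def bottomRow (p : Fˣ × K) : Fin 2 → F := planeAct (diagTorus p.1 * p.2) ![0, 1]

theorem bottomRow_eq (p : Fˣ × K) : bottomRow K p = (p.1 : F)⁻¹ • planeAct p.2 ![0, 1] := by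
  rw [bottomRow, planeAct_mul]
  have : planeAct (diagTorus p.1) ![0, 1] = (p.1 : F)⁻¹ • ![0, 1] := by
    ext j
    rw [planeAct_apply]
    fin_cases j <;> simp [diagTorus]
  rw [this, planeAct_smul]

theorem lintegral_planeAct (g : SL(2, F)) (f : (Fin 2 → F) → ℝ≥0∞) :
    ∫⁻ v, f (planeAct g v) ∂vol[μ] = ∫⁻ v, f v ∂vol[μ] := by
  have h := lintegral_comp_mulVec μ (sl_transpose_isUnit g) f
  rw [det_transpose, g.det_coe, localAbs_one, inv_one, ENNReal.ofReal_one, one_mul] at h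
  exact h

theorem lintegral_comp_smul_plane {a : F} (ha : a ≠ 0) (f : (Fin 2 → F) → ℝ≥0∞) :
    ∫⁻ v, f (a • v) ∂vol[μ] =
      ENNReal.ofReal (localAbs a ^ 2)⁻¹ * ∫⁻ v, f v ∂vol[μ] := by
  have h := lintegral_comp_mulVec μ (κ := Fin 2) (A := a • 1)
    (by rw [det_smul]; simpa using ha) f
  simpa [smul_mulVec, det_smul] using h

theorem exists_planeAct_eq {v : Fin 2 → F} (hv : v ≠ 0) :
    ∃ g : SL(2, F), planeAct g ![0, 1] = v := by
  obtain ⟨g, hg0, hg1⟩ : ∃ g : SL(2, F), g 1 0 = v 0 ∧ g 1 1 = v 1 := by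
    by_cases hc : v 0 = 0
    · have hd : v 1 ≠ 0 := by
        intro hd
        refine hv ?_
        ext j
        fin_cases j
        · exact hc
        · exact hd
      exact ⟨⟨!![(v 1)⁻¹, 0; 0, v 1], by simp [det_fin_two, hd]⟩, hc.symm, rfl⟩
    · exact ⟨⟨!![0, -(v 0)⁻¹; v 0, v 1], by simp [det_fin_two, hc]⟩, rfl, rfl⟩
  refine ⟨g, ?_⟩
  ext j
  rw [planeAct_apply]
  fin_cases j <;> simp [hg0, hg1]

theorem exists_bottomRow (hK : IsIwasawa K) {v : Fin 2 → F} (hv : v ≠ 0) :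
    ∃ p : Fˣ × K, v = bottomRow K p := by
  obtain ⟨g, hg⟩ := exists_planeAct_eq hv
  obtain ⟨t, a, m, hm, rfl⟩ := hK g
  refine ⟨⟨a, m, hm⟩, ?_⟩
  rw [bottomRow, ← hg, mul_assoc, planeAct_mul]
  congr 1
  ext j
  rw [planeAct_apply]
  fin_cases j <;> simp [upperUnip]

theorem measurable_entry (i j : Fin 2) : Measurable fun g : K => (g : SL(2, F)) i j := by
  refine Continuous.measurable ?_
  have h1 : Continuous fun g : K => (((g : SL(2, F)) : Matrix (Fin 2) (Fin 2) F)) :=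
    continuous_subtype_val.comp continuous_subtype_val
  exact h1.matrix_elem i j

theorem measurable_planeAct {X : Type*} [MeasurableSpace X] {g : X → K} {v : X → Fin 2 → F}
    (hg : Measurable g) (hv : Measurable v) : Measurable fun x => planeAct (g x) (v x) := by
  refine measurable_pi_iff.2 fun j => ?_
  simp only [planeAct_apply]
  exact (((measurable_entry K 0 j).comp hg).mul ((measurable_pi_apply 0).comp hv)).add
    (((measurable_entry K 1 j).comp hg).mul ((measurable_pi_apply 1).comp hv))

theorem measurable_bottomRow : Measurable (bottomRow K) := by
  rw [funext (bottomRow_eq K)]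
  have h1 : Measurable fun p : Fˣ × K => (p.1 : F)⁻¹ :=
    (units_measurableEmbedding.measurable.comp measurable_fst).inv
  have h2 : Measurable fun p : Fˣ × K => planeAct (p.2 : SL(2, F)) ![0, 1] :=
    measurable_planeAct K measurable_snd measurable_const
  exact h1.smul h2

/-- `bottomRow` for the products of group elements. -/
theorem bottomRow_mul (q p : Fˣ × K) :
    bottomRow K (q * p) = (p.1 : F)⁻¹ • planeAct p.2 (bottomRow K q) := by
  rw [bottomRow_eq, bottomRow_eq, planeAct_smul, smul_smul, Prod.fst_mul, Prod.snd_mul,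
    Units.val_mul, mul_inv, mul_comm (q.1 : F)⁻¹]
  congr 1
  exact planeAct_mul _ _ _

/-- Haar measure of `F^× × K`. -/
def polarMeasure : Measure (Fˣ × K) := (unitsMeasure μ).prod (maxCompactMeasure K)

instance sFinite_polarMeasure : SFinite (polarMeasure K μ) := by
  unfold polarMeasure; infer_instance

theorem lintegral_polarMeasure_mul_left {g : Fˣ × K → ℝ≥0∞} (hg : Measurable g) (q : Fˣ × K) :
    ∫⁻ p, g (q * p) ∂polarMeasure K μ = ∫⁻ p, g p ∂polarMeasure K μ := by
  have hm : Measurable fun p : Fˣ × K => q * p :=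
    ((measurable_const_mul q.1).comp measurable_fst).prodMk
      ((measurable_const_mul q.2).comp measurable_snd)
  have hg' : Measurable fun p => g (q * p) := hg.comp hm
  rw [polarMeasure, lintegral_prod _ hg'.aemeasurable, lintegral_prod _ hg.aemeasurable]
  have h1 : ∀ a : Fˣ, ∫⁻ m, g (q * (a, m)) ∂maxCompactMeasure K =
      ∫⁻ m, g (q.1 * a, m) ∂maxCompactMeasure K := fun a =>
    lintegral_mul_left_eq_self (fun m => g (q.1 * a, m)) q.2
  simp only [h1]
  exact lintegral_mul_left_eq_self (fun a => ∫⁻ m, g (a, m) ∂maxCompactMeasure K) q.1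

theorem lintegral_polarMeasure_mul_right {g : Fˣ × K → ℝ≥0∞} (hg : Measurable g) (q : Fˣ × K) :
    ∫⁻ p, g (p * q) ∂polarMeasure K μ = ∫⁻ p, g p ∂polarMeasure K μ := by
  have hm : Measurable fun p : Fˣ × K => p * q :=
    ((measurable_mul_const q.1).comp measurable_fst).prodMk
      ((measurable_mul_const q.2).comp measurable_snd)
  have hg' : Measurable fun p => g (p * q) := hg.comp hm
  rw [polarMeasure, lintegral_prod _ hg'.aemeasurable, lintegral_prod _ hg.aemeasurable]
  have h1 : ∀ a : Fˣ, ∫⁻ m, g ((a, m) * q) ∂maxCompactMeasure K =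
      ∫⁻ m, g (a * q.1, m) ∂maxCompactMeasure K := fun a =>
    lintegral_mul_right_eq_self (fun m => g (a * q.1, m)) q.2
  simp only [h1, mul_comm _ q.1]
  exact lintegral_mul_left_eq_self (fun a => ∫⁻ m, g (a, m) ∂maxCompactMeasure K) q.1

theorem lintegral_quotMeasure (k : LocalKind F) {g : Fˣ × K → ℝ≥0∞} (hg : Measurable g) :
    ∫⁻ p, g p ∂quotMeasure k μ K = ENNReal.ofReal (zetaOne k) *
      ∫⁻ p, ENNReal.ofReal (localAbs (p.1 : F) ^ 2)⁻¹ * g p ∂polarMeasure K μ := by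
  have hm : Measurable fun a : Fˣ => ENNReal.ofReal ((modulus a ^ 2)⁻¹) :=
    ENNReal.measurable_ofReal.comp (measurable_modulus.pow_const 2).inv
  have hg' : Measurable fun p : Fˣ × K => ENNReal.ofReal (localAbs (p.1 : F) ^ 2)⁻¹ * g p := by
    simp only [localAbs_units]
    exact (hm.comp measurable_fst).mul hg
  rw [quotMeasure, lintegral_prod _ hg.aemeasurable, polarMeasure,
    lintegral_prod _ hg'.aemeasurable, mulMeasure, withDensity_smul_measure,
    lintegral_smul_measure, smul_eq_mul,
    lintegral_withDensity_eq_lintegral_mul _ hm hg.lintegral_prod_right']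
  congr 1
  refine lintegral_congr fun a => ?_
  have h1 := lintegral_const_mul' (μ := maxCompactMeasure K)
    (ENNReal.ofReal (localAbs (a : F) ^ 2)⁻¹) (fun m => g (a, m)) ENNReal.ofReal_ne_top
  rw [h1, localAbs_units]
  rfl

/-- The point `a v k⁻¹` of the plane. -/
def polarPoint (p : Fˣ × K) (v : Fin 2 → F) : Fin 2 → F :=
  (p.1 : F) • planeAct (p.2 : SL(2, F))⁻¹ v

/-- The weight of a test function: its average over the dilates and rotates of a point. -/
def polarAverage (w : (Fin 2 → F) → ℝ≥0∞) (v : Fin 2 → F) : ℝ≥0∞ :=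
  ∫⁻ p, ENNReal.ofReal (localAbs (p.1 : F) ^ 2) * w (polarPoint K p v)
    ∂polarMeasure K μ

theorem measurable_polar_aux {w : (Fin 2 → F) → ℝ≥0∞} (hw : Measurable w) :
    Measurable fun q : (Fin 2 → F) × (Fˣ × K) => ENNReal.ofReal (localAbs (q.2.1 : F) ^ 2) *
      w (polarPoint K q.2 q.1) := by
  have h1 : Measurable fun q : (Fin 2 → F) × (Fˣ × K) => (q.2.1 : F) :=
    units_measurableEmbedding.measurable.comp (measurable_fst.comp measurable_snd)
  have h2 : Measurable fun q : (Fin 2 → F) × (Fˣ × K) => q.2.2 :=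
    measurable_snd.comp measurable_snd
  have h3 : Measurable fun q : (Fin 2 → F) × (Fˣ × K) => ENNReal.ofReal (localAbs (q.2.1 : F) ^ 2) :=
    ENNReal.measurable_ofReal.comp ((measurable_localAbs.comp h1).pow_const 2)
  have h4 : Measurable fun q : (Fin 2 → F) × (Fˣ × K) =>
      planeAct (q.2.2 : SL(2, F))⁻¹ q.1 := by
    refine measurable_pi_iff.2 fun j => ?_
    have e : ∀ i j, Measurable fun q : (Fin 2 → F) × (Fˣ × K) => (q.2.2 : SL(2, F)) i j :=
      fun i j => (measurable_entry K i j).comp h2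
    have e' : ∀ i, Measurable fun q : (Fin 2 → F) × (Fˣ × K) => q.1 i :=
      fun i => (measurable_pi_apply i).comp measurable_fst
    fin_cases j
    · rw [show (⟨0, by omega⟩ : Fin 2) = 0 from rfl]
      simp only [planeAct_inv_zero]
      exact (((e 1 1).mul (e' 0)).sub ((e 1 0).mul (e' 1)))
    · rw [show (⟨1, by omega⟩ : Fin 2) = 1 from rfl]
      simp only [planeAct_inv_one]
      exact (((e 0 0).mul (e' 1)).sub ((e 0 1).mul (e' 0)))
  exact h3.mul (hw.comp (h1.smul h4))

theorem measurable_polarAverage_integrand {w : (Fin 2 → F) → ℝ≥0∞} (hw : Measurable w)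
    (v : Fin 2 → F) : Measurable fun p : Fˣ × K =>
      ENNReal.ofReal (localAbs (p.1 : F) ^ 2) * w (polarPoint K p v) := by
  have h := (measurable_polar_aux K hw).comp (measurable_prodMk_left (x := v))
  exact h

theorem polarAverage_bottomRow {w : (Fin 2 → F) → ℝ≥0∞} (hw : Measurable w) (q : Fˣ × K) :
    polarAverage K μ w (bottomRow K q) =
      ENNReal.ofReal (localAbs (q.1 : F) ^ 2) * polarAverage K μ w ![0, 1] := by
  have hm := measurable_polarAverage_integrand K hw (bottomRow K q)
  rw [polarAverage, ← lintegral_polarMeasure_mul_right K μ hm q, polarAverage,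
    ← lintegral_const_mul' _ _ ENNReal.ofReal_ne_top]
  refine lintegral_congr fun p => ?_
  have hq := q.1.ne_zero
  have e1 : polarPoint K (p * q) (bottomRow K q) = polarPoint K p ![0, 1] := by
    have h3 : ((p * q).2 : SL(2, F))⁻¹ = (q.2 : SL(2, F))⁻¹ * (p.2 : SL(2, F))⁻¹ := by
      rw [Prod.snd_mul, Subgroup.coe_mul, _root_.mul_inv_rev]
    have h4 : planeAct (q.2 : SL(2, F))⁻¹ (planeAct (q.2 : SL(2, F)) ![0, 1]) = ![0, 1] := by
      rw [← planeAct_mul, mul_inv_cancel, planeAct_one]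
    rw [polarPoint, h3, bottomRow_eq, planeAct_smul, planeAct_mul, h4, smul_smul,
      Prod.fst_mul, Units.val_mul, mul_assoc, mul_inv_cancel₀ hq, mul_one, polarPoint]
  rw [e1, Prod.fst_mul, Units.val_mul, localAbs_mul, mul_pow, mul_comm (localAbs (p.1 : F) ^ 2),
    ENNReal.ofReal_mul (by positivity), mul_assoc]

/-- Unfolding the average of a test function against Lebesgue measure. -/
theorem lintegral_mul_polarAverage (hK : IsIwasawa K) {h w : (Fin 2 → F) → ℝ≥0∞}
    (hh : Measurable h) (hw : Measurable w) :
    ∫⁻ v, h v * polarAverage K μ w v ∂vol[μ] =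
      (∫⁻ v, w v ∂vol[μ]) * ∫⁻ p, h (bottomRow K p) ∂polarMeasure K μ := by
  have hne : ∀ᵐ v ∂(Measure.pi fun _ : Fin 2 => μ), v ≠ 0 := by rw [ae_iff]; simp
  have hm1 := measurable_polar_aux K hw
  have hm2 : Measurable fun q : (Fˣ × K) × (Fin 2 → F) =>
      h ((q.1.1 : F)⁻¹ • planeAct (q.1.2 : SL(2, F)) q.2) * w q.2 := by
    have h1 : Measurable fun q : (Fˣ × K) × (Fin 2 → F) => ((q.1.1 : F))⁻¹ :=
      (units_measurableEmbedding.measurable.comp (measurable_fst.comp measurable_fst)).inv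
    have h2 : Measurable fun q : (Fˣ × K) × (Fin 2 → F) => q.1.2 :=
      measurable_snd.comp measurable_fst
    exact (hh.comp (h1.smul (measurable_planeAct K h2 measurable_snd))).mul
      (hw.comp measurable_snd)
  have hm3 : Measurable fun q : (Fin 2 → F) × (Fˣ × K) => h q.1 *
      (ENNReal.ofReal (localAbs (q.2.1 : F) ^ 2) * w (polarPoint K q.2 q.1)) :=
    (hh.comp measurable_fst).mul hm1
  calc ∫⁻ v, h v * polarAverage K μ w v ∂vol[μ]
      = ∫⁻ v, ∫⁻ p, h v * (ENNReal.ofReal (localAbs (p.1 : F) ^ 2) *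
          w (polarPoint K p v)) ∂polarMeasure K μ
          ∂vol[μ] := by
        refine lintegral_congr fun v => ?_
        have hm := measurable_polarAverage_integrand K hw v
        rw [polarAverage, ← lintegral_const_mul _ hm]
    _ = ∫⁻ p, ∫⁻ v, h v * (ENNReal.ofReal (localAbs (p.1 : F) ^ 2) *
          w (polarPoint K p v)) ∂vol[μ]
          ∂polarMeasure K μ :=
        lintegral_lintegral_swap (f := fun v p => h v * (ENNReal.ofReal (localAbs (p.1 : F) ^ 2) *
          w (polarPoint K p v))) hm3.aemeasurable
    _ = ∫⁻ p, ∫⁻ v, h ((p.1 : F)⁻¹ • planeAct (p.2 : SL(2, F)) v) * w v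
          ∂vol[μ] ∂polarMeasure K μ := by
        refine lintegral_congr fun p => ?_
        have hp := p.1.ne_zero
        have hpp := localAbs_pos hp
        have h1 := lintegral_comp_smul_plane μ hp fun v => ENNReal.ofReal (localAbs (p.1 : F) ^ 2) *
          (h ((p.1 : F)⁻¹ • planeAct (p.2 : SL(2, F)) v) * w v)
        have h2 := lintegral_planeAct μ (p.2 : SL(2, F))⁻¹ fun v =>
          ENNReal.ofReal (localAbs (p.1 : F) ^ 2) *
          (h ((p.1 : F)⁻¹ • planeAct (p.2 : SL(2, F)) ((p.1 : F) • v)) * w ((p.1 : F) • v))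
        have h3 := lintegral_const_mul' (μ := Measure.pi fun _ : Fin 2 => μ)
          (ENNReal.ofReal (localAbs (p.1 : F) ^ 2))
          (fun v => h ((p.1 : F)⁻¹ • planeAct (p.2 : SL(2, F)) v) * w v) ENNReal.ofReal_ne_top
        rw [h3, ← mul_assoc, ← ENNReal.ofReal_mul (by positivity), inv_mul_cancel₀ (by positivity),
          ENNReal.ofReal_one, one_mul] at h1
        rw [← h1, ← h2]
        refine lintegral_congr fun v => ?_
        have h4 : planeAct (p.2 : SL(2, F)) (planeAct (p.2 : SL(2, F))⁻¹ v) = v := by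
          rw [← planeAct_mul, inv_mul_cancel, planeAct_one]
        rw [polarPoint, planeAct_smul, smul_smul, inv_mul_cancel₀ hp, one_smul, h4]
        ring
    _ = ∫⁻ v, ∫⁻ p, h ((p.1 : F)⁻¹ • planeAct (p.2 : SL(2, F)) v) * w v
          ∂polarMeasure K μ ∂vol[μ] :=
        lintegral_lintegral_swap hm2.aemeasurable
    _ = ∫⁻ v, (∫⁻ p, h (bottomRow K p) ∂polarMeasure K μ) * w v ∂vol[μ] := by
        refine lintegral_congr_ae (hne.mono fun v hv => ?_)
        beta_reduce
        obtain ⟨q, rfl⟩ := exists_bottomRow K hK hv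
        have hm3 : Measurable fun p : Fˣ × K => h (bottomRow K p) := hh.comp (measurable_bottomRow K)
        have hm4 : Measurable fun p : Fˣ × K => h (bottomRow K (q * p)) := by
          have : Measurable fun p : Fˣ × K => q * p :=
            ((measurable_const_mul q.1).comp measurable_fst).prodMk
              ((measurable_const_mul q.2).comp measurable_snd)
          exact hm3.comp this
        simp only [← bottomRow_mul]
        rw [lintegral_mul_const _ hm4, lintegral_polarMeasure_mul_left K μ hm3]
    _ = _ := by rw [lintegral_const_mul _ hw, mul_comm]

/-- The points `(0, 1) k⁻¹` stay away from `0`, so only bounded `a` contribute, and these have finite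
volume for `|a|² d^×a`. -/
theorem polarAverage_ball_ne_top :
    polarAverage K μ ((Metric.ball 0 1).indicator 1) ![0, 1] ≠ ⊤ := by
  obtain ⟨r, hr, hrK⟩ : ∃ r : ℝ, 0 < r ∧
      ∀ m : K, r ≤ ‖planeAct (m : SL(2, F))⁻¹ ![0, 1]‖ := by
    have hc : Continuous fun m : K => ‖planeAct (m : SL(2, F))⁻¹ ![0, 1]‖ := by
      have h1 : Continuous fun g : K => ((g : SL(2, F)) : Matrix (Fin 2) (Fin 2) F) :=
        continuous_subtype_val.comp continuous_subtype_val
      refine (continuous_pi fun j => ?_).norm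
      fin_cases j
      · rw [show (⟨0, by omega⟩ : Fin 2) = 0 from rfl]
        refine (h1.matrix_elem 1 0).neg.congr fun g => ?_
        rw [planeAct_inv_zero]
        simp
      · rw [show (⟨1, by omega⟩ : Fin 2) = 1 from rfl]
        simpa [planeAct_inv_one] using h1.matrix_elem 0 0
    obtain ⟨m₀, -, h⟩ := isCompact_univ.exists_isMinOn (Set.univ_nonempty (α := K)) hc.continuousOn
    refine ⟨_, norm_pos_iff.2 fun h0 => ?_, fun m => h (Set.mem_univ m)⟩
    have h1 := congrArg (planeAct (m₀ : SL(2, F))) h0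
    rw [← planeAct_mul, inv_mul_cancel, planeAct_one] at h1
    have h2 := congrFun h1 1
    rw [planeAct_apply] at h2
    simp at h2
  obtain ⟨B, hB⟩ : ∃ B : ℝ, ∀ x ∈ Metric.ball (0 : F) r⁻¹, localAbs x ≤ B := by
    obtain ⟨C, hC, M, h⟩ := modulus_le_norm_pow F
    refine ⟨C * (1 + r⁻¹) ^ M, fun x hx => ?_⟩
    rw [mem_ball_zero_iff] at hx
    rcases eq_or_ne x 0 with rfl | h0
    · rw [localAbs_zero]; positivity
    · rw [localAbs_of_ne_zero h0]
      refine (h _).trans ?_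
      rw [Units.val_mk0]
      gcongr
  set g : F → ℝ≥0∞ := fun a => ENNReal.ofReal (localAbs a ^ 2) *
    (Metric.ball (0 : F) r⁻¹).indicator 1 a with hg
  have hgm : Measurable g := (ENNReal.measurable_ofReal.comp (measurable_localAbs.pow_const 2)).mul
    (measurable_one.indicator Metric.isOpen_ball.measurableSet)
  have hgp : Measurable fun p : Fˣ × K => g p.1 :=
    hgm.comp (units_measurableEmbedding.measurable.comp measurable_fst)
  refine ne_top_of_le_ne_top (b := ∫⁻ p, g p.1 ∂polarMeasure K μ) ?_ (lintegral_mono fun p => ?_)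
  · rw [polarMeasure, lintegral_prod _ hgp.aemeasurable]
    simp only [lintegral_const, measure_univ, mul_one]
    rw [lintegral_unitsMeasure μ hgm]
    refine ne_top_of_le_ne_top (b := ∫⁻ x in Metric.ball (0 : F) r⁻¹, ENNReal.ofReal B ∂μ) ?_ ?_
    · rw [lintegral_const, Measure.restrict_apply_univ]
      exact ENNReal.mul_ne_top ENNReal.ofReal_ne_top measure_ball_lt_top.ne
    · rw [← lintegral_indicator Metric.isOpen_ball.measurableSet]
      refine lintegral_mono fun x => ?_
      by_cases hx : x ∈ Metric.ball (0 : F) r⁻¹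
      · simp only [hg, Set.indicator_of_mem hx, Pi.one_apply, mul_one]
        rw [← ENNReal.ofReal_mul (inv_nonneg.2 (localAbs_nonneg x))]
        refine ENNReal.ofReal_le_ofReal ?_
        rcases eq_or_ne x 0 with rfl | h0
        · simpa using (localAbs_nonneg _).trans (hB 0 hx)
        · rw [sq, inv_mul_cancel_left₀ (localAbs_pos h0).ne']
          exact hB x hx
      · simp [hg, Set.indicator_of_notMem hx]
  · refine mul_le_mul_right ?_ _
    by_cases hx : (p.1 : F) ∈ Metric.ball (0 : F) r⁻¹
    · rw [Set.indicator_of_mem hx]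
      exact Set.indicator_le_self' (fun _ _ => zero_le_one) _ |>.trans le_rfl
    · rw [Set.indicator_of_notMem, Set.indicator_of_notMem hx]
      rw [mem_ball_zero_iff, not_lt] at hx ⊢
      rw [polarPoint, norm_smul]
      calc (1 : ℝ) = r⁻¹ * r := (inv_mul_cancel₀ hr.ne').symm
        _ ≤ _ := mul_le_mul hx (hrK p.2) hr.le (norm_nonneg _)

/-- The invariant measure on `N\SL₂` is a multiple of Lebesgue measure on the plane of bottom
rows: both satisfy the same unfolding identity, since Lebesgue measure is invariant under `K` and
scales by `|a|⁻²` under `diag(a, a⁻¹)`. -/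
theorem exists_map_quotMeasure (k : LocalKind F) (hK : IsIwasawa K) :
    ∃ C : ℝ≥0∞, C ≠ ⊤ ∧
      (quotMeasure k μ K).map (bottomRow K) = C • Measure.pi fun _ : Fin 2 => μ := by
  set w : (Fin 2 → F) → ℝ≥0∞ := (Metric.ball 0 1).indicator 1
  have hw : Measurable w := measurable_one.indicator Metric.isOpen_ball.measurableSet
  set τ := polarAverage K μ w ![0, 1] with hτ
  have hτt : τ ≠ ⊤ := polarAverage_ball_ne_top K μ
  set L := ∫⁻ v, w v ∂(Measure.pi fun _ : Fin 2 => μ) with hL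
  have hL' : L = (Measure.pi fun _ : Fin 2 => μ) (Metric.ball 0 1) :=
    lintegral_indicator_one Metric.isOpen_ball.measurableSet
  have hL0 : L ≠ 0 := by
    rw [hL']; exact (Metric.measure_ball_pos _ _ one_pos).ne'
  have hLt : L ≠ ⊤ := by rw [hL']; exact measure_ball_lt_top.ne
  refine ⟨ENNReal.ofReal (zetaOne k) * (L⁻¹ * τ),
    ENNReal.mul_ne_top ENNReal.ofReal_ne_top (ENNReal.mul_ne_top (ENNReal.inv_ne_top.2 hL0) hτt),
    ?_⟩
  have hb := measurable_bottomRow K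
  have hpm : Measurable fun v : Fin 2 → F => polarAverage K μ w v :=
    (measurable_polar_aux K hw).lintegral_prod_right'
  ext s hs
  rw [Measure.map_apply hb hs, ← lintegral_indicator_one (hb hs),
    lintegral_quotMeasure K μ k (measurable_one.indicator (hb hs)), Measure.smul_apply, smul_eq_mul,
    ← lintegral_indicator_one hs, mul_assoc, mul_assoc]
  congr 1
  have hne : ∀ᵐ v ∂(Measure.pi fun _ : Fin 2 => μ), v ≠ 0 := by rw [ae_iff]; simp
  -- otherwise `F^×` would have measure zero
  have hτ0 : τ ≠ 0 := by
    intro h0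
    have h1 := lintegral_mul_polarAverage K μ hK (h := 1) measurable_one hw
    have h2 : ∫⁻ v, (1 : (Fin 2 → F) → ℝ≥0∞) v * polarAverage K μ w v
        ∂vol[μ] = 0 := by
      refine (lintegral_congr_ae (hne.mono fun v hv => ?_)).trans lintegral_zero
      obtain ⟨q, rfl⟩ := exists_bottomRow K hK hv
      rw [polarAverage_bottomRow K μ hw, ← hτ, h0, mul_zero, mul_zero]
    have h3 : ∫⁻ p : Fˣ × K, (1 : (Fin 2 → F) → ℝ≥0∞) (bottomRow K p) ∂polarMeasure K μ =
        ∫⁻ a : Fˣ, (1 : F → ℝ≥0∞) a ∂unitsMeasure μ := by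
      simp [polarMeasure, Measure.prod_apply MeasurableSet.univ]
    rw [h2, h3, lintegral_unitsMeasure μ measurable_one, zero_eq_mul] at h1
    have h4 := h1.resolve_left hL0
    have hm : Measurable fun x : F => ENNReal.ofReal (localAbs x)⁻¹ * (1 : F → ℝ≥0∞) x :=
      (ENNReal.measurable_ofReal.comp measurable_localAbs.inv).mul measurable_one
    rw [lintegral_eq_zero_iff hm] at h4
    have h5 : ∀ᵐ x : F ∂μ, x ≠ 0 := by rw [ae_iff]; simp
    obtain ⟨x, hx, hx0⟩ := (h4.and h5).exists
    have := localAbs_pos hx0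
    simp [this] at hx
  have hhm : Measurable fun v => s.indicator (1 : (Fin 2 → F) → ℝ≥0∞) v *
      (polarAverage K μ w v)⁻¹ := (measurable_one.indicator hs).mul hpm.inv
  have hX := lintegral_mul_polarAverage K μ hK hhm hw
  have h1 : ∫⁻ v, s.indicator (1 : (Fin 2 → F) → ℝ≥0∞) v * (polarAverage K μ w v)⁻¹ *
      polarAverage K μ w v ∂vol[μ] =
      ∫⁻ v, s.indicator (1 : (Fin 2 → F) → ℝ≥0∞) v ∂vol[μ] := by
    refine lintegral_congr_ae (hne.mono fun v hv => ?_)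
    obtain ⟨q, rfl⟩ := exists_bottomRow K hK hv
    have hq := localAbs_pos q.1.ne_zero
    beta_reduce
    rw [polarAverage_bottomRow K μ hw, mul_assoc, ENNReal.inv_mul_cancel, mul_one]
    · exact mul_ne_zero (ENNReal.ofReal_pos.2 (by positivity)).ne' hτ0
    · exact ENNReal.mul_ne_top ENNReal.ofReal_ne_top hτt
  have h2 : ∫⁻ p, s.indicator (1 : (Fin 2 → F) → ℝ≥0∞) (bottomRow K p) *
      (polarAverage K μ w (bottomRow K p))⁻¹ ∂polarMeasure K μ =
      τ⁻¹ * ∫⁻ p, ENNReal.ofReal (localAbs (p.1 : F) ^ 2)⁻¹ *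
        (bottomRow K ⁻¹' s).indicator 1 p ∂polarMeasure K μ := by
    rw [← lintegral_const_mul' _ _ (ENNReal.inv_ne_top.2 hτ0)]
    refine lintegral_congr fun p => ?_
    have hq := localAbs_pos p.1.ne_zero
    rw [polarAverage_bottomRow K μ hw, ENNReal.mul_inv (Or.inr hτt) (Or.inr hτ0),
      ENNReal.ofReal_inv_of_pos (by positivity),
      show (bottomRow K ⁻¹' s).indicator (1 : Fˣ × K → ℝ≥0∞) p =
        s.indicator (1 : (Fin 2 → F) → ℝ≥0∞) (bottomRow K p) from rfl]
    ring
  rw [h1, h2, ← hL] at hX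
  rw [hX, ← mul_assoc τ, mul_comm τ L, mul_assoc L, ← mul_assoc τ, ENNReal.mul_inv_cancel hτ0 hτt,
    one_mul, ← mul_assoc, ENNReal.inv_mul_cancel hL0 hLt, one_mul]

end Plane

/-! ### Products of Schwartz functions and uniform bounds -/

section Tensor

variable {D D₁ D₂ : Type*} [NormedAddCommGroup D] [NormedSpace ℝ D] [NormedAddCommGroup D₁]
  [NormedSpace ℝ D₁] [NormedAddCommGroup D₂] [NormedSpace ℝ D₂]

theorem norm_iteratedFDeriv_comp_le {p : D →L[ℝ] D₁} (hp : ‖p‖ ≤ 1) (f : 𝓢(D₁, ℂ)) (n : ℕ)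
    (x : D) : ‖iteratedFDeriv ℝ n (fun x => f (p x)) x‖ ≤ ‖iteratedFDeriv ℝ n f (p x)‖ := by
  have h1 := p.iteratedFDeriv_comp_right (f.smooth ⊤) x (i := n) (by exact_mod_cast le_top)
  rw [show (fun x => f (p x)) = f ∘ p from rfl, h1]
  refine (ContinuousMultilinearMap.norm_compContinuousLinearMap_le _ _).trans ?_
  rw [Finset.prod_const]
  exact mul_le_of_le_one_right (norm_nonneg _) (pow_le_one₀ (norm_nonneg _) hp)

/-- The product `f(p₁ x) g(p₂ x)` of Schwartz functions depends continuously on `f`. -/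
def tensorCLM (p₁ : D →L[ℝ] D₁) (p₂ : D →L[ℝ] D₂) (h₁ : ‖p₁‖ ≤ 1) (h₂ : ‖p₂‖ ≤ 1)
    (h : ∀ x, ‖x‖ ≤ ‖p₁ x‖ + ‖p₂ x‖) (g : 𝓢(D₂, ℂ)) : 𝓢(D₁, ℂ) →L[ℂ] 𝓢(D, ℂ) :=
  SchwartzMap.mkCLM (fun f x => f (p₁ x) * g (p₂ x))
    (fun f f' x => by simp [add_mul])
    (fun a f x => by simp [mul_assoc])
    (fun f => ((f.smooth ⊤).comp p₁.contDiff).mul ((g.smooth ⊤).comp p₂.contDiff))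
    (fun ⟨k, n⟩ => by
      refine ⟨Finset.Iic (k, n), ∑ i ∈ Finset.range (n + 1), (n.choose i : ℝ) * 2 ^ k *
        (2 ^ k * (Finset.Iic (k, n)).sup (fun m => SchwartzMap.seminorm ℝ m.1 m.2) g),
        by positivity, fun f x => ?_⟩
      have h1 := norm_iteratedFDeriv_mul_le ((f.smooth ⊤).comp p₁.contDiff)
        ((g.smooth ⊤).comp p₂.contDiff) x (n := n) (by exact_mod_cast le_top)
      refine (mul_le_mul_of_nonneg_left h1 (by positivity)).trans ?_
      rw [Finset.mul_sum, Finset.sum_mul]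
      refine Finset.sum_le_sum fun i hi => ?_
      have hx : ‖x‖ ^ k ≤ (1 + ‖p₁ x‖) ^ k * (1 + ‖p₂ x‖) ^ k := by
        rw [← mul_pow]
        refine pow_le_pow_left₀ (norm_nonneg _) ((h x).trans ?_) k
        nlinarith [norm_nonneg (p₁ x), norm_nonneg (p₂ x)]
      have hf := SchwartzMap.one_add_le_sup_seminorm_apply (𝕜 := ℂ) (m := (k, n)) (k := k) (n := i)
        le_rfl (by simpa [Nat.lt_succ_iff] using hi) f (p₁ x)
      have hg := SchwartzMap.one_add_le_sup_seminorm_apply (𝕜 := ℝ) (m := (k, n)) (k := k)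
        (n := n - i) le_rfl (by simp) g (p₂ x)
      calc ‖x‖ ^ k * ((n.choose i : ℝ) * ‖iteratedFDeriv ℝ i (fun x => f (p₁ x)) x‖ *
            ‖iteratedFDeriv ℝ (n - i) (fun x => g (p₂ x)) x‖)
          ≤ ((1 + ‖p₁ x‖) ^ k * (1 + ‖p₂ x‖) ^ k) * ((n.choose i : ℝ) *
            ‖iteratedFDeriv ℝ i f (p₁ x)‖ * ‖iteratedFDeriv ℝ (n - i) g (p₂ x)‖) := by
            gcongr
            · exact norm_iteratedFDeriv_comp_le h₁ f i x
            · exact norm_iteratedFDeriv_comp_le h₂ g (n - i) x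
        _ = (n.choose i : ℝ) * ((1 + ‖p₁ x‖) ^ k * ‖iteratedFDeriv ℝ i f (p₁ x)‖) *
            ((1 + ‖p₂ x‖) ^ k * ‖iteratedFDeriv ℝ (n - i) g (p₂ x)‖) := by ring
        _ ≤ (n.choose i : ℝ) * (2 ^ k * (Finset.Iic (k, n)).sup
              (fun m => SchwartzMap.seminorm ℂ m.1 m.2) f) *
            (2 ^ k * (Finset.Iic (k, n)).sup (fun m => SchwartzMap.seminorm ℝ m.1 m.2) g) := by
            gcongr
        _ = _ := by
            rw [show schwartzSeminormFamily ℂ D₁ ℂ = fun m => SchwartzMap.seminorm ℂ m.1 m.2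
              from rfl]
            ring)

end Tensor

section Bounded

variable {F : Type*} [NontriviallyNormedField F] [ProperSpace F] {k : LocalKind F}
  {κ κ₁ κ₂ κ' : Type*} [Fintype κ] [Fintype κ₁] [Fintype κ₂] [Fintype κ'] {X : Type*}

/-- The linear map `x ↦ x ∘ e`. -/
def reindexCLM [NormedAlgebra ℝ F] (e : κ₁ → κ) : (κ → F) →L[ℝ] (κ₁ → F) :=
  ContinuousLinearMap.pi fun i => ContinuousLinearMap.proj (e i)

theorem norm_reindexCLM_le [NormedAlgebra ℝ F] (e : κ₁ → κ) :
    ‖(reindexCLM e : (κ → F) →L[ℝ] (κ₁ → F))‖ ≤ 1 := by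
  refine ContinuousLinearMap.opNorm_le_bound _ zero_le_one fun x => ?_
  rw [one_mul]
  exact (pi_norm_le_iff_of_nonneg (norm_nonneg _)).2 fun i => norm_le_pi_norm x (e i)

/-- The product of the pullbacks of Schwartz functions to complementary sets of coordinates. -/
theorem isSchwartzOp_tensor (e₁ : κ₁ → κ) (e₂ : κ₂ → κ)
    (h : ∀ i, i ∈ Set.range e₁ ∨ i ∈ Set.range e₂) {g : (κ₂ → F) → ℂ} (hg : g ∈ schwartz k κ₂) :
    IsSchwartzOp k fun (f : (κ₁ → F) → ℂ) (x : κ → F) => f (x ∘ e₁) * g (x ∘ e₂) := by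
  have hn : ∀ x : κ → F, ‖x‖ ≤ ‖x ∘ e₁‖ + ‖x ∘ e₂‖ := fun x => by
    refine (pi_norm_le_iff_of_nonneg (by positivity)).2 fun i => ?_
    rcases h i with ⟨j, rfl⟩ | ⟨j, rfl⟩
    · exact (norm_le_pi_norm (x ∘ e₁) j).trans (le_add_of_nonneg_right (norm_nonneg _))
    · exact (norm_le_pi_norm (x ∘ e₂) j).trans (le_add_of_nonneg_left (norm_nonneg _))
  cases k with
  | nonarch _ =>
    refine ⟨fun f hf => ⟨?_, ?_⟩, fun f _ f' _ => ?_, fun c f _ => ?_⟩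
    · exact (hf.1.comp_continuous (continuous_pi fun i => continuous_apply (e₁ i))).mul
        (hg.1.comp_continuous (continuous_pi fun i => continuous_apply (e₂ i)))
    · obtain ⟨-, R₁, h₁⟩ := (mem_locConstCompact_iff f).1 hf
      obtain ⟨-, R₂, h₂⟩ := (mem_locConstCompact_iff g).1 hg
      refine HasCompactSupport.intro (isCompact_closedBall (0 : κ → F) (R₁ + R₂)) fun x hx => ?_
      by_contra h0
      obtain ⟨hf0, hg0⟩ := mul_ne_zero_iff.1 h0
      exact hx (mem_closedBall_zero_iff.2 ((hn x).trans (add_le_add (h₁ _ hf0) (h₂ _ hg0))))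
    · ext x; exact add_mul _ _ _
    · ext x; exact mul_assoc _ _ _
  | arch alg =>
    obtain ⟨g, rfl⟩ := hg
    exact ⟨tensorCLM (reindexCLM e₁) (reindexCLM e₂) (norm_reindexCLM_le e₁) (norm_reindexCLM_le e₂)
      hn g, fun f => rfl⟩

/-- A family of functionals of `f ∈ S(F^κ)` that is bounded for every `f`; if `F` is archimedean,
the bound is required to be a continuous seminorm. -/
def SchwartzBounded (k : LocalKind F) (Φ : ((κ → F) → ℂ) → X → ℝ) : Prop :=
  match k with
  | .nonarch _ => ∀ f ∈ locConstCompact F κ, ∃ C, ∀ x, Φ f x ≤ C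
  | .arch _ => SeminormBounded fun (f : 𝓢(κ → F, ℂ)) x => Φ f x

namespace SchwartzBounded

variable {Φ : ((κ → F) → ℂ) → X → ℝ}

theorem exists_bound (h : SchwartzBounded k Φ) {f : (κ → F) → ℂ} (hf : f ∈ schwartz k κ) :
    ∃ C, ∀ x, Φ f x ≤ C := by
  cases k with
  | nonarch _ => exact h f hf
  | arch _ =>
    obtain ⟨s, C, -, h⟩ := h
    obtain ⟨f, rfl⟩ := hf
    exact ⟨_, h f⟩

theorem comp (h : SchwartzBounded k Φ) {T : ((κ' → F) → ℂ) → ((κ → F) → ℂ)}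
    (hT : IsSchwartzOp k T) : SchwartzBounded k fun f x => Φ (T f) x := by
  cases k with
  | nonarch _ => exact fun f hf => h _ (hT.1 f hf)
  | arch _ =>
    obtain ⟨A, hA⟩ := hT
    refine (SeminormBounded.comp h A).mono fun f x => ?_
    exact (congrArg (Φ · x) (hA f)).le

/-- A family that is controlled by the bounds of two others. -/
theorem of_bounds {X₁ X₂ : Type*} {Φ₁ : ((κ → F) → ℂ) → X₁ → ℝ} {Φ₂ : ((κ → F) → ℂ) → X₂ → ℝ}
    (h₁ : SchwartzBounded k Φ₁) (h₂ : SchwartzBounded k Φ₂) {c : ℝ} (hc : 0 ≤ c)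
    (h : ∀ f ∈ schwartz k κ, ∀ B, (∀ y, Φ₁ f y ≤ B) → (∀ y, Φ₂ f y ≤ B) → ∀ x, Φ f x ≤ c * B) :
    SchwartzBounded k Φ := by
  cases k with
  | nonarch _ =>
    intro f hf
    obtain ⟨C₁, h₁⟩ := h₁ f hf
    obtain ⟨C₂, h₂⟩ := h₂ f hf
    exact ⟨_, h f hf (max C₁ C₂) (fun y => (h₁ y).trans (le_max_left _ _))
      fun y => (h₂ y).trans (le_max_right _ _)⟩
  | arch _ =>
    obtain ⟨s₁, C₁, hC₁, h₁⟩ := h₁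
    obtain ⟨s₂, C₂, hC₂, h₂⟩ := h₂
    have hs : ∀ {s t : Finset (ℕ × ℕ)}, s ⊆ t → ∀ f : 𝓢(κ → F, ℂ),
        s.sup (schwartzSeminormFamily ℂ (κ → F) ℂ) f ≤
          t.sup (schwartzSeminormFamily ℂ (κ → F) ℂ) f := fun hst f =>
      Seminorm.le_def.1 (Finset.sup_mono hst) f
    refine ⟨s₁ ∪ s₂, c * (C₁ + C₂), by positivity, fun f x => ?_⟩
    rw [mul_assoc]
    refine h f ⟨f, rfl⟩ _ (fun y => (h₁ f y).trans ?_) (fun y => (h₂ f y).trans ?_) x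
    · exact mul_le_mul (le_add_of_nonneg_right hC₂) (hs Finset.subset_union_left f)
        (apply_nonneg _ _) (by positivity)
    · exact mul_le_mul (le_add_of_nonneg_left hC₁) (hs Finset.subset_union_right f)
        (apply_nonneg _ _) (by positivity)

theorem mono {X₁ : Type*} {Φ₁ : ((κ → F) → ℂ) → X₁ → ℝ} (h₁ : SchwartzBounded k Φ₁) {c : ℝ}
    (hc : 0 ≤ c) (h : ∀ f ∈ schwartz k κ, ∀ x, ∃ y, Φ f x ≤ c * Φ₁ f y) : SchwartzBounded k Φ :=
  of_bounds h₁ h₁ hc fun f hf _ hB _ x => by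
    obtain ⟨y, hy⟩ := h f hf x
    exact hy.trans (mul_le_mul_of_nonneg_left (hB y) hc)

theorem decay (N : ℕ) : SchwartzBounded k fun (f : (κ → F) → ℂ) x => (1 + ‖x‖) ^ N * ‖f x‖ := by
  cases k with
  | nonarch h => exact fun f hf => schwartz_decay (k := .nonarch h) hf N
  | arch _ =>
    refine ⟨Finset.Iic (N, 0), 2 ^ N, by positivity, fun f x => ?_⟩
    have := SchwartzMap.one_add_le_sup_seminorm_apply (𝕜 := ℂ) (m := (N, 0)) (k := N) (n := 0)
      le_rfl le_rfl f x
    rwa [norm_iteratedFDeriv_zero] at this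

end SchwartzBounded

/-- A functional that is bounded and vanishes on a space of Schwartz functions vanishes on its
closure. -/
theorem eq_zero_of_mem_schwartzClosure {Λ : ((κ → F) → ℂ) → ℂ}
    (hb : SchwartzBounded k fun f (_ : Unit) => ‖Λ f‖)
    (hadd : ∀ f ∈ schwartz k κ, ∀ g ∈ schwartz k κ, Λ (f + g) = Λ f + Λ g)
    (hsmul : ∀ (c : ℂ), ∀ f ∈ schwartz k κ, Λ (c • f) = c * Λ f)
    {W : Submodule ℂ ((κ → F) → ℂ)} (hW : ∀ f ∈ W, f ∈ schwartz k κ → Λ f = 0)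
    {f : (κ → F) → ℂ} (hf : f ∈ schwartzClosure k κ W) (hf' : f ∈ schwartz k κ) : Λ f = 0 := by
  cases k with
  | nonarch _ => exact hW f hf hf'
  | arch _ =>
    obtain ⟨s, C, hC, hb⟩ := hb
    let A : 𝓢(κ → F, ℂ) →L[ℂ] ℂ := SchwartzMap.mkCLMtoNormedSpace (fun f => Λ f)
      (fun f g => hadd f ⟨f, rfl⟩ g ⟨g, rfl⟩) (fun c f => hsmul c f ⟨f, rfl⟩)
      ⟨s, C, hC, fun f => hb f ()⟩
    obtain ⟨f, hf, rfl⟩ := hf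
    have h1 : (W.comap (schwartzIncl κ)).topologicalClosure ≤ LinearMap.ker A.toLinearMap :=
      Submodule.topologicalClosure_minimal _ (fun g hg => hW _ hg ⟨g, rfl⟩) A.isClosed_ker
    exact h1 hf

/-- An operator that preserves a space of Schwartz functions preserves its closure. -/
theorem IsSchwartzOp.map_schwartzClosure {T : ((κ → F) → ℂ) → ((κ → F) → ℂ)}
    (hT : IsSchwartzOp k T) {W : Submodule ℂ ((κ → F) → ℂ)}
    (hW : ∀ f ∈ W, f ∈ schwartz k κ → T f ∈ W) {f : (κ → F) → ℂ}
    (hf : f ∈ schwartzClosure k κ W) (hf' : f ∈ schwartz k κ) : T f ∈ schwartzClosure k κ W := by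
  cases k with
  | nonarch _ => exact hW f hf hf'
  | arch _ =>
    obtain ⟨A, hA⟩ := hT
    obtain ⟨f, hf, rfl⟩ := hf
    have h1 : (W.comap (schwartzIncl κ)).topologicalClosure ≤
        ((W.comap (schwartzIncl κ)).topologicalClosure).comap A.toLinearMap := by
      refine Submodule.topologicalClosure_minimal _ (fun g hg => ?_)
        ((Submodule.isClosed_topologicalClosure _).preimage A.continuous)
      refine Submodule.le_topologicalClosure _ ?_
      have h2 : T (schwartzIncl κ g) = schwartzIncl κ (A g) := hA g
      change schwartzIncl κ (A g) ∈ W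
      rw [← h2]
      exact hW _ hg ⟨g, rfl⟩
    exact ⟨A f, h1 hf, (hA f).symm⟩

end Bounded

/-! ### Convergence and continuity of the integral over `N\SL₂` -/

section Weight

variable {F : Type*} [NontriviallyNormedField F] [ProperSpace F] [MeasurableSpace F] [BorelSpace F]
variable (μ : Measure F) [μ.IsAddHaarMeasure]

/-- A large negative power of `1 + ‖v‖` is integrable on the plane: compare it with a geometric
series on the dilates of the unit ball. -/
theorem exists_integrable_weight : ∃ N : ℕ,
    Integrable (fun v : Fin 2 → F => ((1 + ‖v‖) ^ N)⁻¹) vol[μ] := by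
  obtain ⟨x, hx⟩ := NormedField.exists_one_lt_norm F
  have hx0 : x ≠ 0 := norm_pos_iff.1 (one_pos.trans hx)
  have hxp := one_pos.trans hx
  have hq := localAbs_pos hx0
  obtain ⟨N, hN⟩ := pow_unbounded_of_one_lt (localAbs x ^ 2) hx
  refine ⟨N, ?_, ?_⟩
  · exact (Continuous.inv₀ (by fun_prop) fun v => by positivity).aestronglyMeasurable
  set ρ := localAbs x ^ 2 * (‖x‖ ^ N)⁻¹ with hρ
  have hρ1 : ρ < 1 := by rw [hρ, ← div_eq_mul_inv, div_lt_one (by positivity)]; exact hN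
  set w : (Fin 2 → F) → ℝ≥0∞ := (Metric.closedBall 0 1).indicator 1
  have hw : Measurable w := measurable_one.indicator Metric.isClosed_closedBall.measurableSet
  have hle : ∀ v : Fin 2 → F, ENNReal.ofReal ((1 + ‖v‖) ^ N)⁻¹ ≤
      ∑' n : ℕ, ENNReal.ofReal (‖x‖ ^ N * ((‖x‖ ^ N)⁻¹) ^ n) * w ((x⁻¹) ^ n • v) := by
    intro v
    have hex : ∃ n : ℕ, ‖v‖ ≤ ‖x‖ ^ n := (pow_unbounded_of_one_lt ‖v‖ hx).imp fun n h => h.le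
    classical
    set n := Nat.find hex with hn
    refine le_trans ?_ (ENNReal.le_tsum n)
    have h1 : w ((x⁻¹) ^ n • v) = 1 := by
      refine Set.indicator_of_mem ?_ _
      rw [mem_closedBall_zero_iff, norm_smul, norm_pow, norm_inv, inv_pow, inv_mul_le_iff₀
        (by positivity), mul_one]
      exact Nat.find_spec hex
    rw [h1, mul_one]
    refine ENNReal.ofReal_le_ofReal ?_
    have hv := norm_nonneg v
    rcases hn' : n with - | l
    · rw [pow_zero, mul_one]
      exact (inv_le_one_of_one_le₀ (one_le_pow₀ (by linarith))).trans (one_le_pow₀ hx.le)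
    · have h2 : ‖x‖ ^ l < ‖v‖ := not_le.1 (Nat.find_min hex (by omega))
      rw [pow_succ', mul_inv_cancel_left₀ (by positivity), inv_pow, ← pow_mul, mul_comm N, pow_mul]
      exact inv_anti₀ (by positivity) (pow_le_pow_left₀ (by positivity) (by linarith) N)
  have hi : ∀ n : ℕ, ∫⁻ v, ENNReal.ofReal (‖x‖ ^ N * ((‖x‖ ^ N)⁻¹) ^ n) * w ((x⁻¹) ^ n • v)
      ∂vol[μ] = ENNReal.ofReal (‖x‖ ^ N) * ENNReal.ofReal ρ ^ n *
        ∫⁻ v, w v ∂vol[μ] := by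
    intro n
    rw [lintegral_const_mul' _ _ ENNReal.ofReal_ne_top,
      lintegral_comp_smul_plane μ (pow_ne_zero n (inv_ne_zero hx0)), ← mul_assoc,
      ← ENNReal.ofReal_mul (by positivity), ← ENNReal.ofReal_pow (by positivity),
      ← ENNReal.ofReal_mul (by positivity), localAbs_pow, localAbs_inv, hρ]
    congr 2
    rw [inv_pow, inv_pow, inv_pow, inv_inv, mul_pow, inv_pow, ← pow_mul (localAbs x), mul_comm n 2,
      pow_mul]
    ring
  have hwt : ∫⁻ v, w v ∂(Measure.pi fun _ : Fin 2 => μ) ≠ ⊤ := by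
    rw [lintegral_indicator_one Metric.isClosed_closedBall.measurableSet]
    exact (isCompact_closedBall _ _).measure_lt_top.ne
  rw [hasFiniteIntegral_iff_ofReal (.of_forall fun v => by positivity)]
  refine lt_of_le_of_lt (lintegral_mono hle) ?_
  have hwm : ∀ n : ℕ, Measurable fun v : Fin 2 → F =>
      ENNReal.ofReal (‖x‖ ^ N * ((‖x‖ ^ N)⁻¹) ^ n) * w ((x⁻¹) ^ n • v) := fun n =>
    (hw.comp (measurable_const_smul ((x⁻¹) ^ n))).const_mul _
  rw [lintegral_tsum fun n => (hwm n).aemeasurable]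
  simp only [hi]
  rw [ENNReal.tsum_mul_right, ENNReal.tsum_mul_left, ENNReal.tsum_geometric]
  refine (ENNReal.mul_ne_top (ENNReal.mul_ne_top ENNReal.ofReal_ne_top ?_) hwt).lt_top
  rw [ne_eq, ENNReal.inv_eq_top, tsub_eq_zero_iff_le, not_le, ENNReal.ofReal_lt_one]
  exact hρ1

/-- The Hilbert symbol is a measurable function: the set where it is `1` is σ-compact. -/
theorem measurable_hilbertSymbol (b : F) : Measurable fun a : F => hilbertSymbol a b := by
  classical
  refine Measurable.ite (p := fun a : F => ∃ x y z : F, (x ≠ 0 ∨ y ≠ 0 ∨ z ≠ 0) ∧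
    z ^ 2 = a * x ^ 2 + b * y ^ 2) ?_ measurable_const measurable_const
  let E : ℕ → Set (F × F × F × F) := fun n =>
    {p | p.2.2.2 ^ 2 = p.1 * p.2.1 ^ 2 + b * p.2.2.1 ^ 2} ∩ {p | 1 / ((n : ℝ) + 1) ≤ ‖p.2‖} ∩
      Metric.closedBall 0 n
  have hE : ∀ n, IsCompact (E n) := fun n => (isCompact_closedBall _ _).inter_left
    ((isClosed_eq (by fun_prop) (by fun_prop)).inter (isClosed_le (by fun_prop) (by fun_prop)))
  have hset : {a : F | ∃ x y z : F, (x ≠ 0 ∨ y ≠ 0 ∨ z ≠ 0) ∧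
      z ^ 2 = a * x ^ 2 + b * y ^ 2} = ⋃ n, Prod.fst '' E n := by
    ext a
    simp only [Set.mem_ofPred_eq, Set.mem_iUnion, Set.mem_image]
    constructor
    · rintro ⟨x, y, z, h0, h⟩
      have hp : (x, y, z) ≠ (0 : F × F × F) := by
        simp only [ne_eq, Prod.mk_eq_zero]
        tauto
      obtain ⟨n₁, h1⟩ := exists_nat_one_div_lt (norm_pos_iff.2 hp)
      obtain ⟨n₂, h2⟩ := exists_nat_ge ‖(a, x, y, z)‖
      refine ⟨max n₁ n₂, (a, x, y, z), ⟨⟨h, ?_⟩, ?_⟩, rfl⟩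
      · refine le_trans ?_ h1.le
        exact one_div_le_one_div_of_le (by positivity) (by
          have : (n₁ : ℝ) ≤ (max n₁ n₂ : ℕ) := by exact_mod_cast le_max_left _ _
          linarith)
      · refine mem_closedBall_zero_iff.2 (h2.trans ?_)
        exact_mod_cast le_max_right _ _
    · rintro ⟨n, ⟨a', x, y, z⟩, ⟨⟨h, h1⟩, -⟩, rfl⟩
      refine ⟨x, y, z, ?_, h⟩
      by_contra! h0
      obtain ⟨rfl, rfl, rfl⟩ := h0
      have h2 : (0 : ℝ) < 1 / ((n : ℝ) + 1) := by positivity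
      have h3 : 1 / ((n : ℝ) + 1) ≤ ‖((0 : F), (0 : F), (0 : F))‖ := h1
      rw [show ((0 : F), (0 : F), (0 : F)) = 0 from rfl, norm_zero] at h3
      linarith
  change MeasurableSet {a : F | ∃ x y z : F, (x ≠ 0 ∨ y ≠ 0 ∨ z ≠ 0) ∧
      z ^ 2 = a * x ^ 2 + b * y ^ 2}
  rw [hset]
  exact MeasurableSet.iUnion fun n => ((hE n).image continuous_fst).isClosed.measurableSet

theorem norm_hilbertSymbol (a b : F) : ‖hilbertSymbol a b‖ = 1 := by
  unfold hilbertSymbol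
  split_ifs <;> simp

end Weight

section ConeSchwartzSpace

variable {F : Type*} [NontriviallyNormedField F] [ProperSpace F] [MeasurableSpace F] [BorelSpace F]
  {k : LocalKind F} {ψ : AddChar F Circle} (μ : Measure F) [μ.IsAddHaarMeasure]
  {κ : Type*} [Fintype κ] [DecidableEq κ] {S : Matrix κ κ F}

/-- The function `r(g) f(ξ, 0, 1)` of `g ∈ N\SL₂`, in terms of the bottom row `v = (c, d)` of `g`,
on the open set `c ≠ 0`. -/
def coneFun (ψ : AddChar F Circle) (hS : IsUnit S.det) (f : (κ ⊕ Fin 2 → F) → ℂ) (ξ : κ → F)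
    (v : Fin 2 → F) : ℂ :=
  weilConst ψ μ S * quadChar S (-v 0) * (((localAbs (v 0) ^ (Fintype.card κ / 2))⁻¹ : ℝ) : ℂ) *
    ∫ y, f (Sum.elim y v) * (ψ ((v 1 * quad S y - pairing S ξ y) / v 0) : ℂ) ∂quadMeasure μ hS

theorem planeAct_zero_one (g : SL(2, F)) (j : Fin 2) : planeAct g ![0, 1] j = g 1 j := by
  simp [planeAct_apply]

theorem mixedRep_eq_coneFun (hψ : Continuous ψ) (hψ1 : ψ ≠ 1) (hμ : IsSelfDual k ψ μ)
    (h2 : (2 : F) ≠ 0) (hn : Even (Fintype.card κ)) (hS : IsUnit S.det) (hs : S.IsSymm)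
    (f : (κ ⊕ Fin 2 → F) → ℂ) {ξ : κ → F} (hξ : quad S ξ = 0) {g : SL(2, F)}
    (hg : planeAct g ![0, 1] 0 ≠ 0) :
    mixedRep k ψ μ hS g f (Sum.elim ξ ![0, 1]) = coneFun μ ψ hS f ξ (planeAct g ![0, 1]) := by
  have hm : Fintype.card κ = 2 * (Fintype.card κ / 2) := (Nat.two_mul_div_two_of_even hn).symm
  rw [planeAct_zero_one] at hg
  unfold mixedRep
  rw [weilRep_of_ne_zero μ hψ hψ1 hμ h2 hm hS hs hg, coneFun]
  simp only [planeAct_zero_one, Sum.elim_comp_inl, Sum.elim_comp_inr, hξ, mul_zero, zero_div,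
    AddChar.map_zero_eq_one, Circle.coe_one, mul_one]
  rfl

theorem coneFun_mixedRep (hψ : Continuous ψ) (hψ1 : ψ ≠ 1) (hμ : IsSelfDual k ψ μ)
    (h2 : (2 : F) ≠ 0) (hn : Even (Fintype.card κ)) (hS : IsUnit S.det) (hs : S.IsSymm)
    {f : (κ ⊕ Fin 2 → F) → ℂ} (hf : f ∈ schwartz k (κ ⊕ Fin 2)) {ξ : κ → F} (hξ : quad S ξ = 0)
    (g : SL(2, F)) {v : Fin 2 → F} (hv : v 0 ≠ 0) (hg : planeAct g v 0 ≠ 0) :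
    coneFun μ ψ hS (mixedRep k ψ μ hS g f) ξ v = coneFun μ ψ hS f ξ (planeAct g v) := by
  obtain ⟨h, rfl⟩ := exists_planeAct_eq (v := v) fun h0 => hv (by rw [h0]; rfl)
  rw [← planeAct_mul] at hg ⊢
  rw [← mixedRep_eq_coneFun μ hψ hψ1 hμ h2 hn hS hs _ hξ hv,
    ← mixedRep_eq_coneFun μ hψ hψ1 hμ h2 hn hS hs _ hξ hg, mixedRep_mul μ hψ hψ1 hμ h2 hn hS hs h g hf]

theorem measurable_coneFun (hψ : Continuous ψ) (hS : IsUnit S.det) {f : (κ ⊕ Fin 2 → F) → ℂ}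
    (hf : Continuous f) (ξ : κ → F) : Measurable (coneFun μ ψ hS f ξ) := by
  have h0 : ∀ i, Measurable fun v : Fin 2 → F => v i := fun i => measurable_pi_apply i
  refine (((measurable_const.mul ((measurable_hilbertSymbol _).comp (h0 0).neg)).mul
    (Complex.measurable_ofReal.comp ((measurable_localAbs.comp (h0 0)).pow_const _).inv)).mul ?_)
  simp only [integral_quadMeasure]
  refine Measurable.const_smul (StronglyMeasurable.measurable ?_) _
  refine StronglyMeasurable.integral_prod_right' (f := fun p : (Fin 2 → F) × (κ → F) =>
    f (Sum.elim p.2 p.1) * (ψ ((p.1 1 * quad S p.2 - pairing S ξ p.2) / p.1 0) : ℂ)) ?_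
  refine Measurable.stronglyMeasurable (Measurable.mul ?_ ?_)
  · refine (hf.comp (continuous_pi ?_)).measurable
    rintro (i | i)
    · exact (continuous_apply i).comp continuous_snd
    · exact (continuous_apply i).comp continuous_fst
  · refine (measurable_character hψ).comp (Measurable.div ?_ ((h0 0).comp measurable_fst))
    refine Continuous.measurable ?_
    have h1 : Continuous fun p : (Fin 2 → F) × (κ → F) => quad S p.2 :=
      (continuous_quad S).comp continuous_snd
    have h3 : Continuous fun p : (Fin 2 → F) × (κ → F) => pairing S ξ p.2 :=
      continuous_const.dotProduct (continuous_const.matrix_mulVec continuous_snd)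
    exact (((continuous_apply 1).comp continuous_fst).mul h1).sub h3

/-- The absolute value of the inverse of a coordinate is polynomially bounded. -/
theorem exists_localAbs_inv_pow_le (F : Type*) [NontriviallyNormedField F] [ProperSpace F] (m : ℕ) :
    ∃ C : ℝ, 0 ≤ C ∧ ∃ M : ℕ, ∀ a : F, a ≠ 0 → (localAbs a ^ m)⁻¹ ≤ C * (1 + ‖a⁻¹‖) ^ M := by
  obtain ⟨C, hC, M, h⟩ := modulus_le_norm_pow F
  refine ⟨C ^ m, by positivity, M * m, fun a ha => ?_⟩
  rw [← inv_pow, ← localAbs_inv, localAbs_of_ne_zero (inv_ne_zero ha), pow_mul, ← mul_pow]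
  exact pow_le_pow_left₀ (modulus_pos _).le (h _) m

/-- A test function on the line that is bounded below on the unit ball, up to dilation. -/
theorem exists_bump_lower_bound (k : LocalKind F) : ∃ g : (Unit → F) → ℝ, ∃ a : F,
    (fun t => (g t : ℂ)) ∈ schwartz k Unit ∧ a ≠ 0 ∧ ∀ s : F, ‖s‖ ≤ 1 → 1 / 2 ≤ g fun _ => a * s := by
  obtain ⟨g, hg, -, hg1⟩ := exists_bump k Unit (F := F)
  have hc : Continuous g := Complex.continuous_re.comp (schwartz_continuous hg.mem_schwartz)
  obtain ⟨ε, hε, h⟩ := Metric.continuous_iff.1 hc 0 (1 / 2) (by norm_num)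
  obtain ⟨a, ha, haε⟩ := NormedField.exists_norm_lt F hε
  refine ⟨g, a, hg.mem_schwartz, norm_pos_iff.1 ha, fun s hs => ?_⟩
  have h1 := h (fun _ => a * s) (by
    rw [dist_zero_right]
    refine lt_of_le_of_lt ((pi_norm_le_iff_of_nonneg (norm_nonneg a)).2 fun _ => ?_) haε
    rw [norm_mul]
    exact mul_le_of_le_one_right (norm_nonneg _) hs)
  rw [hg1, Real.dist_eq] at h1
  linarith [(abs_lt.1 h1).1]

/-- The operator `f(y, v) ↦ ψ(b t Q(y)) f(y, v) g(t)`, which makes the parameter of a quadratic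
chirp into a variable of compact range. -/
theorem isSchwartzOp_chirp_family (hψ : Continuous ψ) (S : Matrix κ κ F) (b : F)
    {g : (Unit → F) → ℂ} (hg : g ∈ schwartz k Unit) :
    IsSchwartzOp k fun (f : (κ ⊕ Fin 2 → F) → ℂ) (z : κ ⊕ (Fin 2 ⊕ Unit) → F) =>
      (ψ (b * (z (Sum.inr (Sum.inr ())) * quad S (z ∘ Sum.inl))) : ℂ) *
        (f (z ∘ Sum.map id Sum.inl) * g (z ∘ fun u => Sum.inr (Sum.inr u))) := by
  refine (isSchwartzOp_phase ψ hψ (P := fun z : κ ⊕ (Fin 2 ⊕ Unit) → F =>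
    b * (z (Sum.inr (Sum.inr ())) * quad S (z ∘ Sum.inl))) ?_ fun alg => ?_).comp
    (isSchwartzOp_tensor _ _ ?_ hg)
  · exact continuous_const.mul ((continuous_apply _).mul
      ((continuous_quad S).comp (continuous_pi fun i => continuous_apply _)))
  · have h1 : Function.HasTemperateGrowth fun z : κ ⊕ (Fin 2 ⊕ Unit) → F =>
        z (Sum.inr (Sum.inr ())) :=
      (ContinuousLinearMap.proj (R := ℝ) (φ := fun _ : κ ⊕ (Fin 2 ⊕ Unit) => F)
        (Sum.inr (Sum.inr ()))).hasTemperateGrowth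
    have h3 : Function.HasTemperateGrowth fun z : κ ⊕ (Fin 2 ⊕ Unit) → F =>
        quad S (z ∘ Sum.inl) := by
      have h4 := ((hasTemperateGrowth_dotProduct_mulVec S).comp
        (reindexCLM (F := F) (Sum.inl : κ → κ ⊕ (Fin 2 ⊕ Unit))).hasTemperateGrowth).mul
        (.const (2 : F)⁻¹)
      simp only [quad, pairing, div_eq_mul_inv]
      exact h4
    exact (Function.HasTemperateGrowth.const b).mul (h1.mul h3)
  · rintro (i | i | i)
    · exact Or.inl ⟨Sum.inl i, rfl⟩
    · exact Or.inl ⟨Sum.inr i, rfl⟩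
    · exact Or.inr ⟨i, rfl⟩

/-- On the region `‖d‖ ≤ ‖c‖` the integral defining `coneFun` is the Fourier transform of a
Schwartz function at a point whose norm is at least `‖Sξ‖ / ‖c‖`; hence it decays faster than any
power of `‖c‖` as `c → 0`, which beats the factor `|c|^{-dim V / 2}`. -/
theorem schwartzBounded_coneFun_region (hψ : Continuous ψ) (hψ1 : ψ ≠ 1) (hS : IsUnit S.det)
    (hs : S.IsSymm) {ξ : κ → F} (hξ : ξ ≠ 0) (N : ℕ) :
    SchwartzBounded k fun (f : (κ ⊕ Fin 2 → F) → ℂ)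
      (v : {v : Fin 2 → F // v 0 ≠ 0 ∧ ‖v 1‖ ≤ ‖v 0‖}) =>
        (1 + ‖v.1‖) ^ N * ‖coneFun μ ψ hS f ξ v.1‖ := by
  obtain ⟨g, a, hg, ha, hga⟩ := exists_bump_lower_bound k
  obtain ⟨C, hC, M, hM⟩ := exists_localAbs_inv_pow_le F (Fintype.card κ / 2)
  have hη : S *ᵥ ξ ≠ 0 := fun h0 => hξ (by
    rw [← one_mulVec ξ, ← nonsing_inv_mul S hS, ← mulVec_mulVec, h0,
      mulVec_zero])
  have hηp := norm_pos_iff.2 hη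
  have hop := (isSchwartzOp_blockFourier (k := k) μ ψ hψ hψ1).comp
    (isSchwartzOp_chirp_family (κ := κ) hψ S a⁻¹ hg)
  set T := fun (f : (κ ⊕ Fin 2 → F) → ℂ) => blockFourier ψ μ
    fun z : κ ⊕ (Fin 2 ⊕ Unit) → F => (ψ (a⁻¹ * (z (Sum.inr (Sum.inr ())) *
      quad S (z ∘ Sum.inl))) : ℂ) * (f (z ∘ Sum.map id Sum.inl) *
        (g (z ∘ fun u => Sum.inr (Sum.inr u)) : ℂ)) with hT
  set D := Real.sqrt (localAbs S.det)
  refine SchwartzBounded.mono ((SchwartzBounded.decay (N + M)).comp hop)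
    (c := ‖weilConst ψ μ S‖ * C * (1 + ‖S *ᵥ ξ‖⁻¹) ^ M * D * 2) (by positivity) ?_
  rintro f hf ⟨v, hc, hd⟩
  set z : κ ⊕ (Fin 2 ⊕ Unit) → F :=
    Sum.elim (-((v 0)⁻¹ • (S *ᵥ ξ))) (Sum.elim v fun _ => a * (v 1 / v 0)) with hz
  refine ⟨z, ?_⟩
  have hTz : T f z = (g fun _ => a * (v 1 / v 0) : ℂ) * ∫ y, f (Sum.elim y v) *
      (ψ ((v 1 * quad S y - pairing S ξ y) / v 0) : ℂ) ∂vol[μ] := by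
    rw [← integral_const_mul]
    refine integral_congr_forall fun y => ?_
    have e1 : (Sum.elim y (z ∘ Sum.inr) : κ ⊕ (Fin 2 ⊕ Unit) → F) ∘ Sum.map id Sum.inl =
        Sum.elim y v := by ext (i | i) <;> rfl
    have e2 : (v 1 * quad S y - pairing S ξ y) / v 0 =
        a⁻¹ * ((a * (v 1 / v 0)) * quad S y) + (z ∘ Sum.inl) ⬝ᵥ y := by
      have : (z ∘ Sum.inl) ⬝ᵥ y = -((v 0)⁻¹ * pairing S ξ y) := by
        rw [pairing_eq hs, hz, Sum.elim_comp_inl, neg_dotProduct, smul_dotProduct, smul_eq_mul]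
      rw [this]
      field_simp
      ring
    beta_reduce
    rw [e1, e2, char_mul]
    change (ψ (a⁻¹ * ((a * (v 1 / v 0)) * quad S y)) : ℂ) * (f (Sum.elim y v) *
      (g fun _ => a * (v 1 / v 0) : ℂ)) * _ = _
    ring
  have hg2 : 1 / 2 ≤ g fun _ => a * (v 1 / v 0) := hga _ (by
    rw [norm_div]; exact div_le_one_of_le₀ hd (norm_nonneg _))
  have hz1 : ‖v‖ ≤ ‖z‖ := (pi_norm_le_iff_of_nonneg (norm_nonneg _)).2 fun i =>
    norm_le_pi_norm z (Sum.inr (Sum.inl i))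
  have hz2 : ‖(v 0)⁻¹‖ * ‖S *ᵥ ξ‖ ≤ ‖z‖ := by
    rw [← norm_smul, ← norm_neg]
    exact (pi_norm_le_iff_of_nonneg (norm_nonneg _)).2 fun i => norm_le_pi_norm z (Sum.inl i)
  have hz3 : 1 + ‖(v 0)⁻¹‖ ≤ (1 + ‖S *ᵥ ξ‖⁻¹) * (1 + ‖z‖) := by
    have : ‖(v 0)⁻¹‖ ≤ ‖S *ᵥ ξ‖⁻¹ * ‖z‖ := by
      rw [inv_mul_eq_div, le_div_iff₀ hηp]; exact hz2
    nlinarith [norm_nonneg z, inv_pos.2 hηp]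
  set J := ∫ y, f (Sum.elim y v) *
      (ψ ((v 1 * quad S y - pairing S ξ y) / v 0) : ℂ) ∂vol[μ] with hJ
  have hJz : ‖J‖ ≤ 2 * ‖T f z‖ := by
    rw [hTz, norm_mul, Complex.norm_real, Real.norm_eq_abs, abs_of_nonneg (by linarith)]
    nlinarith [norm_nonneg J]
  have hcf : ‖coneFun μ ψ hS f ξ v‖ = ‖weilConst ψ μ S‖ *
      (localAbs (v 0) ^ (Fintype.card κ / 2))⁻¹ * (D * ‖J‖) := by
    rw [coneFun, integral_quadMeasure, ← hJ, norm_mul, norm_mul, norm_mul, quadChar,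
      norm_hilbertSymbol, mul_one, Complex.norm_real, Real.norm_of_nonneg
        (inv_nonneg.2 (pow_nonneg (localAbs_nonneg _) _)), norm_smul,
      Real.norm_of_nonneg (Real.sqrt_nonneg _)]
  rw [hcf]
  have hl := (hM (v 0) hc).trans (mul_le_mul_of_nonneg_left
    (pow_le_pow_left₀ (by positivity) hz3 M) hC)
  calc (1 + ‖v‖) ^ N * (‖weilConst ψ μ S‖ * (localAbs (v 0) ^ (Fintype.card κ / 2))⁻¹ * (D * ‖J‖))
      ≤ (1 + ‖z‖) ^ N * (‖weilConst ψ μ S‖ * (C * ((1 + ‖S *ᵥ ξ‖⁻¹) * (1 + ‖z‖)) ^ M) *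
        (D * (2 * ‖T f z‖))) := by
        have := localAbs_nonneg (v 0)
        gcongr
    _ = _ := by
        rw [mul_pow, pow_add]
        ring

/-- `coneFun` decays rapidly. The region `‖c‖ < ‖d‖` is moved to the region `‖d‖ ≤ ‖c‖` by the
Weyl element. -/
theorem schwartzBounded_coneFun (hψ : Continuous ψ) (hψ1 : ψ ≠ 1) (hμ : IsSelfDual k ψ μ)
    (h2 : (2 : F) ≠ 0) (hn : Even (Fintype.card κ)) (hS : IsUnit S.det)
    (hs : S.IsSymm) {ξ : κ → F} (hξ : ξ ∈ cone S) (N : ℕ) :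
    SchwartzBounded k fun (f : (κ ⊕ Fin 2 → F) → ℂ)
      (v : {v : Fin 2 → F // v 0 ≠ 0 ∧ v 1 ≠ 0}) =>
        (1 + ‖v.1‖) ^ N * ‖coneFun μ ψ hS f ξ v.1‖ := by
  have h := schwartzBounded_coneFun_region (k := k) μ hψ hψ1 hS hs hξ.2 N
  refine SchwartzBounded.of_bounds h
    (h.comp (isSchwartzOp_mixedRep μ hψ hψ1 hμ h2 hn hS hs weylElt)) zero_le_one ?_
  rintro f hf B h₁ h₂ ⟨v, hc, hd⟩
  rw [one_mul]
  rcases le_or_gt ‖v 1‖ ‖v 0‖ with hle | hlt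
  · exact h₁ ⟨v, hc, hle⟩
  · set u : Fin 2 → F := ![v 1, -v 0] with hu
    have hw : planeAct weylElt u = v := by
      ext j
      rw [planeAct_apply]
      fin_cases j <;> simp [weylElt, hu]
    have hnorm : ‖u‖ = ‖v‖ := by
      simp [hu, Pi.norm_def, Fin.univ_succ, sup_comm]
    have h3 := h₂ ⟨u, hd, by simpa [hu] using hlt.le⟩
    beta_reduce at h3
    rwa [coneFun_mixedRep μ hψ hψ1 hμ h2 hn hS hs hf hξ.1 weylElt hd (by rwa [hw]), hw, hnorm] at h3

theorem ae_plane_ne_zero : ∀ᵐ v ∂(Measure.pi fun _ : Fin 2 => μ), v 0 ≠ 0 ∧ v 1 ≠ 0 := by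
  have h : ∀ i, ∀ᵐ v ∂(Measure.pi fun _ : Fin 2 => μ), v i ≠ 0 := fun i => by
    rw [ae_iff]
    simpa using Measure.pi_hyperplane (fun _ : Fin 2 => μ) i 0
  exact (h 0).and (h 1)

section

variable (hψ : Continuous ψ) (hψ1 : ψ ≠ 1) (hμ : IsSelfDual k ψ μ)
  (h2 : (2 : F) ≠ 0) (hn : Even (Fintype.card κ)) (hS : IsUnit S.det)
  (hs : S.IsSymm) {ξ : κ → F} (hξ : ξ ∈ cone S)
include hψ hψ1 hμ h2 hn hs hξ

theorem integrable_coneFun {f : (κ ⊕ Fin 2 → F) → ℂ} (hf : f ∈ schwartz k (κ ⊕ Fin 2)) :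
    Integrable (coneFun μ ψ hS f ξ) vol[μ] := by
  obtain ⟨N, hN⟩ := exists_integrable_weight μ
  obtain ⟨B, hB⟩ := (schwartzBounded_coneFun (k := k) μ hψ hψ1 hμ h2 hn hS hs hξ N).exists_bound hf
  refine (hN.const_mul B).mono'
    (measurable_coneFun μ hψ hS (schwartz_continuous hf) ξ).aestronglyMeasurable
    ((ae_plane_ne_zero μ).mono fun v hv => ?_)
  rw [← div_eq_mul_inv, le_div_iff₀ (by positivity), mul_comm]
  exact hB ⟨v, hv⟩

theorem schwartzBounded_integral_coneFun :
    SchwartzBounded k fun (f : (κ ⊕ Fin 2 → F) → ℂ) (_ : Unit) =>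
      ‖∫ v, coneFun μ ψ hS f ξ v ∂vol[μ]‖ := by
  obtain ⟨N, hN⟩ := exists_integrable_weight μ
  have h := schwartzBounded_coneFun (k := k) μ hψ hψ1 hμ h2 hn hS hs hξ N
  refine SchwartzBounded.of_bounds h h
    (c := ∫ v : Fin 2 → F, ((1 + ‖v‖) ^ N)⁻¹ ∂vol[μ])
    (integral_nonneg fun v => by positivity) fun f hf B hB _ _ => ?_
  rw [mul_comm, ← integral_const_mul]
  refine norm_integral_le_of_norm_le (hN.const_mul B) ((ae_plane_ne_zero μ).mono fun v hv => ?_)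
  rw [← div_eq_mul_inv, le_div_iff₀ (by positivity), mul_comm]
  exact hB ⟨v, hv⟩

/-- The integral `I(f)(ξ)` converges absolutely and is a multiple of the Lebesgue integral of
`coneFun`, where the multiple does not depend on `f` and `ξ`. -/
theorem integrable_coneIntegrand (K : Subgroup SL(2, F)) [CompactSpace K] {C : ℝ≥0∞} (hC : C ≠ ⊤)
    (hmap : (quotMeasure k μ K).map (bottomRow K) = C • Measure.pi fun _ : Fin 2 => μ)
    {f : (κ ⊕ Fin 2 → F) → ℂ} (hf : f ∈ schwartz k (κ ⊕ Fin 2)) :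
    Integrable (coneIntegrand k ψ μ hS K f ξ) (quotMeasure k μ K) ∧
      coneIntegral k ψ μ hS K f ξ =
        C.toReal * ∫ v, coneFun μ ψ hS f ξ v ∂vol[μ] := by
  have hb := measurable_bottomRow K
  have hm := measurable_coneFun μ hψ hS (schwartz_continuous hf) ξ
  have hae : coneIntegrand k ψ μ hS K f ξ =ᵐ[quotMeasure k μ K]
      fun p => coneFun μ ψ hS f ξ (bottomRow K p) := by
    have h1 : ∀ᵐ v ∂((quotMeasure k μ K).map (bottomRow K)), v 0 ≠ 0 := by
      rw [hmap]
      exact Measure.ae_smul_measure ((ae_plane_ne_zero μ).mono fun v hv => hv.1) C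
    exact (ae_of_ae_map hb.aemeasurable h1).mono fun p hp =>
      mixedRep_eq_coneFun μ hψ hψ1 hμ h2 hn hS hs f hξ.1 hp
  have hi := (integrable_coneFun μ hψ hψ1 hμ h2 hn hS hs hξ hf).smul_measure hC
  rw [← hmap] at hi
  refine ⟨(hi.comp_measurable hb).congr hae.symm, ?_⟩
  rw [coneIntegral, integral_congr_ae hae, ← integral_map hb.aemeasurable hm.aestronglyMeasurable,
    hmap, integral_smul_measure]
  simp

end

/-! ### The partial Fourier transform -/

section Split

variable {F : Type*} [NontriviallyNormedField F] [ProperSpace F] [MeasurableSpace F] [BorelSpace F]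
  {k : LocalKind F} {ψ : AddChar F Circle} (μ : Measure F) [μ.IsAddHaarMeasure]
  {κ κ₁ κ₂ : Type*} [Fintype κ] [Fintype κ₁] [Fintype κ₂]

/-- Splitting off one coordinate. -/
def splitCoord (e : κ₁ ⊕ Unit ≃ κ) : (κ₁ → F) × F ≃ᵐ (κ → F) :=
  ((MeasurableEquiv.prodCongr (MeasurableEquiv.refl (κ₁ → F))
    (MeasurableEquiv.funUnique Unit F).symm).trans
      (MeasurableEquiv.sumPiEquivProdPi fun _ : κ₁ ⊕ Unit => F).symm).trans
        (MeasurableEquiv.piCongrLeft (fun _ : κ => F) e)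

theorem splitCoord_apply (e : κ₁ ⊕ Unit ≃ κ) (p : (κ₁ → F) × F) :
    splitCoord e p = Sum.elim p.1 (fun _ => p.2) ∘ e.symm := by
  ext i
  obtain ⟨j, rfl⟩ := e.surjective i
  have h := Equiv.piCongrLeft_apply_apply (fun _ : κ => F) e (Sum.elim p.1 fun _ => p.2) j
  rw [Function.comp_apply, Equiv.symm_apply_apply, ← h]
  change (MeasurableEquiv.piCongrLeft (fun _ : κ => F) e) _ (e j) = _
  rw [MeasurableEquiv.coe_piCongrLeft]
  congr 1

theorem measurePreserving_splitCoord (e : κ₁ ⊕ Unit ≃ κ) :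
    MeasurePreserving (splitCoord e : (κ₁ → F) × F → κ → F)
      (vol[μ].prod μ) vol[μ] := by
  have h1 := (MeasurePreserving.id (Measure.pi fun _ : κ₁ => μ)).prod
    (measurePreserving_funUnique μ Unit).symm
  have h2 := measurePreserving_sumPiEquivProdPi_symm (fun _ : κ₁ ⊕ Unit => μ)
  exact (measurePreserving_piCongrLeft (fun _ : κ => μ) e).comp (h2.comp h1)

/-- Fubini's theorem for splitting off one coordinate, which is integrated last. -/
theorem integral_split (e : κ₁ ⊕ Unit ≃ κ) {g : (κ → F) → ℂ}
    (hg : Integrable g vol[μ]) :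
    ∫ x, g x ∂vol[μ] =
      ∫ a, ∫ z : κ₁ → F, g (Sum.elim z (fun _ => a) ∘ e.symm) ∂vol[μ] ∂μ := by
  have hm := measurePreserving_splitCoord μ e
  rw [← hm.integral_comp (splitCoord e).measurableEmbedding]
  rw [integral_prod_symm (fun p => g (splitCoord e p))
    ((hm.integrable_comp_emb (splitCoord e).measurableEmbedding).2 hg)]
  simp only [splitCoord_apply]

/-- Fubini's theorem for splitting off one coordinate, which is integrated first. -/
theorem integral_split' (e : κ₁ ⊕ Unit ≃ κ) {g : (κ → F) → ℂ}
    (hg : Integrable g vol[μ]) :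
    ∫ x, g x ∂vol[μ] =
      ∫ z : κ₁ → F, ∫ a, g (Sum.elim z (fun _ => a) ∘ e.symm) ∂μ ∂vol[μ] := by
  have hm := measurePreserving_splitCoord μ e
  rw [← hm.integral_comp (splitCoord e).measurableEmbedding]
  rw [integral_prod (fun p => g (splitCoord e p))
    ((hm.integrable_comp_emb (splitCoord e).measurableEmbedding).2 hg)]
  simp only [splitCoord_apply]

theorem isSchwartzOp_reindex (e : κ₁ ≃ κ) :
    IsSchwartzOp k fun (f : (κ → F) → ℂ) (x : κ₁ → F) => f (x ∘ e.symm) :=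
  isSchwartzOp_comp_linearEquiv (LinearEquiv.funCongrLeft F F e.symm)

/-- The restriction of a Schwartz function to a coordinate subspace. -/
theorem schwartz_slice_equiv (e : κ₁ ⊕ κ₂ ≃ κ) {f : (κ → F) → ℂ} (hf : f ∈ schwartz k κ)
    (z : κ₂ → F) : (fun y : κ₁ → F => f (Sum.elim y z ∘ e.symm)) ∈ schwartz k κ₁ :=
  schwartz_slice ((isSchwartzOp_reindex (k := k) e).mem hf) z

end Split

/-- The last coordinate of `V ⊕ F²` comes first. -/
def lastFirst (κ : Type*) : Unit ⊕ (κ ⊕ Unit) ≃ κ ⊕ Fin 2 where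
  toFun := Sum.elim (fun _ => Sum.inr 1) (Sum.elim Sum.inl fun _ => Sum.inr 0)
  invFun := Sum.elim (fun i => Sum.inr (Sum.inl i)) ![Sum.inr (Sum.inr ()), Sum.inl ()]
  left_inv := by rintro (i | i | i) <;> rfl
  right_inv := by
    rintro (i | i)
    · rfl
    · fin_cases i <;> rfl

/-- The first coordinate of `F²` comes last. -/
def firstLast (κ : Type*) : (κ ⊕ Unit) ⊕ Unit ≃ κ ⊕ Fin 2 where
  toFun := Sum.elim (Sum.elim Sum.inl fun _ => Sum.inr 1) fun _ => Sum.inr 0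
  invFun := Sum.elim (fun i => Sum.inl (Sum.inl i)) ![Sum.inr (), Sum.inl (Sum.inr ())]
  left_inv := by rintro ((i | i) | i) <;> rfl
  right_inv := by
    rintro (i | i)
    · rfl
    · fin_cases i <;> rfl

theorem elim_lastFirst (x : κ → F) (a : F) (y : Unit → F) :
    Sum.elim y (Sum.elim x fun _ => a) ∘ (lastFirst κ).symm = Sum.elim x ![a, y ()] := by
  ext (i | i)
  · rfl
  · fin_cases i <;> rfl

theorem elim_firstLast (x : κ → F) (a b : F) :
    Sum.elim (Sum.elim x fun _ => b) (fun _ : Unit => a) ∘ (firstLast κ).symm =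
      Sum.elim x ![a, b] := by
  ext (i | i)
  · rfl
  · fin_cases i <;> rfl

theorem partialFourier_apply (f : (κ ⊕ Fin 2 → F) → ℂ) (x : κ → F) (a b : F) :
    partialFourier ψ μ f (Sum.elim x ![a, b]) =
      ∫ s, f (Sum.elim x ![a, s]) * (ψ (b * s) : ℂ) ∂μ := rfl

theorem partialFourierInv_apply (f : (κ ⊕ Fin 2 → F) → ℂ) (x : κ → F) (a b : F) :
    partialFourierInv ψ μ f (Sum.elim x ![a, b]) =
      ∫ s, f (Sum.elim x ![a, s]) * (ψ (-(b * s)) : ℂ) ∂μ := rfl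

/-- Points of `V ⊕ F²` in coordinates. -/
theorem eq_elim (v : κ ⊕ Fin 2 → F) :
    v = Sum.elim (v ∘ Sum.inl) ![v (Sum.inr 0), v (Sum.inr 1)] := by
  ext (i | i)
  · rfl
  · fin_cases i <;> rfl

theorem schwartz_line {f : (κ ⊕ Fin 2 → F) → ℂ} (hf : f ∈ schwartz k (κ ⊕ Fin 2)) (x : κ → F)
    (a : F) : (fun y : Unit → F => f (Sum.elim x ![a, y ()])) ∈ schwartz k Unit := by
  have h := schwartz_slice_equiv (lastFirst κ) hf (Sum.elim x fun _ => a)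
  simpa only [elim_lastFirst] using h

theorem isSchwartzOp_partialFourier (hψ : Continuous ψ) (hψ1 : ψ ≠ 1) :
    IsSchwartzOp k (partialFourier ψ μ : ((κ ⊕ Fin 2 → F) → ℂ) → _) := by
  refine ((isSchwartzOp_reindex (lastFirst κ).symm).comp
    ((isSchwartzOp_blockFourier (k := k) μ ψ hψ hψ1).comp
      (isSchwartzOp_reindex (lastFirst κ)))).congr fun f _ => ?_
  ext v
  refine (integral_unit μ fun s => f (Sum.elim (v ∘ Sum.inl) ![v (Sum.inr 0), s]) *
    (ψ (v (Sum.inr 1) * s) : ℂ)).symm.trans ?_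
  refine integral_congr_forall fun y => ?_
  have h : Sum.elim y ((v ∘ (lastFirst κ).symm.symm) ∘ Sum.inr) ∘ (lastFirst κ).symm =
      Sum.elim (v ∘ Sum.inl) ![v (Sum.inr 0), y ()] := by
    rw [← elim_lastFirst]
    congr 2
    ext (i | i) <;> rfl
  have h' : ((v ∘ (lastFirst κ).symm.symm) ∘ Sum.inl) ⬝ᵥ y = v (Sum.inr 1) * y () := by
    simp [dotProduct, lastFirst]
  beta_reduce
  rw [h, h']

theorem partialFourierInv_eq (f : (κ ⊕ Fin 2 → F) → ℂ) (x : κ → F) (a b : F) :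
    partialFourierInv ψ μ f (Sum.elim x ![a, b]) =
      partialFourier ψ μ f (Sum.elim x ![a, -b]) := by
  rw [partialFourierInv_apply, partialFourier_apply]
  simp only [neg_mul]

theorem isSchwartzOp_partialFourierInv (hψ : Continuous ψ) (hψ1 : ψ ≠ 1) :
    IsSchwartzOp k (partialFourierInv ψ μ : ((κ ⊕ Fin 2 → F) → ℂ) → _) := by
  refine ((isSchwartzOp_comp_blocks (A := (1 : Matrix κ κ F)) (B := !![1, 0; 0, -1]) (by simp)
    (by simp [det_fin_two])).comp (isSchwartzOp_partialFourier μ hψ hψ1)).congr fun f _ => ?_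
  ext v
  rw [eq_elim v, partialFourierInv_eq]
  congr 1
  ext (i | i)
  · simp
  · fin_cases i <;> simp

theorem partialFourier_partialFourierInv (hμ : IsSelfDual k ψ μ) {f : (κ ⊕ Fin 2 → F) → ℂ}
    (hf : f ∈ schwartz k (κ ⊕ Fin 2)) :
    partialFourier ψ μ (partialFourierInv ψ μ f) = f := by
  ext v
  rw [eq_elim v, partialFourier_apply]
  simp only [partialFourierInv_apply]
  have h := hμ (fun s => f (Sum.elim (v ∘ Sum.inl) ![v (Sum.inr 0), s])) (schwartz_line hf _ _)
    (v (Sum.inr 1))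
  rw [← integral_neg_eq_self] at h
  simpa using h

theorem partialFourierInv_partialFourier (hμ : IsSelfDual k ψ μ) {f : (κ ⊕ Fin 2 → F) → ℂ}
    (hf : f ∈ schwartz k (κ ⊕ Fin 2)) :
    partialFourierInv ψ μ (partialFourier ψ μ f) = f := by
  ext v
  rw [eq_elim v, partialFourierInv_apply]
  simp only [partialFourier_apply]
  exact hμ (fun s => f (Sum.elim (v ∘ Sum.inl) ![v (Sum.inr 0), s])) (schwartz_line hf _ _)
    (v (Sum.inr 1))

theorem isUnit_det_simMat {T : Matrix κ κ F} (h : GO T) :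
    IsUnit ((simMat h)⁻¹ : GL κ F).1.det :=
  (isUnit_iff_isUnit_det _).1 (Units.isUnit _)

theorem isSchwartzOp_sigma (hψ : Continuous ψ) (hψ1 : ψ ≠ 1) (h : GO (addPlane S)) :
    IsSchwartzOp k (sigma ψ μ h) :=
  (isSchwartzOp_partialFourier μ hψ hψ1).comp ((isSchwartzOp_comp_mulVec (isUnit_det_simMat h)).comp
    (isSchwartzOp_partialFourierInv μ hψ hψ1))

/-- `σ(h)` on the image of `F₂`. -/
theorem sigma_partialFourier (hμ : IsSelfDual k ψ μ) (h : GO (addPlane S))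
    {φ : (κ ⊕ Fin 2 → F) → ℂ} (hφ : φ ∈ schwartz k (κ ⊕ Fin 2)) :
    sigma ψ μ h (partialFourier ψ μ φ) =
      partialFourier ψ μ fun x => φ (((simMat h)⁻¹ : GL (κ ⊕ Fin 2) F).1 *ᵥ x) := by
  rw [sigma, partialFourierInv_partialFourier μ hμ hφ]

theorem sigma_one (hμ : IsSelfDual k ψ μ) {f : (κ ⊕ Fin 2 → F) → ℂ}
    (hf : f ∈ schwartz k (κ ⊕ Fin 2)) : sigma ψ μ (1 : GO (addPlane S)) f = f := by
  have h1 : simMat (1 : GO (addPlane S)) = 1 := rfl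
  simp only [sigma, h1, inv_one, Units.val_one, one_mulVec]
  exact partialFourier_partialFourierInv μ hμ hf

theorem sigma_mul (hψ : Continuous ψ) (hψ1 : ψ ≠ 1) (hμ : IsSelfDual k ψ μ)
    (h h' : GO (addPlane S)) {f : (κ ⊕ Fin 2 → F) → ℂ}
    (hf : f ∈ schwartz k (κ ⊕ Fin 2)) : sigma ψ μ (h * h') f = sigma ψ μ h (sigma ψ μ h' f) := by
  have h1 : simMat (h * h') = simMat h * simMat h' := rfl
  conv_rhs => rw [sigma.eq_def ψ μ h' f]
  rw [sigma_partialFourier μ hμ h ((isSchwartzOp_comp_mulVec (isUnit_det_simMat h')).mem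
    ((isSchwartzOp_partialFourierInv μ hψ hψ1).mem hf)), sigma]
  simp only [h1, _root_.mul_inv_rev, Units.val_mul, mulVec_mulVec]

/-! ### The similitude group acts on the coinvariants -/

section AddPlane

variable {F : Type*} [Field F] {κ : Type*} [Fintype κ] [DecidableEq κ] {S : Matrix κ κ F}

theorem addPlane_symm (hs : S.IsSymm) : (addPlane S).IsSymm :=
  Matrix.IsSymm.fromBlocks hs (by simp) hypPlane_symm

theorem addPlane_mulVec (x : κ → F) (a b : F) :
    addPlane S *ᵥ Sum.elim x ![a, b] = Sum.elim (S *ᵥ x) ![b, a] := by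
  rw [addPlane, fromBlocks_mulVec]
  ext (i | i)
  · simp
  · fin_cases i <;> simp [hypPlane]

theorem quad_addPlane (h2 : (2 : F) ≠ 0) (x : κ → F) (a b : F) :
    quad (addPlane S) (Sum.elim x ![a, b]) = quad S x + a * b := by
  rw [quad, pairing, addPlane_mulVec, quad, pairing, sumElim_dotProduct_sumElim]
  simp only [dotProduct, Fin.sum_univ_two, cons_val_zero, cons_val_one]
  field_simp
  ring

theorem even_card_addPlane (hn : Even (Fintype.card κ)) : Even (Fintype.card (κ ⊕ Fin 2)) := by
  rw [Fintype.card_sum, Fintype.card_fin]; exact hn.add even_two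

theorem quad_mulVec_simMat {T : Matrix κ κ F} (h : GO T) (v : κ → F) :
    quad T (((simMat h)⁻¹ : GL κ F).1 *ᵥ v) = (simNorm h : F)⁻¹ * quad T v := by
  rw [← quad_inv_mulVec h v, inv_mul_cancel_left₀ (simNorm h).ne_zero]

theorem simMat_mulVec_inv {T : Matrix κ κ F} (h : GO T) (v : κ → F) :
    (simMat h : Matrix κ κ F) *ᵥ (((simMat h)⁻¹ : GL κ F).1 *ᵥ v) = v := by
  rw [mulVec_mulVec, ← Units.val_mul, mul_inv_cancel, Units.val_one, one_mulVec]

theorem simMat_inv_mulVec {T : Matrix κ κ F} (h : GO T) (v : κ → F) :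
    ((simMat h)⁻¹ : GL κ F).1 *ᵥ ((simMat h : Matrix κ κ F) *ᵥ v) = v := by
  rw [mulVec_mulVec, ← Units.val_mul, inv_mul_cancel, Units.val_one, one_mulVec]

theorem pairing_mulVec_simMat {T : Matrix κ κ F} (h : GO T) (v w : κ → F) :
    pairing T ((simMat h : Matrix κ κ F) *ᵥ v) ((simMat h : Matrix κ κ F) *ᵥ w) =
      (simNorm h : F) * pairing T v w := by
  have h1 : (simMat h : Matrix κ κ F)ᵀ * T * (simMat h : Matrix κ κ F) = (simNorm h : F) • T := h.2
  have h3 : pairing T ((simMat h : Matrix κ κ F) *ᵥ v) ((simMat h : Matrix κ κ F) *ᵥ w) =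
      v ⬝ᵥ (((simMat h : Matrix κ κ F)ᵀ * T * (simMat h : Matrix κ κ F)) *ᵥ w) := by
    rw [pairing, ← mulVec_mulVec, ← mulVec_mulVec, dotProduct_mulVec v,
      vecMul_transpose]
  rw [h3, h1, smul_mulVec, dotProduct_smul, smul_eq_mul, pairing]

end AddPlane

theorem quadChar_addPlane (a : F) :
    quadChar (addPlane S) a = quadChar S a := by
  have h1 : (addPlane S).det = -S.det := by
    simp [addPlane, det_fromBlocks_zero₂₁, hypPlane_det]
  rw [quadChar, quadChar, h1, Fintype.card_sum, Fintype.card_fin,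
    Nat.add_div_of_dvd_left (dvd_refl 2), Nat.div_self two_pos, pow_succ]
  congr 1
  ring

theorem isUnit_det_simMat' {T : Matrix κ κ F} (h : GO T) :
    IsUnit (simMat h : Matrix κ κ F).det :=
  (isUnit_iff_isUnit_det _).1 (Units.isUnit _)

theorem localAbs_det_simMat {T : Matrix κ κ F} (hT : IsUnit T.det) {m : ℕ}
    (hm : Fintype.card κ = 2 * m) (h : GO T) :
    localAbs (simMat h : Matrix κ κ F).det = localAbs (simNorm h : F) ^ m := by
  have h1 : (simMat h : Matrix κ κ F)ᵀ * T * (simMat h : Matrix κ κ F) = (simNorm h : F) • T := h.2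
  have h3 := congrArg (fun A => localAbs (Matrix.det A)) h1
  simp only [det_mul, det_transpose, det_smul, localAbs_mul, localAbs_pow,
    hm] at h3
  have hTp := localAbs_pos hT.ne_zero
  have h4 : localAbs (simMat h : Matrix κ κ F).det ^ 2 = (localAbs (simNorm h : F) ^ m) ^ 2 := by
    refine mul_right_cancel₀ hTp.ne' ?_
    rw [← pow_mul, mul_comm m 2, ← h3]
    ring
  exact (pow_left_inj₀ (localAbs_nonneg _) (pow_nonneg (localAbs_nonneg _) _) two_ne_zero).1 h4

theorem quadFourier_comp_simMat {T : Matrix κ κ F} (hT : IsUnit T.det) {m : ℕ}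
    (hm : Fintype.card κ = 2 * m) (h : GO T) (φ : (κ → F) → ℂ) (x : κ → F) :
    quadFourier ψ μ hT (fun y => φ (((simMat h)⁻¹ : GL κ F).1 *ᵥ y)) x =
      (localAbs (simNorm h : F) ^ m : ℝ) •
        quadFourier ψ μ hT φ (((simMat h)⁻¹ : GL κ F).1 *ᵥ ((simNorm h : F) • x)) := by
  have hl := localAbs_pos (simNorm h).ne_zero
  have h1 := integral_comp_mulVec' μ (isUnit_det_simMat' h) fun y =>
    φ (((simMat h)⁻¹ : GL κ F).1 *ᵥ y) * (ψ (pairing T x y) : ℂ)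
  rw [localAbs_det_simMat hT hm] at h1
  rw [quadFourier, quadFourier, integral_quadMeasure, integral_quadMeasure, smul_comm]
  congr 1
  rw [← inv_smul_eq_iff₀ (by positivity), ← h1]
  refine integral_congr_forall fun y => ?_
  have h3 : pairing T x ((simMat h : Matrix κ κ F) *ᵥ y) =
      pairing T (((simMat h)⁻¹ : GL κ F).1 *ᵥ ((simNorm h : F) • x)) y := by
    rw [mulVec_smul]
    conv_lhs => rw [← simMat_mulVec_inv h x, pairing_mulVec_simMat]
    rw [pairing, pairing, smul_dotProduct, smul_eq_mul]
  rw [simMat_inv_mulVec, h3]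

theorem mixedRep_upperUnip_partialFourier (h2 : (2 : F) ≠ 0) (hn : Even (Fintype.card κ))
    (hS : IsUnit S.det) (t : F) (φ : (κ ⊕ Fin 2 → F) → ℂ) :
    mixedRep k ψ μ hS (upperUnip t) (partialFourier ψ μ φ) =
      partialFourier ψ μ fun v => (ψ (t * quad (addPlane S) v) : ℂ) * φ v := by
  ext v
  have h1 : (upperUnip t).1ᵀ *ᵥ (v ∘ Sum.inr) = ![v (Sum.inr 0), t * v (Sum.inr 0) + v (Sum.inr 1)] := by
    ext j; fin_cases j <;> simp [upperUnip, mulVec, dotProduct, Fin.sum_univ_two]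
  rw [mixedRep_upperUnip μ h2 hn hS, h1, partialFourier_apply]
  conv_rhs => rw [eq_elim v]
  rw [partialFourier_apply, ← integral_const_mul]
  refine integral_congr_forall fun s => ?_
  have h3 : (ψ (t * quad S (v ∘ Sum.inl)) : ℂ) *
      (ψ ((t * v (Sum.inr 0) + v (Sum.inr 1)) * s) : ℂ) =
      (ψ (t * (quad S (v ∘ Sum.inl) + v (Sum.inr 0) * s)) : ℂ) * (ψ (v (Sum.inr 1) * s) : ℂ) := by
    rw [← char_mul, ← char_mul]
    congr 2
    ring
  rw [quad_addPlane h2]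
  linear_combination φ (Sum.elim (v ∘ Sum.inl) ![v (Sum.inr 0), s]) * h3

theorem mixedRep_diagTorus_partialFourier {m : ℕ} (hm : Fintype.card κ = 2 * m)
    (hS : IsUnit S.det) (a : Fˣ) (φ : (κ ⊕ Fin 2 → F) → ℂ) :
    mixedRep k ψ μ hS (diagTorus a) (partialFourier ψ μ φ) =
      partialFourier ψ μ ((quadChar S a * ((localAbs (a : F) ^ (m + 1) : ℝ) : ℂ)) •
        fun v => φ ((a : F) • v)) := by
  ext v
  have ha := a.ne_zero
  have h1 : (diagTorus a).1ᵀ *ᵥ (v ∘ Sum.inr) =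
      ![(a : F) * v (Sum.inr 0), (a : F)⁻¹ * v (Sum.inr 1)] := by
    ext j; fin_cases j <;> simp [diagTorus, mulVec, dotProduct, Fin.sum_univ_two]
  rw [mixedRep, weilRep_diagTorus μ hm hS, h1, partialFourier_apply]
  conv_rhs => rw [eq_elim v]
  rw [partialFourier_apply]
  have h3 := integral_comp_mul μ ha fun s => φ (Sum.elim ((a : F) • (v ∘ Sum.inl))
    ![(a : F) * v (Sum.inr 0), s]) * (ψ ((a : F)⁻¹ * v (Sum.inr 1) * s) : ℂ)
  have hap := localAbs_pos ha
  rw [eq_inv_smul_iff₀ hap.ne'] at h3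
  rw [← h3, Complex.real_smul, ← integral_const_mul, ← integral_const_mul]
  refine integral_congr_forall fun s => ?_
  have h4 : (a : F) • Sum.elim (v ∘ Sum.inl) ![v (Sum.inr 0), s] =
      Sum.elim ((a : F) • (v ∘ Sum.inl)) ![(a : F) * v (Sum.inr 0), (a : F) * s] := by
    ext (i | i)
    · rfl
    · fin_cases i <;> rfl
  have h5 : (a : F)⁻¹ * v (Sum.inr 1) * ((a : F) * s) = v (Sum.inr 1) * s := by
    field_simp
  simp only [Pi.smul_apply, smul_eq_mul]
  rw [h4, h5]
  push_cast
  ring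

/-- Under `F₂` the Weyl element acts by the Fourier transform of `V ⊕ F²`: one application of
Fourier inversion in one variable. -/
theorem mixedRep_weylElt_partialFourier (hψ : Continuous ψ) (hψ1 : ψ ≠ 1) (hμ : IsSelfDual k ψ μ)
    (h2 : (2 : F) ≠ 0) (hn : Even (Fintype.card κ)) (hS : IsUnit S.det) (hs : S.IsSymm)
    {φ : (κ ⊕ Fin 2 → F) → ℂ} (hφ : φ ∈ schwartz k (κ ⊕ Fin 2)) :
    mixedRep k ψ μ hS weylElt (partialFourier ψ μ φ) =
      partialFourier ψ μ (weilConst ψ μ S • quadFourier ψ μ (addPlane_det hS) φ) := by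
  ext v
  set x := S *ᵥ (v ∘ Sum.inl) with hx
  set u := v (Sum.inr 0) with hu
  set t := v (Sum.inr 1) with ht
  have hdet : localAbs (addPlane S).det = localAbs S.det := by
    simp [addPlane, det_fromBlocks_zero₂₁, hypPlane_det]
  -- the Fourier transform in all variables but one
  set A : F → ℂ := fun a => ∫ z : κ ⊕ Unit → F,
    φ (Sum.elim z (fun _ => a) ∘ (firstLast κ).symm) *
      (ψ (Sum.elim x (fun _ => u) ⬝ᵥ z) : ℂ) ∂vol[μ] with hA
  have hAs : (fun y : Unit → F => A (y ())) ∈ schwartz k Unit := by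
    have h1 := (isSchwartzOp_blockFourier (k := k) μ ψ hψ hψ1).mem
      ((isSchwartzOp_reindex (firstLast κ)).mem hφ)
    have h3 := schwartz_slice_equiv (Equiv.sumComm Unit (κ ⊕ Unit)) h1 (Sum.elim x fun _ => u)
    refine (congrArg (· ∈ schwartz k Unit) (funext fun y => ?_)).mp h3
    rfl
  have hint : ∀ a, Integrable (fun z : κ ⊕ Unit → F =>
      φ (Sum.elim z (fun _ => a) ∘ (firstLast κ).symm) *
      (ψ (Sum.elim x (fun _ => u) ⬝ᵥ z) : ℂ)) vol[μ] := fun a =>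
    integrable_mul_char hψ (schwartz_integrable μ (schwartz_slice_equiv (firstLast κ) hφ fun _ => a))
      (continuous_const.dotProduct continuous_id)
  -- both sides are integrals of `A`, and self-duality relates them
  have hL : mixedRep k ψ μ hS weylElt (partialFourier ψ μ φ) v =
      weilConst ψ μ S * (Real.sqrt (localAbs S.det) * A (-t)) := by
    have h1 : weylElt.1ᵀ *ᵥ (v ∘ Sum.inr) = ![-t, u] := by
      ext j; fin_cases j <;> simp [weylElt, mulVec, dotProduct, Fin.sum_univ_two, hu, ht]
    rw [mixedRep_weylElt μ hψ hψ1 hμ h2 hn hS hs, quadFourier_eq μ hS hs, h1, Complex.real_smul,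
      fourier, hA]
    beta_reduce
    rw [integral_split' μ (Equiv.refl (κ ⊕ Unit)) (hint (-t))]
    congr 2
    refine integral_congr_forall fun y => ?_
    rw [partialFourier_apply, ← integral_mul_const]
    refine integral_congr_forall fun s => ?_
    have h3 : Sum.elim x (fun _ : Unit => u) ⬝ᵥ
        (Sum.elim y (fun _ => s) ∘ (Equiv.refl (κ ⊕ Unit)).symm) = u * s + x ⬝ᵥ y := by
      rw [Equiv.refl_symm, Equiv.coe_refl, Function.comp_id, sumElim_dotProduct_sumElim, add_comm]
      simp [dotProduct]
    rw [h3, char_mul, Equiv.refl_symm, Equiv.coe_refl, Function.comp_id, elim_firstLast]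
    ring
  have hR : ∀ s, quadFourier ψ μ (addPlane_det hS) φ (Sum.elim (v ∘ Sum.inl) ![u, s]) =
      Real.sqrt (localAbs S.det) * ∫ a, A a * (ψ (s * a) : ℂ) ∂μ := by
    intro s
    rw [quadFourier_eq μ _ (addPlane_symm hs), hdet, Complex.real_smul, addPlane_mulVec, fourier]
    have hi : Integrable (fun y => φ y * (ψ (Sum.elim (S *ᵥ (v ∘ Sum.inl)) ![s, u] ⬝ᵥ y) : ℂ))
        vol[μ] := integrable_mul_char hψ (schwartz_integrable μ hφ)
      (continuous_const.dotProduct continuous_id)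
    rw [integral_split μ (firstLast κ) hi]
    congr 1
    refine integral_congr_forall fun a => ?_
    rw [hA]
    beta_reduce
    rw [← integral_mul_const]
    refine integral_congr_forall fun z => ?_
    have h3 : Sum.elim (S *ᵥ (v ∘ Sum.inl)) ![s, u] ⬝ᵥ
        (Sum.elim z (fun _ => a) ∘ (firstLast κ).symm) =
          Sum.elim x (fun _ : Unit => u) ⬝ᵥ z + s * a := by
      have hz : z = Sum.elim (z ∘ Sum.inl) fun _ => z (Sum.inr ()) := by ext (i | i) <;> rfl
      rw [hz, elim_firstLast, sumElim_dotProduct_sumElim, sumElim_dotProduct_sumElim, ← hx]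
      simp [dotProduct, Fin.sum_univ_two]
      ring
    rw [h3, char_mul]
    ring
  rw [hL]
  conv_rhs => rw [eq_elim v, partialFourier_apply]
  simp only [Pi.smul_apply, smul_eq_mul, ← hu, ← ht, hR]
  have hinv := hμ A hAs (-t)
  rw [← hinv, ← integral_const_mul, ← integral_const_mul]
  refine integral_congr_forall fun s => ?_
  rw [show -(-t * s) = t * s by ring]
  ring

/-- The span of all `f - r(g) f`. -/
def coinvSpan (k : LocalKind F) (ψ : AddChar F Circle) (hS : IsUnit S.det) :
    Submodule ℂ ((κ ⊕ Fin 2 → F) → ℂ) :=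
  Submodule.span ℂ
    {w | ∃ g : SL(2, F), ∃ f ∈ schwartz k (κ ⊕ Fin 2), w = f - mixedRep k ψ μ hS g f}

theorem isSchwartzOp_quadFourier (hψ : Continuous ψ) (hψ1 : ψ ≠ 1) {T : Matrix κ κ F}
    (hT : IsUnit T.det) (hs : T.IsSymm) : IsSchwartzOp k (quadFourier ψ μ hT) := by
  refine (((isSchwartzOp_comp_mulVec hT).comp
    (isSchwartzOp_fourier (k := k) μ hψ hψ1)).const_smul
      (Real.sqrt (localAbs T.det))).congr fun f _ => ?_
  ext x
  rw [quadFourier_eq μ hT hs, Complex.real_smul]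
  rfl

section

variable (hψ : Continuous ψ) (hψ1 : ψ ≠ 1) (hμ : IsSelfDual k ψ μ)
  (h2 : (2 : F) ≠ 0) (hn : Even (Fintype.card κ)) (hS : IsUnit S.det) (hs : S.IsSymm)
include hψ hψ1 hμ h2 hn hs

theorem coinvSpan_le : coinvSpan μ k ψ hS ≤ schwartz k (κ ⊕ Fin 2) := by
  refine Submodule.span_le.2 ?_
  rintro _ ⟨g, f, hf, rfl⟩
  exact Submodule.sub_mem _ hf ((isSchwartzOp_mixedRep μ hψ hψ1 hμ h2 hn hS hs g).mem hf)

theorem sigma_mixedRep_upperUnip (h : GO (addPlane S)) (t : F) {f : (κ ⊕ Fin 2 → F) → ℂ}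
    (hf : f ∈ schwartz k (κ ⊕ Fin 2)) :
    sigma ψ μ h (mixedRep k ψ μ hS (upperUnip t) f) =
      mixedRep k ψ μ hS (upperUnip (t * (simNorm h : F)⁻¹)) (sigma ψ μ h f) := by
  set φ := partialFourierInv ψ μ f with hφ
  have hφs : φ ∈ schwartz k (κ ⊕ Fin 2) := (isSchwartzOp_partialFourierInv μ hψ hψ1).mem hf
  rw [← partialFourier_partialFourierInv μ hμ hf, ← hφ,
    mixedRep_upperUnip_partialFourier μ h2 hn hS, sigma_partialFourier μ hμ h hφs,
    mixedRep_upperUnip_partialFourier μ h2 hn hS, sigma_partialFourier μ hμ h]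
  · simp only [quad_mulVec_simMat, mul_assoc]
  · simpa only [smul_quad] using (isSchwartzOp_quad hψ (t • addPlane S)).mem hφs

theorem sigma_mixedRep_diagTorus (h : GO (addPlane S)) (a : Fˣ) {f : (κ ⊕ Fin 2 → F) → ℂ}
    (hf : f ∈ schwartz k (κ ⊕ Fin 2)) :
    sigma ψ μ h (mixedRep k ψ μ hS (diagTorus a) f) =
      mixedRep k ψ μ hS (diagTorus a) (sigma ψ μ h f) := by
  obtain ⟨m, hm⟩ := hn
  rw [← two_mul] at hm
  set φ := partialFourierInv ψ μ f with hφ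
  have hφs : φ ∈ schwartz k (κ ⊕ Fin 2) := (isSchwartzOp_partialFourierInv μ hψ hψ1).mem hf
  have hop := isSchwartzOp_comp_mulVec (k := k) (A := (a : F) • (1 : Matrix (κ ⊕ Fin 2) (κ ⊕ Fin 2) F))
    (by rw [det_smul]; simp)
  rw [← partialFourier_partialFourierInv μ hμ hf, ← hφ,
    mixedRep_diagTorus_partialFourier μ hm hS, sigma_partialFourier μ hμ h hφs,
    mixedRep_diagTorus_partialFourier μ hm hS, sigma_partialFourier μ hμ h]
  · congr 1
    ext v
    simp only [Pi.smul_apply, mulVec_smul]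
  · refine Submodule.smul_mem _ _ ?_
    simpa only [smul_mulVec, one_mulVec] using hop.mem hφs

/-- The element `h` conjugates the action of the Weyl element `w` to that of `diag(λ⁻¹, λ) w`;
the quadratic character does not show up, since it is trivial on similitude norms. -/
theorem mixedRep_weylElt_sigma (h : GO (addPlane S)) {f : (κ ⊕ Fin 2 → F) → ℂ}
    (hf : f ∈ schwartz k (κ ⊕ Fin 2)) :
    mixedRep k ψ μ hS weylElt (sigma ψ μ h f) =
      mixedRep k ψ μ hS (diagTorus (simNorm h))
        (sigma ψ μ h (mixedRep k ψ μ hS weylElt f)) := by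
  have hchar : quadChar S (simNorm h : F) = 1 := by
    rw [← quadChar_addPlane]
    exact quadChar_similitude μ hψ hψ1 hμ h2 (even_card_addPlane hn) (addPlane_det hS)
      (addPlane_symm hs) (isUnit_det_simMat' h) (simNorm h).ne_zero h.2
  have hn' := hn
  obtain ⟨m, hm⟩ := hn'
  rw [← two_mul] at hm
  have hm' : Fintype.card (κ ⊕ Fin 2) = 2 * (m + 1) := by
    rw [Fintype.card_sum, hm, Fintype.card_fin]; ring
  set φ := partialFourierInv ψ μ f with hφ
  have hφs : φ ∈ schwartz k (κ ⊕ Fin 2) := (isSchwartzOp_partialFourierInv μ hψ hψ1).mem hf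
  rw [← partialFourier_partialFourierInv μ hμ hf, ← hφ, sigma_partialFourier μ hμ h hφs,
    mixedRep_weylElt_partialFourier μ hψ hψ1 hμ h2 hn hS hs hφs,
    mixedRep_weylElt_partialFourier μ hψ hψ1 hμ h2 hn hS hs
      ((isSchwartzOp_comp_mulVec (isUnit_det_simMat h)).mem hφs), sigma_partialFourier μ hμ h,
    mixedRep_diagTorus_partialFourier μ hm hS, hchar, one_mul]
  · congr 1
    ext v
    simp only [Pi.smul_apply, smul_eq_mul, quadFourier_comp_simMat μ (addPlane_det hS) hm',
      Complex.real_smul]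
    ring
  · exact Submodule.smul_mem _ _
      ((isSchwartzOp_quadFourier μ hψ hψ1 (addPlane_det hS) (addPlane_symm hs)).mem hφs)

/-- Modulo the span of all `f - r(g) f`, each generator acts trivially before and after `σ(h)`. -/
theorem sigma_mixedRep_sub_mem (h : GO (addPlane S)) (g : SL(2, F)) :
    ∀ f ∈ schwartz k (κ ⊕ Fin 2), sigma ψ μ h (mixedRep k ψ μ hS g f) - sigma ψ μ h f ∈
      coinvSpan μ k ψ hS := by
  have hσ := isSchwartzOp_sigma (k := k) μ hψ hψ1 h
  have hr := fun g => isSchwartzOp_mixedRep (k := k) μ hψ hψ1 hμ h2 hn hS hs g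
  have hgen : ∀ g, ∀ f ∈ schwartz k (κ ⊕ Fin 2),
      mixedRep k ψ μ hS g f - f ∈ coinvSpan μ k ψ hS := fun g f hf => by
    rw [← neg_sub]
    exact Submodule.neg_mem _ (Submodule.subset_span ⟨g, f, hf, rfl⟩)
  induction g using sl_induction with
  | h1 => intro f _; rw [mixedRep_one μ h2 hn hS, sub_self]; exact Submodule.zero_mem _
  | hn t g ih =>
    intro f hf
    have hF := (hr g).mem hf
    rw [mixedRep_mul μ hψ hψ1 hμ h2 hn hS hs _ _ hf,
      sigma_mixedRep_upperUnip μ hψ hψ1 hμ h2 hn hS hs h t hF,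
      ← sub_add_sub_cancel _ (sigma ψ μ h (mixedRep k ψ μ hS g f))]
    exact Submodule.add_mem _ (hgen _ _ (hσ.mem hF)) (ih f hf)
  | hm a g ih =>
    intro f hf
    have hF := (hr g).mem hf
    rw [mixedRep_mul μ hψ hψ1 hμ h2 hn hS hs _ _ hf,
      sigma_mixedRep_diagTorus μ hψ hψ1 hμ h2 hn hS hs h a hF,
      ← sub_add_sub_cancel _ (sigma ψ μ h (mixedRep k ψ μ hS g f))]
    exact Submodule.add_mem _ (hgen _ _ (hσ.mem hF)) (ih f hf)
  | hw g ih =>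
    intro f hf
    have hF := (hr g).mem hf
    have hX := hσ.mem ((hr weylElt).mem hF)
    have h1 := hgen (diagTorus (simNorm h)) _ hX
    rw [← mixedRep_weylElt_sigma μ hψ hψ1 hμ h2 hn hS hs h hF] at h1
    rw [mixedRep_mul μ hψ hψ1 hμ h2 hn hS hs _ _ hf,
      ← sub_add_sub_cancel _ (sigma ψ μ h (mixedRep k ψ μ hS g f)),
      ← sub_sub_sub_cancel_left _ _
        (mixedRep k ψ μ hS weylElt (sigma ψ μ h (mixedRep k ψ μ hS g f)))]
    refine Submodule.add_mem _ (Submodule.sub_mem _ (hgen _ _ (hσ.mem hF)) h1) (ih f hf)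

/-- Preservation of the span extends to the closure by continuity. -/
theorem sigma_mem_coinvKernel (h : GO (addPlane S)) {f : (κ ⊕ Fin 2 → F) → ℂ}
    (hf : f ∈ coinvKernel k ψ μ hS) (hf' : f ∈ schwartz k (κ ⊕ Fin 2)) :
    sigma ψ μ h f ∈ coinvKernel k ψ μ hS := by
  have hσ := isSchwartzOp_sigma (k := k) μ hψ hψ1 h
  have hle := coinvSpan_le (k := k) μ hψ hψ1 hμ h2 hn hS hs
  refine hσ.map_schwartzClosure (W := coinvSpan μ k ψ hS) (fun f hf _ => ?_) hf hf'
  induction hf using Submodule.span_induction with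
  | mem x hx =>
    obtain ⟨g, f, hf, rfl⟩ := hx
    have hr := (isSchwartzOp_mixedRep (k := k) μ hψ hψ1 hμ h2 hn hS hs g).mem hf
    have h1 := sigma_mixedRep_sub_mem μ hψ hψ1 hμ h2 hn hS hs h g f hf
    rw [sub_eq_add_neg, ← neg_one_smul ℂ (mixedRep k ψ μ hS g f),
      hσ.map_add hf (Submodule.smul_mem _ _ hr), hσ.map_smul _ hr, neg_one_smul, ← sub_eq_add_neg,
      ← neg_sub]
    exact Submodule.neg_mem _ h1
  | zero =>
    have h0 := hσ.map_smul 0 (Submodule.zero_mem _)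
    rw [zero_smul, zero_smul] at h0
    rw [h0]
    exact Submodule.zero_mem _
  | add x y hx hy ihx ihy =>
    rw [hσ.map_add (hle hx) (hle hy)]
    exact Submodule.add_mem _ (ihx (hle hx)) (ihy (hle hy))
  | smul c x hx ihx =>
    rw [hσ.map_smul c (hle hx)]
    exact Submodule.smul_mem _ c (ihx (hle hx))

end

theorem integrable_coneFun_integrand (hψ : Continuous ψ) (hS : IsUnit S.det)
    {f : (κ ⊕ Fin 2 → F) → ℂ} (hf : f ∈ schwartz k (κ ⊕ Fin 2)) (ξ : κ → F) (v : Fin 2 → F) :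
    Integrable (fun y => f (Sum.elim y v) * (ψ ((v 1 * quad S y - pairing S ξ y) / v 0) : ℂ))
      (quadMeasure μ hS) := by
  refine integrable_quadMeasure μ hS
    (integrable_mul_char hψ (schwartz_integrable μ (schwartz_slice hf v)) ?_)
  have h3 : Continuous fun y : κ → F => pairing S ξ y :=
    continuous_const.dotProduct (continuous_const.matrix_mulVec continuous_id)
  exact ((continuous_const.mul (continuous_quad S)).sub h3).div_const _

theorem coneFun_add (hψ : Continuous ψ) (hS : IsUnit S.det) {f g : (κ ⊕ Fin 2 → F) → ℂ}
    (hf : f ∈ schwartz k (κ ⊕ Fin 2)) (hg : g ∈ schwartz k (κ ⊕ Fin 2)) (ξ : κ → F)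
    (v : Fin 2 → F) :
    coneFun μ ψ hS (f + g) ξ v = coneFun μ ψ hS f ξ v + coneFun μ ψ hS g ξ v := by
  simp only [coneFun, Pi.add_apply, add_mul]
  rw [integral_add (integrable_coneFun_integrand μ hψ hS hf ξ v)
    (integrable_coneFun_integrand μ hψ hS hg ξ v), mul_add]

theorem coneFun_smul (hS : IsUnit S.det) (c : ℂ) (f : (κ ⊕ Fin 2 → F) → ℂ) (ξ : κ → F)
    (v : Fin 2 → F) : coneFun μ ψ hS (c • f) ξ v = c * coneFun μ ψ hS f ξ v := by
  simp only [coneFun, Pi.smul_apply, smul_eq_mul, mul_assoc]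
  rw [integral_const_mul]
  ring

section

variable (hψ : Continuous ψ) (hψ1 : ψ ≠ 1) (hμ : IsSelfDual k ψ μ)
  (h2 : (2 : F) ≠ 0) (hn : Even (Fintype.card κ)) (hS : IsUnit S.det)
  (hs : S.IsSymm) {ξ : κ → F} (hξ : ξ ∈ cone S)
include hψ hψ1 hμ h2 hn hs hξ

theorem integral_coneFun_add {f g : (κ ⊕ Fin 2 → F) → ℂ}
    (hf : f ∈ schwartz k (κ ⊕ Fin 2)) (hg : g ∈ schwartz k (κ ⊕ Fin 2)) :
    ∫ v, coneFun μ ψ hS (f + g) ξ v ∂vol[μ] =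
      ∫ v, coneFun μ ψ hS f ξ v ∂vol[μ] +
        ∫ v, coneFun μ ψ hS g ξ v ∂vol[μ] := by
  simp only [coneFun_add μ hψ hS hf hg]
  exact integral_add (integrable_coneFun μ hψ hψ1 hμ h2 hn hS hs hξ hf)
    (integrable_coneFun μ hψ hψ1 hμ h2 hn hS hs hξ hg)

/-- `r(g)` translates `coneFun` by an element of `SL₂`, which preserves the measure of the plane. -/
theorem integral_coneFun_mixedRep (g : SL(2, F)) {f : (κ ⊕ Fin 2 → F) → ℂ}
    (hf : f ∈ schwartz k (κ ⊕ Fin 2)) :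
    ∫ v, coneFun μ ψ hS (mixedRep k ψ μ hS g f) ξ v ∂vol[μ] =
      ∫ v, coneFun μ ψ hS f ξ v ∂vol[μ] := by
  have hA := sl_transpose_isUnit g
  have h1 := integral_comp_mulVec' μ hA (coneFun μ ψ hS f ξ)
  rw [det_transpose, g.det_coe, localAbs_one, inv_one, one_smul] at h1
  rw [← h1]
  have h3 : ∀ᵐ v ∂(Measure.pi fun _ : Fin 2 => μ), planeAct g v 0 ≠ 0 := by
    have hmap := map_mulVec_pi μ _ hA
    refine ae_of_ae_map (mulVec_measurableEmbedding _ hA).measurable.aemeasurable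
      (p := fun v : Fin 2 → F => v 0 ≠ 0) ?_
    rw [hmap]
    exact Measure.ae_smul_measure ((ae_plane_ne_zero μ).mono fun v hv => hv.1) _
  refine integral_congr_ae (((ae_plane_ne_zero μ).and h3).mono fun v hv => ?_)
  exact coneFun_mixedRep μ hψ hψ1 hμ h2 hn hS hs hf hξ.1 g hv.1.1 hv.2

/-- An invariant functional bounded by Schwartz seminorms vanishes on the closure of the span. -/
theorem integral_coneFun_eq_zero {f : (κ ⊕ Fin 2 → F) → ℂ}
    (hf : f ∈ coinvKernel k ψ μ hS) (hf' : f ∈ schwartz k (κ ⊕ Fin 2)) :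
    ∫ v, coneFun μ ψ hS f ξ v ∂vol[μ] = 0 := by
  have hadd := fun f (hf : f ∈ schwartz k (κ ⊕ Fin 2)) g (hg : g ∈ schwartz k (κ ⊕ Fin 2)) =>
    integral_coneFun_add μ hψ hψ1 hμ h2 hn hS hs hξ hf hg
  have hsmul : ∀ (c : ℂ) f, ∫ v, coneFun μ ψ hS (c • f) ξ v ∂vol[μ] =
      c * ∫ v, coneFun μ ψ hS f ξ v ∂vol[μ] := fun c f => by
    simp only [coneFun_smul]
    exact integral_const_mul _ _
  have hle := coinvSpan_le (k := k) μ hψ hψ1 hμ h2 hn hS hs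
  refine eq_zero_of_mem_schwartzClosure (W := coinvSpan μ k ψ hS)
    (Λ := fun f => ∫ v, coneFun μ ψ hS f ξ v ∂vol[μ])
    (schwartzBounded_integral_coneFun μ hψ hψ1 hμ h2 hn hS hs hξ) hadd (fun c f _ => hsmul c f)
    (fun f hf _ => ?_) hf hf'
  induction hf using Submodule.span_induction with
  | mem x hx =>
    obtain ⟨g, f, hf, rfl⟩ := hx
    have hr := (isSchwartzOp_mixedRep (k := k) μ hψ hψ1 hμ h2 hn hS hs g).mem hf
    rw [sub_eq_add_neg, ← neg_one_smul ℂ (mixedRep k ψ μ hS g f),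
      hadd _ hf _ (Submodule.smul_mem _ _ hr), hsmul,
      integral_coneFun_mixedRep μ hψ hψ1 hμ h2 hn hS hs hξ g hf]
    ring
  | zero => simpa using hsmul 0 0
  | add x y hx hy ihx ihy =>
    beta_reduce at ihx ihy ⊢
    rw [hadd _ (hle hx) _ (hle hy), ihx (hle hx), ihy (hle hy), add_zero]
  | smul c x hx ihx =>
    beta_reduce at ihx ⊢
    rw [hsmul, ihx (hle hx), mul_zero]

end

/-! ### Explicit formulas for the action of the similitude group -/

section InverseMatrices

variable {F : Type*} [Field F] {κ : Type*} [Fintype κ] [DecidableEq κ] {S : Matrix κ κ F}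

theorem simMat_inv_mulVec_eq {h : GO S} {v w : κ → F} (hw : (simMat h : Matrix κ κ F) *ᵥ w = v) :
    ((simMat h)⁻¹ : GL κ F).1 *ᵥ v = w := by
  rw [← hw, simMat_inv_mulVec]

theorem embGO_inv_mulVec (hS : IsUnit S.det) (h : GO S) (x : κ → F) (a b : F) :
    ((simMat (embGO hS h))⁻¹ : GL (κ ⊕ Fin 2) F).1 *ᵥ Sum.elim x ![a, b] =
      Sum.elim (((simMat h)⁻¹ : GL κ F).1 *ᵥ x) ![(simNorm h : F)⁻¹ * a, b] := by
  refine simMat_inv_mulVec_eq ?_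
  change fromBlocks (simMat h : Matrix κ κ F) 0 0 !![(simNorm h : F), 0; 0, 1] *ᵥ _ = _
  rw [fromBlocks_mulVec]
  ext (i | i)
  · simp
  · fin_cases i <;> simp [mul_comm]

theorem torusGO_inv_mulVec (hS : IsUnit S.det) (c : Fˣ) (x : κ → F) (a b : F) :
    ((simMat (torusGO hS c))⁻¹ : GL (κ ⊕ Fin 2) F).1 *ᵥ Sum.elim x ![a, b] =
      Sum.elim x ![(c : F)⁻¹ * a, c * b] := by
  refine simMat_inv_mulVec_eq ?_
  change fromBlocks 1 0 0 !![(c : F), 0; 0, (c : F)⁻¹] *ᵥ _ = _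
  rw [fromBlocks_mulVec]
  ext (i | i)
  · simp
  · fin_cases i <;> simp [mul_comm]

theorem swapGO_inv_mulVec (hS : IsUnit S.det) (x : κ → F) (a b : F) :
    ((simMat (swapGO hS))⁻¹ : GL (κ ⊕ Fin 2) F).1 *ᵥ Sum.elim x ![a, b] = Sum.elim x ![b, a] := by
  refine simMat_inv_mulVec_eq ?_
  change fromBlocks 1 0 0 !![0, 1; 1, 0] *ᵥ _ = _
  rw [fromBlocks_mulVec]
  ext (i | i)
  · simp
  · fin_cases i <;> simp

theorem dotProduct_inv_mulVec (hS : IsUnit S.det) (h2 : (2 : F) ≠ 0) (x : κ → F) :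
    x ⬝ᵥ (S⁻¹ *ᵥ x) = 2 * quad S (S⁻¹ *ᵥ x) := by
  rw [quad, pairing, mulVec_mulVec, mul_nonsing_inv _ hS, one_mulVec,
    dotProduct_comm]
  field_simp

theorem unipGO_inv_mulVec (hS : IsUnit S.det) (hs : S.IsSymm) (h2 : (2 : F) ≠ 0) (x y : κ → F)
    (a b : F) :
    ((simMat (unipGO hS hs h2 x))⁻¹ : GL (κ ⊕ Fin 2) F).1 *ᵥ Sum.elim y ![a, b] =
      Sum.elim (y - a • S⁻¹ *ᵥ x) ![a, b + (x ⬝ᵥ y - a * quad S (S⁻¹ *ᵥ x))] := by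
  refine simMat_inv_mulVec_eq ?_
  change unipMatrix S x *ᵥ _ = _
  rw [unipMatrix, fromBlocks_mulVec]
  have h3 : (of fun (j : Fin 2) p => ![0, -(x p)] j) *ᵥ (y - a • S⁻¹ *ᵥ x) =
      ![0, -(x ⬝ᵥ y - a * (2 * quad S (S⁻¹ *ᵥ x)))] := by
    rw [← dotProduct_inv_mulVec hS h2, ← smul_eq_mul, ← dotProduct_smul, ← dotProduct_sub]
    ext j
    fin_cases j <;> simp [mulVec, dotProduct]
  ext (i | i)
  · simp [mulVec, dotProduct, mul_comm]
  · simp only [Sum.elim_comp_inl, Sum.elim_comp_inr, Sum.elim_inr, h3]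
    fin_cases i
    · simp
    · simp
      ring

end InverseMatrices

theorem sigma_embGO (hμ : IsSelfDual k ψ μ) (hS : IsUnit S.det) (h : GO S)
    {f : (κ ⊕ Fin 2 → F) → ℂ} (hf : f ∈ schwartz k (κ ⊕ Fin 2)) (x : κ → F) (a b : F) :
    sigma ψ μ (embGO hS h) f (Sum.elim x ![a, b]) =
      f (Sum.elim (((simMat h)⁻¹ : GL κ F).1 *ᵥ x) ![(simNorm h : F)⁻¹ * a, b]) := by
  rw [sigma, partialFourier_apply]
  simp only [embGO_inv_mulVec]
  rw [← partialFourier_apply, partialFourier_partialFourierInv μ hμ hf]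

theorem sigma_torusGO (hμ : IsSelfDual k ψ μ) (hS : IsUnit S.det) (c : Fˣ)
    {f : (κ ⊕ Fin 2 → F) → ℂ} (hf : f ∈ schwartz k (κ ⊕ Fin 2)) (x : κ → F) (a b : F) :
    sigma ψ μ (torusGO hS c) f (Sum.elim x ![a, b]) =
      (localAbs (c : F))⁻¹ • f (Sum.elim x ![(c : F)⁻¹ * a, (c : F)⁻¹ * b]) := by
  have hc := c.ne_zero
  rw [sigma, partialFourier_apply]
  simp only [torusGO_inv_mulVec]
  rw [← congrFun (partialFourier_partialFourierInv μ hμ hf) (Sum.elim x _), partialFourier_apply,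
    ← integral_comp_mul μ hc]
  refine integral_congr_forall fun s => ?_
  congr 3
  field_simp

theorem sigma_unipGO (hμ : IsSelfDual k ψ μ) (hS : IsUnit S.det) (hs : S.IsSymm)
    (h2 : (2 : F) ≠ 0) (x : κ → F)
    {f : (κ ⊕ Fin 2 → F) → ℂ} (hf : f ∈ schwartz k (κ ⊕ Fin 2)) (y : κ → F) (a b : F) :
    sigma ψ μ (unipGO hS hs h2 x) f (Sum.elim y ![a, b]) =
      (ψ (-(b * (x ⬝ᵥ y - a * quad S (S⁻¹ *ᵥ x)))) : ℂ) *
        f (Sum.elim (y - a • S⁻¹ *ᵥ x) ![a, b]) := by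
  rw [sigma, partialFourier_apply]
  simp only [unipGO_inv_mulVec]
  rw [← congrFun (partialFourier_partialFourierInv μ hμ hf) (Sum.elim (y - a • S⁻¹ *ᵥ x) _),
    partialFourier_apply, ← integral_const_mul,
    ← integral_add_right_eq_self (fun s => (ψ (-(b * (x ⬝ᵥ y - a * quad S (S⁻¹ *ᵥ x)))) : ℂ) * _)
      (x ⬝ᵥ y - a * quad S (S⁻¹ *ᵥ x))]
  refine integral_congr_forall fun s => ?_
  have h3 : (ψ (b * s) : ℂ) = (ψ (-(b * (x ⬝ᵥ y - a * quad S (S⁻¹ *ᵥ x)))) : ℂ) *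
      (ψ (b * (s + (x ⬝ᵥ y - a * quad S (S⁻¹ *ᵥ x)))) : ℂ) := by
    rw [← char_mul]
    congr 2
    ring
  rw [h3]
  ring

theorem sigma_swapGO (hψ : Continuous ψ) (hS : IsUnit S.det) {f : (κ ⊕ Fin 2 → F) → ℂ}
    (hf : f ∈ schwartz k (κ ⊕ Fin 2)) :
    sigma ψ μ (swapGO hS) f = wedgeFourier ψ μ f := by
  ext v
  have hi : Integrable (fun w : Fin 2 → F => f (Sum.elim (v ∘ Sum.inl) w) *
      (ψ (w 0 * v (Sum.inr 1) - w 1 * v (Sum.inr 0)) : ℂ)) vol[μ] := by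
    have hs := schwartz_slice_equiv (Equiv.sumComm (Fin 2) κ) hf (v ∘ Sum.inl)
    have he : ∀ w : Fin 2 → F, Sum.elim w (v ∘ Sum.inl) ∘ (Equiv.sumComm (Fin 2) κ).symm =
        Sum.elim (v ∘ Sum.inl) w := fun w => by ext (i | i) <;> rfl
    simp only [he] at hs
    refine integrable_mul_char hψ (schwartz_integrable μ hs) ?_
    fun_prop
  have hm := (measurePreserving_finTwoArrow μ).symm
  have hE := (MeasurableEquiv.finTwoArrow (α := F)).symm.measurableEmbedding
  have hp := integral_prod _ ((hm.integrable_comp_emb hE).2 hi)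
  rw [wedgeFourier, ← hm.integral_comp hE]
  refine Eq.trans ?_ hp.symm
  conv_lhs => rw [eq_elim v]
  rw [sigma, partialFourier_apply]
  simp only [swapGO_inv_mulVec, partialFourierInv_apply]
  refine integral_congr_forall fun s => ?_
  rw [← integral_mul_const]
  refine integral_congr_forall fun t => ?_
  have h3 : (ψ (-(v (Sum.inr 0) * t)) : ℂ) * (ψ (v (Sum.inr 1) * s) : ℂ) =
      (ψ (s * v (Sum.inr 1) - t * v (Sum.inr 0)) : ℂ) := by
    rw [← char_mul]
    congr 2
    ring
  exact (mul_assoc _ _ _).trans (congrArg (f (Sum.elim (v ∘ Sum.inl) ![s, t]) * ·) h3)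

/-- The substitution `y ↦ h y`. -/
theorem coneFun_sigma_embGO (hψ : Continuous ψ) (hψ1 : ψ ≠ 1) (hμ : IsSelfDual k ψ μ)
    (h2 : (2 : F) ≠ 0) (hn : Even (Fintype.card κ)) (hS : IsUnit S.det) (hs : S.IsSymm) (h : GO S)
    {f : (κ ⊕ Fin 2 → F) → ℂ} (hf : f ∈ schwartz k (κ ⊕ Fin 2)) (ξ : κ → F) {a : F} (ha : a ≠ 0)
    (b : F) :
    coneFun μ ψ hS (sigma ψ μ (embGO hS h) f) ξ ![a, b] =
      coneFun μ ψ hS f (((simMat h)⁻¹ : GL κ F).1 *ᵥ ξ) ![(simNorm h : F)⁻¹ * a, b] := by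
  obtain ⟨m, hm⟩ := hn
  rw [← two_mul] at hm
  have hl := (simNorm h).ne_zero
  have hlp := localAbs_pos hl
  have hχ : quadChar S (-((simNorm h : F)⁻¹ * a)) = quadChar S (-a) := by
    rw [← mul_neg, quadChar_mul k h2 hS (inv_ne_zero hl) (neg_ne_zero.2 ha), quadChar_inv k h2 hS hl,
      quadChar_similitude μ hψ hψ1 hμ h2 (hm ▸ even_two_mul m) hS hs (isUnit_det_simMat' h) hl h.2,
      one_mul]
  have hi := integral_comp_mulVec' μ (isUnit_det_simMat' h) fun y =>
    f (Sum.elim (((simMat h)⁻¹ : GL κ F).1 *ᵥ y) ![(simNorm h : F)⁻¹ * a, b]) *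
      (ψ ((b * quad S y - pairing S ξ y) / a) : ℂ)
  rw [localAbs_det_simMat hS hm, eq_inv_smul_iff₀ (by positivity)] at hi
  simp only [coneFun, cons_val_zero, cons_val_one, hχ,
    sigma_embGO μ hμ hS h hf, integral_quadMeasure]
  rw [← hi]
  have hy : ∀ y, ((b * quad S ((simMat h : Matrix κ κ F) *ᵥ y) -
      pairing S ξ ((simMat h : Matrix κ κ F) *ᵥ y)) / a) =
      (b * quad S y - pairing S (((simMat h)⁻¹ : GL κ F).1 *ᵥ ξ) y) / ((simNorm h : F)⁻¹ * a) := by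
    intro y
    conv_lhs => rw [← simMat_mulVec_inv h ξ, pairing_mulVec_simMat, quad, pairing_mulVec_simMat]
    rw [quad]
    field_simp
  simp only [hy, simMat_inv_mulVec, localAbs_mul, localAbs_inv, hm,
    Nat.mul_div_cancel_left m two_pos, Complex.real_smul]
  push_cast
  rw [mul_pow, inv_pow]
  have h5 : (localAbs (simNorm h : F) : ℂ) ^ m ≠ 0 := by
    exact_mod_cast (pow_pos hlp m).ne'
  field_simp

theorem coneFun_sigma_torusGO (hμ : IsSelfDual k ψ μ)
    (h2 : (2 : F) ≠ 0) (hS : IsUnit S.det) (c : Fˣ)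
    {f : (κ ⊕ Fin 2 → F) → ℂ} (hf : f ∈ schwartz k (κ ⊕ Fin 2)) (ξ : κ → F) {a : F} (ha : a ≠ 0)
    (b : F) :
    coneFun μ ψ hS (sigma ψ μ (torusGO hS c) f) ξ ![a, b] =
      quadChar S (c : F) * (((localAbs (c : F) ^ (Fintype.card κ / 2 + 1))⁻¹ : ℝ) : ℂ) *
      coneFun μ ψ hS f ((c : F)⁻¹ • ξ) ![(c : F)⁻¹ * a, (c : F)⁻¹ * b] := by
  have hc := c.ne_zero
  have hcp := localAbs_pos hc
  have hχ : quadChar S (-((c : F)⁻¹ * a)) = quadChar S (c : F) * quadChar S (-a) := by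
    rw [← mul_neg, quadChar_mul k h2 hS (inv_ne_zero hc) (neg_ne_zero.2 ha), quadChar_inv k h2 hS hc]
  have hy : ∀ y, ((c : F)⁻¹ * b * quad S y - pairing S ((c : F)⁻¹ • ξ) y) / ((c : F)⁻¹ * a) =
      (b * quad S y - pairing S ξ y) / a := by
    intro y
    rw [pairing, smul_dotProduct, smul_eq_mul, ← pairing]
    field_simp
  simp only [coneFun, cons_val_zero, cons_val_one, hχ,
    sigma_torusGO μ hμ hS c hf, hy, Complex.real_smul]
  simp only [mul_assoc]
  rw [integral_const_mul, localAbs_mul, localAbs_inv]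
  generalize (∫ y, f (Sum.elim y ![(c : F)⁻¹ * a, (c : F)⁻¹ * b]) *
    (ψ ((b * quad S y - pairing S ξ y) / a) : ℂ) ∂quadMeasure μ hS) = G
  push_cast
  rw [mul_pow, inv_pow]
  have h5 : (localAbs (c : F) : ℂ) ≠ 0 := by exact_mod_cast hcp.ne'
  have h6 := quadChar_mul_self h2 hS (c : F)
  field_simp
  linear_combination -(weilConst ψ μ S * quadChar S (-a) * G * (localAbs (c : F) : ℂ) *
    (localAbs (c : F) : ℂ) ^ (Fintype.card κ / 2) *
    (localAbs a : ℂ)⁻¹ ^ (Fintype.card κ / 2)) * h6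

/-- The substitution `y ↦ y + a S⁻¹ x`. -/
theorem coneFun_sigma_unipGO (hμ : IsSelfDual k ψ μ)
    (h2 : (2 : F) ≠ 0) (hS : IsUnit S.det) (hs : S.IsSymm) (x : κ → F)
    {f : (κ ⊕ Fin 2 → F) → ℂ} (hf : f ∈ schwartz k (κ ⊕ Fin 2)) (ξ : κ → F) {a : F} (ha : a ≠ 0)
    (b : F) :
    coneFun μ ψ hS (sigma ψ μ (unipGO hS hs h2 x) f) ξ ![a, b] =
      (ψ (-(x ⬝ᵥ ξ)) : ℂ) * coneFun μ ψ hS f ξ ![a, b] := by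
  simp only [coneFun, cons_val_zero, cons_val_one, sigma_unipGO μ hμ hS hs h2 x hf,
    integral_quadMeasure]
  rw [← integral_add_right_eq_self _ (a • S⁻¹ *ᵥ x)]
  have hSx : S *ᵥ (S⁻¹ *ᵥ x) = x := by
    rw [mulVec_mulVec, mul_nonsing_inv _ hS, one_mulVec]
  have hy : ∀ y, (ψ (-(b * (x ⬝ᵥ (y + a • S⁻¹ *ᵥ x) - a * quad S (S⁻¹ *ᵥ x)))) : ℂ) *
      f (Sum.elim (y + a • S⁻¹ *ᵥ x - a • S⁻¹ *ᵥ x) ![a, b]) *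
      (ψ ((b * quad S (y + a • S⁻¹ *ᵥ x) - pairing S ξ (y + a • S⁻¹ *ᵥ x)) / a) : ℂ) =
      (ψ (-(x ⬝ᵥ ξ)) : ℂ) * (f (Sum.elim y ![a, b]) *
        (ψ ((b * quad S y - pairing S ξ y) / a) : ℂ)) := by
    intro y
    have h1 : (b * quad S (y + a • S⁻¹ *ᵥ x) - pairing S ξ (y + a • S⁻¹ *ᵥ x)) / a =
        (b * quad S y - pairing S ξ y) / a +
          (b * (x ⬝ᵥ (y + a • S⁻¹ *ᵥ x) - a * quad S (S⁻¹ *ᵥ x)) - x ⬝ᵥ ξ) := by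
      have h3 : pairing S (a • S⁻¹ *ᵥ x) y = a * (x ⬝ᵥ y) := by
        rw [pairing_eq hs, mulVec_smul, hSx, smul_dotProduct, smul_eq_mul]
      have h4 : pairing S ξ (y + a • S⁻¹ *ᵥ x) = pairing S ξ y + a * (x ⬝ᵥ ξ) := by
        rw [pairing, mulVec_add, mulVec_smul, hSx, dotProduct_add, dotProduct_smul,
          smul_eq_mul, dotProduct_comm ξ x, pairing]
      rw [quad_add hs h2, h3, quad_smul, h4, dotProduct_add, dotProduct_smul,
        dotProduct_inv_mulVec hS h2, smul_eq_mul]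
      field_simp
      ring
    have h3 : (ψ (-(b * (x ⬝ᵥ (y + a • S⁻¹ *ᵥ x) - a * quad S (S⁻¹ *ᵥ x)))) : ℂ) *
        (ψ ((b * quad S (y + a • S⁻¹ *ᵥ x) - pairing S ξ (y + a • S⁻¹ *ᵥ x)) / a) : ℂ) =
        (ψ (-(x ⬝ᵥ ξ)) : ℂ) * (ψ ((b * quad S y - pairing S ξ y) / a) : ℂ) := by
      rw [h1, ← char_mul, ← char_mul]
      congr 2
      ring
    rw [add_sub_cancel_right]
    linear_combination f (Sum.elim y ![a, b]) * h3
  simp only [hy]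
  rw [integral_const_mul, Complex.real_smul, Complex.real_smul]
  ring

/-! ### The operators on the space of coinvariants -/

variable (hψ : Continuous ψ) (hψ1 : ψ ≠ 1) (hμ : IsSelfDual k ψ μ) (h2 : (2 : F) ≠ 0)
  (hn : Even (Fintype.card κ)) (hS : IsUnit S.det) (hs : S.IsSymm)

/-- The operator `σ(h)` as an endomorphism of `S(V ⊕ F²)`. -/
def sigmaEnd (hψ : Continuous ψ) (hψ1 : ψ ≠ 1) (h : GO (addPlane S)) :
    Module.End ℂ (schwartz k (κ ⊕ Fin 2)) where
  toFun f := ⟨sigma ψ μ h f.1, (isSchwartzOp_sigma μ hψ hψ1 h).mem f.2⟩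
  map_add' f g := Subtype.ext ((isSchwartzOp_sigma (k := k) μ hψ hψ1 h).map_add f.2 g.2)
  map_smul' c f := Subtype.ext ((isSchwartzOp_sigma (k := k) μ hψ hψ1 h).map_smul c f.2)

include hψ hψ1 hμ h2 hn hs in
/-- The representation `σ` descends to the coinvariants. -/
theorem exists_sigma_coinvariants :
    ∃ σX : GO (addPlane S) →* Module.End ℂ (ConeSchwartz k ψ μ hS),
      ∀ (h : GO (addPlane S)) (f : schwartz k (κ ⊕ Fin 2)),
        σX h (coneClass k ψ μ hS f) = coneClass k ψ μ hS (sigmaEnd μ hψ hψ1 h f) := by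
  have hmap : ∀ h : GO (addPlane S), (coinvKernel k ψ μ hS).submoduleOf (schwartz k (κ ⊕ Fin 2)) ≤
      ((coinvKernel k ψ μ hS).submoduleOf (schwartz k (κ ⊕ Fin 2))).comap
        (sigmaEnd μ hψ hψ1 h) := fun h f hf =>
    sigma_mem_coinvKernel μ hψ hψ1 hμ h2 hn hS hs h hf f.2
  refine ⟨{ toFun := fun h => Submodule.mapQ _ _ (sigmaEnd μ hψ hψ1 h) (hmap h)
            map_one' := ?_
            map_mul' := fun h h' => ?_ }, fun h f => rfl⟩
  · refine Submodule.linearMap_qext _ (LinearMap.ext fun f => ?_)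
    exact congrArg (coneClass k ψ μ hS) (Subtype.ext (sigma_one μ hμ f.2))
  · refine Submodule.linearMap_qext _ (LinearMap.ext fun f => ?_)
    exact congrArg (coneClass k ψ μ hS) (Subtype.ext (sigma_mul μ hψ hψ1 hμ h h' f.2))

include hψ hψ1 hμ h2 hn hs in
/-- The integral of `coneFun` over the plane descends to the coinvariants. -/
theorem exists_integral_coneFun_coinvariants :
    ∃ L : ConeSchwartz k ψ μ hS →ₗ[ℂ] (cone S → ℂ),
      ∀ (f : schwartz k (κ ⊕ Fin 2)) (ξ : cone S),
        L (coneClass k ψ μ hS f) ξ =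
          ∫ v, coneFun μ ψ hS f.1 ξ.1 v ∂vol[μ] := by
  refine ⟨Submodule.liftQ _
    { toFun := fun f ξ => ∫ v, coneFun μ ψ hS f.1 ξ.1 v ∂vol[μ]
      map_add' := fun f g => funext fun ξ =>
        integral_coneFun_add μ hψ hψ1 hμ h2 hn hS hs ξ.2 f.2 g.2
      map_smul' := fun c f => funext fun ξ => ?_ } (fun f hf => ?_), fun f ξ => rfl⟩
  · change ∫ v, coneFun μ ψ hS (c • f.1) ξ.1 v ∂_ = c * ∫ v, coneFun μ ψ hS f.1 ξ.1 v ∂_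
    simp only [coneFun_smul]
    exact integral_const_mul _ _
  · exact LinearMap.mem_ker.2 (funext fun ξ =>
      integral_coneFun_eq_zero μ hψ hψ1 hμ h2 hn hS hs ξ.2 hf f.2)

include hψ hψ1 hμ h2 hn hs in
theorem integral_coneFun_sigma_embGO (h : GO S) {f : (κ ⊕ Fin 2 → F) → ℂ}
    (hf : f ∈ schwartz k (κ ⊕ Fin 2)) (ξ : κ → F) :
    ∫ v, coneFun μ ψ hS (sigma ψ μ (embGO hS h) f) ξ v ∂vol[μ] =
      (modulus (simNorm h) : ℂ) *
        ∫ v, coneFun μ ψ hS f (((simMat h)⁻¹ : GL κ F).1 *ᵥ ξ) v ∂vol[μ] := by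
  have hdet : (!![(simNorm h : F)⁻¹, 0; 0, 1]).det = (simNorm h : F)⁻¹ := by
    simp [det_fin_two]
  have h1 := integral_comp_mulVec' μ (A := !![(simNorm h : F)⁻¹, 0; 0, 1])
    (by rw [hdet]; exact (inv_ne_zero (simNorm h).ne_zero).isUnit)
    (coneFun μ ψ hS f (((simMat h)⁻¹ : GL κ F).1 *ᵥ ξ))
  rw [hdet, localAbs_inv, inv_inv, localAbs_units, Complex.real_smul] at h1
  rw [← h1]
  refine integral_congr_ae ((ae_plane_ne_zero μ).mono fun v hv => ?_)
  have hv' : v = ![v 0, v 1] := by ext j; fin_cases j <;> rfl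
  have hA : !![(simNorm h : F)⁻¹, 0; 0, 1] *ᵥ v = ![(simNorm h : F)⁻¹ * v 0, v 1] := by
    ext j; fin_cases j <;> simp [mulVec, dotProduct, Fin.sum_univ_two]
  beta_reduce
  rw [hA]
  conv_lhs => rw [hv']
  exact coneFun_sigma_embGO μ hψ hψ1 hμ h2 hn hS hs h hf ξ hv.1 _

include hμ h2 in
theorem integral_coneFun_sigma_torusGO {m : ℕ} (hm : Fintype.card κ = 2 * m) (c : Fˣ)
    {f : (κ ⊕ Fin 2 → F) → ℂ}
    (hf : f ∈ schwartz k (κ ⊕ Fin 2)) (ξ : κ → F) :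
    ∫ v, coneFun μ ψ hS (sigma ψ μ (torusGO hS c) f) ξ v ∂vol[μ] =
      quadChar S (c : F) *
        ((modulus c ^ (1 - (Fintype.card κ : ℝ) / 2) : ℝ) : ℂ) *
        ∫ v, coneFun μ ψ hS f ((c : F)⁻¹ • ξ) v ∂vol[μ] := by
  have hc := c.ne_zero
  have h1 := integral_comp_smul μ (inv_ne_zero hc) (coneFun μ ψ hS f ((c : F)⁻¹ • ξ))
  have hcp := modulus_pos c
  have h3 : modulus c ^ (1 - (Fintype.card κ : ℝ) / 2) =
      (modulus c ^ (m + 1))⁻¹ * modulus c ^ 2 := by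
    have h4 : (1 - (Fintype.card κ : ℝ) / 2) = (2 : ℕ) - ((m + 1 : ℕ) : ℝ) := by
      rw [hm]; push_cast; ring
    rw [h4, Real.rpow_sub hcp, Real.rpow_natCast, Real.rpow_natCast, div_eq_inv_mul]
  rw [Fintype.card_fin, localAbs_inv, inv_pow, inv_inv, localAbs_units, Complex.real_smul] at h1
  rw [h3, Complex.ofReal_mul, mul_assoc, mul_assoc, ← h1, ← integral_const_mul,
    ← integral_const_mul]
  refine integral_congr_ae ((ae_plane_ne_zero μ).mono fun v hv => ?_)
  have hv' : v = ![v 0, v 1] := by ext j; fin_cases j <;> rfl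
  have hA : (c : F)⁻¹ • v = ![(c : F)⁻¹ * v 0, (c : F)⁻¹ * v 1] := by
    ext j; fin_cases j <;> rfl
  beta_reduce
  rw [hA]
  conv_lhs => rw [hv']
  rw [coneFun_sigma_torusGO μ hμ h2 hS c hf ξ hv.1, hm, Nat.mul_div_cancel_left m two_pos,
    localAbs_units, mul_assoc]

include hμ in
theorem integral_coneFun_sigma_unipGO (x : κ → F) {f : (κ ⊕ Fin 2 → F) → ℂ}
    (hf : f ∈ schwartz k (κ ⊕ Fin 2)) (ξ : κ → F) :
    ∫ v, coneFun μ ψ hS (sigma ψ μ (unipGO hS hs h2 x) f) ξ v ∂vol[μ] =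
      (starRingEnd ℂ) (ψ (x ⬝ᵥ ξ) : ℂ) *
        ∫ v, coneFun μ ψ hS f ξ v ∂vol[μ] := by
  rw [← Circle.coe_inv_eq_conj, ← AddChar.map_neg_eq_inv, ← integral_const_mul]
  refine integral_congr_ae ((ae_plane_ne_zero μ).mono fun v hv => ?_)
  have hv' : v = ![v 0, v 1] := by ext j; fin_cases j <;> rfl
  beta_reduce
  rw [hv']
  exact coneFun_sigma_unipGO μ hμ h2 hS hs x hf ξ hv.1 _

end ConeSchwartzSpace

end QuadricSchwartz

end

open QuadricSchwartz in
theorem mainTheorem7 {F : Type*} [NontriviallyNormedField F] [ProperSpace F] [MeasurableSpace F]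
    [BorelSpace F] (k : LocalKind F) (h2 : (2 : F) ≠ 0)
    (ψ : AddChar F Circle) (hψ : Continuous ψ) (hψ1 : ψ ≠ 1)
    (μ : Measure F) [μ.IsAddHaarMeasure] (hμ : IsSelfDual k ψ μ)
    (K : Subgroup SL(2, F)) [CompactSpace K] (hK : IsIwasawa K)
    {ι₀ : Type*} [Fintype ι₀] [DecidableEq ι₀] (J₀ : Matrix ι₀ ι₀ F)
    (hcard : Even (Fintype.card ι₀)) (hsymm : J₀.IsSymm) (hdet : J₀.det ≠ 0) (i : ℕ) :
    -- `σ`, `I` and `F_X` descend to the space of coinvariants `S(X_i)`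
    ∃ (σX : GO (addPlane (quadMatrix J₀ i)) →*
          Module.End ℂ (ConeSchwartz k ψ μ (quadMatrix_det hdet i)))
      (IX : ConeSchwartz k ψ μ (quadMatrix_det hdet i) →ₗ[ℂ] (cone (quadMatrix J₀ i) → ℂ))
      (FX : ConeSchwartz k ψ μ (quadMatrix_det hdet i) →ₗ[ℂ]
          ConeSchwartz k ψ μ (quadMatrix_det hdet i)),
      (∀ (h : GO (addPlane (quadMatrix J₀ i)))
          (f : schwartz k ((ι₀ ⊕ Fin 2 × Fin i) ⊕ Fin 2)),
        ∃ f' : schwartz k ((ι₀ ⊕ Fin 2 × Fin i) ⊕ Fin 2),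
          f'.1 = sigma ψ μ h f.1 ∧
            σX h (coneClass k ψ μ (quadMatrix_det hdet i) f) =
              coneClass k ψ μ (quadMatrix_det hdet i) f') ∧
      (∀ (f : schwartz k ((ι₀ ⊕ Fin 2 × Fin i) ⊕ Fin 2)) (ξ : cone (quadMatrix J₀ i)),
        Integrable (coneIntegrand k ψ μ (quadMatrix_det hdet i) K f.1 ξ.1) (quotMeasure k μ K) ∧
          IX (coneClass k ψ μ (quadMatrix_det hdet i) f) ξ =
            coneIntegral k ψ μ (quadMatrix_det hdet i) K f.1 ξ.1) ∧
      (∀ f : schwartz k ((ι₀ ⊕ Fin 2 × Fin i) ⊕ Fin 2),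
        ∃ f' : schwartz k ((ι₀ ⊕ Fin 2 × Fin i) ⊕ Fin 2),
          f'.1 = wedgeFourier ψ μ f.1 ∧
            FX (coneClass k ψ μ (quadMatrix_det hdet i) f) =
              coneClass k ψ μ (quadMatrix_det hdet i) f') ∧
      -- the four formulas
      (∀ (f : ConeSchwartz k ψ μ (quadMatrix_det hdet i)) (ξ : cone (quadMatrix J₀ i))
          (h : GO (quadMatrix J₀ i)),
        IX (σX (embGO (quadMatrix_det hdet i) h) f) ξ =
          (modulus (simNorm h) : ℂ) * IX f (invActCone h ξ)) ∧
      (∀ (f : ConeSchwartz k ψ μ (quadMatrix_det hdet i)) (ξ : cone (quadMatrix J₀ i)) (a : Fˣ),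
        IX (σX (torusGO (quadMatrix_det hdet i) a) f) ξ =
          quadChar (quadMatrix J₀ i) (a : F) *
            ((modulus a ^ (1 - (Fintype.card (ι₀ ⊕ Fin 2 × Fin i) : ℝ) / 2) : ℝ) : ℂ) *
            IX f (smulCone a⁻¹ ξ)) ∧
      (∀ (f : ConeSchwartz k ψ μ (quadMatrix_det hdet i)) (ξ : cone (quadMatrix J₀ i))
          (x : ι₀ ⊕ Fin 2 × Fin i → F),
        IX (σX (unipGO (quadMatrix_det hdet i) (quadMatrix_symm hsymm i) h2 x) f) ξ =
          (starRingEnd ℂ) (ψ (x ⬝ᵥ ξ.1) : ℂ) * IX f ξ) ∧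
      (∀ f : ConeSchwartz k ψ μ (quadMatrix_det hdet i),
        σX (swapGO (quadMatrix_det hdet i)) f = FX f) := by
  have hS := quadMatrix_det hdet i
  have hs := quadMatrix_symm hsymm i
  have hn : Even (Fintype.card (ι₀ ⊕ Fin 2 × Fin i)) := by
    rw [Fintype.card_sum, Fintype.card_prod, Fintype.card_fin]
    exact hcard.add (even_two_mul _)
  obtain ⟨m, hm⟩ := hn
  rw [← two_mul] at hm
  obtain ⟨σX, hσX⟩ := exists_sigma_coinvariants (k := k) μ hψ hψ1 hμ h2 (hm ▸ even_two_mul m) hS hs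
  obtain ⟨L, hL⟩ :=
    exists_integral_coneFun_coinvariants (k := k) μ hψ hψ1 hμ h2 (hm ▸ even_two_mul m) hS hs
  obtain ⟨C, hC, hmap⟩ := exists_map_quotMeasure K μ k hK
  have hI := fun (f : schwartz k ((ι₀ ⊕ Fin 2 × Fin i) ⊕ Fin 2)) (ξ : cone (quadMatrix J₀ i)) =>
    integrable_coneIntegrand μ hψ hψ1 hμ h2 (hm ▸ even_two_mul m) hS hs ξ.2 K hC hmap f.2
  have hsmul : ∀ f ξ, ((C.toReal : ℂ) • L) f ξ = (C.toReal : ℂ) * L f ξ := fun _ _ => rfl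
  refine ⟨σX, (C.toReal : ℂ) • L, σX (swapGO hS), fun h f => ⟨_, rfl, hσX h f⟩,
    fun f ξ => ⟨(hI f ξ).1, ?_⟩, fun f => ⟨_, sigma_swapGO μ hψ hS f.2, hσX _ f⟩,
    fun f ξ h => ?_, fun f ξ a => ?_, fun f ξ x => ?_, fun f => rfl⟩
  · rw [hsmul, hL, (hI f ξ).2]
  · obtain ⟨f, rfl⟩ := Submodule.mkQ_surjective _ f
    rw [hsmul, hsmul, mul_left_comm]
    congr 1
    exact ((congrFun (congrArg L (hσX _ f)) ξ).trans (hL _ ξ)).trans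
      ((integral_coneFun_sigma_embGO μ hψ hψ1 hμ h2 (hm ▸ even_two_mul m) hS hs h f.2 ξ.1).trans
        (congrArg _ (hL f (invActCone h ξ)).symm))
  · obtain ⟨f, rfl⟩ := Submodule.mkQ_surjective _ f
    rw [hsmul, hsmul, mul_left_comm]
    congr 1
    refine ((congrFun (congrArg L (hσX _ f)) ξ).trans (hL _ ξ)).trans
      ((integral_coneFun_sigma_torusGO μ hμ h2 hS hm a f.2 ξ.1).trans ?_)
    rw [← Units.val_inv_eq_inv_val]
    exact congrArg _ (hL f (smulCone a⁻¹ ξ)).symm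
  · obtain ⟨f, rfl⟩ := Submodule.mkQ_surjective _ f
    rw [hsmul, hsmul, mul_left_comm]
    congr 1
    exact ((congrFun (congrArg L (hσX _ f)) ξ).trans (hL _ ξ)).trans
      ((integral_coneFun_sigma_unipGO μ hμ h2 hS hs x f.2 ξ.1).trans (congrArg _ (hL f ξ).symm))
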